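/- **Theorem 4.2 (pre-Hamiltonian induction is well-defined).** *Setting.* Let $G$ be a connected Lie group, $K<G$ a maximal compact subgroup, and $\mathfrak p\subset\mathfrak g$ an $\mathrm{Ad}(K)$-invariant subspace with $\mathfrak g=\mathfrak k\oplus\mathfrak p$; view $\mathfrak k^*\subset\mathfrak g^*$ through this decomposition. Fix an $\mathrm{Ad}(K)$-invariant inner product on $\mathfrak p$, and a lift $\widetilde{\mathrm{Ad}}\colon K\to\mathrm{Spin}(\mathfrak p)$ (a smooth homomorphism) of $\mathrm{Ad}\colon K\to\mathrm{SO}(\mathfrak p)$. For a Lie group $H$, a *prequantised pre-Hamiltonian $H$-manifold with $\mathrm{Spin}^c$-structure* is a (Hausdorff, second countable) smooth $H$-manifold $X$, together with: 1. an $H$-invariant closed smooth two-form $\omega$ (a presymplectic form); 2. a momentum map $\Phi\colon X\to\mathfrak h^*$: a smooth, $H$-equivariant map with $d\langle\Phi,Z\rangle=-\omega(Z_X,\cdot)$ for $Z\in\mathfrak h$, where $Z_X(x)=\frac{d}{dt}\big|_{t=0}\exp(tZ)x$; 3. an $H$-equivariant $\mathrm{Spin}^c$-prequantisation $(L^{2\omega},(-,-),\nabla)$: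 an $H$-equivariant smooth Hermitian line bundle (with $H$ acting by fibrewise isometries) with an $H$-invariant smooth Hermitian connection of curvature $2\pi i\cdot 2\omega$, such that the infinitesimal action of $\mathfrak h$ on sections is given by Kostant's formula $\mathcal L_Z s=-\nabla_{Z_X}s+2\pi i\cdot 2\langle\Phi,Z\rangle s$, where $(\mathcal L_Zs)(x)=\frac{d}{dt}\big|_{t=0}\exp(tZ)\,s(\exp(-tZ)x)$; 4. an $H$-equivariant $\mathrm{Spin}^c$-structure: an $H$-equivariant smooth principal $\mathrm{Spin}^c(d_X)$-bundle $P\to X$, $d_X=\dim X$, with an $H$-equivariant isomorphism $P\times_{\mathrm{Spin}^c(d_X)}\mathbb R^{d_X}\cong TX$, whose determinant line bundle $P\times_{\det}\mathbb C$ is $H$-equivariantly isomorphic to $L^{2\omega}$. *Theorem.* Let $\bigl(N,\nu,\Phi_N,L^{2\nu},(-,-)_{L^{2\nu}},\nabla^N,P^N\bigr)$ be a prequantised pre-Hamiltonian $K$-manifold with $\mathrm{Spin}^c$-structure. Let $M=G\times_KN$ be the quotient of $G\times N$ by the $K$-action $k(g,n)=(gk^{-1},kn)$, with quotient map $q$.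 Then $M$ is a Hausdorff, second countable smooth manifold, of which the smooth structure is such that $q$ is a smooth submersion, and $G$ acts smoothly on it by $g[g',n]=[gg',n]$. Moreover, $M$ is a prequantised pre-Hamiltonian $G$-manifold with $\mathrm{Spin}^c$-structure, when equipped with the following (well-defined) structures $\bigl(\omega,\Phi_M,L^{2\omega},(-,-)_{L^{2\omega}},\nabla^M,P^M\bigr)$: * the $G$-invariant two-form $\omega$ determined by $$\omega_{[e,n]}\bigl(Tq(v+X),Tq(w+Y)\bigr)=\nu_n(v,w)-\langle\Phi_N(n),[X,Y]\rangle,\qquad n\in N,\ v,w\in T_nN,\ X,Y\in\mathfrak p;$$ * the momentum map $\Phi_M([g,n])=\mathrm{Ad}^*(g)\Phi_N(n)$; * the line bundle $L^{2\omega}=G\times_KL^{2\nu}$, with the metric $([g,l],[g,l'])_{L^{2\omega}}=(l,l')_{L^{2\nu}}$; * the connection $\nabla^M$ on $L^{2\omega}$ given as follows: if $s$ is a smooth section of $L^{2\omega}$, and $s_g(n)\in L^{2\nu}_n$ is defined by $s([g,n])=[g,s_g(n)]$, then for $g\in G$, $n\in N$, $v\in T_nN$, $X\in\mathfrak p$,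 $$\bigl(\nabla^M_{T_{(g,n)}q(v+gX)}s\bigr)([g,n])=\Bigl[g,\ (\nabla^N_vs_g)(n)+\tfrac{d}{dt}\Big|_{t=0}s_{g\exp(tX)}(n)\Bigr];$$ * the principal bundle $P^M=G\times_K\bigl(P^N\times_{\mathrm{Spin}^c(d_N)}\mathrm{Spin}^c(d_M)\bigr)$, where $\mathrm{Spin}^c(d_M)$ is the group $\mathrm{Spin}^c(\mathbb R^{d_N}\oplus\mathfrak p)$, and $k\in K$ acts on this factor as left multiplication by $\widetilde{\mathrm{Ad}}(k)\in\mathrm{Spin}(\mathfrak p)\subset\mathrm{Spin}^c(d_M)$, with the isomorphism $P^M\times_{\mathrm{Spin}^c(d_M)}(\mathbb R^{d_N}\oplus\mathfrak p)\cong TM$ given by $[[g,[p,1]],(v,X)]\mapsto T_{(g,n)}q([p,v]+gX)$ for $g\in G$, $n\in N$, $p\in P^N_n$, $v\in\mathbb R^{d_N}$, $X\in\mathfrak p$, and the isomorphism of its determinant line bundle with $L^{2\omega}$ induced by the one of $P^N$ with $L^{2\nu}$. -/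

import Mathlib

open Set Bundle
open scoped Manifold ContDiff TensorProduct Topology

noncomputable section

/-! ## Lie groups and actions

A Lie group `H` is modelled on a finite-dimensional real vector space `E`; its Lie algebra is
`T_1 H`, whose underlying vector space is `E` (this is Mathlib's `GroupLieAlgebra 𝓘(ℝ, E) H`). -/

namespace PreHam

section LieGroups

variable {E : Type*} [NormedAddCommGroup E] [NormedSpace ℝ E]

/-- The Lie bracket on `Lie H = T_1 H`, i.e. the bracket of left-invariant vector fields. -/
def lieBr (H : Type*) [TopologicalSpace H] [ChartedSpace E H] [Group H] (X Y : E) : E :=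
  Bracket.bracket (L := GroupLieAlgebra 𝓘(ℝ, E) H) (M := GroupLieAlgebra 𝓘(ℝ, E) H) X Y

/-- The adjoint action `Ad(h)` of `h` on `Lie H`: the derivative of conjugation at `1`. -/
def Ad {H : Type*} [TopologicalSpace H] [ChartedSpace E H] [Group H] (h : H) : E →L[ℝ] E :=
  mfderiv 𝓘(ℝ, E) 𝓘(ℝ, E) (fun a : H => h * a * h⁻¹) 1

/-- The tangent vector `g · X` at `g`, the value at `g` of the left-invariant field of `X`. -/
def leftVec {H : Type*} [TopologicalSpace H] [ChartedSpace E H] [Group H] (X : E) (h : H) :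
    TangentSpace 𝓘(ℝ, E) h :=
  mulInvariantVectorField (I := 𝓘(ℝ, E)) (X : GroupLieAlgebra 𝓘(ℝ, E) H) h

variable {V : Type*} [NormedAddCommGroup V] [NormedSpace ℝ V]

/-- The vector field `X_M` of an action, `X_M(x) = d/dt|_{t=0} exp(tX) x`: the derivative of the
orbit map `h ↦ h x` at `1`, applied to `X`. -/
def fundVec (H : Type*) [TopologicalSpace H] [ChartedSpace E H] [Group H]
    {M : Type*} [TopologicalSpace M] [ChartedSpace V M] [MulAction H M] (X : E) (x : M) :
    TangentSpace 𝓘(ℝ, V) x :=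
  (mfderiv 𝓘(ℝ, E) 𝓘(ℝ, V) (fun h : H => h • x) 1 : E →L[ℝ] V) X

/-- The tangent map `T_x M → T_{hx} M` of the action of `h`. -/
def tangentAct (V : Type*) [NormedAddCommGroup V] [NormedSpace ℝ V] {H : Type*} [Group H]
    {M : Type*} [TopologicalSpace M] [ChartedSpace V M] [MulAction H M] (h : H) (x : M) :
    TangentSpace 𝓘(ℝ, V) x →L[ℝ] TangentSpace 𝓘(ℝ, V) (h • x) :=
  mfderiv 𝓘(ℝ, V) 𝓘(ℝ, V) (fun y : M => h • y) x

end LieGroups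

/-! ## Presymplectic forms -/

section Forms

variable {V : Type*} [NormedAddCommGroup V] [NormedSpace ℝ V]
  {M : Type*} [TopologicalSpace M] [ChartedSpace V M]

/-- A (not necessarily continuous) two-form on `M`: an alternating bilinear form on every
tangent space. -/
abbrev TwoForm (V : Type*) [NormedAddCommGroup V] [NormedSpace ℝ V]
    (M : Type*) [TopologicalSpace M] [ChartedSpace V M] :=
  ∀ x : M, TangentSpace 𝓘(ℝ, V) x [⋀^Fin 2]→L[ℝ] ℝ

/-- The expression of `Ω` in the preferred chart `φ` at `x₀`, i.e. `(φ⁻¹)^* Ω`. -/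
def chartForm (Ω : TwoForm V M) (x₀ : M) (y : V) : V [⋀^Fin 2]→L[ℝ] ℝ :=
  (Ω ((extChartAt 𝓘(ℝ, V) x₀).symm y)).compContinuousLinearMap
    (mfderiv 𝓘(ℝ, V) 𝓘(ℝ, V) (extChartAt 𝓘(ℝ, V) x₀).symm y)

/-- `Ω` is a presymplectic form: it is smooth, and closed. -/
structure IsPresymplectic (Ω : TwoForm V M) : Prop where
  smooth : ∀ x₀ : M, ContDiffOn ℝ ∞ (chartForm Ω x₀) (extChartAt 𝓘(ℝ, V) x₀).target
  closed : ∀ x₀ : M, ∀ y ∈ (extChartAt 𝓘(ℝ, V) x₀).target, extDeriv (chartForm Ω x₀) y = 0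

/-- `Ω` is invariant under the action of `H`. -/
def IsInvariantForm (H : Type*) [Group H] [MulAction H M] (Ω : TwoForm V M) : Prop :=
  ∀ (h : H) (x : M) (v w : TangentSpace 𝓘(ℝ, V) x),
    Ω (h • x) ![tangentAct V h x v, tangentAct V h x w] = Ω x ![v, w]

/-- `Φ : M → (Lie H)^*` is an equivariant momentum map for the action of `H` on `(M, Ω)`, with the
sign convention `d⟨Φ, X⟩ = -Ω(X_M, ·)`. -/
structure IsMomentumMap (H : Type*) {E : Type*} [NormedAddCommGroup E] [NormedSpace ℝ E]
    [TopologicalSpace H] [ChartedSpace E H] [Group H] [MulAction H M]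
    (Ω : TwoForm V M) (Φ : M → (E →L[ℝ] ℝ)) : Prop where
  smooth : ContMDiff 𝓘(ℝ, V) 𝓘(ℝ, E →L[ℝ] ℝ) ∞ Φ
  equivariant : ∀ (h : H) (x : M) (X : E), Φ (h • x) X = Φ x (Ad h⁻¹ X)
  hamilton : ∀ (x : M) (X : E) (v : TangentSpace 𝓘(ℝ, V) x),
    mvfderiv 𝓘(ℝ, V) (fun y => Φ y X) x v = - Ω x ![fundVec H X x, v]

end Forms

/-! ## The group `Spin^c` -/

section SpinC

variable {V : Type*} [AddCommGroup V] [Module ℝ V]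

/-- The complexified Clifford algebra. -/
abbrev CCl (Q : QuadraticForm ℝ V) := ℂ ⊗[ℝ] CliffordAlgebra Q

/-- The vector `v` as an element of the complexified Clifford algebra. -/
def ιC (Q : QuadraticForm ℝ V) (v : V) : CCl Q := (1 : ℂ) ⊗ₜ[ℝ] CliffordAlgebra.ι Q v

/-- `Spin^c(V, Q) = Spin(V, Q) ×_{±1} U(1)`, realised inside the units of the complexified Clifford
algebra as the group of all `z s` with `z ∈ U(1)` and `s ∈ Spin(V, Q)`. -/
def SpinC (Q : QuadraticForm ℝ V) : Subgroup (CCl Q)ˣ where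
  carrier := {u | ∃ (z : Circle) (s : spinGroup Q), (u : CCl Q) = (z : ℂ) ⊗ₜ[ℝ] (s : CliffordAlgebra Q)}
  one_mem' := ⟨1, 1, by simp [Algebra.TensorProduct.one_def]⟩
  mul_mem' := by
    rintro a b ⟨z, s, h⟩ ⟨z', s', h'⟩
    exact ⟨z * z', s * s', by simp [h, h', Algebra.TensorProduct.tmul_mul_tmul]⟩
  inv_mem' := by
    rintro a ⟨z, s, h⟩
    refine ⟨z⁻¹, s⁻¹, ?_⟩
    rw [Units.inv_eq_of_mul_eq_one_right]
    rw [h, Algebra.TensorProduct.tmul_mul_tmul, ← Circle.coe_mul, ← Submonoid.coe_mul]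
    simp [Algebra.TensorProduct.one_def]

/-- The covering `λ : Spin^c(V) → SO(V)` as a relation: `λ(u) v = w`, i.e. `u v u⁻¹ = w` in the
complexified Clifford algebra. -/
def Rotates (Q : QuadraticForm ℝ V) (u : SpinC Q) (v w : V) : Prop :=
  ((u : (CCl Q)ˣ) : CCl Q) * ιC Q v = ιC Q w * ((u : (CCl Q)ˣ) : CCl Q)

/-- The determinant homomorphism `det : Spin^c(V) → U(1)`, `[s, z] ↦ z²`, as a relation. -/
def HasDet (Q : QuadraticForm ℝ V) (u : SpinC Q) (c : Circle) : Prop :=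
  ∃ (z : Circle) (s : spinGroup Q),
    ((u : (CCl Q)ˣ) : CCl Q) = (z : ℂ) ⊗ₜ[ℝ] (s : CliffordAlgebra Q) ∧ c = z ^ 2

/-- Smoothness of a map into a finite-dimensional real vector space `A`, expressed through all
linear functionals (so no norm on `A` has to be chosen). It is used for maps into the Clifford
algebra, and for maps into the group `Spin^c ⊆ CCl`. -/
def SmoothInto {B : Type*} [NormedAddCommGroup B] [NormedSpace ℝ B] {H : Type*} [TopologicalSpace H]
    (I : ModelWithCorners ℝ B H) {X : Type*} [TopologicalSpace X] [ChartedSpace H X]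
    {A : Type*} [AddCommGroup A] [Module ℝ A] (f : X → A) (s : Set X) : Prop :=
  ∀ l : A →ₗ[ℝ] ℝ, ContMDiffOn I 𝓘(ℝ, ℝ) ∞ (fun x => l (f x)) s

/-- An isometric linear map `f : (V, Q) → (V', Q')` induces a homomorphism of Spin groups. -/
theorem map_mem_spinGroup {V' : Type*} [AddCommGroup V'] [Module ℝ V'] {Q : QuadraticForm ℝ V}
    {Q' : QuadraticForm ℝ V'} (f : Q →qᵢ Q') {s : CliffordAlgebra Q} (hs : s ∈ spinGroup Q) :
    CliffordAlgebra.map f s ∈ spinGroup Q' := by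
  have hstar : ∀ x, star (CliffordAlgebra.map f x) = CliffordAlgebra.map f (star x) := by
    intro x
    induction x using CliffordAlgebra.induction with
    | algebraMap r => simp [CliffordAlgebra.star_def]
    | ι m => simp
    | mul a b ha hb => simp [star_mul, ha, hb]
    | add a b ha hb => simp [star_add, ha, hb]
  refine spinGroup.mem_iff.2 ⟨pinGroup.mem_iff.2 ⟨?_, ?_⟩, ?_⟩
  · obtain ⟨x, hx, rfl⟩ := (pinGroup.mem_iff.1 (spinGroup.mem_pin hs)).1
    refine ⟨Units.map (CliffordAlgebra.map f : _ →* CliffordAlgebra Q') x, ?_, rfl⟩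
    have hx' : x ∈ lipschitzGroup Q := hx
    change _ ∈ lipschitzGroup Q'
    clear hx hs
    unfold lipschitzGroup at hx' ⊢
    induction hx' using Subgroup.closure_induction with
    | mem y hy =>
      obtain ⟨m, hm⟩ := hy
      exact Subgroup.subset_closure ⟨f m, by simp [← hm]⟩
    | one => simp
    | mul a b _ _ ha hb => rw [map_mul]; exact mul_mem ha hb
    | inv a _ ha => rw [map_inv]; exact inv_mem ha
  · rw [Unitary.mem_iff, hstar, ← map_mul, ← map_mul, spinGroup.star_mul_self_of_mem hs,
      spinGroup.mul_star_self_of_mem hs, map_one]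
    exact ⟨rfl, rfl⟩
  · have he : s ∈ CliffordAlgebra.evenOdd Q 0 := spinGroup.mem_even hs
    change _ ∈ CliffordAlgebra.evenOdd Q' 0
    clear hs
    induction s, he using CliffordAlgebra.even_induction with
    | algebraMap r => simp; exact SetLike.algebraMap_mem_graded _ _
    | add x y hx hy ihx ihy => rw [map_add]; exact add_mem ihx ihy
    | ι_mul_ι_mul m₁ m₂ x hx ih =>
      simp only [map_mul, CliffordAlgebra.map_apply_ι]
      have := SetLike.mul_mem_graded (CliffordAlgebra.ι_mul_ι_mem_evenOdd_zero Q' (f m₁) (f m₂)) ih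
      simpa using this

/-- The homomorphism `Spin^c(V, Q) → Spin^c(V', Q')` induced by an isometric linear map. -/
def SpinC.map {V' : Type*} [AddCommGroup V'] [Module ℝ V'] {Q : QuadraticForm ℝ V}
    {Q' : QuadraticForm ℝ V'} (f : Q →qᵢ Q') : SpinC Q →* SpinC Q' :=
  ((Units.map (Algebra.TensorProduct.map (AlgHom.id ℝ ℂ) (CliffordAlgebra.map f) :
      CCl Q →* CCl Q')).comp (SpinC Q).subtype).codRestrict (SpinC Q') (by
    rintro ⟨u, z, s, h⟩
    exact ⟨z, ⟨_, map_mem_spinGroup f s.2⟩, by simp [h]⟩)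

/-- The inclusion `Spin(V, Q) → Spin^c(V, Q)`. -/
def spinToSpinC (Q : QuadraticForm ℝ V) : spinGroup Q →* SpinC Q :=
  ((Units.map (Algebra.TensorProduct.includeRight : CliffordAlgebra Q →ₐ[ℝ] CCl Q).toMonoidHom).comp
    spinGroup.toUnits).codRestrict (SpinC Q) (by
    intro s
    exact ⟨1, s, by simp [spinGroup.toUnits]⟩)

end SpinC

/-! ## Hermitian line bundles and connections -/

section LineBundles

variable {V : Type*} [NormedAddCommGroup V] [NormedSpace ℝ V]
  {M : Type*} [TopologicalSpace M] [ChartedSpace V M] [IsManifold 𝓘(ℝ, V) ∞ M]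

/-- A smooth complex line bundle `L → M` with a smooth Hermitian metric: a smooth vector bundle with
model fibre `ℂ`, with complex-linear trivialisations and with a complex inner product on every
fibre that depends smoothly on the base point (equivalently, by polarisation, `l ↦ (l, l) = ‖l‖²`
is smooth on the total space). -/
structure HermitianLineBundle.{w, v, m} (V : Type v) [NormedAddCommGroup V] [NormedSpace ℝ V]
    (M : Type m) [TopologicalSpace M] [ChartedSpace V M] [IsManifold 𝓘(ℝ, V) ∞ M] where
  Fiber : M → Type w
  [normed : ∀ x, NormedAddCommGroup (Fiber x)]
  [inner : ∀ x, InnerProductSpace ℂ (Fiber x)]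
  [top : TopologicalSpace (TotalSpace ℂ Fiber)]
  [fiberBundle : FiberBundle ℂ Fiber]
  [complexVectorBundle : VectorBundle ℂ ℂ Fiber]
  [vectorBundle : VectorBundle ℝ ℂ Fiber]
  [smooth : ContMDiffVectorBundle ∞ ℂ Fiber 𝓘(ℝ, V)]
  metric_smooth : ContMDiff (𝓘(ℝ, V).prod 𝓘(ℝ, ℂ)) 𝓘(ℝ, ℝ) ∞
    (fun l : TotalSpace ℂ Fiber => ‖l.snd‖ ^ 2)

attribute [instance] HermitianLineBundle.normed HermitianLineBundle.inner HermitianLineBundle.top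
  HermitianLineBundle.fiberBundle HermitianLineBundle.complexVectorBundle
  HermitianLineBundle.vectorBundle HermitianLineBundle.smooth

namespace HermitianLineBundle

/-- The total space of the line bundle. -/
abbrev Total (L : HermitianLineBundle V M) := TotalSpace ℂ L.Fiber

/-- The smooth sections of the line bundle. -/
def IsSmoothSection (L : HermitianLineBundle V M) (s : ∀ x, L.Fiber x) : Prop :=
  ContMDiff 𝓘(ℝ, V) (𝓘(ℝ, V).prod 𝓘(ℝ, ℂ)) ∞ (fun x => (⟨x, s x⟩ : L.Total))

/-- A smooth lift to `L`, by fibrewise complex-linear isometries, of the action of `H` on `M`;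
so `L` is an `H`-equivariant Hermitian line bundle. -/
structure Action (L : HermitianLineBundle V M) (E : Type*) [NormedAddCommGroup E]
    [NormedSpace ℝ E] (H : Type*) [TopologicalSpace H] [ChartedSpace E H] [Group H] [MulAction H M] where
  act : ∀ (h : H) (x : M), L.Fiber x ≃ₗᵢ[ℂ] L.Fiber (h • x)
  act_one : ∀ (x : M) (l : L.Fiber x), (⟨(1 : H) • x, act 1 x l⟩ : L.Total) = ⟨x, l⟩
  act_mul : ∀ (h k : H) (x : M) (l : L.Fiber x),
    (⟨(h * k) • x, act (h * k) x l⟩ : L.Total) = ⟨h • k • x, act h (k • x) (act k x l)⟩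
  smooth : ContMDiff (𝓘(ℝ, E).prod (𝓘(ℝ, V).prod 𝓘(ℝ, ℂ))) (𝓘(ℝ, V).prod 𝓘(ℝ, ℂ)) ∞
    (fun p : H × L.Total => (⟨p.1 • p.2.proj, act p.1 p.2.proj p.2.snd⟩ : L.Total))

/-- A vector field is smooth. -/
def _root_.PreHam.IsSmoothField (v : ∀ x : M, TangentSpace 𝓘(ℝ, V) x) : Prop :=
  ContMDiff 𝓘(ℝ, V) 𝓘(ℝ, V).tangent ∞ (fun x => (⟨x, v x⟩ : TangentBundle 𝓘(ℝ, V) M))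

/-- `(L, ( , ), ∇)` is an equivariant `Spin^c`-prequantisation of `(M, Ω)` with momentum map `Φ`:
`∇` is a smooth Hermitian connection on `L`, invariant under the action of `H`, with
curvature `2πi · 2Ω`, and the action of the Lie algebra of `H` on sections is
given by Kostant's formula `L_X s = - ∇_{X_M} s + 2πi · 2⟨Φ, X⟩ s`.
Here `(L_X s)(x) = d/dt|_{t=0} exp(tX) s(exp(-tX) x)`, so `-(L_X s)(x)` is the derivative at `1` in
the direction `X` of the function `h ↦ h⁻¹ s(h x)` with values in the fibre at `x`.
(In Mathlib's `CovariantDerivative`, `nabla s x v` is `∇_v s`.) -/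
structure IsSpincPrequantisation
    (L : HermitianLineBundle V M) {H : Type*} {E : Type*}
    [NormedAddCommGroup E] [NormedSpace ℝ E] [TopologicalSpace H] [ChartedSpace E H] [Group H]
    [MulAction H M] (a : L.Action E H) (nabla : CovariantDerivative 𝓘(ℝ, V) ℂ L.Fiber)
    (Ω : TwoForm V M) (Φ : M → (E →L[ℝ] ℝ)) : Prop where
  smooth : CovariantDerivative.ContMDiffCovariantDerivative nabla ∞
  complex_linear : ∀ (s : ∀ x, L.Fiber x), L.IsSmoothSection s →
    ∀ (x : M) (v : TangentSpace 𝓘(ℝ, V) x),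
      nabla (fun y => Complex.I • s y) x v = Complex.I • nabla s x v
  hermitian : ∀ (s t : ∀ x, L.Fiber x), L.IsSmoothSection s → L.IsSmoothSection t →
    ∀ (x : M) (v : TangentSpace 𝓘(ℝ, V) x),
      mvfderiv 𝓘(ℝ, V) (fun y => Inner.inner ℂ (s y) (t y)) x v =
        Inner.inner ℂ (nabla s x v) (t x) + Inner.inner ℂ (s x) (nabla t x v)
  invariant : ∀ (h : H) (s t : ∀ x, L.Fiber x), L.IsSmoothSection s → L.IsSmoothSection t →
    (∀ x, t (h • x) = a.act h x (s x)) →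
    ∀ (x : M) (v : TangentSpace 𝓘(ℝ, V) x),
      nabla t (h • x) (tangentAct V h x v) = a.act h x (nabla s x v)
  curvature : ∀ (v w : ∀ x : M, TangentSpace 𝓘(ℝ, V) x) (s : ∀ x, L.Fiber x),
    IsSmoothField v → IsSmoothField w → L.IsSmoothSection s → ∀ x : M,
      nabla (fun y => nabla s y (w y)) x (v x) - nabla (fun y => nabla s y (v y)) x (w x)
          - nabla s x (VectorField.mlieBracket 𝓘(ℝ, V) v w x) =
        (2 * Real.pi * Complex.I * (2 * (Ω x ![v x, w x] : ℝ)) : ℂ) • s x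
  kostant : ∀ (X : E) (s : ∀ x, L.Fiber x), L.IsSmoothSection s → ∀ x : M,
    nabla s x (fundVec H X x) =
      (2 * Real.pi * Complex.I * (2 * (Φ x X : ℝ)) : ℂ) • s x +
        mvfderiv 𝓘(ℝ, E) (fun h : H => (a.act h x).symm (s (h • x))) 1 X

end HermitianLineBundle

end LineBundles

/-! ## `Spin^c`-structures -/

section SpincStructures

variable {V : Type*} [NormedAddCommGroup V] [NormedSpace ℝ V]
  {M : Type*} [TopologicalSpace M] [ChartedSpace V M] [IsManifold 𝓘(ℝ, V) ∞ M]

/-- A `Spin^c`-structure on a manifold `M` modelled on the Euclidean space `(V, Q)`: a smooth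
principal `Spin^c(V, Q)`-bundle `P → M` with an isomorphism `P ×_{Spin^c(V, Q)} V ≅ TM`.

The bundle is given by its fibres `P_x`, on which `Spin^c(V, Q)` acts simply transitively from the
right, and a smooth structure: an atlas of local sections over open sets that cover `M`, related on
overlaps by smooth functions with values in `Spin^c(V, Q)`. (An element `(U, s)` of the atlas is the
local section `s|_U`; the values of `s` outside `U` are irrelevant.)

The isomorphism `P ×_{Spin^c(V, Q)} V → TM` is given by the linear isomorphisms
`frame p : V → T_x M`, `v ↦ [p, v]`, for `p ∈ P_x`. -/
structure SpincStructure.{w, v, m} (V : Type v) [NormedAddCommGroup V] [NormedSpace ℝ V]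
    (M : Type m) [TopologicalSpace M] [ChartedSpace V M] [IsManifold 𝓘(ℝ, V) ∞ M]
    (Q : QuadraticForm ℝ V) where
  Fiber : M → Type w
  act : ∀ {x : M}, Fiber x → SpinC Q → Fiber x
  act_one : ∀ {x : M} (p : Fiber x), act p 1 = p
  act_mul : ∀ {x : M} (p : Fiber x) (u u' : SpinC Q), act p (u * u') = act (act p u) u'
  simply_transitive : ∀ {x : M} (p p' : Fiber x), ∃! u : SpinC Q, act p u = p'
  atlas : Set (Set M × ∀ x, Fiber x)
  atlas_open : ∀ c ∈ atlas, IsOpen c.1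
  atlas_cover : ∀ x : M, ∃ c ∈ atlas, x ∈ c.1
  atlas_compatible : ∀ c ∈ atlas, ∀ d ∈ atlas, ∃ u : M → SpinC Q,
    (∀ x ∈ c.1 ∩ d.1, d.2 x = act (c.2 x) (u x)) ∧
      SmoothInto 𝓘(ℝ, V) (fun x => (((u x : (CCl Q)ˣ)) : CCl Q)) (c.1 ∩ d.1)
  frame : ∀ {x : M}, Fiber x → (V ≃L[ℝ] TangentSpace 𝓘(ℝ, V) x)
  frame_act : ∀ {x : M} (p : Fiber x) (u : SpinC Q) (v w : V), Rotates Q u v w →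
    frame (act p u) v = frame p w
  frame_smooth : ∀ c ∈ atlas, ∀ v : V, ContMDiffOn 𝓘(ℝ, V) 𝓘(ℝ, V).tangent ∞
    (fun x => (⟨x, frame (c.2 x) v⟩ : TangentBundle 𝓘(ℝ, V) M)) c.1

namespace SpincStructure

variable {Q : QuadraticForm ℝ V}

/-- The total space of the principal bundle. -/
abbrev Total (P : SpincStructure V M Q) := Σ x : M, P.Fiber x

/-- A smooth lift to `P` of the action of `H` on `M`, which commutes with the action of `Spin^c`,
and for which the isomorphism `P ×_{Spin^c(V, Q)} V ≅ TM` is equivariant; so `P` is an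
`H`-equivariant `Spin^c`-structure. -/
structure Action (P : SpincStructure V M Q) (E : Type*) [NormedAddCommGroup E]
    [NormedSpace ℝ E] (H : Type*) [TopologicalSpace H] [ChartedSpace E H] [Group H] [MulAction H M] where
  lact : ∀ (h : H) {x : M}, P.Fiber x → P.Fiber (h • x)
  lact_one : ∀ {x : M} (p : P.Fiber x), (⟨(1 : H) • x, lact 1 p⟩ : P.Total) = ⟨x, p⟩
  lact_mul : ∀ (h k : H) {x : M} (p : P.Fiber x),
    (⟨(h * k) • x, lact (h * k) p⟩ : P.Total) = ⟨h • k • x, lact h (lact k p)⟩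
  lact_act : ∀ (h : H) {x : M} (p : P.Fiber x) (u : SpinC Q),
    lact h (P.act p u) = P.act (lact h p) u
  frame_lact : ∀ (h : H) {x : M} (p : P.Fiber x) (v : V),
    P.frame (lact h p) v = tangentAct V h x (P.frame p v)
  smooth : ∀ c ∈ P.atlas, ∀ d ∈ P.atlas, ∃ u : H × M → SpinC Q,
    (∀ y : H × M, y.2 ∈ c.1 → y.1 • y.2 ∈ d.1 →
      lact y.1 (c.2 y.2) = P.act (d.2 (y.1 • y.2)) (u y)) ∧
      SmoothInto (𝓘(ℝ, E).prod 𝓘(ℝ, V)) (fun y => (((u y : (CCl Q)ˣ)) : CCl Q))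
        {y : H × M | y.2 ∈ c.1 ∧ y.1 • y.2 ∈ d.1}

/-- An isomorphism of equivariant line bundles from the determinant line bundle `P ×_det ℂ` of the
`Spin^c`-structure `P` to `L`. It is given by the linear isomorphisms `iso p : ℂ → L_x`,
`c ↦ [p, c]`, for `p ∈ P_x`. -/
structure DetIso (P : SpincStructure V M Q) (L : HermitianLineBundle V M) {H : Type*} {E : Type*}
    [NormedAddCommGroup E] [NormedSpace ℝ E] [TopologicalSpace H] [ChartedSpace E H] [Group H]
    [MulAction H M] (aP : P.Action E H) (aL : L.Action E H) where
  iso : ∀ {x : M}, P.Fiber x → (ℂ ≃ₗ[ℂ] L.Fiber x)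
  iso_act : ∀ {x : M} (p : P.Fiber x) (u : SpinC Q) (d : Circle), HasDet Q u d →
    ∀ c : ℂ, iso (P.act p u) c = iso p (d * c)
  iso_lact : ∀ (h : H) {x : M} (p : P.Fiber x) (c : ℂ),
    iso (aP.lact h p) c = aL.act h x (iso p c)
  smooth : ∀ c ∈ P.atlas, ContMDiffOn 𝓘(ℝ, V) (𝓘(ℝ, V).prod 𝓘(ℝ, ℂ)) ∞
    (fun x => (⟨x, iso (c.2 x) 1⟩ : L.Total)) c.1

end SpincStructure

end SpincStructures

/-! ## Prequantised pre-Hamiltonian manifolds -/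

/-- The data that make the `H`-manifold `M` (modelled on the Euclidean space `(V, Q)`) a
pre-Hamiltonian `H`-manifold with an equivariant `Spin^c`-prequantisation and an equivariant
`Spin^c`-structure: an invariant presymplectic form `form`, a momentum map `Φ`, an equivariant
Hermitian line bundle `L` with a connection `nabla` that is an equivariant `Spin^c`-prequantisation,
and an equivariant `Spin^c`-structure `P` with determinant line bundle `L`. -/
structure PreHamSpinc.{wL, wP, h, e, v, m} (E : Type e) [NormedAddCommGroup E]
    [NormedSpace ℝ E] (H : Type h) [TopologicalSpace H] [ChartedSpace E H] [Group H] {V : Type v}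
    [NormedAddCommGroup V] [NormedSpace ℝ V] (M : Type m) [TopologicalSpace M] [ChartedSpace V M]
    [IsManifold 𝓘(ℝ, V) ∞ M] [MulAction H M] (Q : QuadraticForm ℝ V) where
  form : TwoForm V M
  presymplectic : IsPresymplectic form
  form_invariant : IsInvariantForm H form
  Φ : M → (E →L[ℝ] ℝ)
  momentum : IsMomentumMap H form Φ
  L : HermitianLineBundle.{wL} V M
  actL : L.Action E H
  nabla : CovariantDerivative 𝓘(ℝ, V) ℂ L.Fiber
  prequantisation : L.IsSpincPrequantisation actL nabla form Φ
  P : SpincStructure.{wP} V M Q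
  actP : P.Action E H
  det : P.DetIso L actP actL

/-! ## The space `G ×_K N` -/

section AssocSpace

variable {G : Type*} [Group G] (K : Subgroup G) (N : Type*) [MulAction K N]

/-- The orbit relation on `G × N` of the action of `K` given by `k (g, n) = (g k⁻¹, k n)`. -/
def assocSetoid : Setoid (G × N) where
  r p p' := ∃ k : K, p' = (p.1 * (k : G)⁻¹, k • p.2)
  iseqv :=
    { refl := fun p => ⟨1, by simp⟩
      symm := by
        rintro p p' ⟨k, rfl⟩
        exact ⟨k⁻¹, by simp⟩
      trans := by
        rintro p p' p'' ⟨k, rfl⟩ ⟨k', rfl⟩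
        exact ⟨k' * k, by simp [mul_assoc, mul_smul]⟩ }

/-- The quotient `G ×_K N` of `G × N` by the action of `K` (with the quotient topology). -/
def AssocSpace : Type _ := Quotient (assocSetoid K N)

variable {N}

/-- The quotient map `q : G × N → G ×_K N`, `(g, n) ↦ [g, n]`. -/
def assocMk (p : G × N) : AssocSpace K N := Quotient.mk (assocSetoid K N) p

variable (N)

instance [TopologicalSpace G] [TopologicalSpace N] : TopologicalSpace (AssocSpace K N) :=
  inferInstanceAs (TopologicalSpace (Quotient (assocSetoid K N)))

/-- The action of `G` on `G ×_K N`, `g [g', n] = [g g', n]`. -/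
instance : MulAction G (AssocSpace K N) where
  smul g := Quotient.map' (s₁ := assocSetoid K N) (s₂ := assocSetoid K N)
    (fun p => (g * p.1, p.2)) (by
      rintro p p' ⟨k, rfl⟩
      exact ⟨k, by simp [mul_assoc]⟩)
  one_smul := by
    rintro ⟨p⟩
    exact congrArg (assocMk K) (by simp)
  mul_smul g g' := by
    rintro ⟨p⟩
    exact congrArg (assocMk K) (by simp [mul_assoc])

end AssocSpace

/-! ## Pre-Hamiltonian induction -/

section Induction

variable {EG : Type*} [NormedAddCommGroup EG] [NormedSpace ℝ EG]
  {G : Type*} [TopologicalSpace G] [ChartedSpace EG G] [Group G]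
  {EK : Type*} [NormedAddCommGroup EK] [NormedSpace ℝ EK]
  (K : Subgroup G) [ChartedSpace EK K]

/-- The derivative at `1` of the inclusion of `K` into `G`, i.e. the inclusion `𝔨 → 𝔤` of Lie
algebras. -/
def lieIncl : EK →L[ℝ] EG := mfderiv 𝓘(ℝ, EK) 𝓘(ℝ, EG) (Subtype.val : K → G) 1

/-- `K` (with its given smooth structure) is a maximal compact subgroup of `G` and an (embedded) Lie
subgroup. -/
structure IsMaximalCompactLieSubgroup : Prop where
  compact : IsCompact (K : Set G)
  maximal : ∀ C : Subgroup G, IsCompact (C : Set G) → K ≤ C → C = K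
  smooth : ContMDiff 𝓘(ℝ, EK) 𝓘(ℝ, EG) ∞ (Subtype.val : K → G)
  immersion : ∀ k : K, Function.Injective
    (mfderiv 𝓘(ℝ, EK) 𝓘(ℝ, EG) (Subtype.val : K → G) k)

/-- The choices made on the Lie algebra level: an `Ad(K)`-invariant complement `𝔭` of `𝔨` in `𝔤`, an
`Ad(K)`-invariant inner product on `𝔭` (given by its quadratic form `X ↦ (X, X)`), and a lift
`K → Spin(𝔭)` of the representation `Ad : K → SO(𝔭)`. -/
structure SpinComplement where
  𝔭 : Submodule ℝ EG
  isCompl : IsCompl (LinearMap.range (lieIncl (EG := EG) (EK := EK) K).toLinearMap) 𝔭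
  Ad_mem : ∀ (k : K) (X : 𝔭), Ad (k : G) (X : EG) ∈ 𝔭
  Q : QuadraticForm ℝ 𝔭
  posDef : Q.PosDef
  invariant : ∀ (k : K) (X : 𝔭), Q ⟨Ad (k : G) (X : EG), Ad_mem k X⟩ = Q X
  lift : K →* spinGroup Q
  lift_smooth : SmoothInto 𝓘(ℝ, EK) (fun k => (lift k : CliffordAlgebra Q)) univ
  lift_covers : ∀ (k : K) (X : 𝔭),
    (lift k : CliffordAlgebra Q) * CliffordAlgebra.ι Q X =
      CliffordAlgebra.ι Q ⟨Ad (k : G) (X : EG), Ad_mem k X⟩ * (lift k : CliffordAlgebra Q)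

variable {K}

namespace SpinComplement

variable (S : SpinComplement (EG := EG) (EK := EK) K)

/-- The projection `𝔤 = 𝔨 ⊕ 𝔭 → 𝔨`. -/
def proj (Y : EG) : EK :=
  Classical.choose (show ∃ Z : EK, lieIncl (EG := EG) K Z =
      Submodule.projection (LinearMap.range (lieIncl (EG := EG) (EK := EK) K).toLinearMap) S.𝔭
        S.isCompl Y by
    obtain ⟨Z, hZ⟩ := LinearMap.mem_range.1 (Submodule.projection_apply_mem S.isCompl Y)
    exact ⟨Z, hZ⟩)

variable {V : Type*} [NormedAddCommGroup V] [NormedSpace ℝ V]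
  {N : Type*} [TopologicalSpace N] [ChartedSpace V N] [MulAction K N]
  [ChartedSpace (V × S.𝔭) (AssocSpace K N)]

/-- The tangent vector `Tq(v + X)` to `G ×_K N` at `[g, n]`, for `v ∈ T_n N` and `X ∈ 𝔭`; here `X` is
viewed as the vector `g · X ∈ T_g G`, and `q : G × N → G ×_K N` is the quotient map. -/
def tangentVec (g : G) (n : N) (v : TangentSpace 𝓘(ℝ, V) n) (X : S.𝔭) :
    TangentSpace 𝓘(ℝ, V × S.𝔭) (assocMk K (g, n)) :=
  mfderiv (𝓘(ℝ, EG).prod 𝓘(ℝ, V)) 𝓘(ℝ, V × S.𝔭) (assocMk K : G × N → AssocSpace K N) (g, n)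
    ((leftVec (X : EG) g, v) : EG × V)

end SpinComplement

/-- `G ×_K N` carries the smooth structure of a quotient manifold: the quotient map
`q : G × N → G ×_K N` is a smooth submersion. (Such a smooth structure is unique.) -/
structure IsQuotientManifold (S : SpinComplement (EG := EG) (EK := EK) K)
    {V : Type*} [NormedAddCommGroup V] [NormedSpace ℝ V]
    (N : Type*) [TopologicalSpace N] [ChartedSpace V N] [MulAction K N]
    [ChartedSpace (V × S.𝔭) (AssocSpace K N)] : Prop where
  smooth : ContMDiff (𝓘(ℝ, EG).prod 𝓘(ℝ, V)) 𝓘(ℝ, V × S.𝔭) ∞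
    (assocMk K : G × N → AssocSpace K N)
  submersion : ∀ p : G × N, Function.Surjective
    (mfderiv (𝓘(ℝ, EG).prod 𝓘(ℝ, V)) 𝓘(ℝ, V × S.𝔭) (assocMk K : G × N → AssocSpace K N) p)

/-- The structures `D'` on `M = G ×_K N` are the ones obtained from the structures `D` on `N` by
pre-Hamiltonian induction. -/
structure Induces (S : SpinComplement (EG := EG) (EK := EK) K)
    {V : Type*} [NormedAddCommGroup V] [NormedSpace ℝ V]
    {N : Type*} [TopologicalSpace N] [ChartedSpace V N] [IsManifold 𝓘(ℝ, V) ∞ N] [MulAction K N]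
    [ChartedSpace (V × S.𝔭) (AssocSpace K N)] [IsManifold 𝓘(ℝ, V × S.𝔭) ∞ (AssocSpace K N)]
    {Q : QuadraticForm ℝ V} (D : PreHamSpinc EK K N Q)
    (D' : PreHamSpinc EG G (AssocSpace K N) (Q.prod S.Q)) where
  /-- `Ω_{[e, n]}(Tq(v + X), Tq(w + Y)) = ν_n(v, w) - ⟨Φ_N(n), [X, Y]⟩`. -/
  form_eq : ∀ (n : N) (v w : TangentSpace 𝓘(ℝ, V) n) (X Y : S.𝔭),
    D'.form (assocMk K (1, n)) ![S.tangentVec 1 n v X, S.tangentVec 1 n w Y] =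
      D.form n ![v, w] - D.Φ n (S.proj (lieBr G (X : EG) (Y : EG)))
  /-- `Φ_M([g, n]) = Ad^*(g) Φ_N(n)`, where `𝔨^* ⊆ 𝔤^*` through `𝔤 = 𝔨 ⊕ 𝔭`. -/
  Φ_eq : ∀ (g : G) (n : N) (Y : EG), D'.Φ (assocMk K (g, n)) Y = D.Φ n (S.proj (Ad g⁻¹ Y))
  /-- The line bundle of `D'` is `G ×_K L`, with the metric `([g, l], [g, l']) = (l, l')`: this is the
  map `G × L → D'.L`, `(g, l) ↦ [g, l]`. -/
  lineMk : ∀ (g : G) (n : N), D.L.Fiber n ≃ₗᵢ[ℂ] D'.L.Fiber (assocMk K (g, n))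
  lineMk_smooth : ContMDiff (𝓘(ℝ, EG).prod (𝓘(ℝ, V).prod 𝓘(ℝ, ℂ)))
    (𝓘(ℝ, V × S.𝔭).prod 𝓘(ℝ, ℂ)) ∞
    (fun p : G × D.L.Total => (⟨_, lineMk p.1 p.2.proj p.2.snd⟩ : D'.L.Total))
  /-- `[g k⁻¹, k l] = [g, l]`. -/
  lineMk_K : ∀ (g : G) (k : K) (n : N) (l : D.L.Fiber n),
    (⟨_, lineMk (g * (k : G)⁻¹) (k • n) (D.actL.act k n l)⟩ : D'.L.Total) = ⟨_, lineMk g n l⟩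
  /-- `g' [g, l] = [g' g, l]`. -/
  lineMk_G : ∀ (g' g : G) (n : N) (l : D.L.Fiber n),
    (⟨_, D'.actL.act g' _ (lineMk g n l)⟩ : D'.L.Total) = ⟨_, lineMk (g' * g) n l⟩
  /-- The connection: in terms of the functions `(g, n) ↦ s_g(n) ∈ L_n` that correspond to sections `s`
  of `G ×_K L`, by `s([g, n]) = [g, s_g(n)]`, the derivative `∇_{Tq(v + X)} s` at `[g, n]` is given by
  `∇_v s_g` in the direction of `v ∈ T_n N`, and by the derivative of `g ↦ s_g(n)` in the direction of
  `X ∈ 𝔭`. -/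
  nabla_eq : ∀ (s : ∀ x, D'.L.Fiber x), D'.L.IsSmoothSection s →
    ∀ (g : G) (n : N) (v : TangentSpace 𝓘(ℝ, V) n) (X : S.𝔭),
      D'.nabla s (assocMk K (g, n)) (S.tangentVec g n v X) =
        lineMk g n
          (D.nabla (fun m => (lineMk g m).symm (s (assocMk K (g, m)))) n v +
            mvfderiv 𝓘(ℝ, EG) (fun a : G => (lineMk a n).symm (s (assocMk K (a, n)))) g
              (leftVec (X : EG) g))
  /-- The principal bundle of `D'` is `G ×_K (P ×_{Spin^c(V)} Spin^c(V ⊕ 𝔭))`, where `k ∈ K` acts on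
  the factor `Spin^c(V ⊕ 𝔭)` through the lift `K → Spin(𝔭)`: this is the map `G × P → D'.P`,
  `(g, p) ↦ [g, [p, 1]]`. -/
  spinMk : ∀ (g : G) {n : N}, D.P.Fiber n → D'.P.Fiber (assocMk K (g, n))
  /-- `[g, [p u, 1]] = [g, [p, 1]] u` for `u ∈ Spin^c(V) ⊆ Spin^c(V ⊕ 𝔭)`. -/
  spinMk_act : ∀ (g : G) {n : N} (p : D.P.Fiber n) (u : SpinC Q),
    spinMk g (D.P.act p u) = D'.P.act (spinMk g p) (SpinC.map (QuadraticMap.Isometry.inl Q S.Q) u)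
  /-- `[g k⁻¹, [k p, lift k]] = [g, [p, 1]]`. -/
  spinMk_K : ∀ (g : G) (k : K) {n : N} (p : D.P.Fiber n),
    (⟨_, D'.P.act (spinMk (g * (k : G)⁻¹) (D.actP.lact k p))
      (SpinC.map (QuadraticMap.Isometry.inr Q S.Q) (spinToSpinC S.Q (S.lift k)))⟩ : D'.P.Total) =
      ⟨_, spinMk g p⟩
  /-- `g' [g, [p, 1]] = [g' g, [p, 1]]`. -/
  spinMk_G : ∀ (g' g : G) {n : N} (p : D.P.Fiber n),
    (⟨_, D'.actP.lact g' (spinMk g p)⟩ : D'.P.Total) = ⟨_, spinMk (g' * g) p⟩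
  spinMk_smooth : ∀ c ∈ D.P.atlas, ∀ d ∈ D'.P.atlas, ∃ u : G × N → SpinC (Q.prod S.Q),
    (∀ y : G × N, y.2 ∈ c.1 → assocMk K y ∈ d.1 →
      spinMk y.1 (c.2 y.2) = D'.P.act (d.2 (assocMk K y)) (u y)) ∧
      SmoothInto (𝓘(ℝ, EG).prod 𝓘(ℝ, V))
        (fun y => (((u y : (CCl (Q.prod S.Q))ˣ)) : CCl (Q.prod S.Q)))
        {y : G × N | y.2 ∈ c.1 ∧ assocMk K y ∈ d.1}
  /-- The identification with `TM` is the one induced by `TM = G ×_K (TN ⊕ 𝔭)`. -/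
  spinMk_frame : ∀ (g : G) {n : N} (p : D.P.Fiber n) (v : V) (X : S.𝔭),
    D'.P.frame (spinMk g p) (v, X) = S.tangentVec g n (D.P.frame p v) X
  /-- The isomorphism of the determinant line bundle with `G ×_K L` is the one induced by the
  isomorphism of the determinant line bundle of `P` with `L`. -/
  spinMk_det : ∀ (g : G) {n : N} (p : D.P.Fiber n) (c : ℂ),
    D'.det.iso (spinMk g p) c = lineMk g n (D.det.iso p c)

end Induction

end PreHam

end

universe uEG uG uEK uV uN wL wP

open Set Bundle
open scoped Manifold ContDiff TensorProduct Topology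

noncomputable section

set_option linter.unusedSectionVars false
set_option linter.style.haveILetI false

namespace PreHam

/-! ### The groups Spin and `Spin^c`: rotations, determinant, orthogonal sums. -/

section SpinAlgebra

variable {V : Type*} [AddCommGroup V] [Module ℝ V] {Q : QuadraticForm ℝ V}

/-! Write `M = G ×_K N`. The map `q : G × N → M` is constant on `K`-orbits, and every structure on
`M` is a `K`-equivariant structure on `G × N`. Near `1` the inverse function theorem splits `G` as
`σ(𝔭) K` (`exists_slice`), so a ball in `𝔭` times a chart of `N` is a chart of `M` (`assocChart`),
and changes of charts only involve the smooth `K`-component of a group element. A set-theoretic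
`K`-equivariant map `ρ : G → K` (`Retract`) singles out one representative in each class. It need
not be continuous: it centres the charts and gives the fibres of the induced bundles constant
models, while smoothness is always tested through the slice. At the preferred representative, `Tq(gX
+ v)` is the vector `(v, X)` of the model space itself (`dq_rep`), and `Tq` identifies `gZ` with
`Z_N` for `Z ∈ 𝔨` (`dq_vertical`). Pointwise identities on `M` thereby become identities on `N` and
`𝔤`.

Connection. A section `s` of `G ×_K L` is a function `f(g, n) = s_g(n)` with `f(g k⁻¹, k n) = k f(g,
n)`. Let `Df` be its covariant derivative for the pull-back of `∇^N` to `G × N` (`along`,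
`pullDer`). Invariance of `∇^N` makes `Df` equivariant, and Kostant's formula on `N` says that the
derivative of `f` along `(-gZ, Z_N)`, `Z ∈ 𝔨`, is `4πi⟨Φ_N, Z⟩ f` (`pullDer_vertical`). Therefore
`∇^M_{Tq(gξ + v)} s = [g, Df(gξ, v) + 4πi⟨Φ_N, ξ_𝔨⟩ f]` is well defined for all `ξ ∈ 𝔤`
(`indNabla_dq`). For `ξ ∈ 𝔭` this is the asserted formula; for `ξ = Ad(g⁻¹)X`, `v = 0` it is
Kostant's formula on `M`, because the moment term is then `⟨Φ_M, X⟩`.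

Curvature. In a chart of `M` the connection is `d + β` with `β = α + 4πi⟨Φ_N, θ_𝔨⟩`, where `α` is a
connection form on `N` and `θ` is the left Maurer–Cartan form on the slice (`isConnForm_indForm`).
At the centre of the chart `θ_𝔨` vanishes on `𝔭`, so only `dα = 4πiν` and the Maurer–Cartan equation
`dθ(X, Y) = -[X, Y]` contribute, and `dβ = 4πiω` there (`fderiv_indForm_sub`). Every point is the
centre of a chart, so the curvature is `4πiω` everywhere. Conversely `ω` is locally `(4π)⁻¹ Im dβ`,
hence smooth and closed without any direct computation of `dω` (`HasConnForms.isPresymplectic`).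

Momentum map. The function `Φ_N(n)((Ad(g⁻¹)X)_𝔨)` is differentiated in both variables. The
`N`-direction is the momentum equation on `N`; the `G`-direction gives `⟨Φ_N, [Ad(g⁻¹)X, Y]_𝔨⟩`, in
which the `𝔨`-part of `Ad(g⁻¹)X` drops out because `[𝔨, 𝔭] ⊆ 𝔭` (`hamilton_indPhi`).

`Spin^c`-structure. Inside `Spin^c(V ⊕ 𝔭)` the groups `Spin^c(V)` and `Spin(𝔭)` commute, being
generated up to scalars by even elements over orthogonal summands. This makes `[g, [p, 1]]`
compatible with both actions (`spinVal_act`, `spinVal_tot`). Since `det` is trivial on `Spin(𝔭)`,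
the determinant isomorphism descends unchanged (`detVal_spinVal`). -/

/-- Only degrees up to `finrank ℝ V` contribute to the grading, so the algebra is a finite supremum
of finite-dimensional pieces. The Clifford algebra is linearly isomorphic to it; its finiteness
makes products of `SmoothInto` maps smooth. -/
theorem finite_exteriorAlgebra (V : Type*) [AddCommGroup V] [Module ℝ V] [FiniteDimensional ℝ V] :
    Module.Finite ℝ (ExteriorAlgebra ℝ V) := by
  have htop : ⨆ i : ℕ, (⋀[ℝ]^i V) = (⊤ : Submodule ℝ (ExteriorAlgebra ℝ V)) :=
    (DirectSum.Decomposition.isInternal (fun i : ℕ => ⋀[ℝ]^i V)).submodule_iSup_eq_top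
  have hbot : ∀ i, Module.finrank ℝ V < i → (⋀[ℝ]^i V) = ⊥ := by
    intro i hi
    apply Submodule.finrank_eq_zero.1
    rw [exteriorPower.finrank_eq, Nat.choose_eq_zero_of_lt hi]
  have : ⨆ i : Fin (Module.finrank ℝ V + 1), (⋀[ℝ]^(i : ℕ) V) =
      (⊤ : Submodule ℝ (ExteriorAlgebra ℝ V)) := by
    rw [eq_top_iff, ← htop]
    refine iSup_le fun i => ?_
    by_cases hi : Module.finrank ℝ V < i
    · rw [hbot i hi]; exact bot_le
    · exact le_iSup (fun i : Fin (Module.finrank ℝ V + 1) => (⋀[ℝ]^(i : ℕ) V)) ⟨i, by omega⟩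
  refine Module.finite_def.2 ?_
  rw [← this]
  exact Submodule.fg_iSup _ fun i => (Submodule.fg_top _).1 (Module.finite_def.1 inferInstance)

instance finite_cliffordAlgebra [FiniteDimensional ℝ V] : Module.Finite ℝ (CliffordAlgebra Q) :=
  haveI := finite_exteriorAlgebra V
  Module.Finite.equiv (CliffordAlgebra.equivExterior Q).symm

/-- Taking real parts in the first factor is a left inverse. -/
theorem one_tmul_injective {A : Type*} [AddCommGroup A] [Module ℝ A] :
    Function.Injective (fun a : A => (1 : ℂ) ⊗ₜ[ℝ] a) := by
  have h : Function.LeftInverse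
      (fun x : ℂ ⊗[ℝ] A => TensorProduct.lid ℝ A (TensorProduct.map Complex.reLm LinearMap.id x))
      (fun a : A => (1 : ℂ) ⊗ₜ[ℝ] a) := by
    intro a
    simp
  exact h.injective

theorem ι_injective : Function.Injective (CliffordAlgebra.ι Q) := by
  intro v w h
  have := congrArg (CliffordAlgebra.equivExterior Q) h
  simp only [CliffordAlgebra.equivExterior, CliffordAlgebra.changeFormEquiv_apply,
    CliffordAlgebra.changeForm_ι] at this
  exact (ExteriorAlgebra.ι_leftInverse (R := ℝ) (M := V)).injective this

theorem ιC_injective : Function.Injective (ιC Q) :=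
  one_tmul_injective.comp ι_injective

theorem ιC_add (v w : V) : ιC Q (v + w) = ιC Q v + ιC Q w := by
  simp [ιC, TensorProduct.tmul_add]

theorem ιC_smul (c : ℝ) (v : V) : ιC Q (c • v) = c • ιC Q v := by
  simp [ιC]

/-- The scalar `z` is central, so only the spin factor matters, and conjugation by a spin element
preserves the vectors in the Clifford algebra. Together with injectivity of `ιC` this turns the
relation `Rotates` into the linear map `SpinC.rot`. -/
theorem exists_rotates (u : SpinC Q) (v : V) : ∃ w, Rotates Q u v w := by
  obtain ⟨u, z, s, h⟩ := u
  have hu : ((spinGroup.toUnits s : (CliffordAlgebra Q)ˣ) : CliffordAlgebra Q) ∈ spinGroup Q := s.2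
  letI : Invertible (2 : ℝ) := invertibleOfNonzero two_ne_zero
  obtain ⟨w, hw⟩ := spinGroup.conjAct_smul_ι_mem_range_ι hu v
  refine ⟨w, ?_⟩
  rw [ConjAct.units_smul_def] at hw
  have hs : (s : CliffordAlgebra Q) * CliffordAlgebra.ι Q v = CliffordAlgebra.ι Q w * s := by
    have : CliffordAlgebra.ι Q w * ((spinGroup.toUnits s : (CliffordAlgebra Q)ˣ) : CliffordAlgebra Q)
      = (spinGroup.toUnits s : (CliffordAlgebra Q)ˣ) * CliffordAlgebra.ι Q v := by
      rw [hw, ConjAct.ofConjAct_toConjAct, mul_assoc, Units.inv_mul, mul_one]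
    exact this.symm
  simp only [Rotates, ιC, h, Algebra.TensorProduct.tmul_mul_tmul, hs, mul_one, one_mul]

theorem Rotates.unique {u : SpinC Q} {v w w' : V} (h : Rotates Q u v w) (h' : Rotates Q u v w') :
    w = w' := by
  apply ιC_injective (Q := Q)
  have := h.symm.trans h'
  exact (Units.mul_left_inj _).1 this

theorem Rotates.add {u : SpinC Q} {v v' w w' : V} (h : Rotates Q u v w) (h' : Rotates Q u v' w') :
    Rotates Q u (v + v') (w + w') := by
  unfold Rotates at *
  rw [ιC_add, ιC_add, mul_add, add_mul, h, h']

theorem Rotates.smul {u : SpinC Q} {v w : V} (h : Rotates Q u v w) (c : ℝ) :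
    Rotates Q u (c • v) (c • w) := by
  unfold Rotates at *
  rw [ιC_smul, ιC_smul, mul_smul_comm, smul_mul_assoc, h]

/-- The rotation of `V` given by an element of `Spin^c(V, Q)`. -/
def SpinC.rot (u : SpinC Q) : V →ₗ[ℝ] V where
  toFun v := (exists_rotates u v).choose
  map_add' v w := by
    refine Rotates.unique (exists_rotates u (v + w)).choose_spec ?_
    exact (exists_rotates u v).choose_spec.add (exists_rotates u w).choose_spec
  map_smul' c v := by
    refine Rotates.unique (exists_rotates u (c • v)).choose_spec ?_
    exact (exists_rotates u v).choose_spec.smul c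

theorem SpinC.rotates_rot (u : SpinC Q) (v : V) : Rotates Q u v (SpinC.rot u v) :=
  (exists_rotates u v).choose_spec

theorem Rotates.eq_rot {u : SpinC Q} {v w : V} (h : Rotates Q u v w) : SpinC.rot u v = w :=
  (SpinC.rotates_rot u v).unique h

theorem Rotates.mul {u u' : SpinC Q} {v w x : V} (h' : Rotates Q u' v w) (h : Rotates Q u w x) :
    Rotates Q (u * u') v x := by
  unfold Rotates at *
  simp only [Subgroup.coe_mul, Units.val_mul]
  rw [mul_assoc, h', ← mul_assoc, h, mul_assoc]

theorem SpinC.rot_mul (u u' : SpinC Q) (v : V) : SpinC.rot (u * u') v = SpinC.rot u (SpinC.rot u' v) :=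
  ((SpinC.rotates_rot u' v).mul (SpinC.rotates_rot u _)).eq_rot

theorem SpinC.rot_one (v : V) : SpinC.rot (1 : SpinC Q) v = v :=
  Rotates.eq_rot (Q := Q) (by simp [Rotates])

/-- The rotation of `V` given by an element of `Spin^c(V, Q)`, as a linear automorphism. -/
def SpinC.rotEquiv (u : SpinC Q) : V ≃ₗ[ℝ] V where
  toLinearMap := SpinC.rot u
  invFun := SpinC.rot u⁻¹
  left_inv v := by
    change SpinC.rot u⁻¹ (SpinC.rot u v) = v
    rw [← SpinC.rot_mul, inv_mul_cancel, SpinC.rot_one]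
  right_inv v := by
    change SpinC.rot u (SpinC.rot u⁻¹ v) = v
    rw [← SpinC.rot_mul, mul_inv_cancel, SpinC.rot_one]

/-- Taking imaginary parts in the first factor gives `im z • s = 0`, so `z` is real of modulus one.
-/
theorem sq_eq_one_of_tmul_eq {A : Type*} [AddCommGroup A] [Module ℝ A] {z : Circle} {s s' : A}
    (hs : s ≠ 0) (h : (z : ℂ) ⊗ₜ[ℝ] s = (1 : ℂ) ⊗ₜ[ℝ] s') : z ^ 2 = 1 := by
  have him : (z : ℂ).im = 0 := by
    have := congrArg (fun x => TensorProduct.lid ℝ A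
      (TensorProduct.map Complex.imLm LinearMap.id x)) h
    simpa [hs] using this
  have hn := Circle.normSq_coe z
  rw [Complex.normSq_apply, him] at hn
  ext
  simp [pow_two, Complex.ext_iff, him]
  linarith

/-- The scalar in a decomposition `z ⊗ s` is unique up to sign, and the square forgets the sign.
Spin elements are nonzero because `star s * s = 1`. -/
theorem HasDet.unique {u : SpinC Q} {c c' : Circle} (h : HasDet Q u c) (h' : HasDet Q u c') :
    c = c' := by
  obtain ⟨z, s, hu, rfl⟩ := h
  obtain ⟨z', s', hu', rfl⟩ := h'
  have h1 : (z : ℂ) ⊗ₜ[ℝ] (s : CliffordAlgebra Q) = (z' : ℂ) ⊗ₜ[ℝ] (s' : CliffordAlgebra Q) :=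
    hu.symm.trans hu'
  have h2 : ((z'⁻¹ * z : Circle) : ℂ) ⊗ₜ[ℝ] (s : CliffordAlgebra Q) =
      (1 : ℂ) ⊗ₜ[ℝ] (s' : CliffordAlgebra Q) := by
    have := congrArg (fun x => ((z'⁻¹ : Circle) : ℂ) ⊗ₜ[ℝ] (1 : CliffordAlgebra Q) * x) h1
    simp only [Algebra.TensorProduct.tmul_mul_tmul, one_mul, ← Circle.coe_mul] at this
    rw [this, inv_mul_cancel, Circle.coe_one]
  have hs : (s : CliffordAlgebra Q) ≠ 0 := by
    intro h0
    have := spinGroup.coe_star_mul_self s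
    rw [h0, mul_zero] at this
    exact zero_ne_one this
  have := sq_eq_one_of_tmul_eq hs h2
  rw [mul_pow, inv_pow, inv_mul_eq_one] at this
  exact this.symm

theorem exists_hasDet (u : SpinC Q) : ∃ c, HasDet Q u c := by
  obtain ⟨u, z, s, h⟩ := u
  exact ⟨z ^ 2, z, s, h, rfl⟩

theorem HasDet.mul {u u' : SpinC Q} {c c' : Circle} (h : HasDet Q u c) (h' : HasDet Q u' c') :
    HasDet Q (u * u') (c * c') := by
  obtain ⟨z, s, hu, rfl⟩ := h
  obtain ⟨z', s', hu', rfl⟩ := h'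
  exact ⟨z * z', s * s', by simp [hu, hu'], by rw [mul_pow]⟩

/-- The determinant homomorphism `Spin^c(V, Q) → U(1)`. -/
def SpinC.det : SpinC Q →* Circle where
  toFun u := (exists_hasDet u).choose
  map_one' := (exists_hasDet _).choose_spec.unique ⟨1, 1, by simp [Algebra.TensorProduct.one_def]⟩
  map_mul' u u' := (exists_hasDet _).choose_spec.unique
    ((exists_hasDet u).choose_spec.mul (exists_hasDet u').choose_spec)

theorem SpinC.hasDet_det (u : SpinC Q) : HasDet Q u (SpinC.det u) := (exists_hasDet u).choose_spec

theorem HasDet.eq_det {u : SpinC Q} {c : Circle} (h : HasDet Q u c) : c = SpinC.det u :=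
  h.unique (SpinC.hasDet_det u)

theorem SpinC.det_spinToSpinC (s : spinGroup Q) : SpinC.det (spinToSpinC Q s) = 1 := by
  refine (HasDet.eq_det (Q := Q) ⟨1, s, ?_, by simp⟩).symm
  simp [spinToSpinC, spinGroup.toUnits]

variable {V' : Type*} [AddCommGroup V'] [Module ℝ V'] {Q' : QuadraticForm ℝ V'}

theorem SpinC.coe_map (f : Q →qᵢ Q') (u : SpinC Q) :
    ((SpinC.map f u : (CCl Q')ˣ) : CCl Q') =
      Algebra.TensorProduct.map (AlgHom.id ℝ ℂ) (CliffordAlgebra.map f) ((u : (CCl Q)ˣ) : CCl Q) :=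
  rfl

theorem coe_spinToSpinC (s : spinGroup Q) :
    ((spinToSpinC Q s : (CCl Q)ˣ) : CCl Q) = (1 : ℂ) ⊗ₜ[ℝ] (s : CliffordAlgebra Q) :=
  rfl

theorem SpinC.det_map (f : Q →qᵢ Q') (u : SpinC Q) : SpinC.det (SpinC.map f u) = SpinC.det u := by
  obtain ⟨z, s, h, h'⟩ := SpinC.hasDet_det u
  refine (HasDet.eq_det (Q := Q') ⟨z, ⟨_, map_mem_spinGroup f s.2⟩, ?_, h'⟩).symm
  rw [SpinC.coe_map, h]
  simp

theorem isOrtho_inl_inr (v : V) (w : V') :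
    (Q.prod Q').IsOrtho (QuadraticMap.Isometry.inl Q Q' v) (QuadraticMap.Isometry.inr Q Q' w) := by
  simp [QuadraticMap.isOrtho_def]

/-- Vectors of orthogonal summands anticommute, so even elements over the two summands commute. -/
theorem spin_inl_inr_comm (s : spinGroup Q) (t : spinGroup Q') :
    Commute (CliffordAlgebra.map (QuadraticMap.Isometry.inl Q Q') (s : CliffordAlgebra Q))
      (CliffordAlgebra.map (QuadraticMap.Isometry.inr Q Q') (t : CliffordAlgebra Q')) :=
  CliffordAlgebra.commute_map_mul_map_of_isOrtho_of_mem_evenOdd_zero_left _ _ isOrtho_inl_inr _ _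
    (spinGroup.mem_even s.2) (i₂ := 0) (spinGroup.mem_even t.2)

/-- This commutation lets the right action of `Spin^c(V)` and the action of `K` through `Spin(𝔭)`
coexist on the induced principal bundle. -/
theorem SpinC.inl_mul_inr_comm (u : SpinC Q) (t : spinGroup Q') :
    SpinC.map (QuadraticMap.Isometry.inl Q Q') u *
        SpinC.map (QuadraticMap.Isometry.inr Q Q') (spinToSpinC Q' t) =
      SpinC.map (QuadraticMap.Isometry.inr Q Q') (spinToSpinC Q' t) *
        SpinC.map (QuadraticMap.Isometry.inl Q Q') u := by
  obtain ⟨z, s, h, -⟩ := SpinC.hasDet_det u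
  apply Subtype.ext
  apply Units.ext
  simp only [Subgroup.coe_mul, Units.val_mul, SpinC.coe_map, h, coe_spinToSpinC,
    Algebra.TensorProduct.map_tmul, Algebra.TensorProduct.tmul_mul_tmul]
  simp [(spin_inl_inr_comm s t).eq]

/-- Split `(v, w)` into its orthogonal components: the first rotates by functoriality of Clifford
algebras, and the second commutes with the even element `s`. -/
theorem SpinC.rotates_inl (u : SpinC Q) (v : V) (w : V') :
    Rotates (Q.prod Q') (SpinC.map (QuadraticMap.Isometry.inl Q Q') u) (v, w) (SpinC.rot u v, w) := by
  obtain ⟨z, s, h, -⟩ := SpinC.hasDet_det u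
  have hr := SpinC.rotates_rot u v
  have hsplit : ∀ v : V, ιC (Q.prod Q') (v, w) =
      Algebra.TensorProduct.map (AlgHom.id ℝ ℂ)
        (CliffordAlgebra.map (QuadraticMap.Isometry.inl Q Q')) (ιC Q v) +
      Algebra.TensorProduct.map (AlgHom.id ℝ ℂ)
        (CliffordAlgebra.map (QuadraticMap.Isometry.inr Q Q')) (ιC Q' w) := by
    intro v
    simp only [ιC, Algebra.TensorProduct.map_tmul, CliffordAlgebra.map_apply_ι,
      ← TensorProduct.tmul_add, ← map_add]
    simp
  unfold Rotates at hr ⊢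
  rw [hsplit, hsplit, mul_add, add_mul, SpinC.coe_map, ← map_mul, ← map_mul, hr]
  congr 1
  rw [h]
  simp only [ιC, Algebra.TensorProduct.map_tmul, Algebra.TensorProduct.tmul_mul_tmul]
  have := CliffordAlgebra.commute_map_mul_map_of_isOrtho_of_mem_evenOdd_zero_left
    (QuadraticMap.Isometry.inl Q Q') (QuadraticMap.Isometry.inr Q Q') isOrtho_inl_inr
    (s : CliffordAlgebra Q) (CliffordAlgebra.ι Q' w)
    (spinGroup.mem_even s.2) (i₂ := 1) (CliffordAlgebra.ι_mem_evenOdd_one Q' w)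
  rw [this.eq]
  simp

/-- The same splitting as for the first summand; now the vector from `V` commutes with the even
element `t`. -/
theorem rotates_inr (t : spinGroup Q') {w w' : V'}
    (ht : (t : CliffordAlgebra Q') * CliffordAlgebra.ι Q' w = CliffordAlgebra.ι Q' w' * t) (v : V) :
    Rotates (Q.prod Q')
      (SpinC.map (QuadraticMap.Isometry.inr Q Q') (spinToSpinC Q' t)) (v, w) (v, w') := by
  have hsplit : ∀ w : V', ιC (Q.prod Q') (v, w) = (1 : ℂ) ⊗ₜ[ℝ]
      (CliffordAlgebra.map (QuadraticMap.Isometry.inl Q Q') (CliffordAlgebra.ι Q v) +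
        CliffordAlgebra.map (QuadraticMap.Isometry.inr Q Q') (CliffordAlgebra.ι Q' w)) := by
    intro w
    simp only [ιC, CliffordAlgebra.map_apply_ι, ← map_add]
    simp
  unfold Rotates
  rw [hsplit, hsplit, SpinC.coe_map, coe_spinToSpinC]
  simp only [Algebra.TensorProduct.map_tmul, Algebra.TensorProduct.tmul_mul_tmul, mul_add, add_mul,
    ← map_mul, ht]
  have := CliffordAlgebra.commute_map_mul_map_of_isOrtho_of_mem_evenOdd_zero_right
    (QuadraticMap.Isometry.inl Q Q') (QuadraticMap.Isometry.inr Q Q') isOrtho_inl_inr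
    (CliffordAlgebra.ι Q v) (t : CliffordAlgebra Q')
    (i₁ := 1) (CliffordAlgebra.ι_mem_evenOdd_one Q v) (spinGroup.mem_even t.2)
  rw [this.eq]
  simp

end SpinAlgebra

/-! ### Calculus of smooth maps into finite-dimensional algebras. -/

section SmoothInto

variable {B : Type*} [NormedAddCommGroup B] [NormedSpace ℝ B] {H : Type*} [TopologicalSpace H]
  {I : ModelWithCorners ℝ B H} {X : Type*} [TopologicalSpace X] [ChartedSpace H X]
  {B' : Type*} [NormedAddCommGroup B'] [NormedSpace ℝ B'] {H' : Type*} [TopologicalSpace H']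
  {I' : ModelWithCorners ℝ B' H'} {X' : Type*} [TopologicalSpace X'] [ChartedSpace H' X']
  {A : Type*} [AddCommGroup A] [Module ℝ A] {A' : Type*} [AddCommGroup A'] [Module ℝ A']

theorem SmoothInto.comp {f : X → A} {s : Set X} (hf : SmoothInto I f s) {h : X' → X} {t : Set X'}
    (hh : ContMDiffOn I' I ∞ h t) (hst : MapsTo h t s) : SmoothInto I' (fun x => f (h x)) t :=
  fun l => (hf l).comp hh hst

theorem SmoothInto.map {f : X → A} {s : Set X} (hf : SmoothInto I f s) (T : A →ₗ[ℝ] A') :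
    SmoothInto I (fun x => T (f x)) s :=
  fun l => hf (l ∘ₗ T)

/-- In a basis, a linear functional of a product is a finite sum of products of coordinate
functions. -/
theorem SmoothInto.mul {R : Type*} [Ring R] [Algebra ℝ R] [Module.Finite ℝ R] {f g : X → R}
    {s : Set X} (hf : SmoothInto I f s) (hg : SmoothInto I g s) :
    SmoothInto I (fun x => f x * g x) s := by
  intro l
  let b := Module.finBasis ℝ R
  have : ∀ x, l (f x * g x) = ∑ i, ∑ j, (b.coord i (f x) * b.coord j (g x)) * l (b i * b j) := by
    intro x
    conv_lhs => rw [← b.sum_repr (f x), ← b.sum_repr (g x)]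
    simp only [Finset.sum_mul_sum, map_sum, smul_mul_smul_comm, map_smul, smul_eq_mul]
    rfl
  simp only [this]
  refine contMDiffOn_finsetSum fun i _ => contMDiffOn_finsetSum fun j _ => ?_
  exact ((hf _).mul (hg _)).mul contMDiffOn_const

end SmoothInto

end PreHam

namespace PreHam

/-! ### Tangent maps read as linear maps of the model spaces. -/

section TangentMap

variable {E : Type*} [NormedAddCommGroup E] [NormedSpace ℝ E] {H : Type*} [TopologicalSpace H]
  {I : ModelWithCorners ℝ E H} {M : Type*} [TopologicalSpace M] [ChartedSpace H M]
  {E' : Type*} [NormedAddCommGroup E'] [NormedSpace ℝ E'] {H' : Type*} [TopologicalSpace H']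
  {I' : ModelWithCorners ℝ E' H'} {M' : Type*} [TopologicalSpace M'] [ChartedSpace H' M']
  {E'' : Type*} [NormedAddCommGroup E''] [NormedSpace ℝ E''] {H'' : Type*} [TopologicalSpace H'']
  {I'' : ModelWithCorners ℝ E'' H''} {M'' : Type*} [TopologicalSpace M''] [ChartedSpace H'' M'']

variable (I I') in
/-- The tangent map of `f` at `x`, as a linear map between the model vector spaces. -/
def tder (f : M → M') (x : M) : E →L[ℝ] E' := mfderiv I I' f x

theorem tder_comp {g : M' → M''} {f : M → M'} {x : M} (hg : MDifferentiableAt I' I'' g (f x))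
    (hf : MDifferentiableAt I I' f x) :
    tder I I'' (fun y => g (f y)) x = (tder I' I'' g (f x)).comp (tder I I' f x) :=
  mfderiv_comp x hg hf

theorem tder_comp_apply {g : M' → M''} {f : M → M'} {x : M} {y : M'}
    (hg : MDifferentiableAt I' I'' g y)
    (hf : MDifferentiableAt I I' f x) (h : f x = y) (v : E) :
    tder I I'' (fun y => g (f y)) x v = tder I' I'' g y (tder I I' f x v) := by
  subst h
  rw [tder_comp hg hf]; rfl

theorem tder_congr {f g : M → M'} {x : M} (h : f =ᶠ[𝓝 x] g) : tder I I' f x = tder I I' g x :=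
  h.mfderiv_eq

theorem tder_id {x : M} : tder I I (fun y : M => y) x = ContinuousLinearMap.id ℝ E :=
  mfderiv_id

theorem tder_const {x : M} {c : M'} : tder I I' (fun _ : M => c) x = 0 :=
  mfderiv_const

theorem tder_eq_fderiv {f : E → E'} {x : E} : tder 𝓘(ℝ, E) 𝓘(ℝ, E') f x = fderiv ℝ f x :=
  mfderiv_eq_fderiv

theorem tder_prodMk {f : M → M'} {g : M → M''} {x : M} (hf : MDifferentiableAt I I' f x)
    (hg : MDifferentiableAt I I'' g x) (v : E) :
    tder I (I'.prod I'') (fun y => (f y, g y)) x v = (tder I I' f x v, tder I I'' g x v) := by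
  have := mfderiv_prodMk hf hg
  exact congrArg (fun L : E →L[ℝ] E' × E'' => L v) this

theorem tder_prod {f : M × M' → M''} {p : M × M'}
    (hf : MDifferentiableAt (I.prod I') I'' f p) (v : E) (w : E') :
    tder (I.prod I') I'' f p (v, w) =
      tder I I'' (fun x => f (x, p.2)) p.1 v + tder I' I'' (fun y => f (p.1, y)) p.2 w :=
  mfderiv_prod_eq_add_apply hf

end TangentMap

/-! ### Derivatives of the preferred charts. -/

section Charts

variable {E : Type*} [NormedAddCommGroup E] [NormedSpace ℝ E]
  {M : Type*} [TopologicalSpace M] [ChartedSpace E M]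

theorem extChartAt_target_nhds {x₀ : M} {y : E} (hy : y ∈ (extChartAt 𝓘(ℝ, E) x₀).target) :
    (extChartAt 𝓘(ℝ, E) x₀).target ∈ 𝓝 y :=
  (isOpen_extChartAt_target x₀).mem_nhds hy

theorem extChartAt_source_nhds {x₀ x : M} (hx : x ∈ (extChartAt 𝓘(ℝ, E) x₀).source) :
    (extChartAt 𝓘(ℝ, E) x₀).source ∈ 𝓝 x :=
  (isOpen_extChartAt_source x₀).mem_nhds hx

variable [IsManifold 𝓘(ℝ, E) ∞ M]

theorem contMDiffAt_chart {x₀ x : M} (hx : x ∈ (extChartAt 𝓘(ℝ, E) x₀).source) :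
    ContMDiffAt 𝓘(ℝ, E) 𝓘(ℝ, E) ∞ (extChartAt 𝓘(ℝ, E) x₀) x :=
  contMDiffAt_extChartAt' (by simpa using hx)

theorem contMDiffAt_chart_symm {x₀ : M} {y : E} (hy : y ∈ (extChartAt 𝓘(ℝ, E) x₀).target) :
    ContMDiffAt 𝓘(ℝ, E) 𝓘(ℝ, E) ∞ (extChartAt 𝓘(ℝ, E) x₀).symm y :=
  (contMDiffOn_extChartAt_symm x₀).contMDiffAt (extChartAt_target_nhds hy)

theorem mdifferentiableAt_chart {x₀ x : M} (hx : x ∈ (extChartAt 𝓘(ℝ, E) x₀).source) :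
    MDifferentiableAt 𝓘(ℝ, E) 𝓘(ℝ, E) (extChartAt 𝓘(ℝ, E) x₀) x :=
  (contMDiffAt_chart hx).mdifferentiableAt (by simp)

theorem mdifferentiableAt_chart_symm {x₀ : M} {y : E} (hy : y ∈ (extChartAt 𝓘(ℝ, E) x₀).target) :
    MDifferentiableAt 𝓘(ℝ, E) 𝓘(ℝ, E) (extChartAt 𝓘(ℝ, E) x₀).symm y :=
  (contMDiffAt_chart_symm hy).mdifferentiableAt (by simp)

theorem tder_chart_symm {x₀ : M} {y : E} (hy : y ∈ (extChartAt 𝓘(ℝ, E) x₀).target) (v : E) :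
    tder 𝓘(ℝ, E) 𝓘(ℝ, E) (extChartAt 𝓘(ℝ, E) x₀) ((extChartAt 𝓘(ℝ, E) x₀).symm y)
      (tder 𝓘(ℝ, E) 𝓘(ℝ, E) (extChartAt 𝓘(ℝ, E) x₀).symm y v) = v := by
  rw [← tder_comp_apply (mdifferentiableAt_chart ((extChartAt 𝓘(ℝ, E) x₀).map_target hy))
    (mdifferentiableAt_chart_symm hy) rfl]
  have : (fun y => (extChartAt 𝓘(ℝ, E) x₀) ((extChartAt 𝓘(ℝ, E) x₀).symm y)) =ᶠ[𝓝 y]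
      fun y => y := by
    filter_upwards [extChartAt_target_nhds hy] with z hz using
      (extChartAt 𝓘(ℝ, E) x₀).right_inv hz
  rw [tder_congr this, tder_id]; rfl

theorem tder_symm_chart {x₀ x : M} (hx : x ∈ (extChartAt 𝓘(ℝ, E) x₀).source) (v : E) :
    tder 𝓘(ℝ, E) 𝓘(ℝ, E) (extChartAt 𝓘(ℝ, E) x₀).symm (extChartAt 𝓘(ℝ, E) x₀ x)
      (tder 𝓘(ℝ, E) 𝓘(ℝ, E) (extChartAt 𝓘(ℝ, E) x₀) x v) = v := by
  rw [← tder_comp_apply (mdifferentiableAt_chart_symm ((extChartAt 𝓘(ℝ, E) x₀).map_source hx))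
    (mdifferentiableAt_chart hx) rfl]
  have : (fun y => (extChartAt 𝓘(ℝ, E) x₀).symm ((extChartAt 𝓘(ℝ, E) x₀) y)) =ᶠ[𝓝 x]
      fun y => y := by
    filter_upwards [extChartAt_source_nhds hx] with z hz using
      (extChartAt 𝓘(ℝ, E) x₀).left_inv hz
  rw [tder_congr this, tder_id]; rfl

theorem tder_chart_self (x₀ : M) :
    tder 𝓘(ℝ, E) 𝓘(ℝ, E) (extChartAt 𝓘(ℝ, E) x₀) x₀ = ContinuousLinearMap.id ℝ E :=
  haveI : IsManifold 𝓘(ℝ, E) 1 M := IsManifold.of_le (n := ∞) (by simp)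
  mfderiv_extChartAt_self (I := 𝓘(ℝ, E)) (x := x₀)

theorem tder_chart_symm_self (x₀ : M) :
    tder 𝓘(ℝ, E) 𝓘(ℝ, E) (extChartAt 𝓘(ℝ, E) x₀).symm (extChartAt 𝓘(ℝ, E) x₀ x₀) =
      ContinuousLinearMap.id ℝ E := by
  ext v
  have := tder_symm_chart (mem_extChartAt_source (I := 𝓘(ℝ, E)) x₀) v
  rwa [tder_chart_self] at this

end Charts

/-! ### Lie groups: adjoint action, Maurer–Cartan form, Lie bracket. -/

section LieGroup

variable {E : Type*} [NormedAddCommGroup E] [NormedSpace ℝ E]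
  {G : Type*} [TopologicalSpace G] [ChartedSpace E G] [Group G] [LieGroup 𝓘(ℝ, E) ∞ G]

theorem mdiff_mul_left (g h : G) : MDifferentiableAt 𝓘(ℝ, E) 𝓘(ℝ, E) (fun a => g * a) h :=
  (contMDiff_mul_left (I := 𝓘(ℝ, E)) (n := ∞)).contMDiffAt.mdifferentiableAt (by simp)

theorem mdiff_mul_right (g h : G) : MDifferentiableAt 𝓘(ℝ, E) 𝓘(ℝ, E) (fun a => a * g) h :=
  (contMDiff_mul_right (I := 𝓘(ℝ, E)) (n := ∞)).contMDiffAt.mdifferentiableAt (by simp)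

theorem mdiff_conj (g h : G) :
    MDifferentiableAt 𝓘(ℝ, E) 𝓘(ℝ, E) (fun a => g * a * g⁻¹) h :=
  MDifferentiableAt.comp (I' := 𝓘(ℝ, E)) h (mdiff_mul_right g⁻¹ (g * h)) (mdiff_mul_left g h)

/-- The left Maurer-Cartan form of a Lie group. -/
def mc (g : G) : E →L[ℝ] E := tder 𝓘(ℝ, E) 𝓘(ℝ, E) (fun a : G => g⁻¹ * a) g

/-- The left-invariant vector field with value `X` at `1`, as a map into the model space. -/
def lvec (X : E) (g : G) : E := leftVec X g

theorem lvec_eq (X : E) (g : G) :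
    lvec X g = tder 𝓘(ℝ, E) 𝓘(ℝ, E) (fun a : G => g * a) 1 X := rfl

theorem Ad_eq (g : G) :
    Ad g = tder 𝓘(ℝ, E) 𝓘(ℝ, E) (fun a : G => g * a * g⁻¹) 1 := rfl

theorem mul_left_tder_lvec (h : G) (X : E) (g : G) :
    tder 𝓘(ℝ, E) 𝓘(ℝ, E) (fun a : G => h * a) g (lvec X g) = lvec X (h * g) := by
  rw [lvec_eq, lvec_eq, ← tder_comp_apply (mdiff_mul_left _ _) (mdiff_mul_left _ _) (by simp)]
  simp only [mul_assoc]

theorem lvec_one (X : E) : lvec X (1 : G) = X := by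
  rw [lvec_eq]
  simp only [one_mul, tder_id]
  rfl

theorem mc_lvec (X : E) (g : G) : mc g (lvec X g) = X := by
  have := mul_left_tder_lvec g⁻¹ X g
  rw [inv_mul_cancel, lvec_one] at this
  exact this

theorem lvec_mc (g : G) (ξ : E) : lvec (mc g ξ) g = ξ := by
  rw [lvec_eq, mc, ← tder_comp_apply (mdiff_mul_left _ _) (mdiff_mul_left _ _) (by simp)]
  simp only [mul_inv_cancel_left, tder_id]
  rfl

/-- Left-invariant vector fields are linear in their value at `1`. -/
def leftVecL (g : G) : E →L[ℝ] E := tder 𝓘(ℝ, E) 𝓘(ℝ, E) (fun a : G => g * a) 1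

theorem leftVecL_apply (g : G) (X : E) : leftVecL g X = lvec X g := rfl

/-- `g a k⁻¹ = (g k⁻¹)(k a k⁻¹)`, differentiated at `a = 1`. -/
theorem mul_right_tder (k : G) (X : E) (g : G) :
    tder 𝓘(ℝ, E) 𝓘(ℝ, E) (fun a : G => a * k⁻¹) g (lvec X g) = lvec (Ad k X) (g * k⁻¹) := by
  rw [lvec_eq, lvec_eq, Ad_eq,
    ← tder_comp_apply (mdiff_mul_right _ _) (mdiff_mul_left _ _) (by simp),
    ← tder_comp_apply (mdiff_mul_left _ _) (mdiff_conj _ _) (by simp)]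
  congr 2; ext a; group

theorem mul_right_tder_one (X : E) (g : G) :
    tder 𝓘(ℝ, E) 𝓘(ℝ, E) (fun a : G => a * g) 1 X = lvec (Ad g⁻¹ X) g := by
  -- Writing `g` as an inverse makes this the case of `mul_right_tder` with base point `1`.
  obtain ⟨k, rfl⟩ : ∃ k, g = k⁻¹ := ⟨g⁻¹, by simp⟩
  have := mul_right_tder k X (1 : G)
  rw [lvec_one, one_mul] at this
  rw [inv_inv, this]

theorem Ad_mul (g h : G) (X : E) : Ad (g * h) X = Ad g (Ad h X) := by
  rw [Ad_eq, Ad_eq, Ad_eq, ← tder_comp_apply (y := (1 : G)) (mdiff_conj _ _) (mdiff_conj _ _) (by simp)]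
  congr 2; ext a; group

theorem Ad_one (X : E) : Ad (1 : G) X = X := by
  rw [Ad_eq]
  simp [tder_id]

theorem Ad_inv_Ad (g : G) (X : E) : Ad g⁻¹ (Ad g X) = X := by
  rw [← Ad_mul, inv_mul_cancel, Ad_one]


/-- Tangent coordinates of a vector space are trivial, so smooth dependence of `mfderiv` on a
parameter specialises to `fderiv`. It is applied to group operations read in the chart at `1`. -/
theorem contMDiffAt_fderiv_param {B : Type*} [NormedAddCommGroup B] [NormedSpace ℝ B]
    {H : Type*} [TopologicalSpace H] {J : ModelWithCorners ℝ B H} {X : Type*} [TopologicalSpace X]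
    [ChartedSpace H X] {F F' : Type*} [NormedAddCommGroup F] [NormedSpace ℝ F]
    [NormedAddCommGroup F'] [NormedSpace ℝ F'] [IsManifold J ∞ X] {f : X → F → F'} {g : X → F} {x₀ : X}
    (hf : ContMDiffAt (J.prod 𝓘(ℝ, F)) 𝓘(ℝ, F') ∞ (Function.uncurry f) (x₀, g x₀))
    (hg : ContMDiffAt J 𝓘(ℝ, F) ∞ g x₀) :
    ContMDiffAt J 𝓘(ℝ, F →L[ℝ] F') ∞ (fun x => fderiv ℝ (f x) (g x)) x₀ := by
  have h := ContMDiffAt.mfderiv (m := ∞) f g hf hg (by simp)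
  refine h.congr_of_eventuallyEq (Filter.Eventually.of_forall fun x => ?_)
  have := congrFun (inTangentCoordinates_model_space (I := 𝓘(ℝ, F)) (I' := 𝓘(ℝ, F')) g
    (fun x => f x (g x)) (fun x => mfderiv 𝓘(ℝ, F) 𝓘(ℝ, F') (f x) (g x)) x₀) x
  exact (this.trans mfderiv_eq_fderiv).symm

variable (E G) in
/-- The preferred chart at the identity. -/
abbrev oneChart : PartialEquiv G E := extChartAt 𝓘(ℝ, E) (1 : G)

theorem one_mem_source : (1 : G) ∈ (oneChart E G).source := mem_extChartAt_source _

theorem one_mem_target : oneChart E G 1 ∈ (oneChart E G).target :=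
  (oneChart E G).map_source one_mem_source

theorem oneChart_symm_one : (oneChart E G).symm (oneChart E G 1) = 1 :=
  (oneChart E G).left_inv one_mem_source

/-- Conjugation read in the chart at `1` is smooth jointly in the group element and the coordinate,
so its partial derivative at the centre is smooth in the group element. The chart has derivative
`id` at its centre, so this partial derivative is `Ad g` exactly. -/
theorem contMDiff_Ad : ContMDiff 𝓘(ℝ, E) 𝓘(ℝ, E →L[ℝ] E) ∞ (fun g : G => (Ad g : E →L[ℝ] E)) := by
  intro g₀
  have h1 : ContMDiffAt (𝓘(ℝ, E).prod 𝓘(ℝ, E)) 𝓘(ℝ, E) ∞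
      (Function.uncurry fun (g : G) (z : E) => oneChart E G (g * (oneChart E G).symm z * g⁻¹))
      (g₀, oneChart E G 1) := by
    apply ContMDiffAt.comp (I' := 𝓘(ℝ, E)) (g₀, oneChart E G 1) (contMDiffAt_chart _)
    · apply ContMDiffAt.mul (contMDiffAt_fst.mul _) contMDiffAt_fst.inv
      exact ContMDiffAt.comp (g₀, oneChart E G 1)
        (contMDiffAt_chart_symm one_mem_target) contMDiffAt_snd
    · simp only [oneChart_symm_one]
      simp
  have h := contMDiffAt_fderiv_param (g := fun _ => oneChart E G 1) h1 contMDiffAt_const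
  refine h.congr_of_eventuallyEq (Filter.Eventually.of_forall fun g => ?_)
  ext X
  dsimp only
  rw [← tder_eq_fderiv,
    tder_comp_apply (I' := 𝓘(ℝ, E)) (y := (1 : G)) (mdifferentiableAt_chart one_mem_source) _ _,
    tder_comp_apply (I' := 𝓘(ℝ, E)) (y := (1 : G)) (g := fun a : G => g * a * g⁻¹) (mdiff_conj g (1 : G))
      (mdifferentiableAt_chart_symm one_mem_target) oneChart_symm_one,
    tder_chart_self, tder_chart_symm_self]
  · rfl
  · exact MDifferentiableAt.comp (I' := 𝓘(ℝ, E)) _ (mdiff_conj g ((oneChart E G).symm (oneChart E G 1)))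
      (mdifferentiableAt_chart_symm one_mem_target)
  · rw [oneChart_symm_one]; simp

/-- Left multiplication of a tangent vector at `1`, in the preferred chart at `1`. -/
def leftChart (G : Type*) [TopologicalSpace G] [ChartedSpace E G] [Group G] (x : E) : E →L[ℝ] E :=
  fderiv ℝ (fun z => oneChart E G ((oneChart E G).symm x * (oneChart E G).symm z)) (oneChart E G 1)

/-- Right multiplication of a tangent vector at `1`, in the preferred chart at `1`. -/
def rightChart (G : Type*) [TopologicalSpace G] [ChartedSpace E G] [Group G] (x : E) : E →L[ℝ] E :=
  fderiv ℝ (fun z => oneChart E G ((oneChart E G).symm z * (oneChart E G).symm x)) (oneChart E G 1)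

/-- The left Maurer-Cartan form in the preferred chart at `1`. -/
def mcChart (G : Type*) [TopologicalSpace G] [ChartedSpace E G] [Group G] (x : E) : E →L[ℝ] E :=
  (mc ((oneChart E G).symm x)).comp (tder 𝓘(ℝ, E) 𝓘(ℝ, E) (oneChart E G).symm x)

theorem leftChart_apply {x : E} (hx : x ∈ (oneChart E G).target) (X : E) :
    leftChart G x X = tder 𝓘(ℝ, E) 𝓘(ℝ, E) (oneChart E G) ((oneChart E G).symm x)
      (lvec X ((oneChart E G).symm x)) := by
  rw [leftChart, ← tder_eq_fderiv,
    tder_comp_apply (I' := 𝓘(ℝ, E)) (y := (oneChart E G).symm x)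
      (mdifferentiableAt_chart ((oneChart E G).map_target hx)) _ _,
    tder_comp_apply (I' := 𝓘(ℝ, E)) (y := (1 : G)) (mdiff_mul_left _ _)
      (mdifferentiableAt_chart_symm one_mem_target) oneChart_symm_one, tder_chart_symm_self]
  · rfl
  · exact MDifferentiableAt.comp (I' := 𝓘(ℝ, E)) _ (mdiff_mul_left _ _)
      (mdifferentiableAt_chart_symm one_mem_target)
  · rw [oneChart_symm_one, mul_one]

theorem rightChart_apply {x : E} (hx : x ∈ (oneChart E G).target) (X : E) :
    rightChart G x X = tder 𝓘(ℝ, E) 𝓘(ℝ, E) (oneChart E G) ((oneChart E G).symm x)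
      (lvec (Ad ((oneChart E G).symm x)⁻¹ X) ((oneChart E G).symm x)) := by
  rw [rightChart, ← tder_eq_fderiv,
    tder_comp_apply (I' := 𝓘(ℝ, E)) (y := (oneChart E G).symm x)
      (mdifferentiableAt_chart ((oneChart E G).map_target hx)) _ _,
    tder_comp_apply (I' := 𝓘(ℝ, E)) (y := (1 : G)) (mdiff_mul_right _ _)
      (mdifferentiableAt_chart_symm one_mem_target) oneChart_symm_one, tder_chart_symm_self,
      ← mul_right_tder_one]
  · rfl
  · exact MDifferentiableAt.comp (I' := 𝓘(ℝ, E)) _ (mdiff_mul_right _ _)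
      (mdifferentiableAt_chart_symm one_mem_target)
  · rw [oneChart_symm_one, one_mul]

theorem mcChart_tder {x : E} (hx : x ∈ (oneChart E G).target) (ξ : E) :
    mcChart G x (tder 𝓘(ℝ, E) 𝓘(ℝ, E) (oneChart E G) ((oneChart E G).symm x) ξ) =
      mc ((oneChart E G).symm x) ξ := by
  have := tder_symm_chart ((oneChart E G).map_target hx) ξ
  rw [(oneChart E G).right_inv hx] at this
  rw [mcChart, ContinuousLinearMap.comp_apply, this]

theorem mcChart_leftChart {x : E} (hx : x ∈ (oneChart E G).target) (X : E) :
    mcChart G x (leftChart G x X) = X := by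
  rw [leftChart_apply hx, mcChart_tder hx, mc_lvec]

theorem mcChart_rightChart {x : E} (hx : x ∈ (oneChart E G).target) (X : E) :
    mcChart G x (rightChart G x X) = Ad ((oneChart E G).symm x)⁻¹ X := by
  rw [rightChart_apply hx, mcChart_tder hx, mc_lvec]

theorem leftChart_one : leftChart G (oneChart E G 1) = ContinuousLinearMap.id ℝ E := by
  ext X
  rw [leftChart_apply one_mem_target, oneChart_symm_one, tder_chart_self, lvec_one]

theorem mcChart_one : mcChart G (oneChart E G 1) = ContinuousLinearMap.id ℝ E := by
  ext X
  have := mcChart_leftChart (G := G) one_mem_target X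
  rwa [leftChart_one] at this

theorem rightChart_one : rightChart G (oneChart E G 1) = ContinuousLinearMap.id ℝ E := by
  ext X
  have := mcChart_rightChart (G := G) one_mem_target X
  rwa [mcChart_one, oneChart_symm_one, inv_one, Ad_one] at this

/-- This exhibits the form as a partial derivative of `(w, z) ↦ w⁻¹ z` on the diagonal `z = w`, from
which its smoothness follows. -/
theorem mcChart_eq_fderiv {x : E} (hx : x ∈ (oneChart E G).target) :
    mcChart G x =
      fderiv ℝ (fun z => oneChart E G (((oneChart E G).symm x)⁻¹ * (oneChart E G).symm z)) x := by
  ext X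
  rw [← tder_eq_fderiv, tder_comp_apply (I' := 𝓘(ℝ, E)) (y := (1 : G))
    (mdifferentiableAt_chart one_mem_source) _ (by simp),
    tder_comp_apply (I' := 𝓘(ℝ, E)) (mdiff_mul_left _ _)
      (mdifferentiableAt_chart_symm hx) rfl, tder_chart_self]
  · rfl
  · exact MDifferentiableAt.comp (I' := 𝓘(ℝ, E)) _ (mdiff_mul_left _ _)
      (mdifferentiableAt_chart_symm hx)

theorem contDiffOn_mcChart : ContDiffOn ℝ ∞ (mcChart G) (oneChart E G).target := by
  intro x hx
  apply ContDiffAt.contDiffWithinAt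
  rw [← contMDiffAt_iff_contDiffAt]
  have h1 : ContMDiffAt (𝓘(ℝ, E).prod 𝓘(ℝ, E)) 𝓘(ℝ, E) ∞
      (Function.uncurry fun (w : E) (z : E) =>
        oneChart E G (((oneChart E G).symm w)⁻¹ * (oneChart E G).symm z)) (x, x) := by
    apply ContMDiffAt.comp (I' := 𝓘(ℝ, E)) (x, x) (contMDiffAt_chart _)
    · exact ContMDiffAt.mul
        (ContMDiffAt.comp (x, x) (contMDiffAt_chart_symm hx) contMDiffAt_fst).inv
        (ContMDiffAt.comp (x, x) (contMDiffAt_chart_symm hx) contMDiffAt_snd)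
    · simp
  have h := contMDiffAt_fderiv_param (g := fun w => w) h1 contMDiffAt_id
  refine h.congr_of_eventuallyEq ?_
  filter_upwards [extChartAt_target_nhds hx] with z hz using mcChart_eq_fderiv hz

theorem contDiffAt_mulChart : ContDiffAt ℝ ∞
    (fun p : E × E => oneChart E G ((oneChart E G).symm p.1 * (oneChart E G).symm p.2))
    (oneChart E G 1, oneChart E G 1) := by
  have h1 : ContMDiffAt (𝓘(ℝ, E × E)) 𝓘(ℝ, E) ∞ (fun p : E × E =>
      oneChart E G ((oneChart E G).symm p.1 * (oneChart E G).symm p.2))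
      (oneChart E G 1, oneChart E G 1) := by
    apply ContMDiffAt.comp (I' := 𝓘(ℝ, E)) _ (contMDiffAt_chart _)
    · exact ContMDiffAt.mul
        (ContMDiffAt.comp _ (contMDiffAt_chart_symm one_mem_target)
          contDiff_fst.contMDiff.contMDiffAt)
        (ContMDiffAt.comp _ (contMDiffAt_chart_symm one_mem_target)
          contDiff_snd.contMDiff.contMDiffAt)
    · simp only [oneChart_symm_one]; simp
  exact contMDiffAt_iff_contDiffAt.1 h1

/-- Left translation of tangent vectors at `1` is the partial derivative of the chart multiplication
in the second variable. The identity is local because the chart multiplication is differentiable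
only near the centre. -/
theorem eventually_leftChart : ∀ᶠ x in 𝓝 (oneChart E G 1), leftChart G x =
    (fderiv ℝ (fun p : E × E => oneChart E G ((oneChart E G).symm p.1 * (oneChart E G).symm p.2))
      (x, oneChart E G 1)).comp (ContinuousLinearMap.inr ℝ E E) := by
  have h := ((contDiffAt_mulChart (G := G) (E := E)).of_le (m := 1) (by norm_cast)).eventually (by simp)
  have hc : Filter.Tendsto (fun x : E => (x, oneChart E G 1)) (𝓝 (oneChart E G 1))
      (𝓝 (oneChart E G 1, oneChart E G 1)) :=
    (Continuous.tendsto (by fun_prop) _)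
  filter_upwards [hc.eventually h] with x hx
  rw [leftChart]
  exact ((hx.differentiableAt one_ne_zero).hasFDerivAt.comp (oneChart E G 1)
    (hasFDerivAt_prodMk_right x (oneChart E G 1))).fderiv

theorem eventually_rightChart : ∀ᶠ x in 𝓝 (oneChart E G 1), rightChart G x =
    (fderiv ℝ (fun p : E × E => oneChart E G ((oneChart E G).symm p.1 * (oneChart E G).symm p.2))
      (oneChart E G 1, x)).comp (ContinuousLinearMap.inl ℝ E E) := by
  have h := ((contDiffAt_mulChart (G := G) (E := E)).of_le (m := 1) (by norm_cast)).eventually (by simp)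
  have hc : Filter.Tendsto (fun x : E => (oneChart E G 1, x)) (𝓝 (oneChart E G 1))
      (𝓝 (oneChart E G 1, oneChart E G 1)) :=
    (Continuous.tendsto (by fun_prop) _)
  filter_upwards [hc.eventually h] with x hx
  rw [rightChart]
  exact (HasFDerivAt.comp (f := fun e => (e, x)) (oneChart E G 1) (hx.differentiableAt one_ne_zero).hasFDerivAt
    (hasFDerivAt_prodMk_left (𝕜 := ℝ) (oneChart E G 1) x)).fderiv

/-- Both derivatives are the mixed second derivative of the multiplication at `(1, 1)`. Symmetry of
second derivatives makes one the flip of the other. -/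
theorem hasFDerivAt_leftChart_rightChart :
    ∃ b : E →L[ℝ] E →L[ℝ] E, HasFDerivAt (leftChart G) b (oneChart E G 1) ∧
      HasFDerivAt (rightChart G) b.flip (oneChart E G 1) := by
  set μ := fun p : E × E => oneChart E G ((oneChart E G).symm p.1 * (oneChart E G).symm p.2)
  set x₀ := oneChart E G 1
  have hμ : ContDiffAt ℝ ∞ μ (x₀, x₀) := contDiffAt_mulChart (G := G) (E := E)
  have hd : HasFDerivAt (fderiv ℝ μ) (fderiv ℝ (fderiv ℝ μ) (x₀, x₀)) (x₀, x₀) :=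
    ((hμ.fderiv_right (m := 1) (by norm_cast)).differentiableAt one_ne_zero).hasFDerivAt
  have hsymm : IsSymmSndFDerivAt ℝ μ (x₀, x₀) := hμ.isSymmSndFDerivAt (by simp; exact WithTop.coe_le_coe.2 le_top)
  have hl := (((ContinuousLinearMap.compL ℝ E (E × E) E).flip
    (ContinuousLinearMap.inr ℝ E E)).hasFDerivAt.comp x₀
      (HasFDerivAt.comp (f := fun e => (e, x₀)) x₀ hd (hasFDerivAt_prodMk_left (𝕜 := ℝ) x₀ x₀)))
  have hr := (((ContinuousLinearMap.compL ℝ E (E × E) E).flip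
    (ContinuousLinearMap.inl ℝ E E)).hasFDerivAt.comp x₀
      (HasFDerivAt.comp (f := fun e => (x₀, e)) x₀ hd (hasFDerivAt_prodMk_right (𝕜 := ℝ) x₀ x₀)))
  refine ⟨_, hl.congr_of_eventuallyEq (eventually_leftChart (G := G)), ?_⟩
  convert! hr.congr_of_eventuallyEq (eventually_rightChart (G := G)) using 1
  ext X Y
  simp
  exact hsymm _ _

/-- In the chart at `1` the left-invariant field of `X` is `x ↦ leftChart G x X`. The bracket of
fields on a vector space is a difference of directional derivatives, and both `leftChart` and the
derivative of the chart are the identity at the centre. -/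
theorem lieBr_eq (X Y : E) : lieBr G X Y =
    fderiv ℝ (leftChart G) (oneChart E G 1) X Y -
      fderiv ℝ (leftChart G) (oneChart E G 1) Y X := by
  obtain ⟨b, hb, -⟩ := hasFDerivAt_leftChart_rightChart (G := G) (E := E)
  have hpull : ∀ X : E, VectorField.mpullbackWithin 𝓘(ℝ, E) 𝓘(ℝ, E)
      (extChartAt 𝓘(ℝ, E) (1 : G)).symm
      (mulInvariantVectorField (I := 𝓘(ℝ, E)) (X : GroupLieAlgebra 𝓘(ℝ, E) G))
      (range 𝓘(ℝ, E)) =ᶠ[𝓝 (oneChart E G 1)] fun x => leftChart G x X := by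
    intro X
    filter_upwards [extChartAt_target_nhds (one_mem_target (E := E) (G := G))] with x hx
    rw [VectorField.mpullbackWithin_apply]
    simp only [modelWithCornersSelf_coe, range_id, mfderivWithin_univ]
    rw [leftChart_apply hx]
    have : (mfderiv 𝓘(ℝ, E) 𝓘(ℝ, E) (extChartAt 𝓘(ℝ, E) (1 : G)).symm x).inverse =
        mfderiv 𝓘(ℝ, E) 𝓘(ℝ, E) (oneChart E G) ((oneChart E G).symm x) := by
      apply ContinuousLinearMap.inverse_eq
      · ext ξ
        have := tder_symm_chart ((oneChart E G).map_target hx) ξ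
        rw [(oneChart E G).right_inv hx] at this
        exact this
      · ext v
        exact tder_chart_symm hx v
    rw [this]
    rfl
  have h2 : (tder 𝓘(ℝ, E) 𝓘(ℝ, E) (extChartAt 𝓘(ℝ, E) (1 : G)) 1).inverse =
      ContinuousLinearMap.id ℝ E := by
    rw [tder_chart_self (E := E) (1 : G)]; simp
  have h1 : lieBr G X Y = (tder 𝓘(ℝ, E) 𝓘(ℝ, E) (extChartAt 𝓘(ℝ, E) (1 : G)) 1).inverse
      (VectorField.lieBracketWithin ℝ (fun x => leftChart G x X) (fun x => leftChart G x Y) univ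
        (oneChart E G 1)) := by
    refine (VectorField.mlieBracketWithin_apply (I := 𝓘(ℝ, E)) (x₀ := (1 : G)) (s := univ)
      (V := mulInvariantVectorField (I := 𝓘(ℝ, E)) (X : GroupLieAlgebra 𝓘(ℝ, E) G))
      (W := mulInvariantVectorField (I := 𝓘(ℝ, E)) (Y : GroupLieAlgebra 𝓘(ℝ, E) G))).trans ?_
    simp only [modelWithCornersSelf_coe, range_id, preimage_univ, univ_inter]
    have := fun X => (hpull X)
    simp only [modelWithCornersSelf_coe, range_id] at this
    simp only [VectorField.lieBracketWithin_univ]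
    refine congrArg _ ((congrFun VectorField.lieBracketWithin_univ _).trans
      (Filter.EventuallyEq.lieBracket_vectorField_eq (this X) (this Y)))
  rw [h1, h2, VectorField.lieBracketWithin_univ, VectorField.lieBracket, hb.fderiv]
  have hX : ∀ X : E, fderiv ℝ (fun x => leftChart G x X) (oneChart E G 1) = b.flip X := by
    intro X
    have := hb.clm_apply (hasFDerivAt_const X (oneChart E G 1))
    rw [this.fderiv]
    simp
  rw [hX, hX, leftChart_one]
  rfl

/-- Differentiate `mcChart x ∘ leftChart x = id` at the centre, where both factors are the identity.
-/
theorem hasFDerivAt_mcChart {b : E →L[ℝ] E →L[ℝ] E}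
    (hb : HasFDerivAt (leftChart G) b (oneChart E G 1)) :
    HasFDerivAt (mcChart G) (-b) (oneChart E G 1) := by
  have hd := ((contDiffOn_mcChart (E := E) (G := G)).contDiffAt
    (extChartAt_target_nhds one_mem_target)).differentiableAt (by simp) |>.hasFDerivAt
  convert! hd using 1
  have h1 := hd.clm_comp hb
  have h2 : HasFDerivAt (𝕜 := ℝ) (fun x => (mcChart G x).comp (leftChart G x)) 0 (oneChart E G 1) := by
    refine (hasFDerivAt_const (ContinuousLinearMap.id ℝ E) _).congr_of_eventuallyEq ?_
    filter_upwards [extChartAt_target_nhds (one_mem_target (E := E) (G := G))] with x hx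
    ext X
    exact mcChart_leftChart hx X
  have h3 := h1.unique h2
  ext X Y
  have h4 := congrArg (fun L => L X Y) h3
  simp only [leftChart_one, mcChart_one, add_apply,
    ContinuousLinearMap.comp_apply, ContinuousLinearMap.compL_apply, ContinuousLinearMap.flip_apply,
    zero_apply, ContinuousLinearMap.id_apply] at h4
  have h5 : b X Y = - (fderiv ℝ (mcChart G) (oneChart E G 1)) X Y :=
    eq_neg_of_add_eq_zero_left h4
  simp [h5]

/-- The Maurer-Cartan equation at the identity. -/
theorem fderiv_mcChart_sub (X Y : E) :
    fderiv ℝ (mcChart G) (oneChart E G 1) X Y -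
      fderiv ℝ (mcChart G) (oneChart E G 1) Y X = - lieBr G X Y := by
  obtain ⟨b, hb, -⟩ := hasFDerivAt_leftChart_rightChart (G := G) (E := E)
  rw [(hasFDerivAt_mcChart hb).fderiv, lieBr_eq, hb.fderiv]
  simp only [neg_apply]
  abel

/-- The derivative of the adjoint representation is the Lie bracket. -/
theorem tder_Ad_inv (X Y : E) :
    tder 𝓘(ℝ, E) 𝓘(ℝ, E) (fun g : G => Ad g⁻¹ X) 1 Y = lieBr G X Y := by
  obtain ⟨b, hb, hb'⟩ := hasFDerivAt_leftChart_rightChart (G := G) (E := E)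
  have hsm : MDifferentiableAt 𝓘(ℝ, E) 𝓘(ℝ, E) (fun g : G => Ad g⁻¹ X) 1 := by
    have h := (contMDiff_Ad (G := G) (E := E)).comp (contMDiff_inv 𝓘(ℝ, E) ∞)
    exact ((h.clm_apply contMDiff_const) 1).mdifferentiableAt (by simp)
  have h1 := tder_comp_apply hsm (mdifferentiableAt_chart_symm (one_mem_target (E := E) (G := G)))
    oneChart_symm_one Y
  rw [tder_chart_symm_self] at h1
  refine h1.symm.trans ?_
  -- `Ad(g⁻¹)` is right translation followed by the Maurer–Cartan form, so the derivative along `Y`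
  -- is `-b Y X + b X Y`.
  have h2 : (fun x => Ad ((oneChart E G).symm x)⁻¹ X) =ᶠ[𝓝 (oneChart E G 1)]
      fun x => mcChart G x (rightChart G x X) := by
    filter_upwards [extChartAt_target_nhds (one_mem_target (E := E) (G := G))] with x hx
    exact (mcChart_rightChart hx X).symm
  rw [tder_congr h2, tder_eq_fderiv]
  have h3 := (hasFDerivAt_mcChart hb).clm_apply
    (hb'.clm_apply (hasFDerivAt_const X (oneChart E G 1)))
  rw [h3.fderiv, lieBr_eq, hb.fderiv]
  simp only [mcChart_one, rightChart_one, add_apply,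
    ContinuousLinearMap.comp_apply, ContinuousLinearMap.flip_apply, neg_apply,
    zero_apply, ContinuousLinearMap.id_apply]
  abel

end LieGroup

end PreHam

namespace PreHam

/-! ### Slices for right multiplication by `K`, from the inverse function theorem. -/

section SliceSection

variable {EG : Type*} [NormedAddCommGroup EG] [NormedSpace ℝ EG] [FiniteDimensional ℝ EG]
  {G : Type*} [TopologicalSpace G] [ChartedSpace EG G] [Group G] [LieGroup 𝓘(ℝ, EG) ∞ G]
  {EK : Type*} [NormedAddCommGroup EK] [NormedSpace ℝ EK] [FiniteDimensional ℝ EK]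
  {K : Subgroup G} [ChartedSpace EK K] [LieGroup 𝓘(ℝ, EK) ∞ K]

/-- The submanifold through `1` that the preferred chart at `1` identifies with a subspace. -/
def slicePt (𝔭 : Submodule ℝ EG) (X : 𝔭) : G := (oneChart EG G).symm (oneChart EG G 1 + (X : EG))

theorem slicePt_zero (𝔭 : Submodule ℝ EG) : slicePt 𝔭 (0 : 𝔭) = (1 : G) := by
  simp [slicePt]

/-- A slice for the action of `K` on `G` by right multiplication: `(X, k) ↦ σ(X) k` is a
diffeomorphism from `ball × K` onto an open subset of `G`, with inverse `g ↦ (fst g, snd g)`. -/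
structure Slice (K : Subgroup G) [ChartedSpace EK K] (𝔭 : Submodule ℝ EG) where
  ball : Set 𝔭
  dom : Set G
  fst : G → 𝔭
  snd : G → K
  ball_open : IsOpen ball
  zero_mem : (0 : 𝔭) ∈ ball
  ball_target : ∀ X ∈ ball, oneChart EG G 1 + (X : EG) ∈ (oneChart EG G).target
  dom_open : IsOpen dom
  mem_dom : ∀ X ∈ ball, ∀ k : K, slicePt 𝔭 X * (k : G) ∈ dom
  fst_mem : ∀ g ∈ dom, fst g ∈ ball
  slicePt_mul : ∀ g ∈ dom, slicePt 𝔭 (fst g) * (snd g : G) = g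
  fst_apply : ∀ X ∈ ball, ∀ k : K, fst (slicePt 𝔭 X * (k : G)) = X
  snd_apply : ∀ X ∈ ball, ∀ k : K, snd (slicePt 𝔭 X * (k : G)) = k
  fst_smooth : ContMDiffOn 𝓘(ℝ, EG) 𝓘(ℝ, 𝔭) ∞ fst dom
  snd_smooth : ContMDiffOn 𝓘(ℝ, EG) 𝓘(ℝ, EK) ∞ snd dom

theorem contMDiffAt_slicePt {𝔭 : Submodule ℝ EG} {X : 𝔭}
    (hX : oneChart EG G 1 + (X : EG) ∈ (oneChart EG G).target) :
    ContMDiffAt 𝓘(ℝ, 𝔭) 𝓘(ℝ, EG) ∞ (slicePt 𝔭 : 𝔭 → G) X := by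
  have h : ContDiff ℝ ∞ (fun X : 𝔭 => oneChart EG G 1 + (X : EG)) :=
    contDiff_const.add 𝔭.subtypeL.contDiff
  exact (contMDiffAt_chart_symm hX).comp X h.contMDiff.contMDiffAt

theorem tder_slicePt {𝔭 : Submodule ℝ EG} {X : 𝔭}
    (hX : oneChart EG G 1 + (X : EG) ∈ (oneChart EG G).target) (Y : 𝔭) :
    tder 𝓘(ℝ, 𝔭) 𝓘(ℝ, EG) (slicePt 𝔭 : 𝔭 → G) X Y =
      tder 𝓘(ℝ, EG) 𝓘(ℝ, EG) (oneChart EG G).symm (oneChart EG G 1 + (X : EG)) Y := by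
  have h : HasFDerivAt (fun X : 𝔭 => oneChart EG G 1 + (X : EG)) 𝔭.subtypeL X :=
    𝔭.subtypeL.hasFDerivAt.const_add _
  have := tder_comp_apply (mdifferentiableAt_chart_symm hX) h.differentiableAt.mdifferentiableAt
    rfl Y
  refine this.trans ?_
  rw [tder_eq_fderiv, h.fderiv]
  rfl

theorem tder_slicePt_zero {𝔭 : Submodule ℝ EG} (Y : 𝔭) :
    tder 𝓘(ℝ, 𝔭) 𝓘(ℝ, EG) (slicePt 𝔭 : 𝔭 → G) 0 Y = Y := by
  rw [tder_slicePt (by simp)]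
  simp only [ZeroMemClass.coe_zero, add_zero, tder_chart_symm_self]
  rfl

theorem lieIncl_injective (hK : IsMaximalCompactLieSubgroup (EG := EG) (EK := EK) K) :
    Function.Injective (lieIncl (EG := EG) (EK := EK) K) :=
  hK.immersion 1

theorem mdiff_coe (hK : IsMaximalCompactLieSubgroup (EG := EG) (EK := EK) K) (k : K) :
    MDifferentiableAt 𝓘(ℝ, EK) 𝓘(ℝ, EG) (Subtype.val : K → G) k :=
  hK.smooth.contMDiffAt.mdifferentiableAt (by simp)

theorem lieIncl_eq : (lieIncl (EG := EG) (EK := EK) K) =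
    tder 𝓘(ℝ, EK) 𝓘(ℝ, EG) (Subtype.val : K → G) 1 := rfl

/-- The map `(X, z) ↦ σ(X) k(z)` in charts, where `k(z) ∈ K` has coordinate `z`. -/
def sliceMap (K : Subgroup G) [ChartedSpace EK K] (𝔭 : Submodule ℝ EG) (w : 𝔭 × EK) : EG :=
  oneChart EG G ((slicePt 𝔭 w.1 : G) * (((oneChart EK K).symm (oneChart EK K 1 + w.2) : K) : G))

/-- The set on which `sliceMap` is well-behaved. -/
def sliceDom (K : Subgroup G) [ChartedSpace EK K] (𝔭 : Submodule ℝ EG) : Set (𝔭 × EK) :=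
  {w | oneChart EG G 1 + (w.1 : EG) ∈ (oneChart EG G).target ∧
    oneChart EK K 1 + w.2 ∈ (oneChart EK K).target ∧
    (slicePt 𝔭 w.1 : G) * (((oneChart EK K).symm (oneChart EK K 1 + w.2) : K) : G) ∈ (oneChart EG G).source}

theorem contMDiffAt_slicePt_mul (hK : IsMaximalCompactLieSubgroup (EG := EG) (EK := EK) K)
    {𝔭 : Submodule ℝ EG} {w : 𝔭 × EK}
    (h1 : oneChart EG G 1 + (w.1 : EG) ∈ (oneChart EG G).target)
    (h2 : oneChart EK K 1 + w.2 ∈ (oneChart EK K).target) :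
    ContMDiffAt 𝓘(ℝ, 𝔭 × EK) 𝓘(ℝ, EG) ∞ (fun w : 𝔭 × EK =>
      slicePt 𝔭 w.1 * (((oneChart EK K).symm (oneChart EK K 1 + w.2) : K) : G)) w := by
  apply ContMDiffAt.mul
  · exact ContMDiffAt.comp (I' := 𝓘(ℝ, 𝔭)) (g := (slicePt 𝔭 : 𝔭 → G)) (f := Prod.fst) w
      (contMDiffAt_slicePt h1) contDiff_fst.contMDiff.contMDiffAt
  · have h : ContDiff ℝ ∞ (fun w : 𝔭 × EK => oneChart EK K 1 + w.2) :=
      contDiff_const.add contDiff_snd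
    exact hK.smooth.contMDiffAt.comp w
      (ContMDiffAt.comp w (contMDiffAt_chart_symm h2) h.contMDiff.contMDiffAt)

theorem isOpen_sliceDom (hK : IsMaximalCompactLieSubgroup (EG := EG) (EK := EK) K)
    (𝔭 : Submodule ℝ EG) : IsOpen (sliceDom (EK := EK) K 𝔭) := by
  rw [isOpen_iff_mem_nhds]
  rintro w ⟨h1, h2, h3⟩
  have c1 : ContinuousAt (fun w : 𝔭 × EK => oneChart EG G 1 + (w.1 : EG)) w :=
    Continuous.continuousAt (by fun_prop)
  have c2 : ContinuousAt (fun w : 𝔭 × EK => oneChart EK K 1 + w.2) w :=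
    Continuous.continuousAt (by fun_prop)
  exact Filter.inter_mem (c1.preimage_mem_nhds (extChartAt_target_nhds (M := G) h1))
    (Filter.inter_mem (c2.preimage_mem_nhds (extChartAt_target_nhds (M := K) h2))
    ((contMDiffAt_slicePt_mul hK h1 h2).continuousAt.preimage_mem_nhds
      (extChartAt_source_nhds (M := G) h3)))

theorem zero_mem_sliceDom (𝔭 : Submodule ℝ EG) : (0 : 𝔭 × EK) ∈ sliceDom (EK := EK) K 𝔭 := by
  refine ⟨by simp, by simp, ?_⟩
  simp only [Prod.fst_zero, slicePt_zero, Prod.snd_zero, add_zero, oneChart_symm_one]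
  simp

theorem contDiffAt_sliceMap (hK : IsMaximalCompactLieSubgroup (EG := EG) (EK := EK) K)
    {𝔭 : Submodule ℝ EG} {w : 𝔭 × EK} (hw : w ∈ sliceDom (EK := EK) K 𝔭) :
    ContDiffAt ℝ ∞ (sliceMap (EK := EK) K 𝔭) w := by
  rw [← contMDiffAt_iff_contDiffAt]
  exact (contMDiffAt_chart hw.2.2).comp w (contMDiffAt_slicePt_mul hK hw.1 hw.2.1)

/-- The two partial maps are simple: for `z = 0` the chart undoes its own inverse and leaves a
translation near zero, and for `X = 0` the map is the inclusion of `K` read in charts. -/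
theorem fderiv_sliceMap (hK : IsMaximalCompactLieSubgroup (EG := EG) (EK := EK) K)
    {𝔭 : Submodule ℝ EG} (X : 𝔭) (z : EK) :
    fderiv ℝ (sliceMap (EK := EK) K 𝔭) 0 (X, z) = X + lieIncl (EG := EG) K z := by
  have hd := (contDiffAt_sliceMap hK (zero_mem_sliceDom (EK := EK) 𝔭)).differentiableAt (by simp)
  have e : ((X, z) : 𝔭 × EK) = ContinuousLinearMap.inl ℝ 𝔭 EK X +
    ContinuousLinearMap.inr ℝ 𝔭 EK z := by simp
  rw [e, map_add]
  congr 1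
  · have h1 : HasFDerivAt (fun X : 𝔭 => sliceMap (EK := EK) K 𝔭 (X, 0)) _ 0 :=
      HasFDerivAt.comp (f := fun X : 𝔭 => (X, (0 : EK))) (0 : 𝔭) hd.hasFDerivAt
        (hasFDerivAt_prodMk_left (𝕜 := ℝ) (0 : 𝔭) (0 : EK))
    have h2 : (fun X : 𝔭 => sliceMap (EK := EK) K 𝔭 (X, 0)) =ᶠ[𝓝 0]
        fun X : 𝔭 => oneChart EG G 1 + (X : EG) := by
      have c1 : ContinuousAt (fun w : 𝔭 => oneChart EG G 1 + (w : EG)) 0 :=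
        Continuous.continuousAt (by fun_prop)
      filter_upwards [c1.preimage_mem_nhds (extChartAt_target_nhds (M := G)
        (x₀ := 1) (by simp))] with w hw
      simp only [sliceMap, add_zero, oneChart_symm_one, OneMemClass.coe_one, mul_one, slicePt]
      exact (oneChart EG G).right_inv hw
    have h3 : HasFDerivAt (fun X : 𝔭 => oneChart EG G 1 + (X : EG)) 𝔭.subtypeL 0 :=
      𝔭.subtypeL.hasFDerivAt.const_add _
    exact congrArg (fun L => L X) (h1.unique (h3.congr_of_eventuallyEq h2))
  · have h1 : HasFDerivAt (fun z : EK => sliceMap (EK := EK) K 𝔭 (0, z)) _ 0 :=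
      HasFDerivAt.comp (f := fun z : EK => ((0 : 𝔭), z)) (0 : EK) hd.hasFDerivAt
        (hasFDerivAt_prodMk_right (𝕜 := ℝ) (0 : 𝔭) (0 : EK))
    have h2 := congrArg (fun L => L z) h1.fderiv
    refine h2.symm.trans ?_
    have h3 : (fun z : EK => sliceMap (EK := EK) K 𝔭 (0, z)) =
        fun z => oneChart EG G (((oneChart EK K).symm (oneChart EK K 1 + z) : K) : G) := by
      ext z
      simp [sliceMap, slicePt_zero]
    have hc : HasFDerivAt (fun z : EK => oneChart EK K 1 + z) (ContinuousLinearMap.id ℝ EK) 0 :=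
      (hasFDerivAt_id _).const_add _
    have hs : MDifferentiableAt 𝓘(ℝ, EK) 𝓘(ℝ, EK)
        (fun z => (oneChart EK K).symm (oneChart EK K 1 + z)) 0 :=
      MDifferentiableAt.comp (I' := 𝓘(ℝ, EK)) (0 : EK)
        (mdifferentiableAt_chart_symm (M := K) (by simp))
        hc.differentiableAt.mdifferentiableAt
    have e1 : (oneChart EK K).symm (oneChart EK K 1 + 0) = 1 := by rw [add_zero, oneChart_symm_one]
    have hs' : MDifferentiableAt 𝓘(ℝ, EK) 𝓘(ℝ, EG)
        (fun z => (((oneChart EK K).symm (oneChart EK K 1 + z) : K) : G)) 0 :=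
      MDifferentiableAt.comp (I' := 𝓘(ℝ, EK)) (0 : EK) (mdiff_coe hK _) hs
    change fderiv ℝ (fun z : EK => sliceMap (EK := EK) K 𝔭 (0, z)) 0 z = _
    rw [h3, ← tder_eq_fderiv,
      tder_comp_apply (I' := 𝓘(ℝ, EG)) (y := (1 : G)) (mdifferentiableAt_chart one_mem_source)
        hs' (by rw [e1]; rfl),
      tder_comp_apply (I' := 𝓘(ℝ, EK)) (mdiff_coe hK 1) hs e1,
      tder_comp_apply (I' := 𝓘(ℝ, EK)) (mdifferentiableAt_chart_symm one_mem_target)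
        hc.differentiableAt.mdifferentiableAt (by simp), tder_eq_fderiv, hc.fderiv,
        tder_chart_symm_self, tder_chart_self, lieIncl_eq]
    rfl

/-- The derivative of `sliceMap` at the origin, as an isomorphism `𝔭 × 𝔨 ≅ 𝔤`. -/
def sliceEquiv (hK : IsMaximalCompactLieSubgroup (EG := EG) (EK := EK) K)
    {𝔭 : Submodule ℝ EG}
    (h : IsCompl (LinearMap.range (lieIncl (EG := EG) (EK := EK) K).toLinearMap) 𝔭) :
    (𝔭 × EK) ≃L[ℝ] EG :=
  (LinearEquiv.ofBijective (𝔭.subtype.coprod (lieIncl (EG := EG) (EK := EK) K).toLinearMap)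
    ⟨by
      rw [← LinearMap.ker_eq_bot, LinearMap.ker_eq_bot']
      rintro ⟨X, z⟩ hXz
      simp only [LinearMap.coprod_apply, Submodule.subtype_apply] at hXz
      have hX : (X : EG) ∈ LinearMap.range (lieIncl (EG := EG) (EK := EK) K).toLinearMap :=
        ⟨-z, by rw [map_neg]; exact (eq_neg_of_add_eq_zero_left hXz).symm⟩
      have hX0 : (X : EG) = 0 := Submodule.disjoint_def.1 h.disjoint _ hX X.2
      rw [hX0, zero_add] at hXz
      have hz : z = 0 := lieIncl_injective hK (hXz.trans (map_zero _).symm)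
      simp [hz, Submodule.coe_eq_zero.1 hX0], by
      rw [← LinearMap.range_eq_top, LinearMap.range_coprod, Submodule.range_subtype, sup_comm]
      exact h.sup_eq_top⟩).toContinuousLinearEquiv

theorem hasFDerivAt_sliceMap (hK : IsMaximalCompactLieSubgroup (EG := EG) (EK := EK) K)
    {𝔭 : Submodule ℝ EG}
    (h : IsCompl (LinearMap.range (lieIncl (EG := EG) (EK := EK) K).toLinearMap) 𝔭) :
    HasFDerivAt (sliceMap (EK := EK) K 𝔭) (sliceEquiv hK h : (𝔭 × EK) →L[ℝ] EG) 0 := by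
  have hd := (contDiffAt_sliceMap hK (zero_mem_sliceDom (EK := EK) 𝔭)).differentiableAt (by simp)
  have he : (sliceEquiv hK h : (𝔭 × EK) →L[ℝ] EG) = fderiv ℝ (sliceMap (EK := EK) K 𝔭) 0 :=
    ContinuousLinearMap.ext fun w => (fderiv_sliceMap hK w.1 w.2).symm
  rw [he]
  exact hd.hasFDerivAt

/-- The inverse function theorem at `0` gives a local homeomorphism. Since invertible linear maps
form an open set, the source can be shrunk until the derivative is invertible throughout, and then
the inverse is smooth on the whole target. -/
theorem exists_sliceHomeo (hK : IsMaximalCompactLieSubgroup (EG := EG) (EK := EK) K)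
    {𝔭 : Submodule ℝ EG}
    (h : IsCompl (LinearMap.range (lieIncl (EG := EG) (EK := EK) K).toLinearMap) 𝔭) :
    ∃ e : OpenPartialHomeomorph (𝔭 × EK) EG, (∀ w, e w = sliceMap (EK := EK) K 𝔭 w) ∧ 0 ∈ e.source ∧
      e.source ⊆ sliceDom (EK := EK) K 𝔭 ∧ ∀ y ∈ e.target, ContDiffAt ℝ ∞ e.symm y := by
  have hc := contDiffAt_sliceMap hK (zero_mem_sliceDom (EK := EK) 𝔭)
  let e₀ := hc.toOpenPartialHomeomorph (sliceMap (EK := EK) K 𝔭) (hasFDerivAt_sliceMap hK h)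
    (by simp)
  have hdc : ContinuousAt (fderiv ℝ (sliceMap (EK := EK) K 𝔭)) 0 :=
    (hc.fderiv_right (m := 0) (by simp)).continuousAt
  have hinv : ∀ᶠ w in 𝓝 (0 : 𝔭 × EK), fderiv ℝ (sliceMap (EK := EK) K 𝔭) w ∈
      range ((↑) : ((𝔭 × EK) ≃L[ℝ] EG) → (𝔭 × EK) →L[ℝ] EG) := by
    apply hdc.eventually
    rw [(hasFDerivAt_sliceMap hK h).fderiv]
    exact ContinuousLinearEquiv.nhds _
  obtain ⟨W, hW, hWo, h0W⟩ := eventually_nhds_iff.1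
    (hinv.and ((isOpen_sliceDom hK 𝔭).mem_nhds (zero_mem_sliceDom (EK := EK) 𝔭)))
  refine ⟨e₀.restrOpen W hWo, fun w => rfl, ⟨hc.mem_toOpenPartialHomeomorph_source _ (by simp), h0W⟩,
    fun w hw => (hW w hw.2).2, fun y hy => ?_⟩
  have hy' := (e₀.restrOpen W hWo).map_target hy
  obtain ⟨f', hf'⟩ := (hW _ hy'.2).1
  refine (e₀.restrOpen W hWo).contDiffAt_symm hy (f₀' := f') ?_
    (contDiffAt_sliceMap hK (hW _ hy'.2).2)
  rw [hf']
  exact ((contDiffAt_sliceMap hK (hW _ hy'.2).2).differentiableAt (by simp)).hasFDerivAt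

/-- The local homeomorphism only sees elements of `K` near `1`, whereas a slice needs all of `K`.
Injectivity on `ball × K` is achieved by shrinking the ball until `σ(X)⁻¹ σ(X')` is close to `1`;
smoothness of the inverse spreads from `k = 1` by right translation. -/
theorem exists_slice (hK : IsMaximalCompactLieSubgroup (EG := EG) (EK := EK) K)
    {𝔭 : Submodule ℝ EG}
    (h : IsCompl (LinearMap.range (lieIncl (EG := EG) (EK := EK) K).toLinearMap) 𝔭) :
    Nonempty (Slice (EK := EK) K 𝔭) := by
  haveI : IsTopologicalGroup G := topologicalGroup_of_lieGroup 𝓘(ℝ, EG) ∞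
  obtain ⟨e, he, h0, hes, hesymm⟩ := exists_sliceHomeo hK h
  -- a product neighbourhood of the origin
  obtain ⟨B₀, C, hB₀, h0B₀, hC, h0C, hBC⟩ := mem_nhds_prod_iff'.1 (e.open_source.mem_nhds h0)
  have hpair : ∀ X ∈ B₀, ∀ z ∈ C, (X, z) ∈ e.source := fun X hX z hz => hBC ⟨hX, hz⟩
  have hBt : ∀ X ∈ B₀, oneChart EG G 1 + (X : EG) ∈ (oneChart EG G).target := fun X hX =>
    (hes (hpair X hX 0 h0C)).1
  -- a neighbourhood of the identity in `K`
  have hW : {k : K | k ∈ (oneChart EK K).source ∧ oneChart EK K k - oneChart EK K 1 ∈ C} ∈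
      𝓝 (1 : K) := by
    have hcont : ContinuousAt (fun k : K => oneChart EK K k - oneChart EK K 1) 1 :=
      ((contMDiffAt_chart (one_mem_source (E := EK) (G := K))).continuousAt).sub continuousAt_const
    exact Filter.inter_mem (extChartAt_source_nhds one_mem_source)
      (hcont.preimage_mem_nhds (hC.mem_nhds (by simpa using h0C)))
  -- `K` carries the subspace topology, so the chart neighbourhood of `1` in `K` contains the trace
  -- of a neighbourhood `U` of `1` in `G`.
  obtain ⟨U, hU, hUW⟩ := mem_nhds_subtype (K : Set G) 1 _ |>.1 hW
  -- the ball
  have hcσ : ContinuousAt (fun w : 𝔭 × 𝔭 => (slicePt 𝔭 w.1 : G)⁻¹ * slicePt 𝔭 w.2) (0, 0) := by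
    have h1 := (contMDiffAt_slicePt (hBt 0 h0B₀)).continuousAt
    exact (ContinuousAt.comp (x := ((0, 0) : 𝔭 × 𝔭)) h1 continuousAt_fst).inv.mul
      (ContinuousAt.comp (x := ((0, 0) : 𝔭 × 𝔭)) h1 continuousAt_snd)
  have hU' : (fun w : 𝔭 × 𝔭 => (slicePt 𝔭 w.1 : G)⁻¹ * slicePt 𝔭 w.2) ⁻¹' U ∈ 𝓝 ((0, 0) : 𝔭 × 𝔭) := by
    apply hcσ.preimage_mem_nhds
    simpa [slicePt_zero] using hU
  obtain ⟨B₁, B₂, hB₁, h0B₁, hB₂, h0B₂, hB₁₂⟩ := mem_nhds_prod_iff'.1 hU'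
  set B := B₀ ∩ (B₁ ∩ B₂) with hBdef
  have hBo : IsOpen B := hB₀.inter (hB₁.inter hB₂)
  -- If `σ(X) k = σ(X') k'`, then `k k'⁻¹ = σ(X)⁻¹ σ(X')` lies in `U`, hence has small coordinates,
  -- and injectivity of `e` applies.
  have hinj : ∀ X ∈ B, ∀ X' ∈ B, ∀ k k' : K,
      (slicePt 𝔭 X : G) * k = slicePt 𝔭 X' * k' → X = X' ∧ k = k' := by
    intro X hX X' hX' k k' hkk
    have hj : ((k * k'⁻¹ : K) : G) = (slicePt 𝔭 X)⁻¹ * slicePt 𝔭 X' := by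
      rw [Subgroup.coe_mul, Subgroup.coe_inv, eq_inv_mul_iff_mul_eq, ← mul_assoc, hkk]
      group
    have hjU : ((k * k'⁻¹ : K) : G) ∈ U := by
      rw [hj]; exact hB₁₂ (show (X, X') ∈ B₁ ×ˢ B₂ from ⟨hX.2.1, hX'.2.2⟩)
    obtain ⟨hj1, hj2⟩ : k * k'⁻¹ ∈ {k : K | k ∈ (oneChart EK K).source ∧
      oneChart EK K k - oneChart EK K 1 ∈ C} := hUW hjU
    have heq : e (X, oneChart EK K (k * k'⁻¹) - oneChart EK K 1) = e (X', 0) := by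
      rw [he, he, sliceMap, sliceMap]
      simp only [add_sub_cancel, add_zero]
      rw [(oneChart EK K).left_inv hj1, oneChart_symm_one, hj]
      simp
    have := e.injOn (hpair X hX.1 _ hj2) (hpair X' hX'.1 0 h0C) heq
    simp only [Prod.mk.injEq] at this
    refine ⟨this.1, ?_⟩
    have h3 : k * k'⁻¹ = 1 :=
      (oneChart EK K).injOn hj1 one_mem_source (sub_eq_zero.1 this.2)
    exact mul_inv_eq_one.1 h3
  let dom : Set G := {g | ∃ X ∈ B, ∃ k : K, slicePt 𝔭 X * (k : G) = g}
  -- Outside `dom` the pair is the meaningless default `(0, 1)`.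
  have hch : ∀ g : G, ∃ w : 𝔭 × K, g ∈ dom → w.1 ∈ B ∧ slicePt 𝔭 w.1 * (w.2 : G) = g := by
    intro g
    by_cases hg : g ∈ dom
    · obtain ⟨X, hX, k, hk⟩ := hg
      exact ⟨(X, k), fun _ => ⟨hX, hk⟩⟩
    · exact ⟨(0, 1), fun h => absurd h hg⟩
  choose w hw using hch
  have hwa : ∀ X ∈ B, ∀ k : K, w (slicePt 𝔭 X * (k : G)) = (X, k) := by
    intro X hX k
    obtain ⟨h1, h2⟩ := hw _ (show slicePt 𝔭 X * (k : G) ∈ dom from ⟨X, hX, k, rfl⟩)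
    obtain ⟨h3, h4⟩ := hinj _ h1 X hX _ k h2
    exact Prod.ext h3 h4
  -- local description of the inverse
  have hloc : ∀ g₀ ∈ dom, ∃ f : G → 𝔭 × K, ContMDiffAt 𝓘(ℝ, EG) 𝓘(ℝ, 𝔭) ∞ (fun g => (f g).1) g₀ ∧
      ContMDiffAt 𝓘(ℝ, EG) 𝓘(ℝ, EK) ∞ (fun g => (f g).2) g₀ ∧
      ∀ᶠ g in 𝓝 g₀, (f g).1 ∈ B ∧ slicePt 𝔭 (f g).1 * ((f g).2 : G) = g := by
    -- Right translation by `k₀⁻¹` moves the point to `σ(X₀)`, where the smooth inverse of `e` is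
    -- available; the factor `k₀` is then restored in the `K`-component.
    rintro g₀ ⟨X₀, hX₀, k₀, rfl⟩
    have hmem : (X₀, (0 : EK)) ∈ e.source := hpair X₀ hX₀.1 0 h0C
    have hval : e (X₀, 0) = oneChart EG G (slicePt 𝔭 X₀) := by
      rw [he, sliceMap]; simp only [add_zero, oneChart_symm_one]; simp
    have hsrc : (slicePt 𝔭 X₀ : G) ∈ (oneChart EG G).source := by
      have := (hes hmem).2.2
      simpa only [add_zero, oneChart_symm_one, OneMemClass.coe_one, mul_one] using this
    have hr : ContMDiff 𝓘(ℝ, EG) 𝓘(ℝ, EG) ∞ (fun g : G => g * (k₀ : G)⁻¹) := contMDiff_mul_right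
    have e0 : slicePt 𝔭 X₀ * (k₀ : G) * (k₀ : G)⁻¹ = slicePt 𝔭 X₀ := by group
    have hy : oneChart EG G (slicePt 𝔭 X₀) ∈ e.target := by rw [← hval]; exact e.map_source hmem
    have hsm : ContMDiffAt 𝓘(ℝ, EG) 𝓘(ℝ, 𝔭 × EK) ∞
        (fun g : G => e.symm (oneChart EG G (g * (k₀ : G)⁻¹))) (slicePt 𝔭 X₀ * (k₀ : G)) := by
      apply ContMDiffAt.comp (I' := 𝓘(ℝ, EG)) (slicePt 𝔭 X₀ * (k₀ : G)) (f := fun g : G => oneChart EG G (g * (k₀ : G)⁻¹))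
        (g := e.symm)
      · rw [e0]; exact (hesymm _ hy).contMDiffAt
      · apply ContMDiffAt.comp (I' := 𝓘(ℝ, EG)) _ _ hr.contMDiffAt
        rw [e0]; exact contMDiffAt_chart hsrc
    have hval0 : e.symm (oneChart EG G (slicePt 𝔭 X₀ * (k₀ : G) * (k₀ : G)⁻¹)) = (X₀, 0) := by
      rw [e0, ← hval, e.left_inv hmem]
    refine ⟨fun g => ((e.symm (oneChart EG G (g * (k₀ : G)⁻¹))).1,
      (oneChart EK K).symm (oneChart EK K 1 + (e.symm (oneChart EG G (g * (k₀ : G)⁻¹))).2) * k₀),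
      ?_, ?_, ?_⟩
    · exact ContMDiffAt.comp (I' := 𝓘(ℝ, 𝔭 × EK)) (g := (Prod.fst : 𝔭 × EK → 𝔭))
        (f := fun g : G => e.symm (oneChart EG G (g * (k₀ : G)⁻¹))) _
        contDiff_fst.contMDiff.contMDiffAt hsm
    · apply ContMDiffAt.mul _ contMDiffAt_const
      have hc : ContDiff ℝ ∞ (fun w : 𝔭 × EK => oneChart EK K 1 + w.2) :=
        contDiff_const.add contDiff_snd
      apply ContMDiffAt.comp (I' := 𝓘(ℝ, EK)) _ (contMDiffAt_chart_symm _)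
        (ContMDiffAt.comp (I' := 𝓘(ℝ, 𝔭 × EK)) _ hc.contMDiff.contMDiffAt hsm)
      change oneChart EK K 1 + (e.symm _).2 ∈ _
      rw [hval0]
      simp
    · have ht1 := hsm.continuousAt.eventually_mem
        (show (B ×ˢ C) ∈ 𝓝 _ by rw [hval0]; exact (hBo.prod hC).mem_nhds ⟨hX₀, h0C⟩)
      have ht2 : ∀ᶠ g in 𝓝 (slicePt 𝔭 X₀ * (k₀ : G)), g * (k₀ : G)⁻¹ ∈ (oneChart EG G).source :=
        hr.continuous.continuousAt.eventually_mem
          (by rw [e0]; exact extChartAt_source_nhds hsrc)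
      have ht3 : ∀ᶠ g in 𝓝 (slicePt 𝔭 X₀ * (k₀ : G)),
          oneChart EG G (g * (k₀ : G)⁻¹) ∈ e.target := by
        have hcc : ContinuousAt (fun g : G => oneChart EG G (g * (k₀ : G)⁻¹))
            (slicePt 𝔭 X₀ * (k₀ : G)) := by
          apply ContinuousAt.comp (f := fun g : G => g * (k₀ : G)⁻¹) (g := oneChart EG G) _
            hr.continuous.continuousAt
          rw [e0]; exact (contMDiffAt_chart hsrc).continuousAt
        exact hcc.eventually_mem (by rw [e0]; exact e.open_target.mem_nhds hy)
      filter_upwards [ht1, ht2, ht3] with g hg1 hg2 hg3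
      refine ⟨hg1.1, ?_⟩
      set y := e.symm (oneChart EG G (g * (k₀ : G)⁻¹)) with hydef
      have h1 : sliceMap (EK := EK) K 𝔭 y = oneChart EG G (g * (k₀ : G)⁻¹) := by
        rw [← he, hydef, e.right_inv hg3]
      have h2 := (oneChart EG G).injOn (hes (hpair y.1 hg1.1.1 y.2 hg1.2)).2.2 hg2 h1
      rw [Subgroup.coe_mul, ← mul_assoc, h2]
      group
  have hwf : ∀ g₀ ∈ dom, ∃ f : G → 𝔭 × K, ContMDiffAt 𝓘(ℝ, EG) 𝓘(ℝ, 𝔭) ∞ (fun g => (f g).1) g₀ ∧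
      ContMDiffAt 𝓘(ℝ, EG) 𝓘(ℝ, EK) ∞ (fun g => (f g).2) g₀ ∧
      ∀ᶠ g in 𝓝 g₀, g ∈ dom ∧ w g = f g := by
    intro g₀ hg₀
    obtain ⟨f, hf1, hf2, hf3⟩ := hloc g₀ hg₀
    refine ⟨f, hf1, hf2, hf3.mono fun g hg => ⟨⟨_, hg.1, _, hg.2⟩, ?_⟩⟩
    conv_lhs => rw [← hg.2]
    exact hwa _ hg.1 _
  exact ⟨{
    ball := B
    dom := dom
    fst := fun g => (w g).1
    snd := fun g => (w g).2
    ball_open := hBo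
    zero_mem := ⟨h0B₀, h0B₁, h0B₂⟩
    ball_target := fun X hX => hBt X hX.1
    dom_open := isOpen_iff_mem_nhds.2 fun g hg => by
      obtain ⟨f, -, -, hf⟩ := hwf g hg
      exact hf.mono fun g h => h.1
    mem_dom := fun X hX k => ⟨X, hX, k, rfl⟩
    fst_mem := fun g hg => (hw g hg).1
    slicePt_mul := fun g hg => (hw g hg).2
    fst_apply := fun X hX k => by rw [hwa X hX k]
    snd_apply := fun X hX k => by rw [hwa X hX k]
    fst_smooth := fun g hg => by
      obtain ⟨f, hf1, -, hf⟩ := hwf g hg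
      exact (hf1.congr_of_eventuallyEq (hf.mono fun g h => by rw [h.2])).contMDiffWithinAt
    snd_smooth := fun g hg => by
      obtain ⟨f, -, hf2, hf⟩ := hwf g hg
      exact (hf2.congr_of_eventuallyEq (hf.mono fun g h => by rw [h.2])).contMDiffWithinAt }⟩

end SliceSection

end PreHam

namespace PreHam

/-! ### Second countability of `G`; the open quotient map `G × N → G ×_K N`. -/

section Topology

/-- A connected Lie group is second countable. -/
theorem secondCountableTopology_of_connected (E : Type*) [NormedAddCommGroup E] [NormedSpace ℝ E]
    [FiniteDimensional ℝ E] (G : Type*) [TopologicalSpace G] [ChartedSpace E G] [Group G]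
    [LieGroup 𝓘(ℝ, E) ∞ G] [ConnectedSpace G] : SecondCountableTopology G := by
  have : IsTopologicalGroup G := topologicalGroup_of_lieGroup 𝓘(ℝ, E) ∞
  have : LocallyCompactSpace G := Manifold.locallyCompact_of_finiteDimensional 𝓘(ℝ, E)
  obtain ⟨C, hC, h1⟩ := exists_compact_mem_nhds (1 : G)
  set D : Set G := C ∪ C⁻¹
  have hD : IsCompact D := hC.union hC.inv
  -- For each `n` the products of `n` elements of the symmetric compact set `D` form a compact set;
  -- their union is the subgroup generated by `D`.
  have hDn : ∀ n : ℕ, ∃ P : Set G, IsCompact P ∧ P = {g | ∃ l : List G, l.length = n ∧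
      (∀ a ∈ l, a ∈ D) ∧ l.prod = g} := by
    intro n
    induction n with
    | zero => exact ⟨{1}, isCompact_singleton, by
        ext g; simp only [mem_singleton_iff, mem_ofPred_eq, List.length_eq_zero_iff]
        constructor
        · rintro rfl; exact ⟨[], by simp⟩
        · rintro ⟨l, rfl, -, rfl⟩; simp⟩
    | succ n ih =>
      obtain ⟨P, hP, hPe⟩ := ih
      refine ⟨(fun p : G × G => p.1 * p.2) '' (D ×ˢ P),
        (hD.prod hP).image continuous_mul, ?_⟩
      ext g
      subst hPe
      constructor
      · rintro ⟨⟨a, b⟩, ⟨ha, l, hl, hl', rfl⟩, rfl⟩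
        exact ⟨a :: l, by simp [hl], by simpa using ⟨ha, hl'⟩, by simp⟩
      · rintro ⟨l, hl, hl', rfl⟩
        obtain ⟨a, l, rfl⟩ := List.exists_cons_of_length_eq_add_one hl
        refine ⟨(a, l.prod), ⟨hl' a (by simp), l, by simpa using hl,
          fun b hb => hl' b (by simp [hb]), rfl⟩, by simp⟩
  choose P hP hPe using hDn
  let S : Subgroup G :=
    { carrier := ⋃ n, P n
      one_mem' := mem_iUnion.2 ⟨0, by rw [hPe]; exact ⟨[], by simp⟩⟩
      mul_mem' := by
        intro a b ha hb
        obtain ⟨n, hn⟩ := mem_iUnion.1 ha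
        obtain ⟨m, hm⟩ := mem_iUnion.1 hb
        rw [hPe] at hn hm
        obtain ⟨l, -, hl, rfl⟩ := hn
        obtain ⟨l', -, hl', rfl⟩ := hm
        refine mem_iUnion.2 ⟨(l ++ l').length, ?_⟩
        rw [hPe]
        exact ⟨l ++ l', rfl, fun a ha => (List.mem_append.1 ha).elim (hl a) (hl' a), by simp⟩
      inv_mem' := by
        intro a ha
        obtain ⟨n, hn⟩ := mem_iUnion.1 ha
        rw [hPe] at hn
        obtain ⟨l, -, hl, rfl⟩ := hn
        refine mem_iUnion.2 ⟨(l.map (·⁻¹)).reverse.length, ?_⟩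
        rw [hPe]
        refine ⟨(l.map (·⁻¹)).reverse, rfl, fun a ha => ?_, (List.prod_inv_reverse l).symm⟩
        simp only [List.mem_reverse, List.mem_map] at ha
        obtain ⟨b, hb, rfl⟩ := ha
        rcases hl b hb with h | h
        · exact Or.inr (by simpa using h)
        · exact Or.inl h }
  have hCS : C ⊆ (S : Set G) := fun g hg => mem_iUnion.2 ⟨1, by
    rw [hPe]; exact ⟨[g], by simp, by rintro a ha; rw [List.mem_singleton.1 ha]; exact Or.inl hg, by simp⟩⟩
  -- A subgroup that contains a neighbourhood of `1` is open, hence closed, hence all of the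
  -- connected group. The group is thus a countable union of compact sets.
  have hSo : IsOpen (S : Set G) := S.isOpen_of_mem_nhds (Filter.mem_of_superset h1 hCS)
  have hSu : (S : Set G) = univ := IsClopen.eq_univ ⟨S.isClosed_of_isOpen hSo, hSo⟩ ⟨1, S.one_mem⟩
  have : SigmaCompactSpace G := ⟨⟨P, hP, hSu⟩⟩
  exact ChartedSpace.secondCountable_of_sigmaCompact E G

variable {G : Type*} [Group G] {K : Subgroup G} {N : Type*} [MulAction K N]

theorem assocMk_eq_iff {p p' : G × N} : assocMk K p = assocMk K p' ↔
    ∃ k : K, p' = (p.1 * (k : G)⁻¹, k • p.2) :=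
  Quotient.eq (r := assocSetoid K N)

theorem assocMk_mul_inv (g : G) (k : K) (n : N) :
    assocMk K (g * (k : G)⁻¹, k • n) = assocMk K (g, n) :=
  (assocMk_eq_iff (p := (g, n)) (p' := (g * (k : G)⁻¹, k • n)).2 ⟨k, rfl⟩).symm

theorem assocMk_mul (g : G) (k : K) (n : N) :
    assocMk K (g * (k : G), n) = assocMk K (g, k • n) :=
  assocMk_eq_iff.2 ⟨k, by simp⟩

theorem smul_assocMk (g g' : G) (n : N) : g • assocMk K (g', n) = assocMk K (g * g', n) := rfl

theorem assocMk_surjective : Function.Surjective (assocMk K : G × N → AssocSpace K N) :=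
  Quotient.mk_surjective

variable [TopologicalSpace G] [IsTopologicalGroup G] [TopologicalSpace N] [ContinuousConstSMul K N]

/-- The saturation of an open set is the union of its translates by `K`, each of which is open. -/
theorem isOpenQuotientMap_assocMk : IsOpenQuotientMap (assocMk K : G × N → AssocSpace K N) where
  surjective := assocMk_surjective
  continuous := continuous_quotient_mk'
  isOpenMap := by
    intro U hU
    have : (assocMk K : G × N → AssocSpace K N) ⁻¹' (assocMk K '' U) =
        ⋃ k : K, (fun p : G × N => (p.1 * (k : G)⁻¹, k • p.2)) ⁻¹' U := by
      ext p
      simp only [mem_preimage, mem_image, mem_iUnion]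
      constructor
      · rintro ⟨p', hp', h⟩
        obtain ⟨k, rfl⟩ := assocMk_eq_iff.1 h.symm
        exact ⟨k, hp'⟩
      · rintro ⟨k, hk⟩
        exact ⟨_, hk, assocMk_mul_inv _ _ _⟩
    refine isOpen_coinduced.2 ?_
    change IsOpen ((assocMk K : G × N → AssocSpace K N) ⁻¹' (assocMk K '' U))
    rw [this]
    exact isOpen_iUnion fun k => hU.preimage (by fun_prop)

end Topology

/-! ### The quotient is Hausdorff. -/

section Hausdorff

variable {G : Type*} [Group G] {K : Subgroup G} {N : Type*} [MulAction K N]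
  [TopologicalSpace G] [IsTopologicalGroup G] [TopologicalSpace N] [ContinuousSMul K N]

/-- A quotient by an open map is Hausdorff when the relation is closed. If `(g, n)` and `(g', n')`
are equivalent, the element of `K` relating them must be `g'⁻¹ g`, so the relation is the equation
`n' = (g'⁻¹ g) n` on the closed set where `g'⁻¹ g ∈ K`. -/
theorem t2Space_assocSpace [T2Space N] (hK : IsClosed (K : Set G)) :
    T2Space (AssocSpace K N) := by
  rw [t2Space_iff_of_isOpenQuotientMap (isOpenQuotientMap_assocMk (K := K) (N := N))]
  set C : Set ((G × N) × (G × N)) := {x | x.2.1⁻¹ * x.1.1 ∈ K}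
  have hC : IsClosed C := hK.preimage (by fun_prop :
    Continuous fun x : (G × N) × (G × N) => x.2.1⁻¹ * x.1.1)
  have hD : IsClosed {x : C | x.1.2.2 = (⟨x.1.2.1⁻¹ * x.1.1.1, x.2⟩ : K) • x.1.1.2} := by
    apply isClosed_eq
    · fun_prop
    · apply Continuous.smul
      · exact Continuous.subtype_mk (by fun_prop) _
      · fun_prop
  have := hC.isClosedEmbedding_subtypeVal.isClosedMap _ hD
  convert this using 1
  ext ⟨⟨g, n⟩, ⟨g', n'⟩⟩
  simp only [mem_ofPred_eq, mem_image, Subtype.exists, exists_and_right, exists_eq_right]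
  rw [assocMk_eq_iff]
  constructor
  · rintro ⟨k, hk⟩
    simp only [Prod.mk.injEq] at hk
    obtain ⟨rfl, rfl⟩ := hk
    have e : (g * (k : G)⁻¹)⁻¹ * g = k := by group
    refine ⟨?_, ?_⟩
    · simp only [C, mem_ofPred_eq, e]; exact k.2
    · congr 1; exact Subtype.ext e.symm
  · rintro ⟨h, h'⟩
    refine ⟨⟨g'⁻¹ * g, h⟩, ?_⟩
    ext
    · simp
    · exact h'

end Hausdorff

/-! ### Preferred representatives of the classes in `G ×_K N`. -/

section Representatives

/-- A map `ρ : G → K` that is equivariant for the action of `K` by right multiplication. It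
is not assumed to be continuous. -/
structure Retract {G : Type*} [Group G] (K : Subgroup G) where
  ρ : G → K
  map_mul : ∀ (g : G) (k : K), ρ (g * (k : G)) = ρ g * k

/-- Compare each `g` with the chosen representative of its coset `gK`. The resulting `ρ` fixes the
pair `(g ρ(g)⁻¹, ρ(g) n)` in the class of `(g, n)`, so that fibres over `G ×_K N` can be modelled on
constant types. -/
theorem exists_retract {G : Type*} [Group G] (K : Subgroup G) : Nonempty (Retract K) := by
  have h : ∀ g : G, ((g : G ⧸ K).out)⁻¹ * g ∈ K := fun g =>
    QuotientGroup.eq.1 (QuotientGroup.out_eq' _)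
  refine ⟨⟨fun g => ⟨_, h g⟩, fun g k => ?_⟩⟩
  have e : ((g * (k : G) : G) : G ⧸ K) = (g : G ⧸ K) := QuotientGroup.mk_mul_of_mem g k.2
  ext
  simp [e, mul_assoc]

variable {G : Type*} [Group G] {K : Subgroup G} {N : Type*} [MulAction K N] (r : Retract K)

theorem Retract.map_mul_inv (g : G) (k : K) : r.ρ (g * (k : G)⁻¹) = r.ρ g * k⁻¹ := by
  rw [← Subgroup.coe_inv, r.map_mul]

/-- The component in `G` of the preferred representative of a point of `G ×_K N`. -/
def Retract.repG : AssocSpace K N → G :=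
  Quotient.lift (fun p => p.1 * (r.ρ p.1 : G)⁻¹) (by
    rintro p p' ⟨k, rfl⟩
    simp [r.map_mul_inv])

/-- The component in `N` of the preferred representative of a point of `G ×_K N`. -/
def Retract.repN : AssocSpace K N → N :=
  Quotient.lift (fun p => r.ρ p.1 • p.2) (by
    rintro p p' ⟨k, rfl⟩
    simp [r.map_mul_inv, mul_smul])

theorem Retract.repG_mk (g : G) (n : N) : r.repG (assocMk K (g, n)) = g * (r.ρ g : G)⁻¹ := rfl

theorem Retract.repN_mk (g : G) (n : N) : r.repN (assocMk K (g, n)) = r.ρ g • n := rfl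

theorem Retract.mk_rep (m : AssocSpace K N) : assocMk K (r.repG m, r.repN m) = m := by
  obtain ⟨⟨g, n⟩, rfl⟩ := assocMk_surjective m
  exact assocMk_mul_inv _ _ _

theorem Retract.ρ_repG (m : AssocSpace K N) : r.ρ (r.repG m) = 1 := by
  obtain ⟨⟨g, n⟩, rfl⟩ := assocMk_surjective m
  rw [repG_mk, r.map_mul_inv, mul_inv_cancel]

end Representatives

end PreHam

namespace PreHam

/-! ### Equivariance of the slice coordinates. -/

section Slices

variable {EG : Type*} [NormedAddCommGroup EG] [NormedSpace ℝ EG]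
  {G : Type*} [TopologicalSpace G] [ChartedSpace EG G] [Group G]
  {EK : Type*} [NormedAddCommGroup EK] [NormedSpace ℝ EK]
  {K : Subgroup G} [ChartedSpace EK K] {𝔭 : Submodule ℝ EG} (sl : Slice (EK := EK) K 𝔭)

theorem Slice.mul_mem {g : G} (hg : g ∈ sl.dom) (k : K) : g * (k : G) ∈ sl.dom := by
  rw [← sl.slicePt_mul g hg, mul_assoc, ← Subgroup.coe_mul]
  exact sl.mem_dom _ (sl.fst_mem g hg) _

theorem Slice.mul_mem_iff {g : G} (k : K) : g * (k : G) ∈ sl.dom ↔ g ∈ sl.dom :=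
  ⟨fun h => by simpa using sl.mul_mem h k⁻¹, fun h => sl.mul_mem h k⟩

theorem Slice.fst_mul {g : G} (hg : g ∈ sl.dom) (k : K) : sl.fst (g * (k : G)) = sl.fst g := by
  conv_lhs => rw [← sl.slicePt_mul g hg, mul_assoc, ← Subgroup.coe_mul]
  exact sl.fst_apply _ (sl.fst_mem g hg) _

theorem Slice.snd_mul {g : G} (hg : g ∈ sl.dom) (k : K) : sl.snd (g * (k : G)) = sl.snd g * k := by
  conv_lhs => rw [← sl.slicePt_mul g hg, mul_assoc, ← Subgroup.coe_mul]
  exact sl.snd_apply _ (sl.fst_mem g hg) _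

theorem Slice.slicePt_mem {X : 𝔭} (hX : X ∈ sl.ball) : slicePt 𝔭 X ∈ sl.dom := by
  simpa using sl.mem_dom X hX 1

theorem Slice.fst_slicePt {X : 𝔭} (hX : X ∈ sl.ball) : sl.fst (slicePt 𝔭 X) = X := by
  simpa using sl.fst_apply X hX 1

theorem Slice.snd_slicePt {X : 𝔭} (hX : X ∈ sl.ball) : sl.snd (slicePt 𝔭 X) = 1 := by
  simpa using sl.snd_apply X hX 1

end Slices

section OneSlice

variable {EG : Type*} [NormedAddCommGroup EG] [NormedSpace ℝ EG] [FiniteDimensional ℝ EG]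
  {G : Type*} [TopologicalSpace G] [ChartedSpace EG G] [Group G] [LieGroup 𝓘(ℝ, EG) ∞ G]
  {EK : Type*} [NormedAddCommGroup EK] [NormedSpace ℝ EK]
  {K : Subgroup G} [ChartedSpace EK K] {𝔭 : Submodule ℝ EG} (sl : Slice (EK := EK) K 𝔭)

theorem Slice.coe_mem (k : K) : (k : G) ∈ sl.dom := by
  simpa [slicePt_zero] using sl.mem_dom 0 sl.zero_mem k

theorem Slice.one_mem : (1 : G) ∈ sl.dom := by simpa using sl.coe_mem 1

theorem Slice.fst_one : sl.fst (1 : G) = 0 := by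
  simpa [slicePt_zero] using sl.fst_apply 0 sl.zero_mem 1

theorem Slice.snd_coe (k : K) : sl.snd (k : G) = k := by
  simpa [slicePt_zero] using sl.snd_apply 0 sl.zero_mem k

theorem Slice.snd_one : sl.snd (1 : G) = 1 := by simpa using sl.snd_coe 1

end OneSlice

/-! ### Charts of `G ×_K N`. -/

section AssocCharts

variable {EG : Type*} [NormedAddCommGroup EG] [NormedSpace ℝ EG] [FiniteDimensional ℝ EG]
  {G : Type*} [TopologicalSpace G] [ChartedSpace EG G] [Group G] [LieGroup 𝓘(ℝ, EG) ∞ G]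
  {EK : Type*} [NormedAddCommGroup EK] [NormedSpace ℝ EK]
  {K : Subgroup G} [ChartedSpace EK K] {𝔭 : Submodule ℝ EG} (r : Retract K)
  (sl : Slice (EK := EK) K 𝔭)
  {V : Type*} [NormedAddCommGroup V] [NormedSpace ℝ V]
  {N : Type*} [TopologicalSpace N] [ChartedSpace V N] [MulAction K N]

/-- The function on `G × N` that induces the chart of `G ×_K N` around the class of `(g₀, n₀)`. -/
def assocCoord (g₀ : G) (n₀ : N) (p : G × N) : V × 𝔭 :=
  (extChartAt 𝓘(ℝ, V) n₀ (sl.snd (g₀⁻¹ * p.1) • p.2), sl.fst (g₀⁻¹ * p.1))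

/-- The domain of `assocCoord`. -/
def assocDom (g₀ : G) (n₀ : N) : Set (G × N) :=
  {p | g₀⁻¹ * p.1 ∈ sl.dom ∧ sl.snd (g₀⁻¹ * p.1) • p.2 ∈ (extChartAt 𝓘(ℝ, V) n₀).source}

/-- The inverse of the chart, as a map to `G × N`. -/
def assocSec (𝔭 : Submodule ℝ EG) (g₀ : G) (n₀ : N) (y : V × 𝔭) : G × N :=
  (g₀ * slicePt 𝔭 y.2, (extChartAt 𝓘(ℝ, V) n₀).symm y.1)

/-- The component `snd` picks up `k⁻¹` on the right, which cancels the `k` applied to `n`. For the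
same reason `assocCoord` descends to the quotient. -/
theorem assocDom_iff (g₀ : G) (n₀ : N) (g : G) (k : K) (n : N) :
    (g * (k : G)⁻¹, k • n) ∈ assocDom (V := V) sl g₀ n₀ ↔ (g, n) ∈ assocDom (V := V) sl g₀ n₀ := by
  have h1 : g₀⁻¹ * (g * (k : G)⁻¹) = g₀⁻¹ * g * ((k⁻¹ : K) : G) := by simp [mul_assoc]
  simp only [assocDom, mem_ofPred_eq, h1, sl.mul_mem_iff]
  refine and_congr_right fun h => ?_
  rw [sl.snd_mul h, mul_smul, inv_smul_smul]

theorem assocCoord_eq {g₀ : G} {n₀ : N} {g : G} (k : K) {n : N}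
    (h : (g, n) ∈ assocDom (V := V) sl g₀ n₀) :
    assocCoord (V := V) sl g₀ n₀ (g * (k : G)⁻¹, k • n) = assocCoord (V := V) sl g₀ n₀ (g, n) := by
  have h1 : g₀⁻¹ * (g * (k : G)⁻¹) = g₀⁻¹ * g * ((k⁻¹ : K) : G) := by simp [mul_assoc]
  simp only [assocCoord, h1, sl.snd_mul h.1, sl.fst_mul h.1, mul_smul, inv_smul_smul]

theorem assocSec_mem {g₀ : G} {n₀ : N} {y : V × 𝔭} (h1 : y.1 ∈ (extChartAt 𝓘(ℝ, V) n₀).target)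
    (h2 : y.2 ∈ sl.ball) : assocSec 𝔭 g₀ n₀ y ∈ assocDom (V := V) sl g₀ n₀ := by
  simp only [assocSec, assocDom, mem_ofPred_eq, inv_mul_cancel_left, sl.snd_slicePt h2, one_smul]
  exact ⟨sl.slicePt_mem h2, (extChartAt 𝓘(ℝ, V) n₀).map_target h1⟩

theorem assocCoord_assocSec {g₀ : G} {n₀ : N} {y : V × 𝔭}
    (h1 : y.1 ∈ (extChartAt 𝓘(ℝ, V) n₀).target) (h2 : y.2 ∈ sl.ball) :
    assocCoord (V := V) sl g₀ n₀ (assocSec 𝔭 g₀ n₀ y) = y := by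
  simp only [assocSec, assocCoord, inv_mul_cancel_left, sl.snd_slicePt h2, one_smul,
    sl.fst_slicePt h2, (extChartAt 𝓘(ℝ, V) n₀).right_inv h1]

theorem assocCoord_mem {g₀ : G} {n₀ : N} {p : G × N} (h : p ∈ assocDom (V := V) sl g₀ n₀) :
    (assocCoord (V := V) sl g₀ n₀ p).1 ∈ (extChartAt 𝓘(ℝ, V) n₀).target ∧
      (assocCoord (V := V) sl g₀ n₀ p).2 ∈ sl.ball :=
  ⟨(extChartAt 𝓘(ℝ, V) n₀).map_source h.2, sl.fst_mem _ h.1⟩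

/-- Since `σ(fst) snd = g₀⁻¹ g`, the section after the coordinates returns a point to its class, but
moved by the element `snd (g₀⁻¹ g)` of `K`. -/
theorem assocSec_assocCoord {g₀ : G} {n₀ : N} {p : G × N} (h : p ∈ assocDom (V := V) sl g₀ n₀) :
    assocSec 𝔭 g₀ n₀ (assocCoord (V := V) sl g₀ n₀ p) =
      (p.1 * (sl.snd (g₀⁻¹ * p.1) : G)⁻¹, sl.snd (g₀⁻¹ * p.1) • p.2) := by
  simp only [assocSec, assocCoord, (extChartAt 𝓘(ℝ, V) n₀).left_inv h.2, Prod.mk.injEq, and_true]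
  rw [eq_mul_inv_iff_mul_eq, mul_assoc, sl.slicePt_mul _ h.1, mul_inv_cancel_left]

theorem contMDiff_assocCoord [IsManifold 𝓘(ℝ, V) ∞ N] [ContMDiffSMul 𝓘(ℝ, EK) 𝓘(ℝ, V) ∞ K N]
    {g₀ : G} {n₀ : N} {p : G × N}
    (hp : p ∈ assocDom (V := V) sl g₀ n₀) :
    ContMDiffAt (𝓘(ℝ, EG).prod 𝓘(ℝ, V)) 𝓘(ℝ, V × 𝔭) ∞ (assocCoord (V := V) sl g₀ n₀) p := by
  have h0 : ContMDiffAt (𝓘(ℝ, EG).prod 𝓘(ℝ, V)) 𝓘(ℝ, EG) ∞ (fun p : G × N => g₀⁻¹ * p.1) p :=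
    contMDiffAt_const.mul contMDiffAt_fst
  have h1 : ContMDiffAt (𝓘(ℝ, EG).prod 𝓘(ℝ, V)) 𝓘(ℝ, 𝔭) ∞ (fun p : G × N => sl.fst (g₀⁻¹ * p.1)) p :=
    ContMDiffAt.comp (I' := 𝓘(ℝ, EG)) p (sl.fst_smooth.contMDiffAt (sl.dom_open.mem_nhds hp.1)) h0
  have h2 : ContMDiffAt (𝓘(ℝ, EG).prod 𝓘(ℝ, V)) 𝓘(ℝ, EK) ∞
      (fun p : G × N => sl.snd (g₀⁻¹ * p.1)) p :=
    ContMDiffAt.comp (I' := 𝓘(ℝ, EG)) p (sl.snd_smooth.contMDiffAt (sl.dom_open.mem_nhds hp.1)) h0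
  have h3 : ContMDiffAt (𝓘(ℝ, EG).prod 𝓘(ℝ, V)) 𝓘(ℝ, V) ∞
      (fun p : G × N => sl.snd (g₀⁻¹ * p.1) • p.2) p := h2.smul contMDiffAt_snd
  have h4 : ContMDiffAt (𝓘(ℝ, EG).prod 𝓘(ℝ, V)) 𝓘(ℝ, V) ∞
      (fun p : G × N => extChartAt 𝓘(ℝ, V) n₀ (sl.snd (g₀⁻¹ * p.1) • p.2)) p :=
    ContMDiffAt.comp (I' := 𝓘(ℝ, V)) p (contMDiffAt_chart hp.2) h3
  exact h4.prodMk_space h1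

theorem isOpen_assocDom [ContMDiffSMul 𝓘(ℝ, EK) 𝓘(ℝ, V) ∞ K N] (g₀ : G) (n₀ : N) :
    IsOpen (assocDom (V := V) sl g₀ n₀) := by
  rw [isOpen_iff_mem_nhds]
  intro p hp
  have : IsTopologicalGroup G := topologicalGroup_of_lieGroup 𝓘(ℝ, EG) ∞
  have : ContinuousSMul K N := ContMDiffSMul.continuousSMul (I := 𝓘(ℝ, EK)) (I' := 𝓘(ℝ, V)) ∞
  have h0 : ContinuousAt (fun p : G × N => g₀⁻¹ * p.1) p := by fun_prop
  have h2 : ContinuousAt (fun p : G × N => sl.snd (g₀⁻¹ * p.1) • p.2) p :=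
    (ContinuousAt.comp (g := sl.snd) (f := fun p : G × N => g₀⁻¹ * p.1)
      (sl.snd_smooth.contMDiffAt (sl.dom_open.mem_nhds hp.1)).continuousAt h0).smul continuousAt_snd
  exact Filter.inter_mem (h0.preimage_mem_nhds (sl.dom_open.mem_nhds hp.1))
    (h2.preimage_mem_nhds (extChartAt_source_nhds hp.2))

theorem contMDiff_assocSec [IsManifold 𝓘(ℝ, V) ∞ N] {g₀ : G} {n₀ : N} {y : V × 𝔭}
    (h1 : y.1 ∈ (extChartAt 𝓘(ℝ, V) n₀).target) (h2 : y.2 ∈ sl.ball) :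
    ContMDiffAt 𝓘(ℝ, V × 𝔭) (𝓘(ℝ, EG).prod 𝓘(ℝ, V)) ∞ (assocSec 𝔭 g₀ n₀ : V × 𝔭 → G × N) y := by
  apply ContMDiffAt.prodMk
  · exact contMDiffAt_const.mul (ContMDiffAt.comp (I' := 𝓘(ℝ, 𝔭)) (g := (slicePt 𝔭 : 𝔭 → G)) y
      (contMDiffAt_slicePt (sl.ball_target _ h2)) contDiff_snd.contMDiff.contMDiffAt)
  · exact ContMDiffAt.comp (I' := 𝓘(ℝ, V)) (g := (extChartAt 𝓘(ℝ, V) n₀).symm) y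
      (contMDiffAt_chart_symm h1) contDiff_fst.contMDiff.contMDiffAt

variable (V) in
/-- The chart of `G ×_K N` centred at `m₀`. -/
def assocChart [ContMDiffSMul 𝓘(ℝ, EK) 𝓘(ℝ, V) ∞ K N] [IsManifold 𝓘(ℝ, V) ∞ N] (m₀ : AssocSpace K N) :
    OpenPartialHomeomorph (AssocSpace K N) (V × 𝔭) where
  toFun m := assocCoord (V := V) sl (r.repG m₀) (r.repN m₀) (r.repG m, r.repN m)
  invFun y := assocMk K (assocSec 𝔭 (r.repG m₀) (r.repN m₀) y)
  source := {m | (r.repG m, r.repN m) ∈ assocDom (V := V) sl (r.repG m₀) (r.repN m₀)}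
  target := (extChartAt 𝓘(ℝ, V) (r.repN m₀)).target ×ˢ sl.ball
  map_source' m hm := assocCoord_mem sl hm
  map_target' y hy := (assocDom_iff sl _ _ _ _ _).2 (assocSec_mem sl hy.1 hy.2)
  left_inv' m hm := by
    rw [assocSec_assocCoord sl hm, assocMk_mul_inv, r.mk_rep]
  right_inv' y hy := (assocCoord_eq sl _ (assocSec_mem sl hy.1 hy.2)).trans
    (assocCoord_assocSec sl hy.1 hy.2)
  open_source := by
    have : IsTopologicalGroup G := topologicalGroup_of_lieGroup 𝓘(ℝ, EG) ∞
    have : ContinuousSMul K N := ContMDiffSMul.continuousSMul (I := 𝓘(ℝ, EK)) (I' := 𝓘(ℝ, V)) ∞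
    rw [← (isOpenQuotientMap_assocMk (K := K) (N := N)).isQuotientMap.isOpen_preimage]
    convert! isOpen_assocDom (V := V) sl (r.repG m₀) (r.repN m₀) using 1
    ext ⟨g, n⟩
    exact assocDom_iff sl _ _ _ _ _
  open_target := (isOpen_extChartAt_target _).prod sl.ball_open
  continuousOn_toFun := by
    have : IsTopologicalGroup G := topologicalGroup_of_lieGroup 𝓘(ℝ, EG) ∞
    have : ContinuousSMul K N := ContMDiffSMul.continuousSMul (I := 𝓘(ℝ, EK)) (I' := 𝓘(ℝ, V)) ∞
    intro m hm
    apply ContinuousAt.continuousWithinAt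
    have hq := (isOpenQuotientMap_assocMk (K := K) (N := N))
    have h1 := (contMDiff_assocCoord sl hm).continuousAt
    rw [ContinuousAt, Filter.tendsto_def] at h1 ⊢
    intro s hs
    -- Continuity on the quotient comes from continuity on `G × N`, because the open map `assocMk`
    -- carries a neighbourhood of the representative to a neighbourhood of `m`.
    have h2 := hq.isOpenMap.image_mem_nhds (Filter.inter_mem (h1 s hs)
      ((isOpen_assocDom (V := V) sl (r.repG m₀) (r.repN m₀)).mem_nhds hm))
    rw [r.mk_rep] at h2
    refine Filter.mem_of_superset h2 ?_
    rintro _ ⟨⟨g, n⟩, hp, rfl⟩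
    have := assocCoord_eq sl (r.ρ g) hp.2
    simp only [mem_preimage] at hp ⊢
    rw [r.repG_mk, r.repN_mk, this]
    exact hp.1
  continuousOn_invFun := by
    intro y hy
    have : IsTopologicalGroup G := topologicalGroup_of_lieGroup 𝓘(ℝ, EG) ∞
    have : ContinuousSMul K N := ContMDiffSMul.continuousSMul (I := 𝓘(ℝ, EK)) (I' := 𝓘(ℝ, V)) ∞
    exact ((isOpenQuotientMap_assocMk (K := K) (N := N)).continuous.continuousAt.comp
      (contMDiff_assocSec sl hy.1 hy.2).continuousAt).continuousWithinAt

variable (V N) in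
/-- The charts `assocChart` define a smooth structure on `G ×_K N`. -/
abbrev assocCharted [ContMDiffSMul 𝓘(ℝ, EK) 𝓘(ℝ, V) ∞ K N] [IsManifold 𝓘(ℝ, V) ∞ N] :
    ChartedSpace (V × 𝔭) (AssocSpace K N) where
  atlas := range (assocChart r sl V)
  chartAt m := assocChart r sl V m
  mem_chart_source m := by
    change (r.repG m, r.repN m) ∈ assocDom (V := V) sl (r.repG m) (r.repN m)
    simp only [assocDom, mem_ofPred_eq, inv_mul_cancel, sl.snd_one, one_smul]
    exact ⟨sl.one_mem, mem_extChartAt_source _⟩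
  chart_mem_atlas m := mem_range_self m

/-- A transition map is `assocCoord` after `assocSec`. The passage to preferred representatives in
between, which may be discontinuous, is invisible because `assocCoord` is `K`-invariant. -/
theorem isManifold_assocCharted [ContMDiffSMul 𝓘(ℝ, EK) 𝓘(ℝ, V) ∞ K N] [IsManifold 𝓘(ℝ, V) ∞ N] :
    @IsManifold ℝ _ _ _ _ _ _ 𝓘(ℝ, V × 𝔭) ∞ (AssocSpace K N) _ (assocCharted r sl V N) := by
  letI := assocCharted r sl V N
  apply isManifold_of_contDiffOn
  rintro _ _ ⟨m₀, rfl⟩ ⟨m₁, rfl⟩ y ⟨⟨hy1, hy2⟩, -⟩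
  apply ContDiffAt.contDiffWithinAt
  rw [← contMDiffAt_iff_contDiffAt]
  have hy1' : y ∈ (extChartAt 𝓘(ℝ, V) (r.repN m₀)).target ×ˢ sl.ball := hy1
  have hy2' : assocSec 𝔭 (r.repG m₀) (r.repN m₀) y ∈
      assocDom (V := V) sl (r.repG m₁) (r.repN m₁) := (assocDom_iff sl _ _ _ _ _).1 hy2
  have h1 := contMDiff_assocCoord sl hy2'
  have h2 := contMDiff_assocSec sl (g₀ := r.repG m₀) hy1'.1 hy1'.2
  have h3 := ContMDiffAt.comp (I' := 𝓘(ℝ, EG).prod 𝓘(ℝ, V)) y h1 h2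
  refine h3.congr_of_eventuallyEq ?_
  filter_upwards [h2.continuousAt.preimage_mem_nhds
    ((isOpen_assocDom (V := V) sl (r.repG m₁) (r.repN m₁)).mem_nhds hy2')] with z hz
  exact assocCoord_eq sl _ hz

end AssocCharts

end PreHam

namespace PreHam

section Wrappers

variable {E : Type*} [NormedAddCommGroup E] [NormedSpace ℝ E]
  (V : Type*) [NormedAddCommGroup V] [NormedSpace ℝ V] {H : Type*} [Group H]
  {M : Type*} [TopologicalSpace M] [ChartedSpace V M] [MulAction H M]

/-- `tangentAct` as a map of the model space. -/
def actL (h : H) (x : M) : V →L[ℝ] V := tder 𝓘(ℝ, V) 𝓘(ℝ, V) (fun y : M => h • y) x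

variable [TopologicalSpace H] [ChartedSpace E H]

/-- `fundVec` with values in the model space. -/
def fundL (x : M) : E →L[ℝ] V := tder 𝓘(ℝ, E) 𝓘(ℝ, V) (fun h : H => h • x) 1

end Wrappers

/-! ### The projections of `𝔤 = 𝔨 ⊕ 𝔭` and their `Ad(K)`-equivariance. -/

section Decomposition

variable {EG : Type*} [NormedAddCommGroup EG] [NormedSpace ℝ EG] [FiniteDimensional ℝ EG]
  {G : Type*} [TopologicalSpace G] [ChartedSpace EG G] [Group G] [LieGroup 𝓘(ℝ, EG) ∞ G]
  {EK : Type*} [NormedAddCommGroup EK] [NormedSpace ℝ EK] [FiniteDimensional ℝ EK]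
  {K : Subgroup G} [ChartedSpace EK K] [LieGroup 𝓘(ℝ, EK) ∞ K]
  (hK : IsMaximalCompactLieSubgroup (EG := EG) (EK := EK) K)
  (S : SpinComplement (EG := EG) (EK := EK) K)

namespace SpinComplement

/-- The projection `𝔤 → 𝔨` as a continuous linear map. -/
def projL : EG →L[ℝ] EK :=
  (ContinuousLinearMap.snd ℝ S.𝔭 EK).comp ((sliceEquiv hK S.isCompl).symm : EG →L[ℝ] S.𝔭 × EK)

/-- The projection `𝔤 → 𝔭` as a continuous linear map. -/
def compl : EG →L[ℝ] S.𝔭 :=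
  (ContinuousLinearMap.fst ℝ S.𝔭 EK).comp ((sliceEquiv hK S.isCompl).symm : EG →L[ℝ] S.𝔭 × EK)

theorem compl_add_projL (ξ : EG) :
    ((S.compl hK ξ : S.𝔭) : EG) + lieIncl K (S.projL hK ξ) = ξ :=
  (sliceEquiv hK S.isCompl).apply_symm_apply ξ

theorem projL_compl_of_eq {X : S.𝔭} {Z : EK} {ξ : EG} (h : (X : EG) + lieIncl K Z = ξ) :
    S.projL hK ξ = Z ∧ S.compl hK ξ = X := by
  have : (sliceEquiv hK S.isCompl) (X, Z) = ξ := h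
  have h2 := (sliceEquiv hK S.isCompl).symm_apply_apply (X, Z)
  rw [this] at h2
  exact ⟨congrArg Prod.snd h2, congrArg Prod.fst h2⟩

theorem projL_coe (X : S.𝔭) : S.projL hK X = 0 :=
  (S.projL_compl_of_eq hK (X := X) (Z := 0) (by simp)).1

/-- Both sides have the `𝔨`-component of `ξ` as their image under the injective `lieIncl`. This
trades a chosen preimage for a continuous linear map. -/
theorem proj_eq (ξ : EG) : S.proj ξ = S.projL hK ξ := by
  apply lieIncl_injective hK
  have h := Classical.choose_spec (show ∃ Z : EK, lieIncl (EG := EG) K Z =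
      Submodule.projection (LinearMap.range (lieIncl (EG := EG) (EK := EK) K).toLinearMap) S.𝔭
        S.isCompl ξ by
    obtain ⟨Z, hZ⟩ := LinearMap.mem_range.1 (Submodule.projection_apply_mem S.isCompl ξ)
    exact ⟨Z, hZ⟩)
  refine h.trans ?_
  conv_lhs => rw [← S.compl_add_projL hK ξ]
  rw [map_add, Submodule.projection_apply_of_mem_right S.isCompl (S.compl hK ξ).2, zero_add]
  exact Submodule.projection_apply_of_mem_left S.isCompl ⟨_, rfl⟩

end SpinComplement

include hK in
-- The inclusion of `K` is a homomorphism, so it intertwines conjugation by `k`.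
theorem Ad_lieIncl (k : K) (Z : EK) :
    Ad (k : G) (lieIncl (EG := EG) K Z) = lieIncl (EG := EG) K (Ad k Z) := by
  rw [lieIncl_eq, Ad_eq, Ad_eq,
    ← tder_comp_apply (y := (1 : G)) (mdiff_conj _ _) (mdiff_coe hK 1) rfl,
    ← tder_comp_apply (y := (1 : K)) (mdiff_coe hK 1) (mdiff_conj k 1) (by simp)]
  rfl

/-- `Ad(K)` preserves both summands of `𝔨 ⊕ 𝔭`. -/
theorem SpinComplement.proj_Ad (k : K) (ξ : EG) :
    S.projL hK (Ad (k : G) ξ) = Ad k (S.projL hK ξ) := by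
  refine (S.projL_compl_of_eq hK (X := ⟨_, S.Ad_mem k (S.compl hK ξ)⟩) ?_).1
  conv_rhs => rw [← S.compl_add_projL hK ξ]
  rw [map_add, Ad_lieIncl hK]

end Decomposition

/-! ### Local sections of `q`, descent of smoothness, and the action of `G`. -/

section Quotient

variable {EG : Type*} [NormedAddCommGroup EG] [NormedSpace ℝ EG] [FiniteDimensional ℝ EG]
  {G : Type*} [TopologicalSpace G] [ChartedSpace EG G] [Group G] [LieGroup 𝓘(ℝ, EG) ∞ G]
  {EK : Type*} [NormedAddCommGroup EK] [NormedSpace ℝ EK]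
  {K : Subgroup G} [ChartedSpace EK K]
  {S : SpinComplement (EG := EG) (EK := EK) K}
  {V : Type*} [NormedAddCommGroup V] [NormedSpace ℝ V]
  {N : Type*} [TopologicalSpace N] [ChartedSpace V N] [IsManifold 𝓘(ℝ, V) ∞ N] [MulAction K N]
  [ContMDiffSMul 𝓘(ℝ, EK) 𝓘(ℝ, V) ∞ K N]
  [ChartedSpace (V × S.𝔭) (AssocSpace K N)]

variable (S V N) in
/-- The datum that the preferred charts of `G ×_K N` are the charts `assocChart` defined by a slice
and by a choice of representatives. -/
structure AssocAtlas where
  r : Retract K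
  sl : Slice (EK := EK) K S.𝔭
  chartAt_eq : ∀ m : AssocSpace K N, chartAt (V × S.𝔭) m = assocChart r sl V m

namespace AssocAtlas

variable (A : AssocAtlas S V N)

/-- The representative in `G`. -/
abbrev rG (m : AssocSpace K N) : G := A.r.repG m

/-- The representative in `N`. -/
abbrev rN (m : AssocSpace K N) : N := A.r.repN m

theorem mk_rep (m : AssocSpace K N) : assocMk K (A.rG m, A.rN m) = m := A.r.mk_rep m

/-- The inverse image in `G × N` of the domain of a chart. -/
def dom (m₀ : AssocSpace K N) : Set (G × N) := assocDom (V := V) A.sl (A.rG m₀) (A.rN m₀)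

/-- The local section of `G × N → G ×_K N` defined by a chart. -/
def loc (m₀ m : AssocSpace K N) : G × N :=
  assocSec S.𝔭 (A.rG m₀) (A.rN m₀) (extChartAt 𝓘(ℝ, V × S.𝔭) m₀ m)

/-- The element of `K` that maps `(g, n)` to the value of the local section. -/
def kap (m₀ : AssocSpace K N) (g : G) : K := A.sl.snd ((A.rG m₀)⁻¹ * g)

theorem isOpen_dom (m₀ : AssocSpace K N) : IsOpen (A.dom m₀) := isOpen_assocDom _ _ _

theorem source_eq (m₀ : AssocSpace K N) : (extChartAt 𝓘(ℝ, V × S.𝔭) m₀).source =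
    {m | (A.rG m, A.rN m) ∈ A.dom m₀} := by
  rw [extChartAt_source, A.chartAt_eq]; rfl

/-- Chart domains pull back to `K`-saturated sets, so any representative decides membership. -/
theorem mk_mem_source {m₀ : AssocSpace K N} {p : G × N} :
    assocMk K p ∈ (extChartAt 𝓘(ℝ, V × S.𝔭) m₀).source ↔ p ∈ A.dom m₀ := by
  rw [A.source_eq]
  exact assocDom_iff A.sl _ _ _ _ _

theorem target_eq (m₀ : AssocSpace K N) : (extChartAt 𝓘(ℝ, V × S.𝔭) m₀).target =
    (extChartAt 𝓘(ℝ, V) (A.rN m₀)).target ×ˢ A.sl.ball := by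
  rw [extChartAt_target, A.chartAt_eq]
  simp only [modelWithCornersSelf_coe_symm, preimage_id, modelWithCornersSelf_coe, range_id,
    inter_univ]
  rfl

theorem chart_mk {m₀ : AssocSpace K N} {p : G × N} (hp : p ∈ A.dom m₀) :
    extChartAt 𝓘(ℝ, V × S.𝔭) m₀ (assocMk K p) = assocCoord A.sl (A.rG m₀) (A.rN m₀) p := by
  simp only [extChartAt, OpenPartialHomeomorph.extend, A.chartAt_eq]
  exact assocCoord_eq A.sl _ hp

theorem chart_symm (m₀ : AssocSpace K N) (y : V × S.𝔭) :
    (extChartAt 𝓘(ℝ, V × S.𝔭) m₀).symm y = assocMk K (assocSec S.𝔭 (A.rG m₀) (A.rN m₀) y) := by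
  simp only [extChartAt, OpenPartialHomeomorph.extend, A.chartAt_eq]
  rfl

theorem mk_loc {m₀ m : AssocSpace K N} (hm : m ∈ (extChartAt 𝓘(ℝ, V × S.𝔭) m₀).source) :
    assocMk K (A.loc m₀ m) = m := by
  rw [loc, ← A.chart_symm]
  exact (extChartAt 𝓘(ℝ, V × S.𝔭) m₀).left_inv hm

/-- Following `q` by the local section is translation by `kap`. All transition functions of the
induced bundles are computed from this, and are smooth because `kap` is. -/
theorem loc_mk {m₀ : AssocSpace K N} {p : G × N} (hp : p ∈ A.dom m₀) :
    A.loc m₀ (assocMk K p) = (p.1 * (A.kap m₀ p.1 : G)⁻¹, A.kap m₀ p.1 • p.2) := by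
  rw [loc, A.chart_mk hp, assocSec_assocCoord A.sl hp]; rfl

theorem rep_mem_dom (m₀ : AssocSpace K N) : (A.rG m₀, A.rN m₀) ∈ A.dom m₀ := by
  rw [← A.mk_mem_source, A.mk_rep]
  exact mem_extChartAt_source _

theorem kap_rep (m₀ : AssocSpace K N) : A.kap m₀ (A.rG m₀) = 1 := by
  rw [kap, inv_mul_cancel, A.sl.snd_one]

theorem loc_self (m₀ : AssocSpace K N) : A.loc m₀ m₀ = (A.rG m₀, A.rN m₀) := by
  have := A.loc_mk (A.rep_mem_dom m₀)
  rw [A.mk_rep, A.kap_rep] at this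
  simpa using this

theorem chart_self (m₀ : AssocSpace K N) : extChartAt 𝓘(ℝ, V × S.𝔭) m₀ m₀ =
    (extChartAt 𝓘(ℝ, V) (A.rN m₀) (A.rN m₀), 0) := by
  have := A.chart_mk (A.rep_mem_dom m₀)
  rw [A.mk_rep] at this
  rw [this]
  simp [assocCoord, A.sl.snd_one, A.sl.fst_one]

theorem kap_smooth {m₀ : AssocSpace K N} {p : G × N} (hp : p ∈ A.dom m₀) :
    ContMDiffAt 𝓘(ℝ, EG) 𝓘(ℝ, EK) ∞ (A.kap m₀) p.1 :=
  ContMDiffAt.comp (I' := 𝓘(ℝ, EG)) (g := A.sl.snd) (f := fun g : G => (A.rG m₀)⁻¹ * g) p.1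
    (A.sl.snd_smooth.contMDiffAt (A.sl.dom_open.mem_nhds hp.1)) contMDiff_mul_left.contMDiffAt

variable [IsManifold 𝓘(ℝ, V × S.𝔭) ∞ (AssocSpace K N)]

theorem loc_smooth {m₀ m : AssocSpace K N} (hm : m ∈ (extChartAt 𝓘(ℝ, V × S.𝔭) m₀).source) :
    ContMDiffAt 𝓘(ℝ, V × S.𝔭) (𝓘(ℝ, EG).prod 𝓘(ℝ, V)) ∞ (A.loc m₀) m := by
  have h := (extChartAt 𝓘(ℝ, V × S.𝔭) m₀).map_source hm
  rw [A.target_eq] at h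
  exact ContMDiffAt.comp (I' := 𝓘(ℝ, V × S.𝔭)) m (contMDiff_assocSec A.sl h.1 h.2)
    (contMDiffAt_chart hm)

include A in
theorem contMDiff_mk : ContMDiff (𝓘(ℝ, EG).prod 𝓘(ℝ, V)) 𝓘(ℝ, V × S.𝔭) ∞
    (assocMk K : G × N → AssocSpace K N) := by
  intro p
  have hp : p ∈ A.dom (assocMk K p) := A.mk_mem_source.1 (mem_extChartAt_source _)
  have h1 := contMDiff_assocCoord (V := V) A.sl hp
  have hd := A.isOpen_dom (assocMk K p)
  have ht : assocCoord A.sl (A.rG (assocMk K p)) (A.rN (assocMk K p)) p ∈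
      (extChartAt 𝓘(ℝ, V × S.𝔭) (assocMk K p)).target := by
    rw [A.target_eq]; exact assocCoord_mem A.sl hp
  have h2 := ContMDiffAt.comp (I' := 𝓘(ℝ, V × S.𝔭)) p (contMDiffAt_chart_symm ht) h1
  refine h2.congr_of_eventuallyEq ?_
  filter_upwards [hd.mem_nhds hp] with p' hp'
  simp only [Function.comp]
  rw [← A.chart_mk hp']
  exact ((extChartAt 𝓘(ℝ, V × S.𝔭) (assocMk K p)).left_inv (A.mk_mem_source.2 hp')).symm

include A in
theorem mdiff_mk (p : G × N) : MDifferentiableAt (𝓘(ℝ, EG).prod 𝓘(ℝ, V)) 𝓘(ℝ, V × S.𝔭)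
    (assocMk K : G × N → AssocSpace K N) p :=
  A.contMDiff_mk.contMDiffAt.mdifferentiableAt (by simp)

include EK in
theorem contMDiff_translate (k : K) : ContMDiff (𝓘(ℝ, EG).prod 𝓘(ℝ, V)) (𝓘(ℝ, EG).prod 𝓘(ℝ, V)) ∞
    (fun p : G × N => (p.1 * (k : G), k⁻¹ • p.2)) :=
  (contMDiff_fst.mul contMDiff_const).prodMk
    ((contMDiff_const (I' := 𝓘(ℝ, EK)) (c := k⁻¹)).smul contMDiff_snd)

include A in
/-- There is a smooth local section of `G × N → G ×_K N` through every point. -/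
theorem exists_section (p : G × N) : ∃ s : AssocSpace K N → G × N,
    ContMDiffAt 𝓘(ℝ, V × S.𝔭) (𝓘(ℝ, EG).prod 𝓘(ℝ, V)) ∞ s (assocMk K p) ∧
      s (assocMk K p) = p ∧ ∀ᶠ m in 𝓝 (assocMk K p), assocMk K (s m) = m := by
  obtain ⟨g, n⟩ := p
  set m₀ := assocMk K (g, n)
  -- The section of the chart passes through the preferred representative `(g ρ(g)⁻¹, ρ(g) n)`;
  -- translation by `ρ(g)` makes it pass through `(g, n)`.
  refine ⟨fun m => ((A.loc m₀ m).1 * (A.r.ρ g : G), (A.r.ρ g)⁻¹ • (A.loc m₀ m).2), ?_, ?_, ?_⟩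
  · exact ContMDiffAt.comp (I' := 𝓘(ℝ, EG).prod 𝓘(ℝ, V)) m₀
      (contMDiff_translate (EK := EK) (V := V) (EG := EG) (A.r.ρ g)).contMDiffAt (A.loc_smooth (mem_extChartAt_source m₀))
  · simp only [A.loc_self]
    simp only [m₀, rG, rN, A.r.repG_mk, A.r.repN_mk]
    simp
  · filter_upwards [extChartAt_source_nhds (mem_extChartAt_source (I := 𝓘(ℝ, V × S.𝔭)) m₀)] with m hm
    rw [assocMk_mul, smul_inv_smul]
    exact A.mk_loc hm

section Descent

variable {B : Type*} [NormedAddCommGroup B] [NormedSpace ℝ B] {H : Type*} [TopologicalSpace H]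
  {J : ModelWithCorners ℝ B H} {Z : Type*} [TopologicalSpace Z] [ChartedSpace H Z]

include A in
/-- Maps from `G ×_K N` are smooth if they are on `G × N`. -/
theorem contMDiffAt_of_mk {f : AssocSpace K N → Z} {p : G × N}
    (h : ContMDiffAt (𝓘(ℝ, EG).prod 𝓘(ℝ, V)) J ∞ (fun p => f (assocMk K p)) p) :
    ContMDiffAt 𝓘(ℝ, V × S.𝔭) J ∞ f (assocMk K p) := by
  obtain ⟨s, hs, hp, hq⟩ := A.exists_section p
  have h1 := ContMDiffAt.comp_of_eq (I' := 𝓘(ℝ, EG).prod 𝓘(ℝ, V)) h hs hp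
  exact h1.congr_of_eventuallyEq (hq.mono fun m hm => congrArg f hm.symm)

end Descent

include A in
-- The derivative of a local section through `p` is a right inverse.
theorem submersion (p : G × N) : Function.Surjective
    (mfderiv (𝓘(ℝ, EG).prod 𝓘(ℝ, V)) 𝓘(ℝ, V × S.𝔭) (assocMk K : G × N → AssocSpace K N) p) := by
  obtain ⟨s, hs, hp, hq⟩ := A.exists_section p
  intro w
  refine ⟨tder 𝓘(ℝ, V × S.𝔭) (𝓘(ℝ, EG).prod 𝓘(ℝ, V)) s (assocMk K p) w, ?_⟩
  have h := tder_comp_apply (A.mdiff_mk p) (hs.mdifferentiableAt (by simp)) hp w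
  rw [tder_congr hq, tder_id] at h
  exact h.symm

include A in
-- Near `m₀` the action is left multiplication on `G × N`, applied to the local section and followed
-- by `q`.
theorem contMDiff_smul : ContMDiff (𝓘(ℝ, EG).prod 𝓘(ℝ, V × S.𝔭)) 𝓘(ℝ, V × S.𝔭) ∞
    (fun p : G × AssocSpace K N => p.1 • p.2) := by
  rintro ⟨g, m₀⟩
  have hs := A.loc_smooth (mem_extChartAt_source (I := 𝓘(ℝ, V × S.𝔭)) m₀)
  have h1 : ContMDiffAt (𝓘(ℝ, EG).prod 𝓘(ℝ, V × S.𝔭)) (𝓘(ℝ, EG).prod 𝓘(ℝ, V)) ∞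
      (fun p : G × AssocSpace K N => A.loc m₀ p.2) (g, m₀) :=
    ContMDiffAt.comp (I' := 𝓘(ℝ, V × S.𝔭)) (g := A.loc m₀) (g, m₀) hs contMDiffAt_snd
  have h2 : ContMDiffAt (𝓘(ℝ, EG).prod 𝓘(ℝ, V × S.𝔭)) (𝓘(ℝ, EG).prod 𝓘(ℝ, V)) ∞
      (fun p : G × AssocSpace K N => (p.1 * (A.loc m₀ p.2).1, (A.loc m₀ p.2).2)) (g, m₀) :=
    (contMDiffAt_fst.mul h1.fst).prodMk h1.snd
  have h3 := ContMDiffAt.comp (I' := 𝓘(ℝ, EG).prod 𝓘(ℝ, V)) (g, m₀) A.contMDiff_mk.contMDiffAt h2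
  refine h3.congr_of_eventuallyEq ?_
  have hc : Filter.Tendsto (fun p : G × AssocSpace K N => p.2) (𝓝 (g, m₀)) (𝓝 m₀) :=
    continuousAt_snd
  filter_upwards [hc (extChartAt_source_nhds (mem_extChartAt_source (I := 𝓘(ℝ, V × S.𝔭)) m₀))]
    with p hp
  exact congrArg (fun m => p.1 • m) (A.mk_loc hp).symm

include A in
theorem mdiff_smul (h : G) (m : AssocSpace K N) :
    MDifferentiableAt 𝓘(ℝ, V × S.𝔭) 𝓘(ℝ, V × S.𝔭) (fun m : AssocSpace K N => h • m) m := by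
  have h1 := ContMDiffAt.comp (I' := 𝓘(ℝ, EG).prod 𝓘(ℝ, V × S.𝔭)) m
    (A.contMDiff_smul (h, m)) (contMDiffAt_const.prodMk contMDiffAt_id)
  exact h1.mdifferentiableAt (by simp)

end AssocAtlas

/-! ### The tangent map of `q`. -/

section Tangent

/-- The tangent map of `G × N → G ×_K N` at `(g, n)`. -/
def dq (S : SpinComplement (EG := EG) (EK := EK) K) [ChartedSpace (V × S.𝔭) (AssocSpace K N)]
    (p : G × N) : EG × V →L[ℝ] V × S.𝔭 :=
  tder (𝓘(ℝ, EG).prod 𝓘(ℝ, V)) 𝓘(ℝ, V × S.𝔭) (assocMk K : G × N → AssocSpace K N) p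

include EK in
theorem AssocAtlas.tder_translate (g : G) (k : K) (n : N) (X : EG) (v : V) :
    MDifferentiableAt (𝓘(ℝ, EG).prod 𝓘(ℝ, V)) (𝓘(ℝ, EG).prod 𝓘(ℝ, V))
      (fun p : G × N => (p.1 * (k : G)⁻¹, k • p.2)) (g, n) ∧
    tder (𝓘(ℝ, EG).prod 𝓘(ℝ, V)) (𝓘(ℝ, EG).prod 𝓘(ℝ, V))
      (fun p : G × N => (p.1 * (k : G)⁻¹, k • p.2)) (g, n) (lvec X g, v) =
      (lvec (Ad (k : G) X) (g * (k : G)⁻¹), actL V k n v) := by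
  have h1 : MDifferentiableAt (𝓘(ℝ, EG).prod 𝓘(ℝ, V)) (𝓘(ℝ, EG).prod 𝓘(ℝ, V))
      (fun p : G × N => (p.1 * (k : G)⁻¹, k • p.2)) (g, n) := by
    have := (contMDiff_translate (EK := EK) (V := V) (N := N) (EG := EG) k⁻¹).contMDiffAt
      (x := (g, n))
    simp only [inv_inv, Subgroup.coe_inv] at this
    exact this.mdifferentiableAt (by simp)
  refine ⟨h1, ?_⟩
  rw [tder_prod h1]
  have hk : MDifferentiableAt 𝓘(ℝ, V) 𝓘(ℝ, V) (fun a : N => k • a) n :=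
    ((contMDiff_const (I' := 𝓘(ℝ, EK)) (c := k)).smul contMDiff_id :
      ContMDiff 𝓘(ℝ, V) 𝓘(ℝ, V) ∞ (fun a : N => k • a)).contMDiffAt.mdifferentiableAt (by simp)
  have e1 := tder_prodMk (I := 𝓘(ℝ, EG)) (I' := 𝓘(ℝ, EG)) (I'' := 𝓘(ℝ, V))
    (f := fun a : G => a * (k : G)⁻¹)
    (g := fun _ : G => k • n) (x := g) (mdiff_mul_right _ g) mdifferentiableAt_const (lvec X g)
  have e2 := tder_prodMk (I := 𝓘(ℝ, V)) (I' := 𝓘(ℝ, EG)) (I'' := 𝓘(ℝ, V))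
    (f := fun _ : N => g * (k : G)⁻¹)
    (g := fun a : N => k • a) (x := n) mdifferentiableAt_const hk v
  dsimp only
  rw [e1, e2, mul_right_tder, tder_const, tder_const]
  simp
  rfl

variable (A : AssocAtlas S V N) [IsManifold 𝓘(ℝ, V × S.𝔭) ∞ (AssocSpace K N)]

include A

/-- `h • q(g, n) = q(h g, n)`, differentiated. -/
theorem AssocAtlas.tder_smul_dq (h g : G) (n : N) (X : EG) (v : V) :
    tder 𝓘(ℝ, V × S.𝔭) 𝓘(ℝ, V × S.𝔭) (fun m : AssocSpace K N => h • m) (assocMk K (g, n))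
      (dq S (g, n) (lvec X g, v)) = dq S (h * g, n) (lvec X (h * g), v) := by
  rw [dq, ← tder_comp_apply (A.mdiff_smul h _) (A.mdiff_mk _) rfl]
  have h1 : MDifferentiableAt (𝓘(ℝ, EG).prod 𝓘(ℝ, V)) (𝓘(ℝ, EG).prod 𝓘(ℝ, V))
      (fun p : G × N => (h * p.1, p.2)) (g, n) :=
    ((contMDiff_const.mul contMDiff_fst).prodMk contMDiff_snd :
      ContMDiff (𝓘(ℝ, EG).prod 𝓘(ℝ, V)) (𝓘(ℝ, EG).prod 𝓘(ℝ, V)) ∞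
      (fun p : G × N => (h * p.1, p.2))).contMDiffAt.mdifferentiableAt (by simp)
  have h2 := tder_comp_apply (A.mdiff_mk (h * g, n)) h1 rfl (lvec X g, v)
  refine h2.trans ?_
  congr 1
  rw [tder_prod h1]
  have e1 := tder_prodMk (I := 𝓘(ℝ, EG)) (I' := 𝓘(ℝ, EG)) (I'' := 𝓘(ℝ, V)) (f := fun a : G => h * a)
    (g := fun _ : G => n) (x := g) (mdiff_mul_left h g) mdifferentiableAt_const (lvec X g)
  have e2 := tder_prodMk (I := 𝓘(ℝ, V)) (I' := 𝓘(ℝ, EG)) (I'' := 𝓘(ℝ, V)) (f := fun _ : N => h * g)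
    (g := fun a : N => a) (x := n) mdifferentiableAt_const mdifferentiableAt_id v
  dsimp only
  rw [e1, e2, mul_left_tder_lvec, tder_const, tder_const, tder_id]
  simp

/-- `q` is invariant under the `K`-action on `G × N`, whose derivative is known. -/
theorem AssocAtlas.dq_translate (g : G) (k : K) (n : N) (X : EG) (v : V) :
    dq S (g * (k : G)⁻¹, k • n) (lvec (Ad (k : G) X) (g * (k : G)⁻¹), actL V k n v) =
      dq S (g, n) (lvec X g, v) := by
  obtain ⟨h1, h4⟩ := AssocAtlas.tder_translate (EK := EK) (V := V) g k n X v
  have h2 := tder_comp_apply (A.mdiff_mk (g * (k : G)⁻¹, k • n)) h1 rfl (lvec X g, v)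
  have h3 : (fun p : G × N => assocMk K (p.1 * (k : G)⁻¹, k • p.2)) = assocMk K := by
    ext p; exact assocMk_mul_inv _ _ _
  rw [h3, h4] at h2
  exact h2.symm

/-- The inverse of the chart centred at `m` is `q` after its section. It has derivative `id` at the
centre, while the section has derivative `(v, X) ↦ (gX, v)` there, because `σ` has derivative the
inclusion of `𝔭` at `0`. -/
theorem AssocAtlas.dq_rep (m : AssocSpace K N) (v : V) (X : S.𝔭) :
    dq S (A.rG m, A.rN m) (lvec (X : EG) (A.rG m), v) = (v, X) := by
  have h1 : (fun y => assocMk K (assocSec S.𝔭 (A.rG m) (A.rN m) y)) =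
      (extChartAt 𝓘(ℝ, V × S.𝔭) m).symm := funext fun y => (A.chart_symm m y).symm
  have ht : extChartAt 𝓘(ℝ, V × S.𝔭) m m ∈ (extChartAt 𝓘(ℝ, V × S.𝔭) m).target :=
    mem_extChartAt_target m
  have ht' := ht
  rw [A.target_eq] at ht'
  have hs := contMDiff_assocSec (EG := EG) (G := G) A.sl (g₀ := A.rG m) ht'.1 ht'.2
  have h2 := tder_chart_symm_self (E := V × S.𝔭) m
  rw [← h1] at h2
  have h3 := tder_comp_apply (A.mdiff_mk (A.rG m, A.rN m)) (hs.mdifferentiableAt (by simp))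
    (A.loc_self m) (v, X)
  rw [h2] at h3
  refine Eq.trans ?_ h3.symm
  change tder _ _ _ _ _ = _
  congr 1
  rw [A.chart_self] at ht' ⊢
  have hf : ContMDiffAt 𝓘(ℝ, V × S.𝔭) 𝓘(ℝ, EG) ∞ (fun y : V × S.𝔭 => A.rG m * slicePt S.𝔭 y.2)
      (extChartAt 𝓘(ℝ, V) (A.rN m) (A.rN m), 0) :=
    contMDiffAt_const.mul (ContMDiffAt.comp (I' := 𝓘(ℝ, S.𝔭)) (g := (slicePt S.𝔭 : S.𝔭 → G)) _
      (contMDiffAt_slicePt (A.sl.ball_target _ ht'.2)) contDiff_snd.contMDiff.contMDiffAt)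
  have hg : ContMDiffAt 𝓘(ℝ, V × S.𝔭) 𝓘(ℝ, V) ∞
      (fun y : V × S.𝔭 => (extChartAt 𝓘(ℝ, V) (A.rN m)).symm y.1)
      (extChartAt 𝓘(ℝ, V) (A.rN m) (A.rN m), 0) :=
    ContMDiffAt.comp (I' := 𝓘(ℝ, V)) (g := (extChartAt 𝓘(ℝ, V) (A.rN m)).symm) _
      (contMDiffAt_chart_symm ht'.1) contDiff_fst.contMDiff.contMDiffAt
  refine Eq.symm ((tder_prodMk (hf.mdifferentiableAt (by simp))
    (hg.mdifferentiableAt (by simp)) (v, X)).trans ?_)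
  have f1 : MDifferentiableAt 𝓘(ℝ, V × S.𝔭) 𝓘(ℝ, V) (Prod.fst : V × S.𝔭 → V)
      (extChartAt 𝓘(ℝ, V) (A.rN m) (A.rN m), 0) := differentiableAt_fst.mdifferentiableAt
  have f2 : MDifferentiableAt 𝓘(ℝ, V × S.𝔭) 𝓘(ℝ, S.𝔭) (Prod.snd : V × S.𝔭 → S.𝔭)
      (extChartAt 𝓘(ℝ, V) (A.rN m) (A.rN m), 0) := differentiableAt_snd.mdifferentiableAt
  have d1 := tder_comp_apply (g := (extChartAt 𝓘(ℝ, V) (A.rN m)).symm)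
    (mdifferentiableAt_chart_symm ht'.1) f1 rfl (v, X)
  have hσ : MDifferentiableAt 𝓘(ℝ, S.𝔭) 𝓘(ℝ, EG) (slicePt S.𝔭 : S.𝔭 → G) 0 :=
    (contMDiffAt_slicePt (A.sl.ball_target _ ht'.2)).mdifferentiableAt (by simp)
  have hl : MDifferentiableAt 𝓘(ℝ, S.𝔭) 𝓘(ℝ, EG) (fun X => A.rG m * slicePt S.𝔭 X) 0 :=
    MDifferentiableAt.comp (I' := 𝓘(ℝ, EG)) _ (mdiff_mul_left _ _) hσ
  have d2 := tder_comp_apply (g := fun X => A.rG m * slicePt S.𝔭 X) hl f2 rfl (v, X)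
  have d3 := tder_comp_apply (g := fun a : G => A.rG m * a) (mdiff_mul_left _ _) hσ
    (slicePt_zero S.𝔭) X
  rw [d1, d2, tder_eq_fderiv, tder_eq_fderiv, fderiv_fst, fderiv_snd, tder_chart_symm_self]
  simp only [ContinuousLinearMap.coe_fst', ContinuousLinearMap.coe_snd',
    ContinuousLinearMap.id_apply, Prod.mk.injEq, and_true]
  rw [d3, tder_slicePt_zero]
  rfl

/-- Translation by `ρ(g)` leads to the preferred representative, where `Tq` is explicit. The frame,
the form and the connection on `M` are all compared with those on `N` through this formula. -/
theorem AssocAtlas.dq_mk_rep (g : G) (n : N) (v : V) (X : S.𝔭) :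
    dq S (g, n) (lvec (X : EG) g, v) =
      (actL V (A.r.ρ g) n v, ⟨_, S.Ad_mem (A.r.ρ g) X⟩) := by
  rw [← A.dq_translate g (A.r.ρ g) n]
  exact A.dq_rep (assocMk K (g, n)) (actL V (A.r.ρ g) n v) ⟨_, S.Ad_mem (A.r.ρ g) X⟩

end Tangent

end Quotient

/-! ### Vertical vectors of `q`. -/

section Vertical

variable {EG : Type*} [NormedAddCommGroup EG] [NormedSpace ℝ EG] [FiniteDimensional ℝ EG]
  {G : Type*} [TopologicalSpace G] [ChartedSpace EG G] [Group G] [LieGroup 𝓘(ℝ, EG) ∞ G]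
  {EK : Type*} [NormedAddCommGroup EK] [NormedSpace ℝ EK] [FiniteDimensional ℝ EK]
  {K : Subgroup G} [ChartedSpace EK K] [LieGroup 𝓘(ℝ, EK) ∞ K]
  (hK : IsMaximalCompactLieSubgroup (EG := EG) (EK := EK) K)
  {S : SpinComplement (EG := EG) (EK := EK) K}
  {V : Type*} [NormedAddCommGroup V] [NormedSpace ℝ V]
  {N : Type*} [TopologicalSpace N] [ChartedSpace V N] [IsManifold 𝓘(ℝ, V) ∞ N] [MulAction K N]
  [ContMDiffSMul 𝓘(ℝ, EK) 𝓘(ℝ, V) ∞ K N]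
  [ChartedSpace (V × S.𝔭) (AssocSpace K N)] [IsManifold 𝓘(ℝ, V × S.𝔭) ∞ (AssocSpace K N)]
  (A : AssocAtlas S V N)

theorem contMDiff_orbit (n : N) : ContMDiff 𝓘(ℝ, EK) 𝓘(ℝ, V) ∞ (fun k : K => k • n) :=
  contMDiff_id.smul contMDiff_const

include A hK in
-- `[g k, n] = [g, k n]`, differentiated at `k = 1`.
theorem AssocAtlas.dq_vertical (g : G) (n : N) (Z : EK) :
    dq S (g, n) (lvec (lieIncl K Z) g, 0) = dq S (g, n) (0, fundL V (H := K) n Z) := by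
  have ha : MDifferentiableAt 𝓘(ℝ, EK) 𝓘(ℝ, EG) (fun k : K => g * (k : G)) 1 :=
    MDifferentiableAt.comp (I' := 𝓘(ℝ, EG)) _ (mdiff_mul_left g _) (mdiff_coe hK 1)
  have hb : MDifferentiableAt 𝓘(ℝ, EK) 𝓘(ℝ, V) (fun k : K => k • n) 1 :=
    (contMDiff_orbit n).contMDiffAt.mdifferentiableAt (by simp)
  have h1 := tder_comp_apply (A.mdiff_mk (g, n))
    (ha.prodMk (mdifferentiableAt_const (c := n))) (by simp) Z
  have h2 := tder_comp_apply (A.mdiff_mk (g, n))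
    ((mdifferentiableAt_const (c := g)).prodMk hb) (by simp) Z
  have e : (fun k : K => assocMk K (g * (k : G), n)) = fun k => assocMk K (g, k • n) :=
    funext fun k => assocMk_mul g k n
  rw [e, h2] at h1
  rw [tder_prodMk ha mdifferentiableAt_const, tder_prodMk mdifferentiableAt_const hb,
    tder_const, tder_const] at h1
  rw [tder_comp_apply (y := (1 : G)) (mdiff_mul_left g 1) (mdiff_coe hK 1) (by simp)] at h1
  exact h1.symm

include A hK in
-- The `𝔨`-part of `ξ` is traded for the fundamental vector field on `N`, so that the group
-- direction lies in `𝔭`.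
theorem AssocAtlas.dq_eq (g : G) (n : N) (ξ : EG) (v : V) :
    dq S (g, n) (lvec ξ g, v) =
      dq S (g, n) (lvec (S.compl hK ξ : EG) g, v + fundL V (H := K) n (S.projL hK ξ)) := by
  have hl : lvec ξ g = lvec (S.compl hK ξ : EG) g + lvec (lieIncl K (S.projL hK ξ)) g := by
    rw [← leftVecL_apply, ← leftVecL_apply, ← leftVecL_apply, ← map_add, S.compl_add_projL hK]
  have e1 : ((lvec ξ g, v) : EG × V) =
      (lvec (S.compl hK ξ : EG) g, v) + (lvec (lieIncl K (S.projL hK ξ)) g, 0) := by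
    rw [hl]; simp
  have e2 : ((lvec (S.compl hK ξ : EG) g, v + fundL V (H := K) n (S.projL hK ξ)) : EG × V) =
      (lvec (S.compl hK ξ : EG) g, v) + (0, fundL V (H := K) n (S.projL hK ξ)) := by simp
  rw [e1, e2, map_add, map_add, A.dq_vertical hK]

end Vertical

end PreHam

namespace PreHam

/-! ### Line bundles defined by local frames -/

universe w

/-- A copy of `ℂ` in the universe `w`, used as the fibre of a line bundle. -/
def LineModel : Type w := ULift.{w} ℂ

namespace LineModel

instance : NormedAddCommGroup LineModel.{w} := inferInstanceAs (NormedAddCommGroup (ULift.{w} ℂ))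

instance : NormedSpace ℂ LineModel.{w} := inferInstanceAs (NormedSpace ℂ (ULift.{w} ℂ))

/-- The identification with `ℂ`. -/
def equiv : LineModel.{w} ≃ₗᵢ[ℂ] ℂ where
  toFun z := z.down
  invFun z := ⟨z⟩
  map_add' _ _ := rfl
  map_smul' _ _ := rfl
  left_inv _ := rfl
  right_inv _ := rfl
  norm_map' _ := rfl

instance : InnerProductSpace ℂ LineModel.{w} where
  inner a b := Inner.inner ℂ (equiv a) (equiv b)
  norm_sq_eq_re_inner x := by
    rw [← equiv.norm_map x]; exact norm_sq_eq_re_inner (𝕜 := ℂ) (equiv x)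
  conj_inner_symm x y := inner_conj_symm (equiv x) (equiv y)
  add_left x y z := by rw [map_add]; exact inner_add_left _ _ _
  smul_left x y r := by rw [map_smul]; exact inner_smul_left _ _ _

/-- The quotient of two elements. -/
def ratio (z e : LineModel.{w}) : ℂ := equiv z / equiv e

theorem ratio_smul {z e : LineModel.{w}} (he : e ≠ 0) : ratio z e • e = z := by
  apply equiv.injective
  rw [map_smul, ratio, smul_eq_mul, div_mul_cancel₀]
  simpa using he

theorem smul_ratio {c : ℂ} {e : LineModel.{w}} (he : e ≠ 0) : ratio (c • e) e = c := by
  rw [ratio, map_smul, smul_eq_mul, mul_div_cancel_right₀]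
  simpa using he

end LineModel

open LineModel

section Frames

variable {V : Type*} [NormedAddCommGroup V] [NormedSpace ℝ V]
  {M : Type*} [TopologicalSpace M] [ChartedSpace V M] [IsManifold 𝓘(ℝ, V) ∞ M]

variable (V M) in
/-- Local frames that define a Hermitian line bundle with constant fibre. -/
structure LineFrames where
  U : M → Set M
  isOpen : ∀ i, IsOpen (U i)
  mem : ∀ i, i ∈ U i
  e : M → M → LineModel.{w}
  ne_zero : ∀ i, ∀ x ∈ U i, e i x ≠ 0
  smooth : ∀ i j, ContMDiffOn 𝓘(ℝ, V) 𝓘(ℝ, ℂ) ∞ (fun x => ratio (e i x) (e j x)) (U i ∩ U j)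
  norm_smooth : ∀ i, ContMDiffOn 𝓘(ℝ, V) 𝓘(ℝ, ℝ) ∞ (fun x => ‖e i x‖ ^ 2) (U i)

namespace LineFrames

variable (F : LineFrames.{w} V M)

/-- The trivialisation defined by a frame. -/
def pretriv (i : M) : Pretrivialization ℂ (π ℂ (fun _ : M => LineModel.{w})) where
  toFun l := (l.proj, ratio l.snd (F.e i l.proj))
  invFun p := ⟨p.1, p.2 • F.e i p.1⟩
  source := {l | l.proj ∈ F.U i}
  target := F.U i ×ˢ univ
  map_source' l hl := ⟨hl, mem_univ _⟩
  map_target' p hp := hp.1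
  left_inv' l hl := by
    obtain ⟨x, z⟩ := l
    simp only [ratio_smul (F.ne_zero i x hl)]
  right_inv' p hp := by
    simp only [smul_ratio (F.ne_zero i p.1 hp.1)]
  open_target := (F.isOpen i).prod isOpen_univ
  baseSet := F.U i
  open_baseSet := F.isOpen i
  source_eq := rfl
  target_eq := rfl
  proj_toFun _ _ := rfl

theorem pretriv_symm {i x : M} (hx : x ∈ F.U i) (c : ℂ) :
    (F.pretriv i).symm x c = c • F.e i x := by
  have := (F.pretriv i).mk_symm (b := x) hx c
  have h2 : ((F.pretriv i).toPartialEquiv.symm (x, c)) =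
      (⟨x, c • F.e i x⟩ : TotalSpace ℂ (fun _ : M => LineModel.{w})) := rfl
  have h3 := this.trans h2
  injection h3

theorem pretriv_coordChange {i j x : M} (hx : x ∈ F.U i ∩ F.U j) (c : ℂ) :
    (F.pretriv j ⟨x, (F.pretriv i).symm x c⟩).2 = ratio (F.e i x) (F.e j x) * c := by
  rw [F.pretriv_symm hx.1]
  change ratio _ _ = _
  rw [ratio, ratio, map_smul, smul_eq_mul]
  ring

/-- On one fibre the trivialisation is division by a nonzero constant, a homeomorphism of `ℂ`. -/
theorem isInducing (i : M) {x : M} (hx : x ∈ F.U i) :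
    Topology.IsInducing (fun z : LineModel.{w} =>
      F.pretriv i (⟨x, z⟩ : TotalSpace ℂ (fun _ : M => LineModel.{w}))) := by
  have he : equiv (F.e i x) ≠ 0 := by simpa using F.ne_zero i x hx
  have h1 : Topology.IsInducing (fun c : ℂ => (x, c)) := Topology.isInducing_const_prod.2 .id
  have h2 : Topology.IsInducing (fun c : ℂ => c / equiv (F.e i x)) := by
    simp only [div_eq_mul_inv]
    exact (Homeomorph.mulRight₀ _ (inv_ne_zero he)).isInducing
  exact h1.comp (h2.comp equiv.toHomeomorph.isInducing)

/-- The real vector prebundle defined by the frames. -/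
def preReal : VectorPrebundle ℝ ℂ (fun _ : M => LineModel.{w}) where
  pretrivializationAtlas := range F.pretriv
  pretrivialization_linear' := by
    rintro _ ⟨i, rfl⟩
    exact ⟨fun x _ => ⟨fun a b => add_div _ _ _, fun c a => by
      change equiv (((c : ℂ)) • a) / _ = (c : ℂ) • (equiv a / _)
      rw [map_smul, smul_div_assoc]⟩⟩
  pretrivializationAt := F.pretriv
  mem_base_pretrivializationAt := F.mem
  pretrivialization_mem_atlas i := ⟨i, rfl⟩
  exists_coordChange := by
    rintro _ ⟨i, rfl⟩ _ ⟨j, rfl⟩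
    exact ⟨fun x => ContinuousLinearMap.mul ℝ ℂ (ratio (F.e i x) (F.e j x)),
      (ContinuousLinearMap.continuous _).comp_continuousOn (F.smooth i j).continuousOn,
      fun x hx c => (F.pretriv_coordChange hx c).symm⟩
  totalSpaceMk_isInducing x := F.isInducing x (F.mem x)

/-- The complex vector prebundle defined by the frames. -/
def preComplex : VectorPrebundle ℂ ℂ (fun _ : M => LineModel.{w}) where
  pretrivializationAtlas := range F.pretriv
  pretrivialization_linear' := by
    rintro _ ⟨i, rfl⟩
    exact ⟨fun x _ => ⟨fun a b => add_div _ _ _, fun c a => by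
      change equiv (c • a) / _ = c • (equiv a / _)
      rw [map_smul, smul_div_assoc]⟩⟩
  pretrivializationAt := F.pretriv
  mem_base_pretrivializationAt := F.mem
  pretrivialization_mem_atlas i := ⟨i, rfl⟩
  exists_coordChange := by
    rintro _ ⟨i, rfl⟩ _ ⟨j, rfl⟩
    exact ⟨fun x => ContinuousLinearMap.mul ℂ ℂ (ratio (F.e i x) (F.e j x)),
      (ContinuousLinearMap.continuous _).comp_continuousOn (F.smooth i j).continuousOn,
      fun x hx c => (F.pretriv_coordChange hx c).symm⟩
  totalSpaceMk_isInducing x := F.isInducing x (F.mem x)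

instance : F.preReal.IsContMDiff 𝓘(ℝ, V) ∞ where
  exists_contMDiffCoordChange := by
    rintro _ ⟨i, rfl⟩ _ ⟨j, rfl⟩
    exact ⟨fun x => ContinuousLinearMap.mul ℝ ℂ (ratio (F.e i x) (F.e j x)),
      (ContinuousLinearMap.mul ℝ ℂ).contMDiff.comp_contMDiffOn (F.smooth i j),
      fun x hx c => (F.pretriv_coordChange hx c).symm⟩

/-- The topology on the total space. -/
abbrev topology : TopologicalSpace (TotalSpace ℂ (fun _ : M => LineModel.{w})) :=
  F.preReal.totalSpaceTopology

/-- The fibre bundle structure. -/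
abbrev fiberBundle : @FiberBundle M ℂ _ _ (fun _ : M => LineModel.{w}) F.topology _ :=
  F.preReal.toFiberBundle

theorem vectorBundle : @VectorBundle ℝ M ℂ (fun _ : M => LineModel.{w}) _ _ _ _ _ _ F.topology _
    F.fiberBundle :=
  F.preReal.toVectorBundle

/-- The real and the complex prebundle have the same pretrivialisations, so the two topologies on
the total space agree by definition. -/
theorem complexVectorBundle : @VectorBundle ℂ M ℂ (fun _ : M => LineModel.{w}) _ _ _ _ _ _
    F.topology _ F.fiberBundle :=
  F.preComplex.toVectorBundle

theorem contMDiffVectorBundle : @ContMDiffVectorBundle ∞ ℝ M ℂ (fun _ : M => LineModel.{w}) _ _ _ _ _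
    _ 𝓘(ℝ, V) _ _ _ _ _ _ F.topology _ F.fiberBundle F.vectorBundle :=
  F.preReal.contMDiffVectorBundle 𝓘(ℝ, V)

section Smooth

variable {B : Type*} [NormedAddCommGroup B] [NormedSpace ℝ B] {H : Type*} [TopologicalSpace H]
  {J : ModelWithCorners ℝ B H} {Z : Type*} [TopologicalSpace Z] [ChartedSpace H Z]

/-- The `ratio` to a frame is the fibre coordinate of the corresponding trivialisation. All
smoothness questions for maps into the bundle pass through this criterion. -/
theorem contMDiffAt_iff' {f : Z → TotalSpace ℂ (fun _ : M => LineModel.{w})} {z : Z} {i : M}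
    (hi : (f z).proj ∈ F.U i) :
    letI := F.topology
    letI := F.fiberBundle
    ContMDiffAt J (𝓘(ℝ, V).prod 𝓘(ℝ, ℂ)) ∞ f z ↔
      ContMDiffAt J 𝓘(ℝ, V) ∞ (fun z => (f z).proj) z ∧
        ContMDiffAt J 𝓘(ℝ, ℂ) ∞ (fun z => ratio (f z).snd (F.e i (f z).proj)) z := by
  letI := F.topology
  letI := F.fiberBundle
  haveI := F.vectorBundle
  haveI := F.contMDiffVectorBundle
  exact (trivializationAt ℂ (fun _ : M => LineModel.{w}) i).contMDiffAt_iff (f := f)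
    ((trivializationAt ℂ (fun _ : M => LineModel.{w}) i).mem_source.2 hi)

end Smooth

/-- Locally `‖l‖²` is the squared modulus of the fibre coordinate times the squared norm of the
frame. -/
theorem contMDiff_norm_sq :
    letI := F.topology
    letI := F.fiberBundle
    ContMDiff (𝓘(ℝ, V).prod 𝓘(ℝ, ℂ)) 𝓘(ℝ, ℝ) ∞
      (fun l : TotalSpace ℂ (fun _ : M => LineModel.{w}) => ‖l.snd‖ ^ 2) := by
  letI := F.topology
  letI := F.fiberBundle
  haveI := F.vectorBundle
  haveI := F.contMDiffVectorBundle
  intro l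
  obtain ⟨h1, h2⟩ := (F.contMDiffAt_iff' (f := fun l => l) (z := l) (F.mem l.proj)).1 contMDiffAt_id
  have h3 := ContMDiffAt.comp (I' := 𝓘(ℝ, ℂ)) (g := fun c : ℂ => ‖c‖ ^ 2) l
    (contDiff_norm_sq ℝ).contMDiff.contMDiffAt h2
  have h4 := ContMDiffAt.comp (I' := 𝓘(ℝ, V)) (g := fun x => ‖F.e l.proj x‖ ^ 2) l
    ((F.norm_smooth l.proj).contMDiffAt ((F.isOpen l.proj).mem_nhds (F.mem l.proj))) h1
  refine (h3.mul h4).congr_of_eventuallyEq ?_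
  filter_upwards [h1.continuousAt.preimage_mem_nhds ((F.isOpen l.proj).mem_nhds (F.mem l.proj))]
    with l' hl'
  simp only [Pi.mul_apply, Function.comp]
  conv_lhs => rw [← ratio_smul (z := l'.snd) (F.ne_zero l.proj l'.proj hl'), norm_smul, mul_pow]

/-- The Hermitian line bundle defined by local frames. -/
def bundle : HermitianLineBundle.{w} V M :=
  letI := F.topology
  letI := F.fiberBundle
  { Fiber := fun _ => LineModel.{w}
    complexVectorBundle := F.complexVectorBundle
    vectorBundle := F.vectorBundle
    smooth := F.contMDiffVectorBundle
    metric_smooth := F.contMDiff_norm_sq }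

variable {B : Type*} [NormedAddCommGroup B] [NormedSpace ℝ B] {H : Type*} [TopologicalSpace H]
  {J : ModelWithCorners ℝ B H} {Z : Type*} [TopologicalSpace Z] [ChartedSpace H Z]

theorem contMDiffAt_iff {f : Z → F.bundle.Total} {z : Z} {i : M} (hi : (f z).proj ∈ F.U i) :
    ContMDiffAt J (𝓘(ℝ, V).prod 𝓘(ℝ, ℂ)) ∞ f z ↔
      ContMDiffAt J 𝓘(ℝ, V) ∞ (fun z => (f z).proj) z ∧
        ContMDiffAt J 𝓘(ℝ, ℂ) ∞ (fun z => ratio (f z).snd (F.e i (f z).proj)) z :=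
  F.contMDiffAt_iff' hi

end LineFrames

end Frames

end PreHam

namespace PreHam

open LineModel

universe w

/-! ### Trivialisations and isometric models of the fibres of a Hermitian line bundle. -/

section UnitIso

variable {V : Type*} [NormedAddCommGroup V] [NormedSpace ℝ V]
  {M : Type*} [TopologicalSpace M] [ChartedSpace V M] [IsManifold 𝓘(ℝ, V) ∞ M]

namespace HermitianLineBundle

variable (L : HermitianLineBundle.{w} V M)

/-- The preferred trivialisation around `x₀`. -/
abbrev triv (x₀ : M) : Trivialization ℂ (π ℂ L.Fiber) := trivializationAt ℂ L.Fiber x₀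

/-- The section that has constant value `1` in the preferred trivialisation around `x₀`. -/
def unit (x₀ x : M) : L.Fiber x := (L.triv x₀).symm x 1

variable {L}

theorem triv_unit {x₀ x : M} (hx : x ∈ (L.triv x₀).baseSet) :
    L.triv x₀ ⟨x, L.unit x₀ x⟩ = (x, 1) :=
  (L.triv x₀).apply_mk_symm hx 1

theorem unit_ne_zero {x₀ x : M} (hx : x ∈ (L.triv x₀).baseSet) : L.unit x₀ x ≠ 0 := by
  intro h
  have h1 := congrArg Prod.snd (triv_unit hx)
  have h2 := ((L.triv x₀).linear ℂ hx).map_zero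
  rw [h] at h1
  exact one_ne_zero (h1.symm.trans h2)

theorem triv_smul_unit {x₀ x : M} (hx : x ∈ (L.triv x₀).baseSet) (l : L.Fiber x) :
    (L.triv x₀ ⟨x, l⟩).2 • L.unit x₀ x = l := by
  have h1 := ((L.triv x₀).linear ℂ hx).map_smul (L.triv x₀ ⟨x, l⟩).2 (L.unit x₀ x)
  rw [triv_unit hx, smul_eq_mul, mul_one] at h1
  have h2 := congrArg (fun c => (L.triv x₀).symm x c) h1
  rwa [(L.triv x₀).symm_apply_apply_mk hx, (L.triv x₀).symm_apply_apply_mk hx] at h2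

theorem triv_smul {x₀ x : M} (hx : x ∈ (L.triv x₀).baseSet) (c : ℂ) (l : L.Fiber x) :
    (L.triv x₀ ⟨x, c • l⟩).2 = c * (L.triv x₀ ⟨x, l⟩).2 :=
  ((L.triv x₀).linear ℂ hx).map_smul c l

theorem finrank_fiber (x : M) : Module.finrank ℂ (L.Fiber x) = 1 := by
  have hx : x ∈ (L.triv x).baseSet := FiberBundle.mem_baseSet_trivializationAt' x
  rw [finrank_eq_one_iff_of_nonzero' (L.unit x x) (unit_ne_zero hx)]
  exact fun l => ⟨_, triv_smul_unit hx l⟩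

variable (L) in
-- A nonzero vector divided by its norm spans the one-dimensional fibre isometrically.
theorem nonempty_unitIso (x : M) : Nonempty (L.Fiber x ≃ₗᵢ[ℂ] LineModel.{w}) := by
  have hx : x ∈ (L.triv x).baseSet := FiberBundle.mem_baseSet_trivializationAt' x
  set v := ((‖L.unit x x‖ : ℂ)⁻¹) • L.unit x x
  have hv : ‖v‖ = 1 := norm_smul_inv_norm (unit_ne_zero hx)
  have : FiniteDimensional ℂ (L.Fiber x) := FiniteDimensional.of_finrank_eq_succ (finrank_fiber x)
  exact ⟨((LinearIsometry.toSpanSingleton ℂ (L.Fiber x) hv).toLinearIsometryEquiv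
    (by rw [finrank_fiber, Module.finrank_self])).symm.trans LineModel.equiv.symm⟩

variable (L) in
/-- A choice of isometries of the fibres with the model fibre. -/
def unitIso (x : M) : L.Fiber x ≃ₗᵢ[ℂ] LineModel.{w} := (L.nonempty_unitIso x).some

section Smooth

variable {B : Type*} [NormedAddCommGroup B] [NormedSpace ℝ B] {H : Type*} [TopologicalSpace H]
  {J : ModelWithCorners ℝ B H} {Z : Type*} [TopologicalSpace Z] [ChartedSpace H Z]

theorem contMDiffAt_iff {f : Z → L.Total} {z : Z} {x₀ : M} (h : (f z).proj ∈ (L.triv x₀).baseSet) :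
    ContMDiffAt J (𝓘(ℝ, V).prod 𝓘(ℝ, ℂ)) ∞ f z ↔
      ContMDiffAt J 𝓘(ℝ, V) ∞ (fun z => (f z).proj) z ∧
        ContMDiffAt J 𝓘(ℝ, ℂ) ∞ (fun z => (L.triv x₀ (f z)).2) z :=
  (L.triv x₀).contMDiffAt_iff ((L.triv x₀).mem_source.2 h)

theorem contMDiffAt_unit {f : Z → M} {z : Z} {x₀ : M} (h : f z ∈ (L.triv x₀).baseSet)
    (hf : ContMDiffAt J 𝓘(ℝ, V) ∞ f z) :
    ContMDiffAt J (𝓘(ℝ, V).prod 𝓘(ℝ, ℂ)) ∞ (fun z => (⟨f z, L.unit x₀ (f z)⟩ : L.Total)) z := by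
  rw [contMDiffAt_iff (x₀ := x₀) h]
  refine ⟨hf, (contMDiffAt_const (c := (1 : ℂ))).congr_of_eventuallyEq ?_⟩
  filter_upwards [hf.continuousAt.preimage_mem_nhds ((L.triv x₀).open_baseSet.mem_nhds h)] with y hy
  rw [triv_unit hy]

end Smooth

variable {E : Type*} [NormedAddCommGroup E] [NormedSpace ℝ E] {H : Type*} [TopologicalSpace H]
  [ChartedSpace E H] [Group H] [MulAction H M] (a : L.Action E H)

/-- The action on the total space. -/
def Action.tot (h : H) (l : L.Total) : L.Total := ⟨h • l.proj, a.act h l.proj l.snd⟩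

theorem Action.tot_mul (h k : H) (l : L.Total) : a.tot (h * k) l = a.tot h (a.tot k l) :=
  a.act_mul h k l.proj l.snd

theorem Action.tot_one (l : L.Total) : a.tot 1 l = l := a.act_one l.proj l.snd

theorem Action.tot_inv_tot (h : H) (l : L.Total) : a.tot h⁻¹ (a.tot h l) = l := by
  rw [← a.tot_mul, inv_mul_cancel, a.tot_one]

theorem Action.tot_smooth : ContMDiff (𝓘(ℝ, E).prod (𝓘(ℝ, V).prod 𝓘(ℝ, ℂ)))
    (𝓘(ℝ, V).prod 𝓘(ℝ, ℂ)) ∞ (fun p : H × L.Total => a.tot p.1 p.2) := a.smooth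

end HermitianLineBundle

end UnitIso

/-! ### The Hermitian line bundle `G ×_K L` and its `G`-action. -/

section InducedLine

open HermitianLineBundle

variable {EG : Type*} [NormedAddCommGroup EG] [NormedSpace ℝ EG] [FiniteDimensional ℝ EG]
  {G : Type*} [TopologicalSpace G] [ChartedSpace EG G] [Group G] [LieGroup 𝓘(ℝ, EG) ∞ G]
  {EK : Type*} [NormedAddCommGroup EK] [NormedSpace ℝ EK]
  {K : Subgroup G} [ChartedSpace EK K] [LieGroup 𝓘(ℝ, EK) ∞ K]
  {S : SpinComplement (EG := EG) (EK := EK) K}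
  {V : Type*} [NormedAddCommGroup V] [NormedSpace ℝ V]
  {N : Type*} [TopologicalSpace N] [ChartedSpace V N] [IsManifold 𝓘(ℝ, V) ∞ N] [MulAction K N]
  [ContMDiffSMul 𝓘(ℝ, EK) 𝓘(ℝ, V) ∞ K N]
  [ChartedSpace (V × S.𝔭) (AssocSpace K N)] [IsManifold 𝓘(ℝ, V × S.𝔭) ∞ (AssocSpace K N)]
  (A : AssocAtlas S V N) {L : HermitianLineBundle.{w} V N} (aL : L.Action EK K)

namespace AssocAtlas

/-- The map `L_n → (G ×_K L)_{[g, n]}`, `l ↦ [g, l]`. -/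
def lineIso (g : G) (n : N) : L.Fiber n ≃ₗᵢ[ℂ] LineModel.{w} :=
  (aL.act (A.r.ρ g) n).trans (L.unitIso (A.r.ρ g • n))

/-- `unitIso` as a function on the total space. -/
def totIso (l : L.Total) : LineModel.{w} := L.unitIso l.proj l.snd

theorem lineIso_eq (g : G) (l : L.Total) :
    A.lineIso aL g l.proj l.snd = totIso (aL.tot (A.r.ρ g) l) := rfl

/-- `ρ(g k⁻¹) k = ρ(g)`: this is what makes `[g, l]` well defined. -/
theorem lineIso_tot (g : G) (k : K) (l : L.Total) :
    A.lineIso aL (g * (k : G)⁻¹) (aL.tot k l).proj (aL.tot k l).snd =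
      A.lineIso aL g l.proj l.snd := by
  rw [lineIso_eq, lineIso_eq, ← aL.tot_mul, A.r.map_mul_inv, inv_mul_cancel_right]

/-- The local frame of the induced line bundle. -/
def lineFrame (m₀ m : AssocSpace K N) : LineModel.{w} :=
  A.lineIso aL (A.loc m₀ m).1 (A.loc m₀ m).2 (L.unit (A.rN m₀) (A.loc m₀ m).2)

variable (L) in
/-- The domain of the local frame. -/
def lineDom (m₀ : AssocSpace K N) : Set (AssocSpace K N) :=
  (extChartAt 𝓘(ℝ, V × S.𝔭) m₀).source ∩ {m | (A.loc m₀ m).2 ∈ (L.triv (A.rN m₀)).baseSet}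

theorem isOpen_lineDom (m₀ : AssocSpace K N) : IsOpen (A.lineDom L m₀) := by
  rw [isOpen_iff_mem_nhds]
  intro m hm
  exact Filter.inter_mem (extChartAt_source_nhds hm.1)
    ((A.loc_smooth hm.1).snd.continuousAt.preimage_mem_nhds
      ((L.triv (A.rN m₀)).open_baseSet.mem_nhds hm.2))

theorem mem_lineDom (m₀ : AssocSpace K N) : m₀ ∈ A.lineDom L m₀ := by
  refine ⟨mem_extChartAt_source m₀, ?_⟩
  rw [mem_ofPred_eq, A.loc_self]
  exact FiberBundle.mem_baseSet_trivializationAt' _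

theorem lineFrame_ne_zero {m₀ m : AssocSpace K N} (hm : m ∈ A.lineDom L m₀) :
    A.lineFrame aL m₀ m ≠ 0 := by
  rw [lineFrame, Ne, LinearIsometryEquiv.map_eq_zero_iff]
  exact unit_ne_zero hm.2

theorem kap_smul_eq {m₀ : AssocSpace K N} {p : G × N} (hm : assocMk K p ∈ A.lineDom L m₀) :
    A.loc m₀ (assocMk K p) = (p.1 * (A.kap m₀ p.1 : G)⁻¹, A.kap m₀ p.1 • p.2) :=
  A.loc_mk (A.mk_mem_source.1 hm.1)

/-- With `κ = kap m₀ g`, the element `[g, l]` equals `[g κ⁻¹, κ l]`, which lies over the local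
section. There the frame is the unit section of `L`, so the coordinate of `κ l` in `L` is the
coordinate wanted. -/
theorem ratio_lineIso {m₀ : AssocSpace K N} (g : G) (l : L.Total)
    (hm : assocMk K (g, l.proj) ∈ A.lineDom L m₀) :
    ratio (A.lineIso aL g l.proj l.snd) (A.lineFrame aL m₀ (assocMk K (g, l.proj))) =
      (L.triv (A.rN m₀) (aL.tot (A.kap m₀ g) l)).2 := by
  have hl := A.kap_smul_eq hm
  have h2 : A.kap m₀ g • l.proj ∈ (L.triv (A.rN m₀)).baseSet := by
    have := hm.2
    rwa [mem_ofPred_eq, hl] at this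
  have h3 : A.lineIso aL g l.proj l.snd =
      (L.triv (A.rN m₀) (aL.tot (A.kap m₀ g) l)).2 • A.lineFrame aL m₀ (assocMk K (g, l.proj)) := by
    rw [← A.lineIso_tot aL g (A.kap m₀ g), lineFrame, hl, ← map_smul]
    congr 1
    exact (triv_smul_unit h2 _).symm
  rw [h3, smul_ratio (A.lineFrame_ne_zero aL hm)]

/-- The local frames that define `G ×_K L`. -/
def lineFrames : LineFrames.{w} (V × S.𝔭) (AssocSpace K N) where
  U := A.lineDom L
  isOpen := A.isOpen_lineDom
  mem := A.mem_lineDom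
  e := A.lineFrame aL
  ne_zero i x hx := A.lineFrame_ne_zero aL hx
  smooth i j := by
    intro m hm
    apply ContMDiffAt.contMDiffWithinAt
    have hmk : assocMk K (A.loc i m) = m := A.mk_loc hm.1.1
    have hs := A.loc_smooth hm.1.1
    -- The ratio of two frames is the coordinate, in the second trivialisation of `L`, of the first
    -- unit section moved by `kap j`.
    have h1 := contMDiffAt_unit (L := L) (f := fun m => (A.loc i m).2) hm.1.2 hs.snd
    have hdom : A.loc i m ∈ A.dom j := A.mk_mem_source.1 (by rw [hmk]; exact hm.2.1)
    have h2 : ContMDiffAt 𝓘(ℝ, V × S.𝔭) 𝓘(ℝ, EK) ∞ (fun m => A.kap j (A.loc i m).1) m :=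
      ContMDiffAt.comp (I' := 𝓘(ℝ, EG)) (g := A.kap j) m (A.kap_smooth hdom) hs.fst
    have h3 := ContMDiffAt.comp (I' := 𝓘(ℝ, EK).prod (𝓘(ℝ, V).prod 𝓘(ℝ, ℂ))) m
      (aL.tot_smooth (_, _)) (h2.prodMk h1)
    have h4 : (A.kap j (A.loc i m).1) • (A.loc i m).2 ∈ (L.triv (A.rN j)).baseSet := by
      have := hm.2.2
      rwa [mem_ofPred_eq, ← hmk, A.loc_mk hdom] at this
    refine ((contMDiffAt_iff (x₀ := A.rN j) h4).1 h3).2.congr_of_eventuallyEq ?_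
    filter_upwards [(A.isOpen_lineDom i).mem_nhds hm.1, (A.isOpen_lineDom j).mem_nhds hm.2]
      with x hx hx'
    have hmk : assocMk K ((A.loc i x).1, (A.loc i x).2) = x := A.mk_loc hx.1
    have h5 := A.ratio_lineIso aL (m₀ := j) (A.loc i x).1
      ⟨(A.loc i x).2, L.unit (A.rN i) (A.loc i x).2⟩ (by rw [hmk]; exact hx')
    dsimp only at h5
    rw [hmk] at h5
    exact h5
  norm_smooth i := by
    intro m hm
    apply ContMDiffAt.contMDiffWithinAt
    have h1 := contMDiffAt_unit (L := L) (f := fun m => (A.loc i m).2) hm.2 (A.loc_smooth hm.1).snd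
    have h2 := ContMDiffAt.comp (I' := 𝓘(ℝ, V).prod 𝓘(ℝ, ℂ)) m (L.metric_smooth _) h1
    refine h2.congr_of_eventuallyEq (Filter.Eventually.of_forall fun x => ?_)
    simp only [lineFrame, LinearIsometryEquiv.norm_map, Function.comp]

/-- The Hermitian line bundle `G ×_K L`. -/
def lineBundle : HermitianLineBundle.{w} (V × S.𝔭) (AssocSpace K N) := (A.lineFrames aL).bundle

/-- The map `L_n → (G ×_K L)_{[g, n]}`, `l ↦ [g, l]`. -/
def lineMk (g : G) (n : N) : L.Fiber n ≃ₗᵢ[ℂ] (A.lineBundle aL).Fiber (assocMk K (g, n)) :=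
  A.lineIso aL g n

/-- An element of a fibre of `G ×_K L`, as an element of the model fibre. -/
def lineVal {m : AssocSpace K N} (z : (A.lineBundle aL).Fiber m) : LineModel.{w} := z

theorem total_ext {m m' : AssocSpace K N} (h : m = m') {z : (A.lineBundle aL).Fiber m}
    {z' : (A.lineBundle aL).Fiber m'} (hz : A.lineVal aL z = A.lineVal aL z') :
    (⟨m, z⟩ : (A.lineBundle aL).Total) = ⟨m', z'⟩ := by
  subst h
  exact congrArg _ hz

/-- The map `G × L → G ×_K L`. -/
def lineQ (p : G × L.Total) : (A.lineBundle aL).Total :=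
  ⟨assocMk K (p.1, p.2.proj), A.lineMk aL p.1 p.2.proj p.2.snd⟩

theorem lineQ_tot (g : G) (k : K) (l : L.Total) :
    A.lineQ aL (g * (k : G)⁻¹, aL.tot k l) = A.lineQ aL (g, l) :=
  A.total_ext aL (assocMk_mul_inv _ _ _) (A.lineIso_tot aL g k l)

theorem lineQ_smooth : ContMDiff (𝓘(ℝ, EG).prod (𝓘(ℝ, V).prod 𝓘(ℝ, ℂ)))
    (𝓘(ℝ, V × S.𝔭).prod 𝓘(ℝ, ℂ)) ∞ (A.lineQ aL) := by
  rintro ⟨g, l⟩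
  set m₀ := assocMk K (g, l.proj)
  have hm : m₀ ∈ A.lineDom L m₀ := A.mem_lineDom m₀
  have hdom : (g, l.proj) ∈ A.dom m₀ := A.mk_mem_source.1 hm.1
  have hπ : ContMDiff (𝓘(ℝ, EG).prod (𝓘(ℝ, V).prod 𝓘(ℝ, ℂ))) 𝓘(ℝ, V × S.𝔭) ∞
      (fun p : G × L.Total => assocMk K (p.1, p.2.proj)) :=
    A.contMDiff_mk.comp (contMDiff_fst.prodMk ((contMDiff_proj L.Fiber).comp contMDiff_snd))
  refine ((A.lineFrames aL).contMDiffAt_iff (f := A.lineQ aL) (z := (g, l)) (i := m₀) hm).2 ⟨hπ (g, l), ?_⟩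
  have h2 : ContMDiffAt (𝓘(ℝ, EG).prod (𝓘(ℝ, V).prod 𝓘(ℝ, ℂ))) 𝓘(ℝ, EK) ∞
      (fun p : G × L.Total => A.kap m₀ p.1) (g, l) :=
    ContMDiffAt.comp (I' := 𝓘(ℝ, EG)) (g := A.kap m₀) (g, l) (A.kap_smooth hdom) contMDiffAt_fst
  have h3 := ContMDiffAt.comp (I' := 𝓘(ℝ, EK).prod (𝓘(ℝ, V).prod 𝓘(ℝ, ℂ))) (g, l)
    (aL.tot_smooth (_, _)) (h2.prodMk contMDiffAt_snd)
  have h4 : (A.kap m₀ g) • l.proj ∈ (L.triv (A.rN m₀)).baseSet := by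
    have := hm.2
    rwa [mem_ofPred_eq, A.loc_mk hdom] at this
  refine ((contMDiffAt_iff (x₀ := A.rN m₀) h4).1 h3).2.congr_of_eventuallyEq ?_
  filter_upwards [hπ.continuous.continuousAt.preimage_mem_nhds ((A.isOpen_lineDom m₀).mem_nhds hm)]
    with p hp
  exact A.ratio_lineIso aL p.1 p.2 hp

/-- A local section of `G × L → G ×_K L`. -/
def lineSec (m₀ : AssocSpace K N) (l : (A.lineBundle aL).Total) : G × L.Total :=
  ((A.loc m₀ l.proj).1, ⟨(A.loc m₀ l.proj).2,
    (A.lineIso aL (A.loc m₀ l.proj).1 (A.loc m₀ l.proj).2).symm (A.lineVal aL l.snd)⟩)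

theorem lineQ_lineSec {m₀ : AssocSpace K N} {l : (A.lineBundle aL).Total}
    (hl : l.proj ∈ (extChartAt 𝓘(ℝ, V × S.𝔭) m₀).source) : A.lineQ aL (A.lineSec aL m₀ l) = l :=
  A.total_ext aL (A.mk_loc hl)
    ((A.lineIso aL (A.loc m₀ l.proj).1 (A.loc m₀ l.proj).2).apply_symm_apply (A.lineVal aL l.snd))

theorem lineSec_lineQ {m₀ : AssocSpace K N} (g : G) (l : L.Total)
    (hl : (g, l.proj) ∈ A.dom m₀) : A.lineSec aL m₀ (A.lineQ aL (g, l)) =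
      (g * (A.kap m₀ g : G)⁻¹, aL.tot (A.kap m₀ g) l) := by
  have h1 := A.loc_mk hl
  -- Quantifying over the value of `loc` lets the fibre vary with its base point when the equation
  -- for `loc` is substituted.
  have h2 : ∀ (p : G × N), p = (g * (A.kap m₀ g : G)⁻¹, A.kap m₀ g • l.proj) →
      ((p.1, ⟨p.2, (A.lineIso aL p.1 p.2).symm (A.lineIso aL g l.proj l.snd)⟩) : G × L.Total) =
      (g * (A.kap m₀ g : G)⁻¹, aL.tot (A.kap m₀ g) l) := by
    rintro _ rfl
    rw [← A.lineIso_tot aL g (A.kap m₀ g) l]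
    exact Prod.ext rfl (congrArg (TotalSpace.mk _)
      ((A.lineIso aL _ _).symm_apply_apply (aL.tot (A.kap m₀ g) l).snd))
  exact h2 _ h1

theorem lineSec_smooth {m₀ : AssocSpace K N} {l : (A.lineBundle aL).Total}
    (hl : l.proj ∈ A.lineDom L m₀) :
    ContMDiffAt (𝓘(ℝ, V × S.𝔭).prod 𝓘(ℝ, ℂ)) (𝓘(ℝ, EG).prod (𝓘(ℝ, V).prod 𝓘(ℝ, ℂ))) ∞
      (A.lineSec aL m₀) l := by
  obtain ⟨h1, h2⟩ := ((A.lineFrames aL).contMDiffAt_iff (f := fun l => l) (z := l) (i := m₀) hl).1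
    contMDiffAt_id
  have h3 := ContMDiffAt.comp (I' := 𝓘(ℝ, V × S.𝔭)) l (A.loc_smooth hl.1) h1
  refine h3.fst.prodMk ((contMDiffAt_iff (x₀ := A.rN m₀) hl.2).2 ⟨h3.snd, ?_⟩)
  refine h2.congr_of_eventuallyEq ?_
  filter_upwards [h1.continuousAt.preimage_mem_nhds ((A.isOpen_lineDom m₀).mem_nhds hl)] with l' hl'
  have h5 := ratio_smul (z := A.lineVal aL l'.snd) (A.lineFrame_ne_zero aL hl')
  have h6 : (A.lineIso aL (A.loc m₀ l'.proj).1 (A.loc m₀ l'.proj).2).symm (A.lineVal aL l'.snd) =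
      ratio (A.lineVal aL l'.snd) (A.lineFrame aL m₀ l'.proj) •
        L.unit (A.rN m₀) (A.loc m₀ l'.proj).2 := by
    rw [LinearIsometryEquiv.symm_apply_eq, map_smul]
    exact h5.symm
  have h7 := triv_smul hl'.2 (ratio (A.lineVal aL l'.snd) (A.lineFrame aL m₀ l'.proj))
    (L.unit (A.rN m₀) (A.loc m₀ l'.proj).2)
  rw [triv_unit hl'.2, mul_one, ← h6] at h7
  exact h7

/-- The section of `L` that corresponds to a section of `G ×_K L` and an element of `G`. -/
def pullSec (s : ∀ m, (A.lineBundle aL).Fiber m) (g : G) (n : N) : L.Fiber n :=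
  (A.lineMk aL g n).symm (s (assocMk K (g, n)))

/-- The local section `lineSec` gives the representative of the section over `(g κ⁻¹, κ n)`; acting
by `κ⁻¹` brings it back to the fibre over `n`. -/
theorem pullSec_smooth {s : ∀ m, (A.lineBundle aL).Fiber m}
    (hs : (A.lineBundle aL).IsSmoothSection s) :
    ContMDiff (𝓘(ℝ, EG).prod 𝓘(ℝ, V)) (𝓘(ℝ, V).prod 𝓘(ℝ, ℂ)) ∞
      (fun p : G × N => (⟨p.2, A.pullSec aL s p.1 p.2⟩ : L.Total)) := by
  rintro ⟨g, n⟩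
  set m₀ := assocMk K (g, n)
  have hm : m₀ ∈ A.lineDom L m₀ := A.mem_lineDom m₀
  have hdom : (g, n) ∈ A.dom m₀ := A.mk_mem_source.1 hm.1
  have h1 : ContMDiffAt (𝓘(ℝ, EG).prod 𝓘(ℝ, V)) (𝓘(ℝ, V × S.𝔭).prod 𝓘(ℝ, ℂ)) ∞
      (fun p : G × N => (⟨assocMk K p, s (assocMk K p)⟩ : (A.lineBundle aL).Total)) (g, n) :=
    ContMDiffAt.comp (I' := 𝓘(ℝ, V × S.𝔭)) (g, n) (hs m₀) (A.contMDiff_mk (g, n))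
  have h2 := ContMDiffAt.comp (I' := 𝓘(ℝ, V × S.𝔭).prod 𝓘(ℝ, ℂ)) (g, n)
    (A.lineSec_smooth aL (m₀ := m₀) hm) h1
  have h3 : ContMDiffAt (𝓘(ℝ, EG).prod 𝓘(ℝ, V)) 𝓘(ℝ, EK) ∞
      (fun p : G × N => (A.kap m₀ p.1)) (g, n) :=
    ContMDiffAt.comp (I' := 𝓘(ℝ, EG)) (g := A.kap m₀) (g, n) (A.kap_smooth hdom) contMDiffAt_fst
  have h4 : ContMDiffAt (𝓘(ℝ, EG).prod 𝓘(ℝ, V)) 𝓘(ℝ, EK) ∞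
      (fun p : G × N => (A.kap m₀ p.1)⁻¹) (g, n) := h3.inv
  have h5 := ContMDiffAt.comp (I' := 𝓘(ℝ, EK).prod (𝓘(ℝ, V).prod 𝓘(ℝ, ℂ))) (g, n)
    (aL.tot_smooth (_, _)) (h4.prodMk h2.snd)
  refine h5.congr_of_eventuallyEq ?_
  filter_upwards [(A.isOpen_dom m₀).mem_nhds hdom] with p hp
  have h6 : (⟨assocMk K p, s (assocMk K p)⟩ : (A.lineBundle aL).Total) =
      A.lineQ aL (p.1, ⟨p.2, A.pullSec aL s p.1 p.2⟩) :=
    congrArg (TotalSpace.mk _)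
      ((A.lineMk aL p.1 p.2).apply_symm_apply (s (assocMk K (p.1, p.2)))).symm
  simp only [Function.comp]
  rw [h6, A.lineSec_lineQ aL p.1 ⟨p.2, A.pullSec aL s p.1 p.2⟩ hp, aL.tot_inv_tot]

theorem lineMk_pullSec (s : ∀ m, (A.lineBundle aL).Fiber m) (g : G) (n : N) :
    A.lineMk aL g n (A.pullSec aL s g n) = s (assocMk K (g, n)) :=
  (A.lineMk aL g n).apply_symm_apply _

/-- The action of `G` on `G ×_K L`. -/
def lineAct (h : G) (m : AssocSpace K N) :
    (A.lineBundle aL).Fiber m ≃ₗᵢ[ℂ] (A.lineBundle aL).Fiber (h • m) :=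
  show LineModel.{w} ≃ₗᵢ[ℂ] LineModel.{w} from
    (A.lineIso aL (A.rG m) (A.rN m)).symm.trans (A.lineIso aL (h * A.rG m) (A.rN m))

/-- The action is defined at the preferred representative, which differs from `(g, n)` by the action
of `ρ(g)`. Left multiplication on `G` commutes with this right translation. -/
theorem lineAct_mk (h g : G) (n : N) (l : L.Fiber n) :
    A.lineAct aL h (assocMk K (g, n)) (A.lineMk aL g n l) = A.lineMk aL (h * g) n l := by
  have e1 := A.lineIso_tot aL g (A.r.ρ g) ⟨n, l⟩
  have e2 := A.lineIso_tot aL (h * g) (A.r.ρ g) ⟨n, l⟩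
  have e3 : A.lineIso aL (h * (g * (A.r.ρ g : G)⁻¹)) (A.r.ρ g • n)
    ((A.lineIso aL (g * (A.r.ρ g : G)⁻¹) (A.r.ρ g • n)).symm (A.lineIso aL g n l)) =
      A.lineIso aL (h * g) n l := by
    rw [← mul_assoc]
    refine Eq.trans (congrArg _ ?_) e2
    exact (A.lineIso aL _ _).toLinearEquiv.symm_apply_eq.2 e1.symm
  exact e3

theorem lineAct_lineQ (h g : G) (l : L.Total) :
    (⟨h • assocMk K (g, l.proj), A.lineAct aL h _ (A.lineMk aL g l.proj l.snd)⟩ :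
      (A.lineBundle aL).Total) = A.lineQ aL (h * g, l) :=
  A.total_ext aL rfl (A.lineAct_mk aL h g l.proj l.snd)

theorem lineQ_surjective (l : (A.lineBundle aL).Total) : ∃ p, A.lineQ aL p = l :=
  ⟨_, A.lineQ_lineSec aL (mem_extChartAt_source l.proj)⟩

/-- The action of `G` on the line bundle `G ×_K L`. -/
def lineAction : (A.lineBundle aL).Action EG G where
  act := A.lineAct aL
  act_one m z := by
    obtain ⟨⟨g, l⟩, hl⟩ := A.lineQ_surjective aL ⟨m, z⟩
    obtain rfl : assocMk K (g, l.proj) = m := congrArg TotalSpace.proj hl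
    obtain rfl : A.lineMk aL g l.proj l.snd = z := by injection hl
    have := A.lineAct_lineQ aL 1 g l
    rw [one_mul] at this
    exact this
  act_mul h k m z := by
    obtain ⟨⟨g, l⟩, hl⟩ := A.lineQ_surjective aL ⟨m, z⟩
    obtain rfl : assocMk K (g, l.proj) = m := congrArg TotalSpace.proj hl
    obtain rfl : A.lineMk aL g l.proj l.snd = z := by injection hl
    have h1 := A.lineAct_lineQ aL (h * k) g l
    have h2 := A.lineAct_lineQ aL h (k * g) l
    rw [← mul_assoc] at h2
    refine h1.trans (h2.symm.trans ?_)
    exact A.total_ext aL rfl (congrArg (A.lineAct aL h (assocMk K (k * g, l.proj)))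
      (A.lineAct_mk aL k g l.proj l.snd).symm)
  smooth := by
    rintro ⟨h, l⟩
    have hm : l.proj ∈ A.lineDom L l.proj := A.mem_lineDom l.proj
    have h1 : ContMDiffAt (𝓘(ℝ, EG).prod (𝓘(ℝ, V × S.𝔭).prod 𝓘(ℝ, ℂ)))
        (𝓘(ℝ, EG).prod (𝓘(ℝ, V).prod 𝓘(ℝ, ℂ))) ∞
        (fun p : G × (A.lineBundle aL).Total => A.lineSec aL l.proj p.2) (h, l) :=
      ContMDiffAt.comp (I' := 𝓘(ℝ, V × S.𝔭).prod 𝓘(ℝ, ℂ)) (g := A.lineSec aL l.proj) (h, l)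
        (A.lineSec_smooth aL hm) contMDiffAt_snd
    have h2 := ContMDiffAt.comp (I' := 𝓘(ℝ, EG).prod (𝓘(ℝ, V).prod 𝓘(ℝ, ℂ))) (h, l)
      (A.lineQ_smooth aL _) ((contMDiffAt_fst.mul h1.fst).prodMk h1.snd)
    refine h2.congr_of_eventuallyEq ?_
    have hπ : ContMDiff (𝓘(ℝ, EG).prod (𝓘(ℝ, V × S.𝔭).prod 𝓘(ℝ, ℂ))) 𝓘(ℝ, V × S.𝔭) ∞
        (fun p : G × (A.lineBundle aL).Total => p.2.proj) :=
      (contMDiff_proj (A.lineBundle aL).Fiber).comp contMDiff_snd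
    filter_upwards [hπ.continuous.continuousAt.preimage_mem_nhds
      ((A.isOpen_lineDom l.proj).mem_nhds hm)] with p hp
    have h3 := A.lineAct_lineQ aL p.1 (A.lineSec aL l.proj p.2).1 (A.lineSec aL l.proj p.2).2
    have h4 := A.lineQ_lineSec aL hp.1
    refine Eq.trans ?_ h3
    conv_lhs => rw [← h4]
    rfl

end AssocAtlas

end InducedLine

end PreHam

namespace PreHam


/-! ### Coordinates on the fibres of a `Spin^c`-structure. -/

namespace SpincStructure

variable {V : Type*} [NormedAddCommGroup V] [NormedSpace ℝ V]
  {M : Type*} [TopologicalSpace M] [ChartedSpace V M] [IsManifold 𝓘(ℝ, V) ∞ M]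
  {Q : QuadraticForm ℝ V} (P : SpincStructure V M Q)

/-- A chosen point of every fibre. -/
def pt (x : M) : P.Fiber x := (P.atlas_cover x).choose.2 x

/-- The element of `Spin^c` that maps the chosen point to the given one. -/
def coord (p : P.Total) : SpinC Q := (P.simply_transitive (P.pt p.1) p.2).choose

theorem act_coord (p : P.Total) : P.act (P.pt p.1) (P.coord p) = p.2 :=
  (P.simply_transitive (P.pt p.1) p.2).choose_spec.1

theorem coord_eq {x : M} {p : P.Fiber x} {u : SpinC Q} (h : P.act (P.pt x) u = p) :
    P.coord ⟨x, p⟩ = u :=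
  (P.simply_transitive (P.pt x) p).unique (P.act_coord ⟨x, p⟩) h

theorem coord_act {x : M} (p : P.Fiber x) (u : SpinC Q) :
    P.coord ⟨x, P.act p u⟩ = P.coord ⟨x, p⟩ * u :=
  P.coord_eq (by rw [P.act_mul, P.act_coord ⟨x, p⟩])

theorem coord_pt (x : M) : P.coord ⟨x, P.pt x⟩ = 1 := P.coord_eq (P.act_one _)

theorem frame_act_rot {x : M} (p : P.Fiber x) (u : SpinC Q) (v : V) :
    P.frame (P.act p u) v = P.frame p (SpinC.rot u v) :=
  P.frame_act p u v _ (SpinC.rotates_rot u v)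

/-- The frame `P.frame p`, as an automorphism of the model space. -/
def frameL {x : M} (p : P.Fiber x) : V ≃L[ℝ] V := P.frame p

variable {P} {E : Type*} [NormedAddCommGroup E] [NormedSpace ℝ E] {H : Type*} [TopologicalSpace H]
  [ChartedSpace E H] [Group H] [MulAction H M] (a : P.Action E H)

/-- The action on the total space. -/
def Action.tot (h : H) (p : P.Total) : P.Total := ⟨h • p.1, a.lact h p.2⟩

theorem Action.tot_mul (h k : H) (p : P.Total) : a.tot (h * k) p = a.tot h (a.tot k p) :=
  a.lact_mul h k p.2

theorem Action.tot_one (p : P.Total) : a.tot 1 p = p := a.lact_one p.2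

end SpincStructure

/-! ### The induced `Spin^c`-structure, its `G`-action and its determinant. -/

section InducedSpinc

open SpincStructure

variable {EG : Type uEG} [NormedAddCommGroup EG] [NormedSpace ℝ EG] [FiniteDimensional ℝ EG]
  {G : Type uG} [TopologicalSpace G] [ChartedSpace EG G] [Group G] [LieGroup 𝓘(ℝ, EG) ∞ G]
  {EK : Type uEK} [NormedAddCommGroup EK] [NormedSpace ℝ EK]
  {K : Subgroup G} [ChartedSpace EK K] [LieGroup 𝓘(ℝ, EK) ∞ K]
  {S : SpinComplement (EG := EG) (EK := EK) K}
  {V : Type uV} [NormedAddCommGroup V] [NormedSpace ℝ V] [FiniteDimensional ℝ V]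
  {N : Type uN} [TopologicalSpace N] [ChartedSpace V N] [IsManifold 𝓘(ℝ, V) ∞ N] [MulAction K N]
  [ContMDiffSMul 𝓘(ℝ, EK) 𝓘(ℝ, V) ∞ K N]
  [ChartedSpace (V × S.𝔭) (AssocSpace K N)] [IsManifold 𝓘(ℝ, V × S.𝔭) ∞ (AssocSpace K N)]
  {Q : QuadraticForm ℝ V}
  (A : AssocAtlas S V N) {P : SpincStructure.{wP} V N Q} (aP : P.Action EK K)

variable (S Q) in
/-- The inclusion `Spin^c(V) → Spin^c(V ⊕ 𝔭)`. -/
abbrev spinInl : SpinC Q →* SpinC (Q.prod S.Q) := SpinC.map (QuadraticMap.Isometry.inl Q S.Q)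

variable (S Q) in
/-- The homomorphism `K → Spin(𝔭) → Spin^c(V ⊕ 𝔭)`. -/
def spinInr : K →* SpinC (Q.prod S.Q) :=
  ((SpinC.map (QuadraticMap.Isometry.inr Q S.Q)).comp (spinToSpinC S.Q)).comp S.lift

theorem spinInl_mul_spinInr (u : SpinC Q) (k : K) :
    spinInl S Q u * spinInr S Q k = spinInr S Q k * spinInl S Q u :=
  SpinC.inl_mul_inr_comm u (S.lift k)

/-- Both inclusions are restrictions of linear maps of Clifford algebras, and multiplication
preserves smoothness in finite dimension. -/
theorem smoothInto_spin {B : Type*} [NormedAddCommGroup B] [NormedSpace ℝ B] {H : Type*}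
    [TopologicalSpace H] {J : ModelWithCorners ℝ B H} {Z : Type*} [TopologicalSpace Z]
    [ChartedSpace H Z] {u : Z → SpinC Q} {k : Z → K} {t : Set Z}
    (hu : SmoothInto J (fun z => ((u z : (CCl Q)ˣ) : CCl Q)) t)
    (hk : ContMDiffOn J 𝓘(ℝ, EK) ∞ k t) :
    SmoothInto J (fun z => (((spinInl S Q (u z) * spinInr S Q (k z) :
      SpinC (Q.prod S.Q)) : (CCl (Q.prod S.Q))ˣ) : CCl (Q.prod S.Q))) t := by
  have h1 := hu.map (Algebra.TensorProduct.map (AlgHom.id ℝ ℂ)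
    (CliffordAlgebra.map (QuadraticMap.Isometry.inl Q S.Q))).toLinearMap
  have h2 := ((S.lift_smooth.comp hk (mapsTo_univ _ _)).map
    (Algebra.TensorProduct.includeRight : CliffordAlgebra S.Q →ₐ[ℝ] CCl S.Q).toLinearMap).map
    (Algebra.TensorProduct.map (AlgHom.id ℝ ℂ)
    (CliffordAlgebra.map (QuadraticMap.Isometry.inr Q S.Q))).toLinearMap
  exact h1.mul h2

namespace AssocAtlas

/-- The element of the model fibre `Spin^c(V ⊕ 𝔭)` that corresponds to `[g, [p, 1]]`. -/
def spinVal (g : G) (p : P.Total) : SpinC (Q.prod S.Q) :=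
  spinInl S Q (P.coord (aP.tot (A.r.ρ g) p)) * spinInr S Q (A.r.ρ g)

/-- `u ∈ Spin^c(V)` commutes past the factor in `Spin(𝔭)` contributed by `ρ(g)`. -/
theorem spinVal_act (g : G) {n : N} (p : P.Fiber n) (u : SpinC Q) :
    A.spinVal aP g ⟨n, P.act p u⟩ = A.spinVal aP g ⟨n, p⟩ * spinInl S Q u := by
  have h : aP.tot (A.r.ρ g) ⟨n, P.act p u⟩ =
      ⟨A.r.ρ g • n, P.act (aP.lact (A.r.ρ g) p) u⟩ :=
    congrArg (Sigma.mk _) (aP.lact_act (A.r.ρ g) p u)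
  rw [spinVal, h, P.coord_act, map_mul, mul_assoc, spinInl_mul_spinInr, ← mul_assoc]
  rfl

/-- Equivariance of `ρ` acts twice: it makes the coordinates in `P` agree, and it leaves the factor
of `k⁻¹` that cancels against the one of `k`. -/
theorem spinVal_tot (g : G) (k : K) (p : P.Total) :
    A.spinVal aP (g * (k : G)⁻¹) (aP.tot k p) * spinInr S Q k = A.spinVal aP g p := by
  rw [spinVal, spinVal, ← aP.tot_mul, A.r.map_mul_inv, inv_mul_cancel_right, mul_assoc, ← map_mul,
    inv_mul_cancel_right]

theorem spinVal_rep (m : AssocSpace K N) : A.spinVal aP (A.rG m) ⟨A.rN m, P.pt (A.rN m)⟩ = 1 := by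
  rw [spinVal, A.r.ρ_repG, map_one, mul_one, aP.tot_one, P.coord_pt, map_one]

/-- The action of `g` between the fibres, in terms of the model fibre. -/
def spinShift (h : G) (m : AssocSpace K N) : SpinC (Q.prod S.Q) :=
  A.spinVal aP (h * A.rG m) ⟨A.rN m, P.pt (A.rN m)⟩

/-- Right multiplications by `Spin^c(V)` and by the image of `K` commute with the left action of
`h`. It therefore suffices to move the chosen point over the preferred representative, and the
action in the model fibre is left multiplication by its new value. -/
theorem spinShift_mul (h g : G) (p : P.Total) :
    A.spinShift aP h (assocMk K (g, p.1)) * A.spinVal aP g p = A.spinVal aP (h * g) p := by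
  rw [← A.spinVal_tot aP (h * g) (A.r.ρ g) p]
  have h1 : (aP.tot (A.r.ρ g) p) = ⟨A.r.ρ g • p.1,
      P.act (P.pt (A.r.ρ g • p.1)) (P.coord (aP.tot (A.r.ρ g) p))⟩ := by
    rw [show aP.tot (A.r.ρ g) p = ⟨A.r.ρ g • p.1, (aP.tot (A.r.ρ g) p).2⟩ from rfl]
    exact congrArg (Sigma.mk _) (P.act_coord (aP.tot (A.r.ρ g) p)).symm
  conv_rhs => rw [h1]
  rw [A.spinVal_act, mul_assoc, mul_assoc h g]
  rfl

/-- The domain of the local section of the induced principal bundle that is defined by a chart and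
a local section of the given principal bundle. -/
def spinDom (m₀ : AssocSpace K N) (c : Set N × ∀ n, P.Fiber n) : Set (AssocSpace K N) :=
  (extChartAt 𝓘(ℝ, V × S.𝔭) m₀).source ∩ {m | (A.loc m₀ m).2 ∈ c.1}

theorem isOpen_spinDom (m₀ : AssocSpace K N) {c : Set N × ∀ n, P.Fiber n} (hc : IsOpen c.1) :
    IsOpen (A.spinDom m₀ c) := by
  rw [isOpen_iff_mem_nhds]
  intro m hm
  exact Filter.inter_mem (extChartAt_source_nhds hm.1)
    ((A.loc_smooth hm.1).snd.continuousAt.preimage_mem_nhds (hc.mem_nhds hm.2))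

/-- The local section of the induced principal bundle. -/
def spinSec (m₀ : AssocSpace K N) (c : Set N × ∀ n, P.Fiber n) (m : AssocSpace K N) :
    SpinC (Q.prod S.Q) :=
  A.spinVal aP (A.loc m₀ m).1 ⟨(A.loc m₀ m).2, c.2 (A.loc m₀ m).2⟩

/-- The transition function between a local section of the given principal bundle and one of the
induced principal bundle. -/
theorem exists_spinTrans (m₀ : AssocSpace K N) {c d : Set N × ∀ n, P.Fiber n} (hc : c ∈ P.atlas)
    (hd : d ∈ P.atlas) : ∃ u : G × N → SpinC (Q.prod S.Q),
    (∀ y : G × N, y.2 ∈ c.1 → assocMk K y ∈ A.spinDom m₀ d →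
      A.spinVal aP y.1 ⟨y.2, c.2 y.2⟩ = A.spinSec aP m₀ d (assocMk K y) * u y) ∧
    SmoothInto (𝓘(ℝ, EG).prod 𝓘(ℝ, V))
        (fun y => (((u y : (CCl (Q.prod S.Q))ˣ)) : CCl (Q.prod S.Q)))
        {y : G × N | y.2 ∈ c.1 ∧ assocMk K y ∈ A.spinDom m₀ d} := by
  obtain ⟨u, hu1, hu2⟩ := aP.smooth c hc d hd
  -- With `κ = kap m₀ g`, pass to the representative over `(g κ⁻¹, κ n)`. There `κ c(n) = d(κ n)
  -- u(κ, n)`, and the change of representative contributes the factor of `κ` in `Spin(𝔭)`.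
  refine ⟨fun y => spinInl S Q (u (A.kap m₀ y.1, y.2)) * spinInr S Q (A.kap m₀ y.1), ?_, ?_⟩
  · rintro ⟨g, n⟩ hn hm
    dsimp only at hn ⊢
    have hloc := A.loc_mk (A.mk_mem_source.1 hm.1)
    have hd' : A.kap m₀ g • n ∈ d.1 := by
      have := hm.2
      rwa [mem_ofPred_eq, hloc] at this
    have h1 := hu1 (A.kap m₀ g, n) hn hd'
    rw [← A.spinVal_tot aP g (A.kap m₀ g)]
    rw [show aP.tot (A.kap m₀ g) ⟨n, c.2 n⟩ = ⟨A.kap m₀ g • n, aP.lact (A.kap m₀ g) (c.2 n)⟩ from rfl,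
      h1, A.spinVal_act, spinSec, hloc, mul_assoc]
  · have hk : ContMDiffOn (𝓘(ℝ, EG).prod 𝓘(ℝ, V)) 𝓘(ℝ, EK) ∞ (fun y : G × N => A.kap m₀ y.1)
        {y : G × N | y.2 ∈ c.1 ∧ assocMk K y ∈ A.spinDom m₀ d} := by
      intro y hy
      exact (ContMDiffAt.comp (I' := 𝓘(ℝ, EG)) (g := A.kap m₀) y
        (A.kap_smooth (A.mk_mem_source.1 hy.2.1)) contMDiffAt_fst).contMDiffWithinAt
    apply smoothInto_spin _ hk
    apply hu2.comp (h := fun y : G × N => (A.kap m₀ y.1, y.2)) (hk.prodMk contMDiffOn_snd)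
    rintro ⟨g, n⟩ ⟨hn, hm⟩
    refine ⟨hn, ?_⟩
    have := hm.2
    rwa [mem_ofPred_eq, A.loc_mk (A.mk_mem_source.1 hm.1)] at this

/-- The frame of the tangent space given by an element of the model fibre. -/
def spinFrame (P : SpincStructure.{wP} V N Q) (m : AssocSpace K N) (z : SpinC (Q.prod S.Q)) :
    (V × S.𝔭) ≃L[ℝ] (V × S.𝔭) :=
  (SpinC.rotEquiv z).toContinuousLinearEquiv.trans
    ((P.frameL (P.pt (A.rN m))).prodCongr (ContinuousLinearEquiv.refl ℝ S.𝔭))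

theorem spinFrame_mul (m : AssocSpace K N) (z u : SpinC (Q.prod S.Q)) (w : V × S.𝔭) :
    A.spinFrame P m (z * u) w = A.spinFrame P m z (SpinC.rot u w) := by
  have : SpinC.rotEquiv (z * u) w = SpinC.rotEquiv z (SpinC.rot u w) := SpinC.rot_mul z u w
  simp only [spinFrame, ContinuousLinearEquiv.trans_apply, LinearEquiv.coe_toContinuousLinearEquiv']
  rw [this]

/-- The factor of `ρ(g)` rotates `X` to `Ad(ρ(g))X`, and the coordinate of `ρ(g) p` rotates `v` to
its value in the chosen frame. Equivariance of the frame of `P` turns this into the expression for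
`Tq` at the preferred representative. -/
theorem spinFrame_spinVal (g : G) {n : N} (p : P.Fiber n) (v : V) (X : S.𝔭) :
    A.spinFrame P (assocMk K (g, n)) (A.spinVal aP g ⟨n, p⟩) (v, X) =
      dq S (g, n) (lvec (X : EG) g, P.frameL p v) := by
  have h1 : SpinC.rot (spinInr S Q (A.r.ρ g)) (v, X) = (v, ⟨_, S.Ad_mem (A.r.ρ g) X⟩) :=
    (rotates_inr (S.lift (A.r.ρ g)) (S.lift_covers (A.r.ρ g) X) v).eq_rot
  have h2 := (SpinC.rotates_inl (Q' := S.Q) (P.coord (aP.tot (A.r.ρ g) ⟨n, p⟩)) v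
    (⟨_, S.Ad_mem (A.r.ρ g) X⟩ : S.𝔭)).eq_rot
  rw [spinVal, A.spinFrame_mul, h1]
  have h3 : ((SpinC.rotEquiv (spinInl S Q (P.coord (aP.tot (A.r.ρ g) ⟨n, p⟩))))
    (v, (⟨_, S.Ad_mem (A.r.ρ g) X⟩ : S.𝔭))) = _ := h2
  simp only [spinFrame, ContinuousLinearEquiv.trans_apply, LinearEquiv.coe_toContinuousLinearEquiv']
  rw [h3, A.dq_mk_rep]
  refine Prod.ext ?_ rfl
  have h4 := P.frame_act_rot (P.pt (A.r.ρ g • n)) (P.coord (aP.tot (A.r.ρ g) ⟨n, p⟩)) v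
  have h5 : P.act (P.pt (A.r.ρ g • n)) (P.coord (aP.tot (A.r.ρ g) ⟨n, p⟩)) =
    aP.lact (A.r.ρ g) p := P.act_coord (aP.tot (A.r.ρ g) ⟨n, p⟩)
  rw [h5, aP.frame_lact] at h4
  exact h4.symm

/-- The left-invariant field is the tangent map of the multiplication applied to the smooth family
of vectors `(0_g, X)` at `(g, 1)`. -/
theorem contMDiff_lvec (X : EG) : ContMDiff 𝓘(ℝ, EG) 𝓘(ℝ, EG).tangent ∞
    (fun g : G => (⟨g, leftVec X g⟩ : TangentBundle 𝓘(ℝ, EG) G)) := by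
  have h1 := ContMDiff.contMDiff_tangentMap (m := ∞) (contMDiff_mul 𝓘(ℝ, EG) ∞ (G := G)) (by simp)
  have h2 : ContMDiff 𝓘(ℝ, EG) 𝓘(ℝ, EG).tangent ∞
      (fun g : G => (⟨g, 0⟩ : TangentBundle 𝓘(ℝ, EG) G)) :=
    Bundle.contMDiff_zeroSection ℝ (TangentSpace 𝓘(ℝ, EG) (M := G))
  have h3 : ContMDiff 𝓘(ℝ, EG) 𝓘(ℝ, EG).tangent ∞
      (fun _ : G => (⟨1, X⟩ : TangentBundle 𝓘(ℝ, EG) G)) := contMDiff_const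
  have h4 := h1.comp ((contMDiff_equivTangentBundleProd_symm (n := ∞) (I := 𝓘(ℝ, EG))
    (I' := 𝓘(ℝ, EG)) (M := G) (M' := G)).comp (h2.prodMk h3))
  refine h4.congr fun g => ?_
  have h5 := tder_prod (I := 𝓘(ℝ, EG)) (I' := 𝓘(ℝ, EG)) (I'' := 𝓘(ℝ, EG))
    (f := fun p : G × G => p.1 * p.2) (p := (g, 1))
    ((contMDiff_mul 𝓘(ℝ, EG) ∞ (G := G)).mdifferentiable (by simp) (g, 1)) 0 X
  rw [map_zero, zero_add] at h5
  have h6 : ∀ (y : G) (u : EG), y = g → u = lvec X g →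
      (⟨g, leftVec X g⟩ : TangentBundle 𝓘(ℝ, EG) G) = ⟨y, u⟩ := by
    rintro y u rfl rfl
    rfl
  exact h6 _ _ (mul_one g) h5

include A in
-- The tangent map of the smooth map `q` is smooth on `T(G × N)`, and this is identified smoothly
-- with `TG × TN`.
theorem contMDiffAt_dq {B : Type*} [NormedAddCommGroup B] [NormedSpace ℝ B] {H : Type*}
    [TopologicalSpace H] {J : ModelWithCorners ℝ B H} {Z : Type*} [TopologicalSpace Z]
    [ChartedSpace H Z] {a : Z → G} {b : Z → N} {ξ : Z → EG} {v : Z → V} {z : Z}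
    (ha : ContMDiffAt J 𝓘(ℝ, EG).tangent ∞
      (fun z => (⟨a z, ξ z⟩ : TangentBundle 𝓘(ℝ, EG) G)) z)
    (hb : ContMDiffAt J 𝓘(ℝ, V).tangent ∞
      (fun z => (⟨b z, v z⟩ : TangentBundle 𝓘(ℝ, V) N)) z) :
    ContMDiffAt J 𝓘(ℝ, V × S.𝔭).tangent ∞ (fun z =>
      (⟨assocMk K (a z, b z), dq S (a z, b z) (ξ z, v z)⟩ :
        TangentBundle 𝓘(ℝ, V × S.𝔭) (AssocSpace K N))) z := by
  have : IsManifold 𝓘(ℝ, EG) ∞ G := inferInstance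
  have h1 := ContMDiff.contMDiff_tangentMap (m := ∞) A.contMDiff_mk (by simp)
  have h2 := ContMDiffAt.comp z (contMDiff_equivTangentBundleProd_symm (n := ∞) (I := 𝓘(ℝ, EG))
    (I' := 𝓘(ℝ, V)) (M := G) (M' := N) _) (ha.prodMk hb)
  exact ContMDiffAt.comp z (h1 _) h2

/-- The induced `Spin^c`-structure on `G ×_K N`. -/
def spincStructure : SpincStructure.{max wP uEG uG uV uN} (V × S.𝔭) (AssocSpace K N)
    (Q.prod S.Q) where
  Fiber _ := ULift.{max wP uG uN} (SpinC (Q.prod S.Q))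
  act p u := ⟨p.down * u⟩
  act_one p := by simp
  act_mul p u u' := by simp [mul_assoc]
  simply_transitive p p' := ⟨p.down⁻¹ * p'.down, by simp, fun u hu => by
    rw [eq_inv_mul_iff_mul_eq]; exact congrArg ULift.down hu⟩
  atlas := {s | ∃ m₀, ∃ c ∈ P.atlas, s = (A.spinDom m₀ c, fun m => ⟨A.spinSec aP m₀ c m⟩)}
  atlas_open := by
    rintro _ ⟨m₀, c, hc, rfl⟩
    exact A.isOpen_spinDom m₀ (P.atlas_open c hc)
  atlas_cover m := by
    obtain ⟨c, hc, hm⟩ := P.atlas_cover (A.rN m)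
    refine ⟨_, ⟨m, c, hc, rfl⟩, mem_extChartAt_source m, ?_⟩
    rw [mem_ofPred_eq, A.loc_self]
    exact hm
  atlas_compatible := by
    rintro _ ⟨m₀, c, hc, rfl⟩ _ ⟨m₁, d, hd, rfl⟩
    -- The second local section is itself a value of `[g, [d, 1]]` along `loc m₁`, so its comparison
    -- with the first one is the known transition function evaluated on `loc m₁`.
    obtain ⟨u, hu1, hu2⟩ := A.exists_spinTrans aP m₀ hd hc
    refine ⟨fun m => u (A.loc m₁ m), ?_, ?_⟩
    · rintro m ⟨hm, hm'⟩
      have h := hu1 (A.loc m₁ m) hm'.2 (by rw [A.mk_loc hm'.1]; exact hm)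
      rw [A.mk_loc hm'.1] at h
      exact congrArg ULift.up h
    · refine hu2.comp (fun m hm => (A.loc_smooth hm.2.1).contMDiffWithinAt) ?_
      intro m hm
      exact ⟨hm.2.2, by rw [A.mk_loc hm.2.1]; exact hm.1⟩
  frame {m} p := A.spinFrame P m p.down
  frame_act p u v w h := by
    rw [← h.eq_rot]
    exact A.spinFrame_mul _ _ _ _
  frame_smooth := by
    rintro _ ⟨m₀, c, hc, rfl⟩ ⟨v, X⟩ m hm
    apply ContMDiffAt.contMDiffWithinAt
    have hs := A.loc_smooth hm.1
    have h1 := ContMDiffAt.comp (I' := 𝓘(ℝ, EG)) m (contMDiff_lvec (G := G) (X : EG) _) hs.fst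
    have h2 := ContMDiffAt.comp (I' := 𝓘(ℝ, V)) m
      ((P.frame_smooth c hc v).contMDiffAt ((P.atlas_open c hc).mem_nhds hm.2)) hs.snd
    refine (A.contMDiffAt_dq h1 h2).congr_of_eventuallyEq ?_
    filter_upwards [(A.isOpen_spinDom m₀ (P.atlas_open c hc)).mem_nhds hm] with x hx
    have h3 := A.spinFrame_spinVal aP (A.loc m₀ x).1 (c.2 (A.loc m₀ x).2) v X
    have h4 : assocMk K ((A.loc m₀ x).1, (A.loc m₀ x).2) = x := A.mk_loc hx.1
    have h5 : ∀ y, y = x → dq S ((A.loc m₀ x).1, (A.loc m₀ x).2)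
        (lvec (X : EG) (A.loc m₀ x).1, P.frameL (c.2 (A.loc m₀ x).2) v) =
          A.spinFrame P y (A.spinSec aP m₀ c x) (v, X) →
        (⟨x, A.spinFrame P x (A.spinSec aP m₀ c x) (v, X)⟩ :
          TangentBundle 𝓘(ℝ, V × S.𝔭) (AssocSpace K N)) =
        ⟨y, dq S ((A.loc m₀ x).1, (A.loc m₀ x).2)
        (lvec (X : EG) (A.loc m₀ x).1, P.frameL (c.2 (A.loc m₀ x).2) v)⟩ := by
      rintro y rfl h
      rw [h]
    exact h5 _ h4 h3.symm

/-- The map `P_n → P^M_{[g, n]}`, `p ↦ [g, [p, 1]]`. -/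
def spinMk (g : G) {n : N} (p : P.Fiber n) : (A.spincStructure aP).Fiber (assocMk K (g, n)) :=
  ⟨A.spinVal aP g ⟨n, p⟩⟩

theorem spinTotal_ext {m m' : AssocSpace K N} (h : m = m') {z z' : SpinC (Q.prod S.Q)}
    (hz : z = z') : (⟨m, ⟨z⟩⟩ : (A.spincStructure aP).Total) = ⟨m', ⟨z'⟩⟩ := by
  subst h; subst hz; rfl

/-- The action of `G` on the induced principal bundle. -/
def spincAction : (A.spincStructure aP).Action EG G where
  lact h {m} p := ⟨A.spinShift aP h m * p.down⟩
  lact_one {m} p := by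
    obtain ⟨p⟩ := p
    refine A.spinTotal_ext aP (one_smul _ _) ?_
    change A.spinShift aP 1 m * p = p
    rw [spinShift, one_mul, A.spinVal_rep, one_mul]
  lact_mul h k {m} p := by
    obtain ⟨p⟩ := p
    refine A.spinTotal_ext aP (mul_smul _ _ _) ?_
    change A.spinShift aP (h * k) m * p =
      A.spinShift aP h (k • m) * (A.spinShift aP k m * p)
    have h1 := A.spinShift_mul aP h (k * A.rG m) ⟨A.rN m, P.pt (A.rN m)⟩
    dsimp only at h1
    rw [← smul_assocMk, A.mk_rep] at h1
    rw [← mul_assoc, spinShift, mul_assoc h k, ← h1]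
    rfl
  lact_act h {m} p u := by
    obtain ⟨p⟩ := p
    exact congrArg ULift.up (mul_assoc _ _ _).symm
  frame_lact h {m} p w := by
    obtain ⟨p⟩ := p
    change A.spinFrame P (h • m) (A.spinShift aP h m * p) w = _
    rw [A.spinFrame_mul]
    have h1 : ∀ w : V × S.𝔭, A.spinFrame P (h • m) (A.spinShift aP h m) w =
        tder 𝓘(ℝ, V × S.𝔭) 𝓘(ℝ, V × S.𝔭) (fun m : AssocSpace K N => h • m) m
          (A.spinFrame P m 1 w) := by
      rintro ⟨v, X⟩
      have e1 := A.spinFrame_spinVal aP (h * A.rG m) (P.pt (A.rN m)) v X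
      have e2 := A.spinFrame_spinVal aP (A.rG m) (P.pt (A.rN m)) v X
      rw [A.spinVal_rep, A.mk_rep] at e2
      rw [← smul_assocMk, A.mk_rep] at e1
      have e3 := A.tder_smul_dq h (A.rG m) (A.rN m) X (P.frameL (P.pt (A.rN m)) v)
      rw [A.mk_rep] at e3
      rw [e2, e3]
      exact e1
    rw [h1, ← A.spinFrame_mul, one_mul]
    rfl
  smooth := by
    rintro _ ⟨m₀, c, hc, rfl⟩ _ ⟨m₁, d, hd, rfl⟩
    obtain ⟨u, hu1, hu2⟩ := A.exists_spinTrans aP m₁ hc hd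
    refine ⟨fun y => u (y.1 * (A.loc m₀ y.2).1, (A.loc m₀ y.2).2), ?_, ?_⟩
    · rintro ⟨h, m⟩ hm hm'
      dsimp only at hm hm'
      have hmk : assocMk K ((A.loc m₀ m).1, (A.loc m₀ m).2) = m := A.mk_loc hm.1
      have e1 := hu1 (h * (A.loc m₀ m).1, (A.loc m₀ m).2) hm.2
        (by rw [← smul_assocMk, hmk]; exact hm')
      rw [← smul_assocMk, hmk] at e1
      have e2 := A.spinShift_mul aP h (A.loc m₀ m).1 ⟨(A.loc m₀ m).2, c.2 (A.loc m₀ m).2⟩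
      dsimp only at e2
      rw [hmk, e1] at e2
      exact congrArg ULift.up e2
    · have hl : ContMDiffOn (𝓘(ℝ, EG).prod 𝓘(ℝ, V × S.𝔭)) (𝓘(ℝ, EG).prod 𝓘(ℝ, V)) ∞
          (fun y : G × AssocSpace K N => A.loc m₀ y.2)
          {y | y.2 ∈ A.spinDom m₀ c ∧ y.1 • y.2 ∈ A.spinDom m₁ d} := by
        intro y hy
        exact (ContMDiffAt.comp (I' := 𝓘(ℝ, V × S.𝔭)) (g := A.loc m₀) y (A.loc_smooth hy.1.1)
          contMDiffAt_snd).contMDiffWithinAt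
      refine hu2.comp (h := fun y : G × AssocSpace K N =>
        (y.1 * (A.loc m₀ y.2).1, (A.loc m₀ y.2).2)) ((contMDiffOn_fst.mul
          (contMDiff_fst.comp_contMDiffOn hl)).prodMk (contMDiff_snd.comp_contMDiffOn hl)) ?_
      rintro ⟨h, m⟩ ⟨hm, hm'⟩
      have hmk : assocMk K ((A.loc m₀ m).1, (A.loc m₀ m).2) = m := A.mk_loc hm.1
      refine ⟨hm.2, ?_⟩
      dsimp only
      rw [← smul_assocMk, hmk]
      exact hm'

variable {L : HermitianLineBundle.{wL} V N} {aL : L.Action EK K} (di : P.DetIso L aP aL)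

theorem detIso_iso_act {n : N} (p : P.Fiber n) (u : SpinC Q) (c : ℂ) :
    di.iso (P.act p u) c = di.iso p (SpinC.det u * c) :=
  di.iso_act p u _ (SpinC.hasDet_det u) c

/-- The isomorphism of the determinant line bundle, in terms of the model fibres. -/
def detVal (m : AssocSpace K N) (z : SpinC (Q.prod S.Q)) : ℂ ≃ₗ[ℂ] LineModel.{wL} :=
  (LinearEquiv.smulOfNeZero ℂ ℂ (SpinC.det z : ℂ) (Circle.coe_ne_zero _)).trans
    ((di.iso (P.pt (A.rN m))).trans (A.lineIso aL (A.rG m) (A.rN m)).toLinearEquiv)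

theorem detVal_apply (m : AssocSpace K N) (z : SpinC (Q.prod S.Q)) (c : ℂ) :
    A.detVal aP di m z c =
      A.lineIso aL (A.rG m) (A.rN m) (di.iso (P.pt (A.rN m)) (SpinC.det z * c)) := rfl

theorem detVal_mul (m : AssocSpace K N) (z u : SpinC (Q.prod S.Q)) (c : ℂ) :
    A.detVal aP di m (z * u) c = A.detVal aP di m z (SpinC.det u * c) := by
  have h : ((SpinC.det (z * u) : Circle) : ℂ) = (SpinC.det z : Circle) * (SpinC.det u : Circle) := by
    rw [map_mul, Circle.coe_mul]
  rw [detVal_apply, detVal_apply, h, mul_assoc]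

/-- The determinant is trivial on `Spin(𝔭)`, so only the coordinate of `ρ(g) p` contributes. The
rest is equivariance of the isomorphism on `N`. -/
theorem detVal_spinVal (g : G) {n : N} (p : P.Fiber n) (c : ℂ) :
    A.detVal aP di (assocMk K (g, n)) (A.spinVal aP g ⟨n, p⟩) c =
      A.lineIso aL g n (di.iso p c) := by
  have h1 : SpinC.det (A.spinVal aP g ⟨n, p⟩) = SpinC.det (P.coord (aP.tot (A.r.ρ g) ⟨n, p⟩)) := by
    rw [spinVal, map_mul, SpinC.det_map]
    change _ * SpinC.det (SpinC.map _ (spinToSpinC S.Q (S.lift (A.r.ρ g)))) = _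
    rw [SpinC.det_map, SpinC.det_spinToSpinC, mul_one]
  have h5 : P.act (P.pt (A.r.ρ g • n)) (P.coord (aP.tot (A.r.ρ g) ⟨n, p⟩)) =
    aP.lact (A.r.ρ g) p := P.act_coord (aP.tot (A.r.ρ g) ⟨n, p⟩)
  have h6 := detIso_iso_act aP di (P.pt (A.r.ρ g • n)) (P.coord (aP.tot (A.r.ρ g) ⟨n, p⟩)) c
  rw [h5, di.iso_lact] at h6
  have h7 := A.lineIso_tot aL g (A.r.ρ g) ⟨n, di.iso p c⟩
  rw [detVal_apply, h1]
  refine Eq.trans ?_ h7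
  exact congrArg (A.lineIso aL (g * (A.r.ρ g : G)⁻¹) (A.r.ρ g • n)) h6.symm

/-- The isomorphism of the determinant line bundle of the induced `Spin^c`-structure with the
induced line bundle. -/
def detIso : (A.spincStructure aP).DetIso (A.lineBundle aL) (A.spincAction aP)
    (A.lineAction aL) where
  iso {m} p := A.detVal aP di m p.down
  iso_act {m} p u d hd c := by
    rw [hd.eq_det]
    exact A.detVal_mul aP di m p.down u c
  iso_lact h {m} p c := by
    obtain ⟨p⟩ := p
    change A.detVal aP di (h • m) (A.spinShift aP h m * p) c =
      A.lineAct aL h m (A.detVal aP di m p c)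
    have h1 := A.detVal_spinVal aP di (h * A.rG m) (P.pt (A.rN m)) (SpinC.det p * c)
    rw [← smul_assocMk, A.mk_rep] at h1
    rw [A.detVal_mul]
    refine h1.trans ?_
    rw [detVal_apply]
    exact congrArg (A.lineIso aL (h * A.rG m) (A.rN m))
      ((A.lineIso aL (A.rG m) (A.rN m)).symm_apply_apply _).symm
  smooth := by
    rintro _ ⟨m₀, c, hc, rfl⟩ m hm
    apply ContMDiffAt.contMDiffWithinAt
    have hs := A.loc_smooth hm.1
    have h2 := ContMDiffAt.comp (I' := 𝓘(ℝ, V)) m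
      ((di.smooth c hc).contMDiffAt ((P.atlas_open c hc).mem_nhds hm.2)) hs.snd
    have h3 := ContMDiffAt.comp (I' := 𝓘(ℝ, EG).prod (𝓘(ℝ, V).prod 𝓘(ℝ, ℂ))) m
      (A.lineQ_smooth aL _) (hs.fst.prodMk h2)
    refine h3.congr_of_eventuallyEq ?_
    filter_upwards [(A.isOpen_spinDom m₀ (P.atlas_open c hc)).mem_nhds hm] with x hx
    have h4 : assocMk K ((A.loc m₀ x).1, (A.loc m₀ x).2) = x := A.mk_loc hx.1
    have h5 := A.detVal_spinVal aP di (A.loc m₀ x).1 (c.2 (A.loc m₀ x).2) 1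
    rw [h4] at h5
    exact A.total_ext aL h4.symm h5

end AssocAtlas

end InducedSpinc

end PreHam

namespace PreHam

/-! ### Extension of local sections by cut-off functions. -/

section Extension

variable {V : Type*} [NormedAddCommGroup V] [NormedSpace ℝ V] [FiniteDimensional ℝ V]
  {M : Type*} [TopologicalSpace M] [ChartedSpace V M] [IsManifold 𝓘(ℝ, V) ∞ M] [T2Space M]
  (F : Type*) [NormedAddCommGroup F] [NormedSpace ℝ F] (E : M → Type*)
  [TopologicalSpace (TotalSpace F E)] [∀ x, AddCommGroup (E x)] [∀ x, Module ℝ (E x)]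
  [∀ x, TopologicalSpace (E x)] [FiberBundle F E] [VectorBundle ℝ F E]
  [ContMDiffVectorBundle ∞ F E 𝓘(ℝ, V)]

/-- A locally constant section of a vector bundle extends to a smooth global section. -/
theorem exists_smooth_extension (x : M) (f : F) : ∃ s : ∀ x, E x,
    ContMDiff 𝓘(ℝ, V) (𝓘(ℝ, V).prod 𝓘(ℝ, F)) ∞ (fun x => (⟨x, s x⟩ : TotalSpace F E)) ∧
      ∀ᶠ y in 𝓝 x, s y = (trivializationAt F E x).symm y f := by
  obtain ⟨ψ, -, hψ⟩ := (SmoothBumpFunction.nhds_basis_tsupport (I := 𝓘(ℝ, V)) x).mem_iff.1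
    ((trivializationAt F E x).open_baseSet.mem_nhds (FiberBundle.mem_baseSet_trivializationAt' x))
  refine ⟨(ψ : M → ℝ) • fun y => (trivializationAt F E x).symm y f, ?_, ?_⟩
  · refine ContMDiffOn.smul_section_of_tsupport (ψ.contMDiff.contMDiffOn)
      (trivializationAt F E x).open_baseSet hψ ?_
    intro y hy
    apply ContMDiffAt.contMDiffWithinAt
    refine ((trivializationAt F E x).contMDiffAt_iff
      ((trivializationAt F E x).mem_source.2 hy)).2 ⟨contMDiffAt_id, ?_⟩
    refine (contMDiffAt_const (c := f)).congr_of_eventuallyEq ?_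
    filter_upwards [(trivializationAt F E x).open_baseSet.mem_nhds hy] with z hz
    exact congrArg Prod.snd ((trivializationAt F E x).apply_mk_symm hz f)
  · filter_upwards [ψ.eventuallyEq_one] with y hy
    have : ψ y • (trivializationAt F E x).symm y f = (trivializationAt F E x).symm y f := by
      rw [hy]; exact one_smul _ _
    exact this

/-- A vector in a fibre extends to a smooth global section. -/
theorem exists_smooth_section (x : M) (f : E x) : ∃ s : ∀ x, E x,
    ContMDiff 𝓘(ℝ, V) (𝓘(ℝ, V).prod 𝓘(ℝ, F)) ∞ (fun x => (⟨x, s x⟩ : TotalSpace F E)) ∧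
      s x = f := by
  obtain ⟨s, h, h'⟩ := exists_smooth_extension (V := V) F E x (trivializationAt F E x ⟨x, f⟩).2
  refine ⟨s, h, h'.self_of_nhds.trans ?_⟩
  exact (trivializationAt F E x).symm_apply_apply_mk (FiberBundle.mem_baseSet_trivializationAt' x) f

end Extension

namespace HermitianLineBundle

universe w

/-! ### Sections of `L` and of `Hom(TM, L)` in charts and trivialisations. -/

section Coordinates

variable {V : Type*} [NormedAddCommGroup V] [NormedSpace ℝ V]
  {M : Type*} [TopologicalSpace M] [ChartedSpace V M] [IsManifold 𝓘(ℝ, V) ∞ M]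
  (L : HermitianLineBundle.{w} V M)

/-- The fibre coordinate of the preferred trivialisation around `x₀`. -/
def co (x₀ : M) (l : L.Total) : ℂ := (L.triv x₀ l).2

/-- The section `s` is differentiable at `x`. -/
abbrev IsDiffAt (s : ∀ x, L.Fiber x) (x : M) : Prop :=
  MDifferentiableAt 𝓘(ℝ, V) (𝓘(ℝ, V).prod 𝓘(ℝ, ℂ)) (fun x => (⟨x, s x⟩ : L.Total)) x

/-- The section `s` in the preferred chart and trivialisation. -/
def lco (x₀ : M) (s : ∀ x, L.Fiber x) (y : V) : ℂ :=
  L.co x₀ ⟨(extChartAt 𝓘(ℝ, V) x₀).symm y, s ((extChartAt 𝓘(ℝ, V) x₀).symm y)⟩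

variable {L}

theorem IsSmoothSection.isDiffAt {s : ∀ x, L.Fiber x} (hs : L.IsSmoothSection s) (x : M) :
    L.IsDiffAt s x := (hs x).mdifferentiableAt (by simp)

theorem co_unit {x₀ x : M} (hx : x ∈ (L.triv x₀).baseSet) : L.co x₀ ⟨x, L.unit x₀ x⟩ = 1 :=
  congrArg Prod.snd (triv_unit hx)

theorem co_smul {x₀ x : M} (hx : x ∈ (L.triv x₀).baseSet) (c : ℂ) (l : L.Fiber x) :
    L.co x₀ ⟨x, c • l⟩ = c * L.co x₀ ⟨x, l⟩ := triv_smul hx c l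

theorem co_smul_real {x₀ x : M} (hx : x ∈ (L.triv x₀).baseSet) (c : ℝ) (l : L.Fiber x) :
    L.co x₀ ⟨x, c • l⟩ = c * L.co x₀ ⟨x, l⟩ := by
  have := co_smul hx (c : ℂ) l
  rwa [Complex.coe_smul] at this

theorem co_add {x₀ x : M} (hx : x ∈ (L.triv x₀).baseSet) (l l' : L.Fiber x) :
    L.co x₀ ⟨x, l + l'⟩ = L.co x₀ ⟨x, l⟩ + L.co x₀ ⟨x, l'⟩ :=
  ((L.triv x₀).linear ℂ hx).map_add l l'

theorem co_sub {x₀ x : M} (hx : x ∈ (L.triv x₀).baseSet) (l l' : L.Fiber x) :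
    L.co x₀ ⟨x, l - l'⟩ = L.co x₀ ⟨x, l⟩ - L.co x₀ ⟨x, l'⟩ :=
  eq_sub_of_add_eq (by rw [← co_add hx, sub_add_cancel])

theorem co_smul_unit {x₀ x : M} (hx : x ∈ (L.triv x₀).baseSet) (l : L.Fiber x) :
    L.co x₀ ⟨x, l⟩ • L.unit x₀ x = l := triv_smul_unit hx l

theorem co_injective {x₀ x : M} (hx : x ∈ (L.triv x₀).baseSet) {l l' : L.Fiber x}
    (h : L.co x₀ ⟨x, l⟩ = L.co x₀ ⟨x, l'⟩) : l = l' := by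
  rw [← co_smul_unit hx l, ← co_smul_unit hx l', h]

variable (L) in
theorem mem_base (x : M) : x ∈ (L.triv x).baseSet := FiberBundle.mem_baseSet_trivializationAt' x

variable (L) in
/-- The fibre coordinate as a continuous linear map. -/
def coL (x₀ : M) (x : M) : L.Fiber x →L[ℝ] ℂ := (L.triv x₀).continuousLinearMapAt ℝ x

theorem coL_apply {x₀ x : M} (hx : x ∈ (L.triv x₀).baseSet) (l : L.Fiber x) :
    L.coL x₀ x l = L.co x₀ ⟨x, l⟩ := by
  rw [coL, Trivialization.continuousLinearMapAt_apply, Trivialization.coe_linearMapAt_of_mem _ hx]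
  rfl

section Maps

variable {B : Type*} [NormedAddCommGroup B] [NormedSpace ℝ B] {H : Type*} [TopologicalSpace H]
  {J : ModelWithCorners ℝ B H} {Z : Type*} [TopologicalSpace Z] [ChartedSpace H Z]

theorem mdifferentiableAt_co {l : L.Total} {x₀ : M} (h : l.proj ∈ (L.triv x₀).baseSet) :
    MDifferentiableAt (𝓘(ℝ, V).prod 𝓘(ℝ, ℂ)) 𝓘(ℝ, ℂ) (L.co x₀) l :=
  ((contMDiffAt_iff (f := fun l : L.Total => l) h).1 contMDiffAt_id).2.mdifferentiableAt (by simp)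

theorem mdifferentiableAt_proj (l : L.Total) :
    MDifferentiableAt (𝓘(ℝ, V).prod 𝓘(ℝ, ℂ)) 𝓘(ℝ, V) (fun l : L.Total => l.proj) l :=
  Bundle.mdifferentiableAt_proj L.Fiber

theorem contMDiff_invTriv {x₀ : M} {p : M × ℂ} (h : p.1 ∈ (L.triv x₀).baseSet) :
    ContMDiffAt (𝓘(ℝ, V).prod 𝓘(ℝ, ℂ)) (𝓘(ℝ, V).prod 𝓘(ℝ, ℂ)) ∞
      (fun p : M × ℂ => (⟨p.1, p.2 • L.unit x₀ p.1⟩ : L.Total)) p := by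
  refine (contMDiffAt_iff (x₀ := x₀) h).2 ⟨contMDiffAt_fst, contMDiffAt_snd.congr_of_eventuallyEq ?_⟩
  filter_upwards [continuousAt_fst.preimage_mem_nhds ((L.triv x₀).open_baseSet.mem_nhds h)] with q hq
  have := co_smul hq q.2 (L.unit x₀ q.1)
  rw [co_unit hq, mul_one] at this
  exact this

/-- For the converse, the map is rebuilt from its base point and its coordinate through the smooth
inverse of the trivialisation. -/
theorem mdifferentiableAt_iff {f : Z → L.Total} {z : Z} {x₀ : M}
    (h : (f z).proj ∈ (L.triv x₀).baseSet) :
    MDifferentiableAt J (𝓘(ℝ, V).prod 𝓘(ℝ, ℂ)) f z ↔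
      MDifferentiableAt J 𝓘(ℝ, V) (fun z => (f z).proj) z ∧
        MDifferentiableAt J 𝓘(ℝ, ℂ) (fun z => L.co x₀ (f z)) z := by
  refine ⟨fun hf => ⟨(mdifferentiableAt_proj (f z)).comp z hf, (mdifferentiableAt_co h).comp z hf⟩,
    fun hf => ?_⟩
  have h1 := MDifferentiableAt.comp z
    ((contMDiff_invTriv (p := ((f z).proj, L.co x₀ (f z))) h).mdifferentiableAt (by simp))
    (hf.1.prodMk hf.2)
  refine h1.congr_of_eventuallyEq ?_
  filter_upwards [hf.1.continuousAt.preimage_mem_nhds ((L.triv x₀).open_baseSet.mem_nhds h)]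
    with y hy
  exact congrArg (TotalSpace.mk (f y).proj) (co_smul_unit hy (f y).snd).symm

end Maps

theorem contDiffAt_lco {s : ∀ x, L.Fiber x} {x₀ : M} {y : V}
    (hy : y ∈ (extChartAt 𝓘(ℝ, V) x₀).target)
    (hb : (extChartAt 𝓘(ℝ, V) x₀).symm y ∈ (L.triv x₀).baseSet)
    (hs : L.IsSmoothSection s) : ContDiffAt ℝ ∞ (L.lco x₀ s) y := by
  have h1 := ContMDiffAt.comp y (hs _) (contMDiffAt_chart_symm hy)
  exact ((contMDiffAt_iff (x₀ := x₀) hb).1 h1).2.contDiffAt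

/-- The linear map `T : T_x M → L_x`, as a map on the model space. -/
def evL {x : M} (T : TangentSpace 𝓘(ℝ, V) x →L[ℝ] L.Fiber x) : V →L[ℝ] L.Fiber x := T

variable (L) in
/-- A section of `Hom(TM, L)` in the preferred chart and trivialisation. -/
def homLoc (T : ∀ x : M, TangentSpace 𝓘(ℝ, V) x →L[ℝ] L.Fiber x) (x₀ : M) (y : V) : V →L[ℝ] ℂ :=
  (L.coL x₀ ((extChartAt 𝓘(ℝ, V) x₀).symm y)).comp
    ((evL (T ((extChartAt 𝓘(ℝ, V) x₀).symm y))).comp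
      (tder 𝓘(ℝ, V) 𝓘(ℝ, V) (extChartAt 𝓘(ℝ, V) x₀).symm y))

theorem homLoc_apply (T : ∀ x : M, TangentSpace 𝓘(ℝ, V) x →L[ℝ] L.Fiber x) {x₀ : M} {y : V}
    (hb : (extChartAt 𝓘(ℝ, V) x₀).symm y ∈ (L.triv x₀).baseSet) (v : V) :
    L.homLoc T x₀ y v = L.co x₀ ⟨(extChartAt 𝓘(ℝ, V) x₀).symm y,
      evL (T ((extChartAt 𝓘(ℝ, V) x₀).symm y))
        (tder 𝓘(ℝ, V) 𝓘(ℝ, V) (extChartAt 𝓘(ℝ, V) x₀).symm y v)⟩ := coL_apply hb _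

/-- Smoothness of a section of `Hom(TM, L)` in terms of charts. -/
theorem contMDiffAt_hom_iff (T : ∀ x : M, TangentSpace 𝓘(ℝ, V) x →L[ℝ] L.Fiber x) {x₀ x : M}
    (hx : x ∈ (extChartAt 𝓘(ℝ, V) x₀).source) (hb : x ∈ (L.triv x₀).baseSet) :
    ContMDiffAt 𝓘(ℝ, V) (𝓘(ℝ, V).prod 𝓘(ℝ, V →L[ℝ] ℂ)) ∞ (fun x => (⟨x, T x⟩ :
      TotalSpace (V →L[ℝ] ℂ) (fun x => TangentSpace 𝓘(ℝ, V) x →L[ℝ] L.Fiber x))) x ↔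
      ContDiffAt ℝ ∞ (L.homLoc T x₀) (extChartAt 𝓘(ℝ, V) x₀ x) := by
  have hxs : x ∈ (chartAt V x₀).source := by simpa using hx
  have hmem : (⟨x, T x⟩ : TotalSpace (V →L[ℝ] ℂ)
      (fun x => TangentSpace 𝓘(ℝ, V) x →L[ℝ] L.Fiber x)) ∈
      (trivializationAt (V →L[ℝ] ℂ)
        (fun x => TangentSpace 𝓘(ℝ, V) x →L[ℝ] L.Fiber x) x₀).source := by
    rw [hom_trivializationAt_source]
    exact ⟨by simpa using hxs, hb⟩
  have h1 := (trivializationAt (V →L[ℝ] ℂ) (fun x => TangentSpace 𝓘(ℝ, V) x →L[ℝ] L.Fiber x)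
    x₀).contMDiffAt_iff (n := ∞) (IB := 𝓘(ℝ, V)) (IM := 𝓘(ℝ, V)) (f := fun x => (⟨x, T x⟩ :
      TotalSpace (V →L[ℝ] ℂ) (fun x => TangentSpace 𝓘(ℝ, V) x →L[ℝ] L.Fiber x))) (x₀ := x) hmem
  rw [h1]
  have h2 : (fun x => (trivializationAt (V →L[ℝ] ℂ)
      (fun x => TangentSpace 𝓘(ℝ, V) x →L[ℝ] L.Fiber x) x₀ (⟨x, T x⟩ : TotalSpace (V →L[ℝ] ℂ)
      (fun x => TangentSpace 𝓘(ℝ, V) x →L[ℝ] L.Fiber x))).2) =ᶠ[𝓝 x]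
      fun x => L.homLoc T x₀ (extChartAt 𝓘(ℝ, V) x₀ x) := by
    filter_upwards [extChartAt_source_nhds hx] with z hz
    have hzs : z ∈ (chartAt V x₀).source := by simpa using hz
    rw [hom_trivializationAt_apply]
    change ContinuousLinearMap.inCoordinates V _ ℂ _ x₀ z x₀ z (T z) = _
    rw [ContinuousLinearMap.inCoordinates, TangentBundle.symmL_trivializationAt hzs, homLoc,
      (extChartAt 𝓘(ℝ, V) x₀).left_inv hz]
    simp only [modelWithCornersSelf_coe, range_id, mfderivWithin_univ]
    rfl
  constructor
  · rintro ⟨-, h⟩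
    have h3 := h.congr_of_eventuallyEq h2.symm
    have hy := (extChartAt 𝓘(ℝ, V) x₀).map_source hx
    have h4 : ContMDiffAt 𝓘(ℝ, V) 𝓘(ℝ, V →L[ℝ] ℂ) ∞
        (fun x => L.homLoc T x₀ (extChartAt 𝓘(ℝ, V) x₀ x))
        ((extChartAt 𝓘(ℝ, V) x₀).symm (extChartAt 𝓘(ℝ, V) x₀ x)) := by
      rwa [(extChartAt 𝓘(ℝ, V) x₀).left_inv hx]
    have h5 := (ContMDiffAt.comp _ h4 (contMDiffAt_chart_symm hy)).contDiffAt
    refine h5.congr_of_eventuallyEq ?_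
    filter_upwards [extChartAt_target_nhds hy] with z hz
    simp only [Function.comp, (extChartAt 𝓘(ℝ, V) x₀).right_inv hz]
  · intro h
    refine ⟨contMDiffAt_id, ContMDiffAt.congr_of_eventuallyEq ?_ h2⟩
    exact ContMDiffAt.comp x h.contMDiffAt (contMDiffAt_chart hx)

end Coordinates

end HermitianLineBundle

end PreHam

namespace PreHam

theorem two_le_infty : (2 : WithTop ℕ∞) ≤ ∞ := WithTop.coe_le_coe.2 (le_top : (2 : ℕ∞) ≤ ⊤)

theorem three_le_infty : (3 : WithTop ℕ∞) ≤ ∞ := WithTop.coe_le_coe.2 (le_top : (3 : ℕ∞) ≤ ⊤)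

/-! ### Vector fields and their brackets in charts. -/

section ChartFields

variable {V : Type*} [NormedAddCommGroup V] [NormedSpace ℝ V]
  {M : Type*} [TopologicalSpace M] [ChartedSpace V M] [IsManifold 𝓘(ℝ, V) ∞ M]

/-- A vector field in the preferred chart at `x₀`. -/
def chartField (x₀ : M) (v : ∀ x : M, TangentSpace 𝓘(ℝ, V) x) (y : V) : V :=
  tder 𝓘(ℝ, V) 𝓘(ℝ, V) (extChartAt 𝓘(ℝ, V) x₀) ((extChartAt 𝓘(ℝ, V) x₀).symm y)
    (v ((extChartAt 𝓘(ℝ, V) x₀).symm y))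

theorem tder_chartField {x₀ : M} {y : V} (hy : y ∈ (extChartAt 𝓘(ℝ, V) x₀).target)
    (v : ∀ x : M, TangentSpace 𝓘(ℝ, V) x) :
    tder 𝓘(ℝ, V) 𝓘(ℝ, V) (extChartAt 𝓘(ℝ, V) x₀).symm y (chartField x₀ v y) =
      v ((extChartAt 𝓘(ℝ, V) x₀).symm y) := by
  have h := tder_symm_chart ((extChartAt 𝓘(ℝ, V) x₀).map_target hy)
    (v ((extChartAt 𝓘(ℝ, V) x₀).symm y))
  rwa [(extChartAt 𝓘(ℝ, V) x₀).right_inv hy] at h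

/-- The chart expression is the fibre coordinate of the field in the trivialisation of the tangent
bundle at `x₀`. -/
theorem contDiffAt_chartField {x₀ : M} {y : V} (hy : y ∈ (extChartAt 𝓘(ℝ, V) x₀).target)
    {v : ∀ x : M, TangentSpace 𝓘(ℝ, V) x} (hv : IsSmoothField v) :
    ContDiffAt ℝ ∞ (chartField x₀ v) y := by
  have hx := (extChartAt 𝓘(ℝ, V) x₀).map_target hy
  have hxs : (extChartAt 𝓘(ℝ, V) x₀).symm y ∈ (chartAt V x₀).source := by simpa using hx
  have h1 := (((trivializationAt V (TangentSpace 𝓘(ℝ, V)) x₀).contMDiffAt_iff (n := ∞)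
    (IB := 𝓘(ℝ, V)) (IM := 𝓘(ℝ, V)) (f := fun x => (⟨x, v x⟩ : TangentBundle 𝓘(ℝ, V) M))
    (x₀ := (extChartAt 𝓘(ℝ, V) x₀).symm y)
    ((trivializationAt V (TangentSpace 𝓘(ℝ, V)) x₀).mem_source.2 (by simpa using hxs))).1 (hv _)).2
  have h2 := (ContMDiffAt.comp y h1 (contMDiffAt_chart_symm hy)).contDiffAt
  refine h2.congr_of_eventuallyEq ?_
  filter_upwards [extChartAt_target_nhds hy] with z hz
  have hzs : (extChartAt 𝓘(ℝ, V) x₀).symm z ∈ (chartAt V x₀).source := by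
    simpa using (extChartAt 𝓘(ℝ, V) x₀).map_target hz
  have h3 := TangentBundle.continuousLinearMapAt_trivializationAt (I := 𝓘(ℝ, V)) hzs
  have h4 := congrArg (fun T : V →L[ℝ] V => T (v ((extChartAt 𝓘(ℝ, V) x₀).symm z))) h3
  refine h4.symm.trans ?_
  have hb : (extChartAt 𝓘(ℝ, V) x₀).symm z ∈
    (trivializationAt V (TangentSpace 𝓘(ℝ, V)) x₀).baseSet := by simpa using hzs
  exact congrFun ((trivializationAt V (TangentSpace 𝓘(ℝ, V)) x₀).coe_linearMapAt_of_mem (R := ℝ) hb)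
    (v ((extChartAt 𝓘(ℝ, V) x₀).symm z))

theorem mpullback_chart_symm {x₀ : M} {y : V} (hy : y ∈ (extChartAt 𝓘(ℝ, V) x₀).target)
    (v : ∀ x : M, TangentSpace 𝓘(ℝ, V) x) :
    VectorField.mpullback 𝓘(ℝ, V) 𝓘(ℝ, V) (extChartAt 𝓘(ℝ, V) x₀).symm v y = chartField x₀ v y := by
  rw [VectorField.mpullback_apply]
  have h1 : (tder 𝓘(ℝ, V) 𝓘(ℝ, V) (extChartAt 𝓘(ℝ, V) x₀).symm y).inverse =
      tder 𝓘(ℝ, V) 𝓘(ℝ, V) (extChartAt 𝓘(ℝ, V) x₀) ((extChartAt 𝓘(ℝ, V) x₀).symm y) := by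
    apply ContinuousLinearMap.inverse_eq
    · ext u
      have h := tder_symm_chart ((extChartAt 𝓘(ℝ, V) x₀).map_target hy) u
      rwa [(extChartAt 𝓘(ℝ, V) x₀).right_inv hy] at h
    · ext u
      exact tder_chart_symm hy u
  exact congrArg (fun T : V →L[ℝ] V => T (v ((extChartAt 𝓘(ℝ, V) x₀).symm y))) h1

/-- The Lie bracket in a chart. -/
theorem chartField_mlieBracket {x₀ : M} {y : V} (hy : y ∈ (extChartAt 𝓘(ℝ, V) x₀).target)
    {v w : ∀ x : M, TangentSpace 𝓘(ℝ, V) x} (hv : IsSmoothField v) (hw : IsSmoothField w)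
    [CompleteSpace V] :
    chartField x₀ (VectorField.mlieBracket 𝓘(ℝ, V) v w) y =
      fderiv ℝ (chartField x₀ w) y (chartField x₀ v y) -
        fderiv ℝ (chartField x₀ v) y (chartField x₀ w y) := by
  have : IsManifold 𝓘(ℝ, V) (minSmoothness ℝ 3) M := IsManifold.of_le (n := ∞) (by simpa using three_le_infty)
  have h1 := VectorField.mpullback_mlieBracket (n := ∞) (I := 𝓘(ℝ, V)) (I' := 𝓘(ℝ, V)) (x₀ := y)
    (f := (extChartAt 𝓘(ℝ, V) x₀).symm) ((hv _).mdifferentiableAt (by simp))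
    ((hw _).mdifferentiableAt (by simp)) (contMDiffAt_chart_symm hy) (by simpa using two_le_infty)
  rw [mpullback_chart_symm hy] at h1
  rw [h1]
  have h2 : ∀ u : ∀ x : M, TangentSpace 𝓘(ℝ, V) x,
      VectorField.mpullback 𝓘(ℝ, V) 𝓘(ℝ, V) (extChartAt 𝓘(ℝ, V) x₀).symm u =ᶠ[𝓝 y]
        chartField x₀ u := by
    intro u
    filter_upwards [extChartAt_target_nhds hy] with z hz using mpullback_chart_symm hz u
  have h3 := Filter.EventuallyEq.mlieBracket_vectorField_eq (I := 𝓘(ℝ, V)) (h2 v) (h2 w)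
  refine h3.trans ((congrFun (VectorField.mlieBracketWithin_univ (I := 𝓘(ℝ, V))
    (V := chartField x₀ v) (W := chartField x₀ w)).symm y).trans ?_)
  have h4 := congrFun (VectorField.mlieBracketWithin_eq_lieBracketWithin (𝕜 := ℝ) (s := univ)
    (V := chartField x₀ v) (W := chartField x₀ w)) y
  refine h4.trans ?_
  rw [VectorField.lieBracketWithin_univ]
  rfl

end ChartFields

namespace HermitianLineBundle

universe w

/-! ### Connection forms and curvature. -/

section Connections

variable {V : Type*} [NormedAddCommGroup V] [NormedSpace ℝ V]
  {M : Type*} [TopologicalSpace M] [ChartedSpace V M] [IsManifold 𝓘(ℝ, V) ∞ M]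
  {L : HermitianLineBundle.{w} V M} (nabla : CovariantDerivative 𝓘(ℝ, V) ℂ L.Fiber)

/-- In the preferred chart and trivialisation around `x₀`, the connection is `d + α` on `O`. -/
structure IsConnForm (x₀ : M) (O : Set V) (α : V → V →L[ℝ] ℂ) : Prop where
  isOpen : IsOpen O
  subset : O ⊆ (extChartAt 𝓘(ℝ, V) x₀).target
  base : ∀ y ∈ O, (extChartAt 𝓘(ℝ, V) x₀).symm y ∈ (L.triv x₀).baseSet
  smooth : ContDiffOn ℝ ∞ α O
  formula : ∀ y ∈ O, ∀ s : ∀ x, L.Fiber x, L.IsDiffAt s ((extChartAt 𝓘(ℝ, V) x₀).symm y) → ∀ v : V,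
    L.co x₀ ⟨(extChartAt 𝓘(ℝ, V) x₀).symm y, evL (nabla s ((extChartAt 𝓘(ℝ, V) x₀).symm y))
        (tder 𝓘(ℝ, V) 𝓘(ℝ, V) (extChartAt 𝓘(ℝ, V) x₀).symm y v)⟩ =
      fderiv ℝ (L.lco x₀ s) y v + α y v * L.lco x₀ s y

variable {nabla} {x₀ : M} {O : Set V} {α : V → V →L[ℝ] ℂ}

theorem IsConnForm.formula_field (h : IsConnForm nabla x₀ O α) {y : V} (hy : y ∈ O)
    {s : ∀ x, L.Fiber x} (hs : L.IsDiffAt s ((extChartAt 𝓘(ℝ, V) x₀).symm y))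
    (v : ∀ x : M, TangentSpace 𝓘(ℝ, V) x) :
    L.lco x₀ (fun x => nabla s x (v x)) y =
      fderiv ℝ (L.lco x₀ s) y (chartField x₀ v y) + α y (chartField x₀ v y) * L.lco x₀ s y := by
  rw [← h.formula y hy s hs, tder_chartField (h.subset hy)]
  rfl

/-- The product rule for `df(v) + α(v) f`. The differentiability obtained here is what permits a
second covariant derivative in the curvature. -/
theorem IsConnForm.hasFDerivAt_field (h : IsConnForm nabla x₀ O α) {y : V} (hy : y ∈ O)
    {s : ∀ x, L.Fiber x} (hs : L.IsSmoothSection s)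
    {v : ∀ x : M, TangentSpace 𝓘(ℝ, V) x} (hv : IsSmoothField v) (u : V) :
    DifferentiableAt ℝ (L.lco x₀ (fun x => nabla s x (v x))) y ∧
    fderiv ℝ (L.lco x₀ (fun x => nabla s x (v x))) y u =
      fderiv ℝ (fderiv ℝ (L.lco x₀ s)) y u (chartField x₀ v y) +
      fderiv ℝ (L.lco x₀ s) y (fderiv ℝ (chartField x₀ v) y u) +
      ((fderiv ℝ α y u (chartField x₀ v y) + α y (fderiv ℝ (chartField x₀ v) y u)) * L.lco x₀ s y
      + α y (chartField x₀ v y) * fderiv ℝ (L.lco x₀ s) y u) := by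
  have hO := h.isOpen.mem_nhds hy
  have hf := contDiffAt_lco (h.subset hy) (h.base y hy) hs
  have h1 : HasFDerivAt (fderiv ℝ (L.lco x₀ s)) (fderiv ℝ (fderiv ℝ (L.lco x₀ s)) y) y :=
    ((hf.fderiv_right (m := 1) (by norm_cast)).differentiableAt (by simp)).hasFDerivAt
  have h2 := (hf.differentiableAt (by simp)).hasFDerivAt
  have h3 := ((contDiffAt_chartField (h.subset hy) hv).differentiableAt (by simp)).hasFDerivAt
  have h4 := ((h.smooth.contDiffAt hO).differentiableAt (by simp)).hasFDerivAt
  have h5 := (h1.clm_apply h3).add ((h4.clm_apply h3).mul h2)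
  have h6 := h5.congr_of_eventuallyEq (f₁ := L.lco x₀ (fun x => nabla s x (v x))) (by
    filter_upwards [hO] with z hz
    exact h.formula_field hz (hs.isDiffAt _) v)
  refine ⟨h6.differentiableAt, ?_⟩
  rw [h6.fderiv]
  simp only [add_apply, ContinuousLinearMap.comp_apply, ContinuousLinearMap.flip_apply, smul_apply,
    smul_eq_mul]
  ring

theorem IsConnForm.isDiffAt_field (h : IsConnForm nabla x₀ O α) {y : V} (hy : y ∈ O)
    {s : ∀ x, L.Fiber x} (hs : L.IsSmoothSection s)
    {v : ∀ x : M, TangentSpace 𝓘(ℝ, V) x} (hv : IsSmoothField v) :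
    L.IsDiffAt (fun x => nabla s x (v x)) ((extChartAt 𝓘(ℝ, V) x₀).symm y) := by
  have hx := (extChartAt 𝓘(ℝ, V) x₀).map_target (h.subset hy)
  have h1 : MDifferentiableAt 𝓘(ℝ, V) 𝓘(ℝ, ℂ) (L.lco x₀ (fun x => nabla s x (v x)))
      (extChartAt 𝓘(ℝ, V) x₀ ((extChartAt 𝓘(ℝ, V) x₀).symm y)) := by
    rw [(extChartAt 𝓘(ℝ, V) x₀).right_inv (h.subset hy)]
    exact (h.hasFDerivAt_field hy hs hv 0).1.mdifferentiableAt
  refine (mdifferentiableAt_iff (x₀ := x₀) (h.base y hy)).2 ⟨mdifferentiableAt_id, ?_⟩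
  refine (h1.comp _ (mdifferentiableAt_chart hx)).congr_of_eventuallyEq ?_
  filter_upwards [extChartAt_source_nhds hx] with z hz
  have h2 : ∀ z', z' = z → L.co x₀ ⟨z, nabla s z (v z)⟩ = L.co x₀ ⟨z', nabla s z' (v z')⟩ := by
    rintro _ rfl; rfl
  exact h2 _ ((extChartAt 𝓘(ℝ, V) x₀).left_inv hz)

/-- The curvature of a connection in terms of its connection form. -/
theorem IsConnForm.curvature [CompleteSpace V] (h : IsConnForm nabla x₀ O α) {y : V} (hy : y ∈ O)
    {s : ∀ x, L.Fiber x} (hs : L.IsSmoothSection s)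
    {v w : ∀ x : M, TangentSpace 𝓘(ℝ, V) x} (hv : IsSmoothField v) (hw : IsSmoothField w) :
    L.lco x₀ (fun x => nabla (fun y => nabla s y (w y)) x (v x) -
      nabla (fun y => nabla s y (v y)) x (w x) -
      nabla s x (VectorField.mlieBracket 𝓘(ℝ, V) v w x)) y =
      (fderiv ℝ α y (chartField x₀ v y) (chartField x₀ w y) -
        fderiv ℝ α y (chartField x₀ w y) (chartField x₀ v y)) * L.lco x₀ s y := by
  have hb := h.base y hy
  have e : L.lco x₀ (fun x => nabla (fun y => nabla s y (w y)) x (v x) -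
      nabla (fun y => nabla s y (v y)) x (w x) -
      nabla s x (VectorField.mlieBracket 𝓘(ℝ, V) v w x)) y =
      L.lco x₀ (fun x => nabla (fun y => nabla s y (w y)) x (v x)) y -
      L.lco x₀ (fun x => nabla (fun y => nabla s y (v y)) x (w x)) y -
      L.lco x₀ (fun x => nabla s x (VectorField.mlieBracket 𝓘(ℝ, V) v w x)) y := by
    unfold lco
    rw [co_sub hb, co_sub hb]
  rw [e, h.formula_field hy (h.isDiffAt_field hy hs hw), h.formula_field hy
    (h.isDiffAt_field hy hs hv), h.formula_field hy (hs.isDiffAt _),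
    (h.hasFDerivAt_field hy hs hw _).2, (h.hasFDerivAt_field hy hs hv _).2,
    h.formula_field hy (hs.isDiffAt _), h.formula_field hy (hs.isDiffAt _),
    chartField_mlieBracket (h.subset hy) hv hw]
  -- Second derivatives of the section cancel by symmetry, the mixed first-order terms and those
  -- quadratic in `α` cancel because `ℂ` is commutative, and the derivatives of the fields cancel
  -- against the bracket. Only `dα` is left.
  have hsym := (contDiffAt_lco (h.subset hy) hb hs).isSymmSndFDerivAt (by simpa using two_le_infty)
  rw [hsym.eq (chartField x₀ v y) (chartField x₀ w y)]
  simp only [map_sub]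
  ring

/-- A section of `Hom(TM, L)` in a chart, for a connection form. -/
theorem IsConnForm.homLoc_eq (h : IsConnForm nabla x₀ O α) {y : V} (hy : y ∈ O)
    {s : ∀ x, L.Fiber x} (hs : L.IsDiffAt s ((extChartAt 𝓘(ℝ, V) x₀).symm y)) :
    L.homLoc (nabla s) x₀ y = fderiv ℝ (L.lco x₀ s) y + L.lco x₀ s y • α y := by
  ext v
  rw [homLoc_apply _ (h.base y hy), h.formula y hy s hs]
  simp [mul_comm]

/-- A connection that has smooth connection forms is smooth. -/
theorem smooth_of_connForm (h : ∀ x₀ : M, ∃ O α, IsConnForm nabla x₀ O α ∧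
    extChartAt 𝓘(ℝ, V) x₀ x₀ ∈ O) : CovariantDerivative.ContMDiffCovariantDerivative nabla ∞ := by
  constructor
  constructor
  intro s hs x _
  obtain ⟨O, α, h, hO⟩ := h x
  have hs' : L.IsSmoothSection s := contMDiffOn_univ.1 hs
  refine ContMDiffAt.contMDiffWithinAt ?_
  refine (contMDiffAt_hom_iff (nabla s) (mem_extChartAt_source x) (L.mem_base x)).2 ?_
  have hf := contDiffAt_lco (h.subset hO) (h.base _ hO) hs'
  have h1 : ContDiffAt ℝ ∞ (fun y => fderiv ℝ (L.lco x s) y + L.lco x s y • α y)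
      (extChartAt 𝓘(ℝ, V) x x) :=
    (hf.fderiv_right (m := ∞) (by simp)).add (hf.smul (h.smooth.contDiffAt (h.isOpen.mem_nhds hO)))
  refine h1.congr_of_eventuallyEq ?_
  filter_upwards [h.isOpen.mem_nhds hO] with y hy using h.homLoc_eq hy (hs'.isDiffAt _)

/-- Near `x₀` write `s = f e` with `e` extending the local unit section; the connection form is the
coordinate of `∇e`. The Leibniz rule is available for real functions only, so `f e` is split as `re
f • e + im f • (i e)`, and complex linearity handles `∇(i e)`. Locality of the derivative permits
replacing `s` by this expression. -/
theorem exists_connForm [FiniteDimensional ℝ V] [T2Space M]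
    (hsm : CovariantDerivative.ContMDiffCovariantDerivative nabla ∞)
    (hI : ∀ (s : ∀ x, L.Fiber x), L.IsSmoothSection s →
      ∀ (x : M) (v : TangentSpace 𝓘(ℝ, V) x),
      nabla (fun y => Complex.I • s y) x v = Complex.I • nabla s x v) (x₀ : M) :
    ∃ O α, IsConnForm nabla x₀ O α ∧ extChartAt 𝓘(ℝ, V) x₀ x₀ ∈ O := by
  obtain ⟨e, he, he'⟩ := exists_smooth_extension (V := V) ℂ L.Fiber x₀ 1
  have he0 : L.IsSmoothSection e := he
  obtain ⟨U, hU1, hU2, hU3⟩ := eventually_nhds_iff.1 (he'.and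
    ((L.triv x₀).open_baseSet.mem_nhds (L.mem_base x₀)))
  have hO := (continuousOn_extChartAt_symm (I := 𝓘(ℝ, V)) x₀).isOpen_inter_preimage
    (isOpen_extChartAt_target x₀) hU2
  have hIe : L.IsSmoothSection (fun y => Complex.I • e y) := by
    intro x
    have h1 := (contMDiffAt_iff (x₀ := x) (L.mem_base x)).1 (he0 x)
    refine (contMDiffAt_iff (x₀ := x) (L.mem_base x)).2 ⟨contMDiffAt_id, ?_⟩
    refine (ContMDiffAt.comp x
      (ContinuousLinearMap.mul ℝ ℂ Complex.I).contMDiff.contMDiffAt h1.2).congr_of_eventuallyEq ?_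
    filter_upwards [(L.triv x).open_baseSet.mem_nhds (L.mem_base x)] with z hz
    exact co_smul hz _ _
  refine ⟨_, L.homLoc (nabla e) x₀, ⟨hO, inter_subset_left, fun y hy => (hU1 _ hy.2).2, ?_, ?_⟩,
    mem_extChartAt_target x₀, by rwa [mem_preimage, extChartAt_to_inv]⟩
  · intro y hy
    have h1 := contMDiffOn_univ.1 (hsm.contMDiff.contMDiff (σ := e) he0.contMDiffOn)
    have h2 := (contMDiffAt_hom_iff (nabla e) ((extChartAt 𝓘(ℝ, V) x₀).map_target hy.1)
      (hU1 _ hy.2).2).1 (h1 _)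
    rw [(extChartAt 𝓘(ℝ, V) x₀).right_inv hy.1] at h2
    exact h2.contDiffWithinAt
  · intro y hy s hs v
    set x := (extChartAt 𝓘(ℝ, V) x₀).symm y with hx
    have hb : x ∈ (L.triv x₀).baseSet := (hU1 _ hy.2).2
    have hex : ∀ z ∈ U, e z = L.unit x₀ z := fun z hz => (hU1 z hz).1
    set f : M → ℂ := fun z => L.co x₀ ⟨z, s z⟩ with hf
    have hfd : MDifferentiableAt 𝓘(ℝ, V) 𝓘(ℝ, ℂ) f x := ((mdifferentiableAt_iff hb).1 hs).2
    have hre : MDifferentiableAt 𝓘(ℝ, V) 𝓘(ℝ, ℝ) (fun z => (f z).re) x :=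
      MDifferentiableAt.comp x Complex.reCLM.mdifferentiableAt hfd
    have him : MDifferentiableAt 𝓘(ℝ, V) 𝓘(ℝ, ℝ) (fun z => (f z).im) x :=
      MDifferentiableAt.comp x Complex.imCLM.mdifferentiableAt hfd
    have hcov := nabla.isCovariantDerivativeOnUniv
    have h1 : L.IsDiffAt ((fun z => (f z).re) • e) x := hre.smul_section (he0.isDiffAt x)
    have h2 : L.IsDiffAt ((fun z => (f z).im) • fun z => Complex.I • e z) x :=
      him.smul_section (hIe.isDiffAt x)
    have hsum : ∀ᶠ z in 𝓝 x, s z = ((fun z => (f z).re) • e +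
        (fun z => (f z).im) • fun z => Complex.I • e z) z := by
      filter_upwards [hU2.mem_nhds hy.2] with z hz
      change s z = (f z).re • e z + (f z).im • Complex.I • e z
      rw [← Complex.coe_smul, ← Complex.coe_smul, smul_smul, ← add_smul, Complex.re_add_im,
        hex z hz]
      exact (co_smul_unit (hU1 z hz).2 (s z)).symm
    have h3 := hcov.congr_of_eventuallyEq hs (mdifferentiableAt_add_section h1 h2)
      Filter.univ_mem hsum
    rw [hcov.add h1 h2, hcov.leibniz (he0.isDiffAt x) hre, hcov.leibniz (hIe.isDiffAt x) him] at h3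
    rw [h3]
    set u : V := tder 𝓘(ℝ, V) 𝓘(ℝ, V) (extChartAt 𝓘(ℝ, V) x₀).symm y v with hu
    have h4 : (tder 𝓘(ℝ, V) 𝓘(ℝ, ℝ) (fun z => (f z).re) x u : ℝ) =
        (tder 𝓘(ℝ, V) 𝓘(ℝ, ℂ) f x u).re := by
      rw [tder_comp_apply (g := Complex.re) Complex.reCLM.mdifferentiableAt hfd rfl, tder_eq_fderiv]
      exact congrArg (fun T : ℂ →L[ℝ] ℝ => T (tder 𝓘(ℝ, V) 𝓘(ℝ, ℂ) f x u)) Complex.reCLM.fderiv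
    have h5 : (tder 𝓘(ℝ, V) 𝓘(ℝ, ℝ) (fun z => (f z).im) x u : ℝ) =
        (tder 𝓘(ℝ, V) 𝓘(ℝ, ℂ) f x u).im := by
      rw [tder_comp_apply (g := Complex.im) Complex.imCLM.mdifferentiableAt hfd rfl, tder_eq_fderiv]
      exact congrArg (fun T : ℂ →L[ℝ] ℝ => T (tder 𝓘(ℝ, V) 𝓘(ℝ, ℂ) f x u)) Complex.imCLM.fderiv
    have h6 : fderiv ℝ (L.lco x₀ s) y v = tder 𝓘(ℝ, V) 𝓘(ℝ, ℂ) f x u := by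
      rw [← tder_eq_fderiv]
      exact tder_comp_apply hfd (mdifferentiableAt_chart_symm hy.1) rfl v
    have h7 : evL (L := L) ((f x).re • nabla e x + (mvfderiv 𝓘(ℝ, V) (fun z => (f z).re) x).smulRight
        (e x) + ((f x).im • nabla (fun z => Complex.I • e z) x +
        (mvfderiv 𝓘(ℝ, V) (fun z => (f z).im) x).smulRight (Complex.I • e x))) u =
        (f x).re • evL (nabla e x) u + (tder 𝓘(ℝ, V) 𝓘(ℝ, ℝ) (fun z => (f z).re) x u : ℝ) • e x +
        ((f x).im • Complex.I • evL (nabla e x) u +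
          (tder 𝓘(ℝ, V) 𝓘(ℝ, ℝ) (fun z => (f z).im) x u : ℝ) • Complex.I • e x) := by
      have h8 : evL (nabla e x) u = nabla e x u := rfl
      rw [h8, ← hI e he0 x u]
      rfl
    refine (congrArg (fun l => L.co x₀ ⟨x, l⟩) h7).trans ?_
    rw [co_add hb, co_add hb, co_add hb, co_smul_real hb, co_smul_real hb, co_smul_real hb,
      co_smul_real hb, co_smul hb, co_smul hb, h4, h5, h6, hex x hy.2, co_unit hb,
      homLoc_apply (nabla e) hb, ← hx, ← hu, show L.lco x₀ s y = f x from rfl]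
    set a := tder 𝓘(ℝ, V) 𝓘(ℝ, ℂ) f x u
    set b := L.co x₀ ⟨x, evL (nabla e x) u⟩
    conv_rhs => rw [← Complex.re_add_im a, ← Complex.re_add_im (f x)]
    ring

end Connections

end HermitianLineBundle

end PreHam

namespace PreHam

namespace HermitianLineBundle

universe w

section FormulaAt

variable {V : Type*} [NormedAddCommGroup V] [NormedSpace ℝ V]
  {M : Type*} [TopologicalSpace M] [ChartedSpace V M] [IsManifold 𝓘(ℝ, V) ∞ M]
  {L : HermitianLineBundle.{w} V M} {nabla : CovariantDerivative 𝓘(ℝ, V) ℂ L.Fiber}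

/-- The formula `d + α` is transported from a coordinate `y` to a point of the manifold, the form
needed for maps that cover arbitrary maps to `M`. -/
theorem IsConnForm.formula_at {x₀ : M} {O : Set V} {α : V → V →L[ℝ] ℂ}
    (h : IsConnForm nabla x₀ O α) {n : M} (hn : n ∈ (extChartAt 𝓘(ℝ, V) x₀).source)
    (hO : extChartAt 𝓘(ℝ, V) x₀ n ∈ O) {s : ∀ x, L.Fiber x} (hs : L.IsDiffAt s n) (u : V) :
    L.co x₀ ⟨n, evL (nabla s n) u⟩ = tder 𝓘(ℝ, V) 𝓘(ℝ, ℂ) (fun x => L.co x₀ ⟨x, s x⟩) n u +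
      α (extChartAt 𝓘(ℝ, V) x₀ n) (tder 𝓘(ℝ, V) 𝓘(ℝ, V) (extChartAt 𝓘(ℝ, V) x₀) n u) *
        L.co x₀ ⟨n, s n⟩ := by
  have hl := (extChartAt 𝓘(ℝ, V) x₀).left_inv hn
  have hb : n ∈ (L.triv x₀).baseSet := by
    have := h.base _ hO
    rwa [hl] at this
  have hs' : L.IsDiffAt s ((extChartAt 𝓘(ℝ, V) x₀).symm (extChartAt 𝓘(ℝ, V) x₀ n)) := by rwa [hl]
  have h1 := h.formula _ hO s hs' (tder 𝓘(ℝ, V) 𝓘(ℝ, V) (extChartAt 𝓘(ℝ, V) x₀) n u)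
  rw [tder_symm_chart hn] at h1
  have h2 := tder_comp_apply (g := fun x => L.co x₀ ⟨x, s x⟩) ((mdifferentiableAt_iff hb).1 hs).2
    (mdifferentiableAt_chart_symm (h.subset hO)) hl
    (tder 𝓘(ℝ, V) 𝓘(ℝ, V) (extChartAt 𝓘(ℝ, V) x₀) n u)
  rw [tder_symm_chart hn] at h2
  rw [← h2, tder_eq_fderiv]
  have h3 : ∀ m, m = n → L.co x₀ ⟨m, evL (nabla s m) u⟩ =
      fderiv ℝ (L.lco x₀ s) (extChartAt 𝓘(ℝ, V) x₀ n)
        (tder 𝓘(ℝ, V) 𝓘(ℝ, V) (extChartAt 𝓘(ℝ, V) x₀) n u) +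
      α (extChartAt 𝓘(ℝ, V) x₀ n) (tder 𝓘(ℝ, V) 𝓘(ℝ, V) (extChartAt 𝓘(ℝ, V) x₀) n u) *
        L.co x₀ ⟨m, s m⟩ → L.co x₀ ⟨n, evL (nabla s n) u⟩ =
      fderiv ℝ (L.lco x₀ s) (extChartAt 𝓘(ℝ, V) x₀ n)
        (tder 𝓘(ℝ, V) 𝓘(ℝ, V) (extChartAt 𝓘(ℝ, V) x₀) n u) +
      α (extChartAt 𝓘(ℝ, V) x₀ n) (tder 𝓘(ℝ, V) 𝓘(ℝ, V) (extChartAt 𝓘(ℝ, V) x₀) n u) *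
        L.co x₀ ⟨n, s n⟩ := by
    rintro m rfl h; exact h
  exact h3 _ hl h1

end FormulaAt

/-! ### Covariant derivatives along maps into a line bundle. -/

section Along

variable {B : Type*} [NormedAddCommGroup B] [NormedSpace ℝ B] {H : Type*} [TopologicalSpace H]
  {J : ModelWithCorners ℝ B H} {Z : Type*} [TopologicalSpace Z] [ChartedSpace H Z]

theorem _root_.PreHam.tder_mul {f g : Z → ℂ} {z : Z} (hf : MDifferentiableAt J 𝓘(ℝ, ℂ) f z)
    (hg : MDifferentiableAt J 𝓘(ℝ, ℂ) g z) (ξ : B) :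
    tder J 𝓘(ℝ, ℂ) (fun z => f z * g z) z ξ =
      tder J 𝓘(ℝ, ℂ) f z ξ * g z + f z * tder J 𝓘(ℝ, ℂ) g z ξ := by
  have h := (hf.hasMFDerivAt.mul hg.hasMFDerivAt).mfderiv
  refine (congrArg (fun T : B →L[ℝ] ℂ => T ξ) h).trans ?_
  change f z * tder J 𝓘(ℝ, ℂ) g z ξ + g z * tder J 𝓘(ℝ, ℂ) f z ξ = _
  ring

variable {V : Type*} [NormedAddCommGroup V] [NormedSpace ℝ V] [FiniteDimensional ℝ V]
  {M : Type*} [TopologicalSpace M] [ChartedSpace V M] [IsManifold 𝓘(ℝ, V) ∞ M] [T2Space M]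
  {L : HermitianLineBundle.{w} V M} {nabla : CovariantDerivative 𝓘(ℝ, V) ℂ L.Fiber}

variable (L) in
/-- A smooth section that does not vanish near `x`. -/
def ext (x : M) : ∀ y, L.Fiber y := (exists_smooth_extension (V := V) ℂ L.Fiber x 1).choose

theorem ext_smooth (x : M) : L.IsSmoothSection (L.ext x) :=
  (exists_smooth_extension (V := V) ℂ L.Fiber x 1).choose_spec.1

theorem ext_eq (x : M) : ∀ᶠ y in 𝓝 x, L.ext x y = L.unit x y :=
  (exists_smooth_extension (V := V) ℂ L.Fiber x 1).choose_spec.2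

variable (nabla J) in
/-- The covariant derivative of a map `σ : Z → L`, viewed as a section of the pull-back of `L` along
the map `Z → M` that it covers. -/
def along (σ : Z → L.Total) (z : Z) : B →L[ℝ] L.Fiber (σ z).proj :=
  (tder J 𝓘(ℝ, ℂ) (fun z' => L.co (σ z).proj (σ z')) z).smulRight (L.ext (σ z).proj (σ z).proj) +
    L.co (σ z).proj (σ z) • (evL (nabla (L.ext (σ z).proj) (σ z).proj)).comp
      (tder J 𝓘(ℝ, V) (fun z' => (σ z').proj) z)

theorem along_def (σ : Z → L.Total) (z : Z) (ξ : B) : along J nabla σ z ξ =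
    tder J 𝓘(ℝ, ℂ) (fun z' => L.co (σ z).proj (σ z')) z ξ • L.ext (σ z).proj (σ z).proj +
    L.co (σ z).proj (σ z) • evL (nabla (L.ext (σ z).proj) (σ z).proj)
      (tder J 𝓘(ℝ, V) (fun z' => (σ z').proj) z ξ) := rfl

variable (nabla) in
/-- The connection has connection forms around every point. -/
def HasConnForms : Prop :=
  ∀ x₀ : M, ∃ O α, IsConnForm nabla x₀ O α ∧ extChartAt 𝓘(ℝ, V) x₀ x₀ ∈ O

/-- In coordinates `df e + f ∇e` becomes `d + α` applied to the coordinate of `σ`, an expression in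
which `f` and `e` no longer appear. The covariant derivative along `σ` is therefore independent of
the local frame used to define it. -/
theorem IsConnForm.smul_section {x₀ : M} {O : Set V} {α : V → V →L[ℝ] ℂ}
    (h : IsConnForm nabla x₀ O α) {σ : Z → L.Total} {z : Z}
    (hn : (σ z).proj ∈ (extChartAt 𝓘(ℝ, V) x₀).source)
    (hO : extChartAt 𝓘(ℝ, V) x₀ (σ z).proj ∈ O)
    (hσ : MDifferentiableAt J (𝓘(ℝ, V).prod 𝓘(ℝ, ℂ)) σ z)
    {f : Z → ℂ} (hf : MDifferentiableAt J 𝓘(ℝ, ℂ) f z) {e : ∀ x, L.Fiber x}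
    (he : L.IsDiffAt e (σ z).proj) (hσf : ∀ᶠ z' in 𝓝 z, (σ z').snd = f z' • e (σ z').proj) (ξ : B) :
    tder J 𝓘(ℝ, ℂ) (fun z' => L.co x₀ (σ z')) z ξ +
      α (extChartAt 𝓘(ℝ, V) x₀ (σ z).proj) (tder 𝓘(ℝ, V) 𝓘(ℝ, V) (extChartAt 𝓘(ℝ, V) x₀) (σ z).proj
        (tder J 𝓘(ℝ, V) (fun z' => (σ z').proj) z ξ)) * L.co x₀ (σ z) =
    L.co x₀ ⟨(σ z).proj, tder J 𝓘(ℝ, ℂ) f z ξ • e (σ z).proj +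
      f z • evL (nabla e (σ z).proj) (tder J 𝓘(ℝ, V) (fun z' => (σ z').proj) z ξ)⟩ := by
  have hb : (σ z).proj ∈ (L.triv x₀).baseSet := by
    have := h.base _ hO
    rwa [(extChartAt 𝓘(ℝ, V) x₀).left_inv hn] at this
  have hp := ((mdifferentiableAt_iff hb).1 hσ).1
  have heq : (fun z' => L.co x₀ (σ z')) =ᶠ[𝓝 z]
      fun z' => f z' * L.co x₀ ⟨(σ z').proj, e (σ z').proj⟩ := by
    filter_upwards [hσf, hp.continuousAt.preimage_mem_nhds ((L.triv x₀).open_baseSet.mem_nhds hb)]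
      with z' h1 h2
    rw [← co_smul h2, ← h1]
  have hec := ((mdifferentiableAt_iff (f := fun x => (⟨x, e x⟩ : L.Total)) hb).1 he).2
  have hec' : MDifferentiableAt J 𝓘(ℝ, ℂ) (fun z' => L.co x₀ ⟨(σ z').proj, e (σ z').proj⟩) z :=
    MDifferentiableAt.comp (g := fun x => L.co x₀ ⟨x, e x⟩) z hec hp
  have hz : L.co x₀ (σ z) = f z * L.co x₀ ⟨(σ z).proj, e (σ z).proj⟩ := heq.self_of_nhds
  rw [co_add hb, co_smul hb, co_smul hb, h.formula_at hn hO he, tder_congr heq,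
    tder_mul hf hec', hz]
  have h5 := tder_comp_apply (g := fun x => L.co x₀ ⟨x, e x⟩) hec hp rfl ξ
  rw [h5]
  ring

theorem co_ext {σ : Z → L.Total} {z : Z} (hσ : MDifferentiableAt J (𝓘(ℝ, V).prod 𝓘(ℝ, ℂ)) σ z) :
    ∀ᶠ z' in 𝓝 z, (σ z').snd = L.co (σ z).proj (σ z') • L.ext (σ z).proj (σ z').proj := by
  have hp := ((mdifferentiableAt_iff (L.mem_base _)).1 hσ).1
  filter_upwards [hp.continuousAt (ext_eq (L := L) (σ z).proj),
    hp.continuousAt.preimage_mem_nhds ((L.triv _).open_baseSet.mem_nhds (L.mem_base (σ z).proj))]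
    with z' h1 h2
  have h3 : L.ext (σ z).proj (σ z').proj = L.unit (σ z).proj (σ z').proj := h1
  rw [h3]
  exact (co_smul_unit h2 (σ z').snd).symm

/-- The covariant derivative along a map, in a chart and a trivialisation. -/
theorem IsConnForm.co_along {x₀ : M} {O : Set V} {α : V → V →L[ℝ] ℂ}
    (h : IsConnForm nabla x₀ O α) {σ : Z → L.Total} {z : Z}
    (hn : (σ z).proj ∈ (extChartAt 𝓘(ℝ, V) x₀).source)
    (hO : extChartAt 𝓘(ℝ, V) x₀ (σ z).proj ∈ O)
    (hσ : MDifferentiableAt J (𝓘(ℝ, V).prod 𝓘(ℝ, ℂ)) σ z) (ξ : B) :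
    L.co x₀ ⟨(σ z).proj, along J nabla σ z ξ⟩ = tder J 𝓘(ℝ, ℂ) (fun z' => L.co x₀ (σ z')) z ξ +
      α (extChartAt 𝓘(ℝ, V) x₀ (σ z).proj) (tder 𝓘(ℝ, V) 𝓘(ℝ, V) (extChartAt 𝓘(ℝ, V) x₀) (σ z).proj
        (tder J 𝓘(ℝ, V) (fun z' => (σ z').proj) z ξ)) * L.co x₀ (σ z) :=
  (h.smul_section hn hO hσ ((mdifferentiableAt_iff (L.mem_base _)).1 hσ).2
    ((ext_smooth _).isDiffAt _) (co_ext hσ) ξ).symm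

/-- The coordinate expression depends on `σ` alone, so the defining formula holds for every local
presentation `σ = f • e`. -/
theorem HasConnForms.along_eq (hc : HasConnForms nabla) {σ : Z → L.Total} {z : Z}
    (hσ : MDifferentiableAt J (𝓘(ℝ, V).prod 𝓘(ℝ, ℂ)) σ z)
    {f : Z → ℂ} (hf : MDifferentiableAt J 𝓘(ℝ, ℂ) f z) {e : ∀ x, L.Fiber x}
    (he : L.IsDiffAt e (σ z).proj) (hσf : ∀ᶠ z' in 𝓝 z, (σ z').snd = f z' • e (σ z').proj) (ξ : B) :
    along J nabla σ z ξ = tder J 𝓘(ℝ, ℂ) f z ξ • e (σ z).proj +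
      f z • evL (nabla e (σ z).proj) (tder J 𝓘(ℝ, V) (fun z' => (σ z').proj) z ξ) := by
  obtain ⟨O, α, h, hO⟩ := hc (σ z).proj
  have hn := mem_extChartAt_source (I := 𝓘(ℝ, V)) (σ z).proj
  exact co_injective (L.mem_base _) ((h.co_along hn hO hσ ξ).trans
    (h.smul_section hn hO hσ hf he hσf ξ))

/-- The chain rule. -/
theorem along_comp {B' : Type*} [NormedAddCommGroup B'] [NormedSpace ℝ B'] {H' : Type*}
    [TopologicalSpace H'] {J' : ModelWithCorners ℝ B' H'} {Z' : Type*} [TopologicalSpace Z']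
    [ChartedSpace H' Z'] {σ : Z → L.Total} {h : Z' → Z} {z : Z'}
    (hσ : MDifferentiableAt J (𝓘(ℝ, V).prod 𝓘(ℝ, ℂ)) σ (h z)) (hh : MDifferentiableAt J' J h z)
    (ξ : B') :
    along J' nabla (fun z => σ (h z)) z ξ = along J nabla σ (h z) (tder J' J h z ξ) := by
  have h1 := (mdifferentiableAt_iff (L.mem_base _)).1 hσ
  rw [along_def, along_def, tder_comp_apply (g := fun z' => L.co (σ (h z)).proj (σ z')) h1.2 hh rfl,
    tder_comp_apply (g := fun z' => (σ z').proj) h1.1 hh rfl]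

theorem HasConnForms.along_section (hc : HasConnForms nabla) {s : ∀ x, L.Fiber x} {b : Z → M} {z : Z}
    (hb : MDifferentiableAt J 𝓘(ℝ, V) b z) (hs : L.IsDiffAt s (b z)) (ξ : B) :
    along J nabla (fun z => (⟨b z, s (b z)⟩ : L.Total)) z ξ =
      evL (nabla s (b z)) (tder J 𝓘(ℝ, V) b z ξ) := by
  rw [hc.along_eq (σ := fun z => (⟨b z, s (b z)⟩ : L.Total)) (f := fun _ => 1) (e := s)
    (MDifferentiableAt.comp z hs hb) mdifferentiableAt_const hs (.of_forall fun _ => by simp),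
    tder_const]
  simp

/-- The product rule. -/
theorem HasConnForms.along_smul (hc : HasConnForms nabla) {σ : Z → L.Total} {z : Z}
    (hσ : MDifferentiableAt J (𝓘(ℝ, V).prod 𝓘(ℝ, ℂ)) σ z)
    {f : Z → ℂ} (hf : MDifferentiableAt J 𝓘(ℝ, ℂ) f z) (ξ : B) :
    along J nabla (fun z => (⟨(σ z).proj, f z • (σ z).snd⟩ : L.Total)) z ξ =
      tder J 𝓘(ℝ, ℂ) f z ξ • (σ z).snd + f z • along J nabla σ z ξ := by
  have h1 := (mdifferentiableAt_iff (L.mem_base _)).1 hσ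
  have h2 : ∀ᶠ z' in 𝓝 z, f z' • (σ z').snd =
      (f z' * L.co (σ z).proj (σ z')) • L.ext (σ z).proj (σ z').proj := by
    filter_upwards [co_ext hσ] with z' h
    rw [mul_smul, ← h]
  have h3 : MDifferentiableAt J (𝓘(ℝ, V).prod 𝓘(ℝ, ℂ))
      (fun z => (⟨(σ z).proj, f z • (σ z).snd⟩ : L.Total)) z := by
    refine (mdifferentiableAt_iff (f := fun z => (⟨(σ z).proj, f z • (σ z).snd⟩ : L.Total))
      (L.mem_base (σ z).proj)).2 ⟨h1.1, ?_⟩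
    refine (hf.mul h1.2).congr_of_eventuallyEq ?_
    filter_upwards [h1.1.continuousAt.preimage_mem_nhds
      ((L.triv _).open_baseSet.mem_nhds (L.mem_base (σ z).proj))] with z' hz
    exact co_smul hz _ _
  have h5 : MDifferentiableAt J 𝓘(ℝ, ℂ) (fun z' => f z' * L.co (σ z).proj (σ z')) z := hf.mul h1.2
  rw [hc.along_eq h3 h5 ((ext_smooth _).isDiffAt _) h2,
    hc.along_eq hσ h1.2 ((ext_smooth _).isDiffAt _) (co_ext hσ), (co_ext hσ).self_of_nhds]
  have h4 := tder_mul hf h1.2 ξ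
  refine (congrArg (fun c : ℂ => c • L.ext (σ z).proj (σ z).proj + _) h4).trans ?_
  dsimp only
  module

theorem along_add {b : Z → M} {s t : ∀ z, L.Fiber (b z)}
    {z : Z} (hs : MDifferentiableAt J (𝓘(ℝ, V).prod 𝓘(ℝ, ℂ)) (fun z => (⟨b z, s z⟩ : L.Total)) z)
    (ht : MDifferentiableAt J (𝓘(ℝ, V).prod 𝓘(ℝ, ℂ)) (fun z => (⟨b z, t z⟩ : L.Total)) z) (ξ : B) :
    along J nabla (fun z => (⟨b z, s z + t z⟩ : L.Total)) z ξ =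
      along J nabla (fun z => (⟨b z, s z⟩ : L.Total)) z ξ +
      along J nabla (fun z => (⟨b z, t z⟩ : L.Total)) z ξ := by
  have h1 := (mdifferentiableAt_iff (L.mem_base _)).1 hs
  have h2 := (mdifferentiableAt_iff (L.mem_base _)).1 ht
  have h3 : (fun z' => L.co (b z) ⟨b z', s z' + t z'⟩) =ᶠ[𝓝 z]
      fun z' => L.co (b z) ⟨b z', s z'⟩ + L.co (b z) ⟨b z', t z'⟩ := by
    filter_upwards [h1.1.continuousAt.preimage_mem_nhds
      ((L.triv _).open_baseSet.mem_nhds (L.mem_base (b z)))] with z' hz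
    exact co_add hz _ _
  have h4 : tder J 𝓘(ℝ, ℂ) (fun z' => L.co (b z) ⟨b z', s z'⟩ + L.co (b z) ⟨b z', t z'⟩) z ξ =
      tder J 𝓘(ℝ, ℂ) (fun z' => L.co (b z) ⟨b z', s z'⟩) z ξ +
      tder J 𝓘(ℝ, ℂ) (fun z' => L.co (b z) ⟨b z', t z'⟩) z ξ :=
    congrArg (fun T : B →L[ℝ] ℂ => T ξ) (h1.2.hasMFDerivAt.add h2.2.hasMFDerivAt).mfderiv
  rw [along_def, along_def, along_def]
  dsimp only at h3 h4 ⊢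
  rw [tder_congr h3, h4, co_add (L.mem_base (b z))]
  module

/-- The covariant derivative along a constant map is the derivative of a map into a fibre. -/
theorem along_const {n : M} {l : Z → L.Fiber n} {z : Z}
    (hl : MDifferentiableAt J (𝓘(ℝ, V).prod 𝓘(ℝ, ℂ)) (fun z => (⟨n, l z⟩ : L.Total)) z) (ξ : B) :
    MDifferentiableAt J 𝓘(ℝ, L.Fiber n) l z ∧
    along J nabla (fun z => (⟨n, l z⟩ : L.Total)) z ξ = tder J 𝓘(ℝ, L.Fiber n) l z ξ := by
  have h1 := ((mdifferentiableAt_iff (L.mem_base _)).1 hl).2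
  have h2 : l = fun z' => ((1 : ℂ →L[ℝ] ℂ).smulRight (L.unit n n)) (L.co n ⟨n, l z'⟩) := by
    funext z'
    exact (co_smul_unit (L.mem_base n) (l z')).symm
  have h3 : MDifferentiableAt J 𝓘(ℝ, L.Fiber n) l z := by
    rw [h2]
    exact ((1 : ℂ →L[ℝ] ℂ).smulRight (L.unit n n)).mdifferentiableAt.comp z h1
  refine ⟨h3, ?_⟩
  have h4 : tder J 𝓘(ℝ, L.Fiber n) l z ξ =
      tder J 𝓘(ℝ, ℂ) (fun z' => L.co n ⟨n, l z'⟩) z ξ • L.unit n n := by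
    conv_lhs => rw [h2]
    rw [tder_comp_apply (g := fun c => ((1 : ℂ →L[ℝ] ℂ).smulRight (L.unit n n)) c)
      ((1 : ℂ →L[ℝ] ℂ).smulRight (L.unit n n)).mdifferentiableAt h1 rfl, tder_eq_fderiv,
      ContinuousLinearMap.fderiv]
    rfl
  rw [along_def]
  dsimp only
  rw [tder_const, h4, (ext_eq n).self_of_nhds]
  simp

/-- The formula defining `along` is linear in the derivatives of the base map and of the fibre
coordinate, and both are sums of partial derivatives. -/
theorem along_prod {B' : Type*} [NormedAddCommGroup B'] [NormedSpace ℝ B'] {H' : Type*}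
    [TopologicalSpace H'] {J' : ModelWithCorners ℝ B' H'} {Z' : Type*} [TopologicalSpace Z']
    [ChartedSpace H' Z'] {σ : Z × Z' → L.Total} {z : Z} {z' : Z'}
    (hσ : MDifferentiableAt (J.prod J') (𝓘(ℝ, V).prod 𝓘(ℝ, ℂ)) σ (z, z')) (ξ : B) (ξ' : B') :
    along (J.prod J') nabla σ (z, z') (ξ, ξ') =
      along J nabla (fun z => σ (z, z')) z ξ + along J' nabla (fun z' => σ (z, z')) z' ξ' := by
  have h1 := (mdifferentiableAt_iff (L.mem_base _)).1 hσ
  rw [along_def, along_def, along_def, tder_prod h1.1, tder_prod h1.2]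
  dsimp only
  rw [map_add]
  module

end Along

/-! ### Invariant connections and covariant derivatives along maps. -/

section Equivariance

variable {V : Type*} [NormedAddCommGroup V] [NormedSpace ℝ V] [FiniteDimensional ℝ V]
  {M : Type*} [TopologicalSpace M] [ChartedSpace V M] [IsManifold 𝓘(ℝ, V) ∞ M] [T2Space M]
  {L : HermitianLineBundle.{w} V M} {nabla : CovariantDerivative 𝓘(ℝ, V) ℂ L.Fiber}
  {E : Type*} [NormedAddCommGroup E] [NormedSpace ℝ E] {H : Type*} [TopologicalSpace H]
  [ChartedSpace E H] [Group H] [MulAction H M] (a : L.Action E H)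
  [LieGroup 𝓘(ℝ, E) ∞ H] [ContMDiffSMul 𝓘(ℝ, E) 𝓘(ℝ, V) ∞ H M]

/-- The push-forward of a section by `k`. -/
def Action.push (k : H) (s : ∀ x, L.Fiber x) (y : M) : L.Fiber y :=
  (a.act k⁻¹ y).symm (s (k⁻¹ • y))

theorem Action.push_smul (k : H) (s : ∀ x, L.Fiber x) (x : M) :
    a.push k s (k • x) = a.act k x (s x) := by
  rw [push, LinearIsometryEquiv.symm_apply_eq]
  have h : (⟨k⁻¹ • k • x, s (k⁻¹ • k • x)⟩ : L.Total) = ⟨x, s x⟩ := by rw [inv_smul_smul]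
  have h2 := (a.tot_inv_tot k ⟨x, s x⟩).trans h.symm
  injection h2 with _ h3
  exact h3.symm

theorem Action.push_total (k : H) (s : ∀ x, L.Fiber x) (y : M) :
    (⟨y, a.push k s y⟩ : L.Total) = a.tot k ⟨k⁻¹ • y, s (k⁻¹ • y)⟩ := by
  have h1 : a.tot k⁻¹ ⟨y, a.push k s y⟩ = ⟨k⁻¹ • y, s (k⁻¹ • y)⟩ :=
    congrArg (TotalSpace.mk _) ((a.act k⁻¹ y).apply_symm_apply _)
  rw [← h1, ← a.tot_mul, mul_inv_cancel, a.tot_one]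

theorem Action.contMDiff_tot (k : H) : ContMDiff (𝓘(ℝ, V).prod 𝓘(ℝ, ℂ)) (𝓘(ℝ, V).prod 𝓘(ℝ, ℂ)) ∞
    (fun l : L.Total => a.tot k l) :=
  a.tot_smooth.comp (contMDiff_const.prodMk contMDiff_id)

theorem Action.push_smooth (k : H) {s : ∀ x, L.Fiber x} (hs : L.IsSmoothSection s) :
    L.IsSmoothSection (a.push k s) := by
  have h1 : ContMDiff 𝓘(ℝ, V) 𝓘(ℝ, V) ∞ (fun y : M => k⁻¹ • y) :=
    ContMDiff.smul (I := 𝓘(ℝ, E)) contMDiff_const contMDiff_id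
  have h := (a.contMDiff_tot k).comp (hs.comp h1)
  exact h.congr (a.push_total k s)

variable {Z : Type*} {B : Type*} [NormedAddCommGroup B] [NormedSpace ℝ B] {HZ : Type*}
  [TopologicalSpace HZ] {J : ModelWithCorners ℝ B HZ} [TopologicalSpace Z] [ChartedSpace HZ Z]

/-- If `σ = f • e` near the point, then the moved map is `f` times the push-forward of `e`.
Invariance of the connection compares the derivatives of `e` and of its push-forward. -/
theorem HasConnForms.along_act (hc : HasConnForms nabla)
    (hinv : ∀ (h : H) (s t : ∀ x, L.Fiber x), L.IsSmoothSection s → L.IsSmoothSection t →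
      (∀ x, t (h • x) = a.act h x (s x)) → ∀ (x : M) (v : TangentSpace 𝓘(ℝ, V) x),
      nabla t (h • x) (tangentAct V h x v) = a.act h x (nabla s x v))
    (k : H) {σ : Z → L.Total} {z : Z} (hσ : MDifferentiableAt J (𝓘(ℝ, V).prod 𝓘(ℝ, ℂ)) σ z)
    (ξ : B) :
    along J nabla (fun z => a.tot k (σ z)) z ξ =
      a.act k (σ z).proj (along J nabla σ z ξ) := by
  have h1 := (mdifferentiableAt_iff (L.mem_base _)).1 hσ
  have h2 : ∀ᶠ z' in 𝓝 z, (a.tot k (σ z')).snd =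
      L.co (σ z).proj (σ z') • a.push k (L.ext (σ z).proj) (a.tot k (σ z')).proj := by
    filter_upwards [co_ext hσ] with z' h
    have h3 : (a.tot k (σ z')).snd = a.act k (σ z').proj (σ z').snd := rfl
    rw [h3, h, map_smul]
    exact congrArg _ (a.push_smul k _ _).symm
  have h3 : MDifferentiableAt J (𝓘(ℝ, V).prod 𝓘(ℝ, ℂ)) (fun z => a.tot k (σ z)) z :=
    ((a.contMDiff_tot k).mdifferentiable (by simp) (σ z)).comp z hσ
  refine (hc.along_eq h3 h1.2 ((a.push_smooth k (ext_smooth _)).isDiffAt _) h2 ξ).trans ?_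
  rw [hc.along_eq hσ h1.2 ((ext_smooth _).isDiffAt _) (co_ext hσ), map_add, map_smul, map_smul]
  have hsm : MDifferentiableAt 𝓘(ℝ, V) 𝓘(ℝ, V) (fun y : M => k • y) (σ z).proj :=
    (ContMDiff.smul (I := 𝓘(ℝ, E)) (n := ∞) contMDiff_const contMDiff_id).mdifferentiable (by simp) _
  have h4 : tder J 𝓘(ℝ, V) (fun z' => (a.tot k (σ z')).proj) z ξ =
    actL V k (σ z).proj (tder J 𝓘(ℝ, V) (fun z' => (σ z').proj) z ξ) :=
    tder_comp_apply hsm h1.1 rfl ξ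
  have h5 := hinv k _ _ (ext_smooth (L := L) (σ z).proj) (a.push_smooth k (ext_smooth _))
    (a.push_smul k _) (σ z).proj (tder J 𝓘(ℝ, V) (fun z' => (σ z').proj) z ξ)
  have h6 := a.push_smul k (L.ext (σ z).proj) (σ z).proj
  rw [h4]
  exact congrArg₂ (· + ·) (congrArg _ h6) (congrArg _ h5)

end Equivariance

end HermitianLineBundle

end PreHam

namespace PreHam

namespace HermitianLineBundle

universe w

/-! ### Kostant's formula along orbits. -/

section Kostant

variable {V : Type*} [NormedAddCommGroup V] [NormedSpace ℝ V] [FiniteDimensional ℝ V]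
  {M : Type*} [TopologicalSpace M] [ChartedSpace V M] [IsManifold 𝓘(ℝ, V) ∞ M] [T2Space M]
  {L : HermitianLineBundle.{w} V M} {nabla : CovariantDerivative 𝓘(ℝ, V) ℂ L.Fiber}
  {E : Type*} [NormedAddCommGroup E] [NormedSpace ℝ E] {H : Type*} [TopologicalSpace H]
  [ChartedSpace E H] [Group H] [MulAction H M] (a : L.Action E H)
  [LieGroup 𝓘(ℝ, E) ∞ H] [ContMDiffSMul 𝓘(ℝ, E) 𝓘(ℝ, V) ∞ H M]

/-- The fibres over `1 • x` and `x` are different types, and the action of `1` is the transport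
between them. -/
theorem Action.act_one_section (t : ∀ x, L.Fiber x) (x : M) :
    t ((1 : H) • x) = a.act 1 x (t x) := by
  have h : (⟨(1 : H) • x, t ((1 : H) • x)⟩ : L.Total) = ⟨x, t x⟩ := by rw [one_smul]
  have h2 := h.trans (a.act_one x (t x)).symm
  injection h2

theorem Action.contMDiff_orbit (l : L.Total) : ContMDiff 𝓘(ℝ, E) (𝓘(ℝ, V).prod 𝓘(ℝ, ℂ)) ∞
    (fun h : H => a.tot h l) :=
  a.tot_smooth.comp (contMDiff_id.prodMk contMDiff_const)

theorem Action.mdifferentiableAt_shift {s : ∀ x, L.Fiber x} (hs : L.IsSmoothSection s) (n : M)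
    (h₀ : H) : MDifferentiableAt 𝓘(ℝ, E) (𝓘(ℝ, V).prod 𝓘(ℝ, ℂ))
      (fun h : H => (⟨n, (a.act h n).symm (s (h • n))⟩ : L.Total)) h₀ := by
  have ho : ContMDiff 𝓘(ℝ, E) 𝓘(ℝ, V) ∞ (fun h : H => h • n) := contMDiff_id.smul contMDiff_const
  have h1 : ContMDiff 𝓘(ℝ, E) (𝓘(ℝ, V).prod 𝓘(ℝ, ℂ)) ∞
      (fun h : H => (⟨h • n, s (h • n)⟩ : L.Total)) := hs.comp ho
  have h2 : ContMDiff 𝓘(ℝ, E) (𝓘(ℝ, V).prod 𝓘(ℝ, ℂ)) ∞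
      (fun h : H => a.tot h⁻¹ ⟨h • n, s (h • n)⟩) :=
    a.tot_smooth.comp ((contMDiff_id.inv (I := 𝓘(ℝ, E))).prodMk h1)
  refine (h2.congr fun h => ?_).mdifferentiable (by simp) h₀
  have h3 : a.tot h ⟨n, (a.act h n).symm (s (h • n))⟩ = ⟨h • n, s (h • n)⟩ :=
    congrArg (TotalSpace.mk _) ((a.act h n).apply_symm_apply _)
  rw [← h3, a.tot_inv_tot]

/-- Kostant's formula, as a formula for the covariant derivative along an orbit in `L`. -/
theorem HasConnForms.along_orbit (hc : HasConnForms nabla) {Φ : M → (E →L[ℝ] ℝ)}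
    (hk : ∀ (X : E) (s : ∀ x, L.Fiber x), L.IsSmoothSection s → ∀ x : M,
      nabla s x (fundVec H X x) =
        (2 * Real.pi * Complex.I * (2 * (Φ x X : ℝ)) : ℂ) • s x +
          mvfderiv 𝓘(ℝ, E) (fun h : H => (a.act h x).symm (s (h • x))) 1 X)
    (l : L.Total) (X : E) :
    along 𝓘(ℝ, E) nabla (fun h : H => a.tot h l) 1 X =
      a.act 1 l.proj ((2 * Real.pi * Complex.I * (2 * (Φ l.proj X : ℝ)) : ℂ) • l.snd) := by
  obtain ⟨n, u⟩ := l
  set e := L.ext n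
  have he : L.IsSmoothSection e := ext_smooth n
  have hen : e n = L.unit n n := (ext_eq n).self_of_nhds
  set F : H → L.Fiber n := fun h => (a.act h n).symm (e (h • n))
  have hF := a.mdifferentiableAt_shift he n 1
  set r : H → ℂ := fun h => L.co n ⟨n, F h⟩
  have hr : MDifferentiableAt 𝓘(ℝ, E) 𝓘(ℝ, ℂ) r 1 :=
    ((mdifferentiableAt_iff (L.mem_base n)).1 hF).2
  have hFr : ∀ h, F h = r h • e n := fun h => by
    rw [hen]; exact (co_smul_unit (L.mem_base n) (F h)).symm
  have hF1 : F 1 = e n := by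
    change (a.act 1 n).symm (e ((1 : H) • n)) = _
    rw [a.act_one_section e, LinearIsometryEquiv.symm_apply_apply]
  have hr1 : r 1 = 1 := by
    change L.co n ⟨n, F 1⟩ = 1
    rw [hF1, hen]; exact co_unit (L.mem_base n)
  have hr0 : ∀ᶠ h in 𝓝 (1 : H), r h ≠ 0 :=
    hr.continuousAt.eventually_ne (by rw [hr1]; exact one_ne_zero)
  set c₀ := L.co n ⟨n, u⟩
  have hu : u = c₀ • e n := by rw [hen]; exact (co_smul_unit (L.mem_base n) u).symm
  -- The function `r` is defined by `h⁻¹ e(h n) = r(h) e(n)`, so the orbit of `u = c₀ e(n)` is `h u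
  -- = c₀ r(h)⁻¹ e(h n)`.
  have hσf : ∀ᶠ h in 𝓝 (1 : H), (a.tot h ⟨n, u⟩).snd = (c₀ * (r h)⁻¹) • e (a.tot h ⟨n, u⟩).proj := by
    filter_upwards [hr0] with h hh
    change a.act h n u = (c₀ * (r h)⁻¹) • e (h • n)
    have h1 : e (h • n) = r h • a.act h n (e n) := by
      rw [← map_smul, ← hFr]
      exact ((a.act h n).apply_symm_apply _).symm
    rw [h1, smul_smul, mul_assoc, inv_mul_cancel₀ hh, mul_one, ← map_smul, ← hu]
  have hinv : HasFDerivAt (fun z : ℂ => c₀ * z⁻¹) ((1 : ℂ →L[ℝ] ℂ).smulRight (-c₀)) (r 1) := by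
    have h := ((hasDerivAt_inv (x := r 1) (by rw [hr1]; exact one_ne_zero)).const_mul c₀)
    have h2 := h.hasFDerivAt.restrictScalars ℝ
    refine h2.congr_fderiv ?_
    ext
    simp [hr1]
  have hg : MDifferentiableAt 𝓘(ℝ, E) 𝓘(ℝ, ℂ) (fun h => c₀ * (r h)⁻¹) 1 :=
    MDifferentiableAt.comp (I' := 𝓘(ℝ, ℂ)) (g := fun z : ℂ => c₀ * z⁻¹) _
      hinv.differentiableAt.mdifferentiableAt hr
  have hgd : tder 𝓘(ℝ, E) 𝓘(ℝ, ℂ) (fun h => c₀ * (r h)⁻¹) 1 X = -(c₀ * tder 𝓘(ℝ, E) 𝓘(ℝ, ℂ) r 1 X) := by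
    rw [tder_comp_apply (g := fun z : ℂ => c₀ * z⁻¹) hinv.differentiableAt.mdifferentiableAt hr rfl,
      tder_eq_fderiv, hinv.fderiv]
    simp [mul_comm]
  have hσ := (a.contMDiff_orbit ⟨n, u⟩).mdifferentiable (by simp) 1
  refine (hc.along_eq hσ hg (he.isDiffAt _) hσf X).trans ?_
  have hk' := hk X e he n
  have hd : mvfderiv 𝓘(ℝ, E) (fun h : H => (a.act h n).symm (e (h • n))) 1 X =
      tder 𝓘(ℝ, E) 𝓘(ℝ, ℂ) r 1 X • e n := by
    change tder 𝓘(ℝ, E) 𝓘(ℝ, L.Fiber n) F 1 X = _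
    rw [show F = fun h => ((1 : ℂ →L[ℝ] ℂ).smulRight (e n)) (r h) from funext hFr,
      tder_comp_apply (g := fun c => ((1 : ℂ →L[ℝ] ℂ).smulRight (e n)) c)
      ((1 : ℂ →L[ℝ] ℂ).smulRight (e n)).mdifferentiableAt hr rfl, tder_eq_fderiv,
      ContinuousLinearMap.fderiv]
    rfl
  rw [hd] at hk'
  have hk2 : evL (nabla e n) (fundL V (H := H) n X) = (2 * Real.pi * Complex.I * (2 * (Φ n X : ℝ)) : ℂ) • e n +
      tder 𝓘(ℝ, E) 𝓘(ℝ, ℂ) r 1 X • e n := hk'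
  have h1 := a.act_one_section e n
  have h2 := a.act_one_section (fun x => evL (nabla e x) (fundL V (H := H) n X)) n
  -- Kostant's formula expresses `∇e` as the moment term plus `dr(X) e`; the latter cancels the
  -- derivative `-c₀ dr(X)` of `c₀ r⁻¹`.
  have h3 : tder 𝓘(ℝ, E) 𝓘(ℝ, ℂ) (fun h => c₀ * (r h)⁻¹) 1 X • e ((1 : H) • n) +
      (c₀ * (r 1)⁻¹) • evL (nabla e ((1 : H) • n)) (fundL V (H := H) n X) =
      a.act 1 n ((2 * Real.pi * Complex.I * (2 * (Φ n X : ℝ)) : ℂ) • u) := by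
    rw [h1, h2, hk2, hgd, hr1, ← map_smul, ← map_smul, ← map_add, hu]
    congr 1
    module
  exact h3

end Kostant

end HermitianLineBundle

theorem tder_inv_one {E : Type*} [NormedAddCommGroup E] [NormedSpace ℝ E] {G : Type*}
    [TopologicalSpace G] [ChartedSpace E G] [Group G] [LieGroup 𝓘(ℝ, E) ∞ G] (X : E) :
    MDifferentiableAt 𝓘(ℝ, E) 𝓘(ℝ, E) (fun a : G => a⁻¹) 1 ∧
      tder 𝓘(ℝ, E) 𝓘(ℝ, E) (fun a : G => a⁻¹) 1 X = -X := by
  have hi : MDifferentiableAt 𝓘(ℝ, E) 𝓘(ℝ, E) (fun a : G => a⁻¹) 1 :=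
    (contMDiff_inv 𝓘(ℝ, E) ∞).mdifferentiable (by simp) 1
  refine ⟨hi, ?_⟩
  have hm : MDifferentiableAt (𝓘(ℝ, E).prod 𝓘(ℝ, E)) 𝓘(ℝ, E) (fun p : G × G => p.1 * p.2) (1, 1) :=
    (contMDiff_mul 𝓘(ℝ, E) ∞).mdifferentiable (by simp) _
  have h := tder_comp_apply hm (mdifferentiableAt_id.prodMk hi) (by simp) X
  rw [tder_prodMk mdifferentiableAt_id hi, tder_prod hm] at h
  have h0 : (fun a : G => (id a, a⁻¹).1 * (id a, a⁻¹).2) = fun _ => 1 := by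
    funext a; simp
  have h1 : (fun a : G => (a, (1 : G)).1 * (a, (1 : G)).2) = fun a => a := by funext a; simp
  have h2 : (fun a : G => ((1 : G), a).1 * ((1 : G), a).2) = fun a => a := by funext a; simp
  dsimp only at h h0 h1 h2
  rw [h0, h1, h2, tder_const, tder_id] at h
  have h3 : tder 𝓘(ℝ, E) 𝓘(ℝ, E) (id : G → G) 1 = ContinuousLinearMap.id ℝ E := tder_id
  rw [h3] at h
  exact (neg_eq_of_add_eq_zero_right h.symm).symm

/-! ### Definition of the connection on `G ×_K L`. -/

section InducedConnection

universe w

open HermitianLineBundle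

variable {EG : Type*} [NormedAddCommGroup EG] [NormedSpace ℝ EG] [FiniteDimensional ℝ EG]
  {G : Type*} [TopologicalSpace G] [ChartedSpace EG G] [Group G] [LieGroup 𝓘(ℝ, EG) ∞ G]
  {EK : Type*} [NormedAddCommGroup EK] [NormedSpace ℝ EK] [FiniteDimensional ℝ EK]
  {K : Subgroup G} [ChartedSpace EK K] [LieGroup 𝓘(ℝ, EK) ∞ K]
  (hK : IsMaximalCompactLieSubgroup (EG := EG) (EK := EK) K)
  {S : SpinComplement (EG := EG) (EK := EK) K}
  {V : Type*} [NormedAddCommGroup V] [NormedSpace ℝ V] [FiniteDimensional ℝ V]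
  {N : Type*} [TopologicalSpace N] [ChartedSpace V N] [IsManifold 𝓘(ℝ, V) ∞ N] [T2Space N]
  [MulAction K N] [ContMDiffSMul 𝓘(ℝ, EK) 𝓘(ℝ, V) ∞ K N]
  [ChartedSpace (V × S.𝔭) (AssocSpace K N)] [IsManifold 𝓘(ℝ, V × S.𝔭) ∞ (AssocSpace K N)]
  (A : AssocAtlas S V N) {L : HermitianLineBundle.{w} V N} {aL : L.Action EK K}
  {nabla : CovariantDerivative 𝓘(ℝ, V) ℂ L.Fiber} {ν : TwoForm V N} {Φ : N → (EK →L[ℝ] ℝ)}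

namespace AssocAtlas

variable (aL) in
/-- The function on `G × N` that corresponds to a section of `G ×_K L`. -/
def pullTot (s : ∀ m, (A.lineBundle aL).Fiber m) (p : G × N) : L.Total :=
  ⟨p.2, A.pullSec aL s p.1 p.2⟩

/-- The argument of `pullSec_smooth` at a single point. Differentiability alone is needed because
the connection laws are stated for sections that are only differentiable there. -/
theorem mdifferentiableAt_pullTot {s : ∀ m, (A.lineBundle aL).Fiber m} {p : G × N}
    (hs : (A.lineBundle aL).IsDiffAt s (assocMk K p)) :
    MDifferentiableAt (𝓘(ℝ, EG).prod 𝓘(ℝ, V)) (𝓘(ℝ, V).prod 𝓘(ℝ, ℂ)) (A.pullTot aL s) p := by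
  obtain ⟨g, n⟩ := p
  set m₀ := assocMk K (g, n)
  have hm : m₀ ∈ A.lineDom L m₀ := A.mem_lineDom m₀
  have hdom : (g, n) ∈ A.dom m₀ := A.mk_mem_source.1 hm.1
  have h1 : MDifferentiableAt (𝓘(ℝ, EG).prod 𝓘(ℝ, V)) (𝓘(ℝ, V × S.𝔭).prod 𝓘(ℝ, ℂ))
      (fun p : G × N => (⟨assocMk K p, s (assocMk K p)⟩ : (A.lineBundle aL).Total)) (g, n) :=
    MDifferentiableAt.comp (I' := 𝓘(ℝ, V × S.𝔭)) (g, n) hs (A.mdiff_mk (g, n))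
  have h2 : MDifferentiableAt (𝓘(ℝ, EG).prod 𝓘(ℝ, V)) (𝓘(ℝ, EG).prod (𝓘(ℝ, V).prod 𝓘(ℝ, ℂ)))
      (fun p : G × N => A.lineSec aL m₀ ⟨assocMk K p, s (assocMk K p)⟩) (g, n) :=
    MDifferentiableAt.comp (I' := 𝓘(ℝ, V × S.𝔭).prod 𝓘(ℝ, ℂ)) (g, n)
      ((A.lineSec_smooth aL (m₀ := m₀) hm).mdifferentiableAt (by simp)) h1
  have h3 : ContMDiffAt (𝓘(ℝ, EG).prod 𝓘(ℝ, V)) 𝓘(ℝ, EK) ∞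
      (fun p : G × N => (A.kap m₀ p.1)) (g, n) :=
    ContMDiffAt.comp (I' := 𝓘(ℝ, EG)) (g := A.kap m₀) (g, n) (A.kap_smooth hdom) contMDiffAt_fst
  have h4 : MDifferentiableAt (𝓘(ℝ, EG).prod 𝓘(ℝ, V)) 𝓘(ℝ, EK)
      (fun p : G × N => (A.kap m₀ p.1)⁻¹) (g, n) := h3.inv.mdifferentiableAt (by simp)
  have h5 := MDifferentiableAt.comp (I' := 𝓘(ℝ, EK).prod (𝓘(ℝ, V).prod 𝓘(ℝ, ℂ))) (g, n)
    (aL.tot_smooth.mdifferentiable (by simp) (_, _)) (h4.prodMk h2.snd)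
  refine h5.congr_of_eventuallyEq ?_
  filter_upwards [(A.isOpen_dom m₀).mem_nhds hdom] with p hp
  have h6 : (⟨assocMk K p, s (assocMk K p)⟩ : (A.lineBundle aL).Total) =
      A.lineQ aL (p.1, ⟨p.2, A.pullSec aL s p.1 p.2⟩) :=
    congrArg (TotalSpace.mk _)
      ((A.lineMk aL p.1 p.2).apply_symm_apply (s (assocMk K (p.1, p.2)))).symm
  simp only [Function.comp]
  rw [h6, A.lineSec_lineQ aL p.1 ⟨p.2, A.pullSec aL s p.1 p.2⟩ hp, aL.tot_inv_tot]
  rfl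

theorem pullTot_translate (s : ∀ m, (A.lineBundle aL).Fiber m) (g : G) (k : K) (n : N) :
    A.pullTot aL s (g * (k : G)⁻¹, k • n) = aL.tot k (A.pullTot aL s (g, n)) := by
  refine congrArg (TotalSpace.mk (k • n)) ?_
  refine (LinearIsometryEquiv.symm_apply_eq _).2 ?_
  have h1 := A.lineIso_tot aL g k ⟨n, A.pullSec aL s g n⟩
  have h2 := A.lineMk_pullSec aL s g n
  have h4 : A.lineVal aL (s (assocMk K (g * (k : G)⁻¹, k • n))) =
      A.lineVal aL (s (assocMk K (g, n))) := by rw [assocMk_mul_inv]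
  exact h4.trans ((congrArg (A.lineVal aL) h2).symm.trans h1.symm)

variable (aL nabla) in
/-- The covariant derivative of the function on `G × N` that corresponds to a section. -/
def pullDer (s : ∀ m, (A.lineBundle aL).Fiber m) (g : G) (n : N) : EG × V →L[ℝ] L.Fiber n :=
  along (𝓘(ℝ, EG).prod 𝓘(ℝ, V)) nabla (A.pullTot aL s) (g, n)

/-- The pulled-back function satisfies `f(g k⁻¹, k n) = k f(g, n)`. The chain rule on the left and
invariance of `∇^N` on the right give the same relation for derivatives. -/
theorem pullDer_translate (hc : HasConnForms nabla)
    (hP : L.IsSpincPrequantisation aL nabla ν Φ) {s : ∀ m, (A.lineBundle aL).Fiber m} {g : G} {n : N}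
    (hs : (A.lineBundle aL).IsDiffAt s (assocMk K (g, n))) (k : K) (ξ : EG) (v : V) :
    A.pullDer aL nabla s (g * (k : G)⁻¹) (k • n) (lvec (Ad (k : G) ξ) (g * (k : G)⁻¹), actL V k n v) =
      aL.act k n (A.pullDer aL nabla s g n (lvec ξ g, v)) := by
  obtain ⟨h1, h2⟩ := tder_translate (EK := EK) (V := V) g k n ξ v
  have hs' : (A.lineBundle aL).IsDiffAt s (assocMk K (g * (k : G)⁻¹, k • n)) := by
    rwa [assocMk_mul_inv]
  have h3 := along_comp (nabla := nabla) (σ := A.pullTot aL s)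
    (h := fun p : G × N => (p.1 * (k : G)⁻¹, k • p.2))
    (z := (g, n)) (A.mdifferentiableAt_pullTot hs') h1 (lvec ξ g, v)
  rw [h2] at h3
  refine h3.symm.trans ?_
  have h4 := hc.along_act aL hP.invariant k (A.mdifferentiableAt_pullTot hs) (lvec ξ g, v)
  have h5 : (fun p : G × N => A.pullTot aL s (p.1 * (k : G)⁻¹, k • p.2)) =
      fun p => aL.tot k (A.pullTot aL s p) := funext fun p => A.pullTot_translate s p.1 k p.2
  have h6 : ∀ σ : G × N → L.Total, σ = (fun p => aL.tot k (A.pullTot aL s p)) →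
      (⟨_, along (𝓘(ℝ, EG).prod 𝓘(ℝ, V)) nabla σ (g, n) (lvec ξ g, v)⟩ : L.Total) =
      ⟨k • n, aL.act k n (A.pullDer aL nabla s g n (lvec ξ g, v))⟩ := by
    rintro _ rfl
    exact congrArg (TotalSpace.mk (k • n)) h4
  have h7 := h6 _ h5
  injection h7

include hK in
-- Along `k ↦ (g k⁻¹, k n)`, which has velocity `(-gZ, Z_N)`, the pulled-back function runs through
-- the orbit `k s_g(n)` in `L`. Kostant's formula gives the covariant derivative along this orbit.
theorem pullDer_vertical (hc : HasConnForms nabla)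
    (hP : L.IsSpincPrequantisation aL nabla ν Φ) {s : ∀ m, (A.lineBundle aL).Fiber m} {g : G} {n : N}
    (hs : (A.lineBundle aL).IsDiffAt s (assocMk K (g, n))) (Z : EK) :
    A.pullDer aL nabla s g n (-lvec (lieIncl K Z) g, fundL V (H := K) n Z) =
      (2 * Real.pi * Complex.I * (2 * (Φ n Z : ℝ)) : ℂ) • A.pullSec aL s g n := by
  set h : K → G × N := fun k => (g * ((k⁻¹ : K) : G), k • n) with hh
  have hi := tder_inv_one (G := K) Z
  have hb : MDifferentiableAt 𝓘(ℝ, EK) 𝓘(ℝ, V) (fun k : K => k • n) 1 :=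
    (PreHam.contMDiff_orbit n).contMDiffAt.mdifferentiableAt (by simp)
  have hci : MDifferentiableAt 𝓘(ℝ, EK) 𝓘(ℝ, EG) (fun k : K => ((k⁻¹ : K) : G)) 1 :=
    MDifferentiableAt.comp (I' := 𝓘(ℝ, EK)) (g := fun k : K => (k : G)) 1 (mdiff_coe hK _) hi.1
  have ha : MDifferentiableAt 𝓘(ℝ, EK) 𝓘(ℝ, EG) (fun k : K => g * ((k⁻¹ : K) : G)) 1 :=
    MDifferentiableAt.comp (I' := 𝓘(ℝ, EG)) (g := fun x => g * x) _ (mdiff_mul_left g _) hci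
  have had : tder 𝓘(ℝ, EK) 𝓘(ℝ, EG) (fun k : K => g * ((k⁻¹ : K) : G)) 1 Z =
      -lvec (lieIncl K Z) g := by
    rw [tder_comp_apply (y := (1 : G)) (mdiff_mul_left g 1) hci (by simp),
      tder_comp_apply (y := (1 : K)) (g := fun k : K => (k : G)) (mdiff_coe hK 1) hi.1 (by simp),
      hi.2, map_neg, map_neg]
    rfl
  have hhd : MDifferentiableAt 𝓘(ℝ, EK) (𝓘(ℝ, EG).prod 𝓘(ℝ, V)) h 1 := ha.prodMk hb
  have hht : tder 𝓘(ℝ, EK) (𝓘(ℝ, EG).prod 𝓘(ℝ, V)) h 1 Z =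
      (-lvec (lieIncl K Z) g, fundL V (H := K) n Z) := by
    rw [hh, tder_prodMk ha hb, had]; rfl
  have h1p : h 1 = (g, n) := by simp [hh]
  have hσ : MDifferentiableAt (𝓘(ℝ, EG).prod 𝓘(ℝ, V)) (𝓘(ℝ, V).prod 𝓘(ℝ, ℂ))
      (A.pullTot aL s) (h 1) := by rw [h1p]; exact A.mdifferentiableAt_pullTot hs
  have h3 := along_comp (nabla := nabla) (σ := A.pullTot aL s) (h := h) (z := 1) hσ hhd Z
  rw [hht] at h3
  have h4 := hc.along_orbit aL hP.kostant (A.pullTot aL s (g, n)) Z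
  have h5 : (fun k : K => A.pullTot aL s (h k)) = fun k => aL.tot k (A.pullTot aL s (g, n)) :=
    funext fun k => A.pullTot_translate s g k n
  -- The derivatives lie in the fibres over `1 • n` and `n`; comparing points of the total space
  -- absorbs the difference.
  have h6 : ∀ σ : K → L.Total, σ = (fun k => aL.tot k (A.pullTot aL s (g, n))) →
      (⟨_, along 𝓘(ℝ, EK) nabla σ 1 Z⟩ : L.Total) =
      ⟨n, (2 * Real.pi * Complex.I * (2 * (Φ n Z : ℝ)) : ℂ) • A.pullSec aL s g n⟩ := by
    rintro _ rfl
    exact (congrArg (TotalSpace.mk ((1 : K) • n)) h4).trans (aL.act_one n _)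
  have h7 : ∀ p : G × N, p = (g, n) →
      (⟨p.2, along (𝓘(ℝ, EG).prod 𝓘(ℝ, V)) nabla (A.pullTot aL s) p
        (-lvec (lieIncl K Z) g, fundL V (H := K) n Z)⟩ : L.Total) =
      ⟨n, A.pullDer aL nabla s g n (-lvec (lieIncl K Z) g, fundL V (H := K) n Z)⟩ := by
    rintro _ rfl; rfl
  have h8 := (h7 (h 1) h1p).symm.trans ((congrArg (TotalSpace.mk (h 1).2) h3.symm).trans (h6 _ h5))
  injection h8

variable (aL nabla) in
/-- The connection on `G ×_K L`. -/
def indNabla (s : ∀ m, (A.lineBundle aL).Fiber m) (m : AssocSpace K N) :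
    TangentSpace 𝓘(ℝ, V × S.𝔭) m →L[ℝ] (A.lineBundle aL).Fiber m :=
  ((A.lineIso aL (A.rG m) (A.rN m)).toContinuousLinearEquiv.toContinuousLinearMap.restrictScalars
    ℝ).comp ((A.pullDer aL nabla s (A.rG m) (A.rN m)).comp
      (((leftVecL (A.rG m)).comp (S.𝔭.subtypeL.comp (ContinuousLinearMap.snd ℝ V S.𝔭))).prod
        (ContinuousLinearMap.fst ℝ V S.𝔭)))

theorem indNabla_apply (s : ∀ m, (A.lineBundle aL).Fiber m) (m : AssocSpace K N) (w : V × S.𝔭) :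
    A.lineVal aL (evL (A.indNabla aL nabla s m) w) = A.lineIso aL (A.rG m) (A.rN m)
      (A.pullDer aL nabla s (A.rG m) (A.rN m) (lvec (w.2 : EG) (A.rG m), w.1)) := rfl

include hK in
/-- The connection on `G ×_K L`, in terms of functions on `G × N`. -/
theorem indNabla_dq (hc : HasConnForms nabla)
    (hP : L.IsSpincPrequantisation aL nabla ν Φ)
    {s : ∀ m, (A.lineBundle aL).Fiber m} {g : G} {n : N}
    (hs : (A.lineBundle aL).IsDiffAt s (assocMk K (g, n))) (ξ : EG) (v : V) :
    evL (A.indNabla aL nabla s (assocMk K (g, n))) (dq S (g, n) (lvec ξ g, v)) =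
      A.lineMk aL g n (A.pullDer aL nabla s g n (lvec ξ g, v) +
        (2 * Real.pi * Complex.I * (2 * (Φ n (S.projL hK ξ) : ℝ)) : ℂ) • A.pullSec aL s g n) := by
  have hv := A.pullDer_vertical hK hc hP hs (S.projL hK ξ)
  have hlin : ((lvec (S.compl hK ξ : EG) g, v + fundL V (H := K) n (S.projL hK ξ)) : EG × V) =
      (lvec ξ g, v) + (-lvec (lieIncl K (S.projL hK ξ)) g, fundL V (H := K) n (S.projL hK ξ)) := by
    have : lvec ξ g = lvec (S.compl hK ξ : EG) g + lvec (lieIncl K (S.projL hK ξ)) g := by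
      rw [← leftVecL_apply, ← leftVecL_apply, ← leftVecL_apply, ← map_add, S.compl_add_projL hK]
    rw [this]; simp
  -- The moment term is the derivative along the vertical vector `(-gZ, Z_N)`, where `Z` is the
  -- `𝔨`-part of `ξ`. Adding it replaces `(gξ, v)` by the vector with the same image under `Tq` and
  -- group part in `𝔭`.
  rw [A.dq_eq hK, ← hv, ← map_add, ← hlin]
  set v' := v + fundL V (H := K) n (S.projL hK ξ)
  rw [A.dq_mk_rep]
  have h1 := A.pullDer_translate hc hP hs (A.r.ρ g) (S.compl hK ξ : EG) v'
  have h2 := A.lineIso_tot aL g (A.r.ρ g)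
    ⟨n, A.pullDer aL nabla s g n (lvec (S.compl hK ξ : EG) g, v')⟩
  refine Eq.trans ?_ h2
  refine (A.indNabla_apply s (assocMk K (g, n)) _).trans ?_
  have e3 : A.lineIso aL (g * (A.r.ρ g : G)⁻¹) (A.r.ρ g • n)
      (A.pullDer aL nabla s (g * (A.r.ρ g : G)⁻¹) (A.r.ρ g • n)
        (lvec (Ad (A.r.ρ g : G) (S.compl hK ξ : EG)) (g * (A.r.ρ g : G)⁻¹), actL V (A.r.ρ g) n v')) =
      A.lineIso aL (g * (A.r.ρ g : G)⁻¹) (A.r.ρ g • n)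
        (aL.act (A.r.ρ g) n (A.pullDer aL nabla s g n (lvec (S.compl hK ξ : EG) g, v'))) := by
    rw [h1]
  exact e3

end AssocAtlas

end InducedConnection

end PreHam

namespace PreHam

/-! ### Locally exact two-forms. -/

section Closed

variable {V : Type*} [NormedAddCommGroup V] [NormedSpace ℝ V]

variable (V) in
/-- The identification of linear forms with alternating forms of degree one. -/
def oneFormL : (V →L[ℝ] ℝ) →L[ℝ] V [⋀^Fin 1]→L[ℝ] ℝ :=
  (ContinuousAlternatingMap.ofSubsingletonLIE (𝕜 := ℝ) (E := V) (F := ℝ)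
    (0 : Fin 1)).toContinuousLinearEquiv

/-- A family of linear forms, as a differential form of degree one. -/
def oneForm (f : V → V →L[ℝ] ℝ) (y : V) : V [⋀^Fin 1]→L[ℝ] ℝ := oneFormL V (f y)

theorem oneForm_apply (f : V → V →L[ℝ] ℝ) (y : V) (v : Fin 1 → V) : oneForm f y v = f y (v 0) := rfl

theorem contDiffAt_oneForm {f : V → V →L[ℝ] ℝ} {y : V} (hf : ContDiffAt ℝ ∞ f y) :
    ContDiffAt ℝ ∞ (oneForm f) y := (oneFormL V).contDiff.contDiffAt.comp y hf

theorem differentiableAt_oneForm {f : V → V →L[ℝ] ℝ} {y : V} (hf : DifferentiableAt ℝ f y) :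
    DifferentiableAt ℝ (oneForm f) y := (oneFormL V).differentiableAt.comp y hf

theorem extDeriv_oneForm {f : V → V →L[ℝ] ℝ} {y : V} (hf : DifferentiableAt ℝ f y) (a b : V) :
    extDeriv (oneForm f) y ![a, b] = fderiv ℝ f y a b - fderiv ℝ f y b a := by
  have h2 : ∀ u c, fderiv ℝ (fun x => f x u) y c = fderiv ℝ f y c u := fun u c => by
    rw [fderiv_clm_apply hf (differentiableAt_const u)]
    simp
  rw [extDeriv_apply (differentiableAt_oneForm hf), Fin.sum_univ_two, ← h2, ← h2]
  simp only [oneForm_apply]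
  simp [Fin.removeNth, sub_eq_add_neg]

theorem contDiffAt_extDeriv_oneForm {f : V → V →L[ℝ] ℝ} {y : V} (hf : ContDiffAt ℝ ∞ f y) :
    ContDiffAt ℝ ∞ (extDeriv (oneForm f)) y := by
  have h1 : ContDiff ℝ ∞ (ContinuousAlternatingMap.alternatizeUncurryFinCLM ℝ V ℝ (n := 1)) :=
    ContinuousLinearMap.contDiff _
  have h2 : ContDiffAt ℝ ∞ (fderiv ℝ (oneForm f)) y :=
    (contDiffAt_oneForm hf).fderiv_right (m := ∞) (by simp)
  exact h1.contDiffAt.comp y h2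

theorem compContinuousLinearMap_two {V' : Type*} [NormedAddCommGroup V'] [NormedSpace ℝ V']
    (f : V [⋀^Fin 2]→L[ℝ] ℝ) (T : V' →L[ℝ] V) (a b : V') :
    f.compContinuousLinearMap T ![a, b] = f ![T a, T b] := by
  rw [ContinuousAlternatingMap.compContinuousLinearMap_apply]
  congr 1
  ext i
  fin_cases i <;> rfl

variable {M : Type*} [TopologicalSpace M] [ChartedSpace V M] [IsManifold 𝓘(ℝ, V) ∞ M]

theorem chartForm_apply (Ω : TwoForm V M) (x₀ : M) (y : V) (a b : V) :
    chartForm Ω x₀ y ![a, b] = Ω ((extChartAt 𝓘(ℝ, V) x₀).symm y)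
      ![tder 𝓘(ℝ, V) 𝓘(ℝ, V) (extChartAt 𝓘(ℝ, V) x₀).symm y a,
        tder 𝓘(ℝ, V) 𝓘(ℝ, V) (extChartAt 𝓘(ℝ, V) x₀).symm y b] :=
  compContinuousLinearMap_two (V := V) (V' := V) (Ω ((extChartAt 𝓘(ℝ, V) x₀).symm y))
    (tder 𝓘(ℝ, V) 𝓘(ℝ, V) (extChartAt 𝓘(ℝ, V) x₀).symm y) a b

theorem alternating_ext {f g : V [⋀^Fin 2]→L[ℝ] ℝ} (h : ∀ a b, f ![a, b] = g ![a, b]) : f = g := by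
  ext v
  have : v = ![v 0, v 1] := by ext i; fin_cases i <;> rfl
  rw [this, h]

/-- A two-form is presymplectic if it is locally exact. -/
theorem isPresymplectic_of_exact {Ω : TwoForm V M} (h : ∀ x : M, ∃ f : V → V →L[ℝ] ℝ,
    ContDiffAt ℝ ∞ f (extChartAt 𝓘(ℝ, V) x x) ∧
      ∀ᶠ y in 𝓝 (extChartAt 𝓘(ℝ, V) x x), chartForm Ω x y = extDeriv (oneForm f) y) :
    IsPresymplectic Ω := by
  have key : ∀ x₀ : M, ∀ y ∈ (extChartAt 𝓘(ℝ, V) x₀).target, ∃ f : V → V →L[ℝ] ℝ,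
      ContDiffAt ℝ ∞ f y ∧ chartForm Ω x₀ =ᶠ[𝓝 y] extDeriv (oneForm f) := by
    intro x₀ y hy
    set x := (extChartAt 𝓘(ℝ, V) x₀).symm y
    obtain ⟨f, hf, hΩ⟩ := h x
    set τ : V → V := fun z => extChartAt 𝓘(ℝ, V) x ((extChartAt 𝓘(ℝ, V) x₀).symm z)
    have hx := mem_extChartAt_source (I := 𝓘(ℝ, V)) x
    have hτ : ContDiffAt ℝ ∞ τ y := contMDiffAt_iff_contDiffAt.1
      (ContMDiffAt.comp (I' := 𝓘(ℝ, V)) y (contMDiffAt_chart hx) (contMDiffAt_chart_symm hy))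
    -- A potential is given only near the centre of each chart. In another chart it is pulled back
    -- along the transition map `τ`, with which the exterior derivative commutes.
    refine ⟨fun z => (f (τ z)).comp (fderiv ℝ τ z), ?_, ?_⟩
    · exact (ContDiffAt.comp y hf hτ).clm_comp (hτ.fderiv_right (m := ∞) (by simp))
    have hfe : ∀ᶠ z in 𝓝 (extChartAt 𝓘(ℝ, V) x x), DifferentiableAt ℝ f z :=
      ((hf.of_le (m := 1) (by norm_cast)).eventually (by simp)).mono
        fun z hz => hz.differentiableAt (by simp)
    have hτe : ∀ᶠ z in 𝓝 y, ContDiffAt ℝ 2 τ z :=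
      (hτ.of_le two_le_infty).eventually (by simp)
    filter_upwards [hτ.continuousAt.eventually hΩ, hτ.continuousAt.eventually hfe, hτe,
      extChartAt_target_nhds hy, (contMDiffAt_chart_symm hy).continuousAt.preimage_mem_nhds
        (extChartAt_source_nhds hx)] with z h1 h2 h3 h4 h5
    have h6 : (fun z => (oneForm f (τ z)).compContinuousLinearMap (fderiv ℝ τ z)) =
        oneForm (fun z => (f (τ z)).comp (fderiv ℝ τ z)) := by
      funext z
      ext v
      simp [oneForm_apply]
    have h7 := differentiableAt_oneForm h2
    rw [← h6, extDeriv_pullback h7 h3 (by simp), ← h1]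
    apply alternating_ext
    intro a b
    have h8 : ∀ a, tder 𝓘(ℝ, V) 𝓘(ℝ, V) (extChartAt 𝓘(ℝ, V) x).symm (τ z) (fderiv ℝ τ z a) =
        tder 𝓘(ℝ, V) 𝓘(ℝ, V) (extChartAt 𝓘(ℝ, V) x₀).symm z a := fun a => by
      rw [← tder_eq_fderiv, tder_comp_apply (g := extChartAt 𝓘(ℝ, V) x) (mdifferentiableAt_chart h5)
        (mdifferentiableAt_chart_symm h4) rfl]
      exact tder_symm_chart h5 _
    have h9 : (extChartAt 𝓘(ℝ, V) x).symm (τ z) = (extChartAt 𝓘(ℝ, V) x₀).symm z :=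
      (extChartAt 𝓘(ℝ, V) x).left_inv h5
    have h10 : ∀ m, m = (extChartAt 𝓘(ℝ, V) x₀).symm z → ∀ c d : V,
        Ω ((extChartAt 𝓘(ℝ, V) x₀).symm z) ![c, d] = Ω m ![c, d] := by
      rintro _ rfl _ _; rfl
    rw [compContinuousLinearMap_two, chartForm_apply, chartForm_apply, h8, h8]
    exact h10 _ h9 _ _
  constructor
  · intro x₀ y hy
    obtain ⟨f, hf, he⟩ := key x₀ y hy
    exact ((contDiffAt_extDeriv_oneForm hf).congr_of_eventuallyEq he).contDiffWithinAt
  · intro x₀ y hy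
    obtain ⟨f, hf, he⟩ := key x₀ y hy
    rw [he.extDeriv_eq]
    exact extDeriv_extDeriv_apply (contDiffAt_oneForm hf) (by simpa using two_le_infty)

end Closed

namespace HermitianLineBundle

universe w

/-! ### Curvature forms are presymplectic. -/

section Curvature

variable {V : Type*} [NormedAddCommGroup V] [NormedSpace ℝ V] [FiniteDimensional ℝ V]
  {M : Type*} [TopologicalSpace M] [ChartedSpace V M] [IsManifold 𝓘(ℝ, V) ∞ M] [T2Space M]
  {L : HermitianLineBundle.{w} V M} {nabla : CovariantDerivative 𝓘(ℝ, V) ℂ L.Fiber}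
  {Ω : TwoForm V M}

/-- The derivative of a connection form of a connection with curvature `2πi · 2Ω`. -/
theorem IsConnForm.fderiv_sub {x₀ : M} {O : Set V} {α : V → V →L[ℝ] ℂ}
    (h : IsConnForm nabla x₀ O α)
    (hcurv : ∀ (v w : ∀ x : M, TangentSpace 𝓘(ℝ, V) x) (s : ∀ x, L.Fiber x),
      IsSmoothField v → IsSmoothField w → L.IsSmoothSection s → ∀ x : M,
      nabla (fun y => nabla s y (w y)) x (v x) - nabla (fun y => nabla s y (v y)) x (w x)
          - nabla s x (VectorField.mlieBracket 𝓘(ℝ, V) v w x) =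
        (2 * Real.pi * Complex.I * (2 * (Ω x ![v x, w x] : ℝ)) : ℂ) • s x)
    {y : V} (hy : y ∈ O) (a b : V) :
    fderiv ℝ α y a b - fderiv ℝ α y b a =
      2 * Real.pi * Complex.I * (2 * (chartForm Ω x₀ y ![a, b] : ℝ)) := by
  have : CompleteSpace V := FiniteDimensional.complete ℝ V
  set x := (extChartAt 𝓘(ℝ, V) x₀).symm y with hx
  have hb := h.base y hy
  -- The curvature identity concerns global smooth fields and sections, so the two vectors and a
  -- unit vector of the fibre are extended.
  obtain ⟨v, hv, hv'⟩ := exists_smooth_section (V := V) V (TangentSpace 𝓘(ℝ, V) (M := M)) x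
    (tder 𝓘(ℝ, V) 𝓘(ℝ, V) (extChartAt 𝓘(ℝ, V) x₀).symm y a)
  obtain ⟨w, hw, hw'⟩ := exists_smooth_section (V := V) V (TangentSpace 𝓘(ℝ, V) (M := M)) x
    (tder 𝓘(ℝ, V) 𝓘(ℝ, V) (extChartAt 𝓘(ℝ, V) x₀).symm y b)
  obtain ⟨s, hs, hs'⟩ := exists_smooth_section (V := V) ℂ L.Fiber x (L.unit x₀ x)
  have h1 := h.curvature hy hs hv hw
  have h2 := hcurv v w s hv hw hs x
  have hcv : chartField x₀ v y = a := by
    rw [chartField, ← hx, hv']; exact tder_chart_symm (h.subset hy) a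
  have hcw : chartField x₀ w y = b := by
    rw [chartField, ← hx, hw']; exact tder_chart_symm (h.subset hy) b
  have hl : L.lco x₀ s y = 1 := by
    rw [lco, ← hx, hs']; exact co_unit hb
  rw [hcv, hcw, hl, mul_one] at h1
  rw [← h1, lco, ← hx]
  rw [h2, co_smul hb, hs', co_unit hb, mul_one, hv', hw', chartForm_apply]

/-- A form that is the curvature of a connection is presymplectic. -/
theorem HasConnForms.isPresymplectic (hc : HasConnForms nabla)
    (hcurv : ∀ (v w : ∀ x : M, TangentSpace 𝓘(ℝ, V) x) (s : ∀ x, L.Fiber x),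
      IsSmoothField v → IsSmoothField w → L.IsSmoothSection s → ∀ x : M,
      nabla (fun y => nabla s y (w y)) x (v x) - nabla (fun y => nabla s y (v y)) x (w x)
          - nabla s x (VectorField.mlieBracket 𝓘(ℝ, V) v w x) =
        (2 * Real.pi * Complex.I * (2 * (Ω x ![v x, w x] : ℝ)) : ℂ) • s x) :
    IsPresymplectic Ω := by
  refine isPresymplectic_of_exact fun x => ?_
  obtain ⟨O, α, h, hO⟩ := hc x
  -- The curvature is `4πiΩ`, so the real form `(4π)⁻¹ Im α` is a potential of `Ω`.
  set T : (V →L[ℝ] ℂ) →L[ℝ] (V →L[ℝ] ℝ) :=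
    ContinuousLinearMap.compL ℝ V ℂ ℝ ((4 * Real.pi)⁻¹ • Complex.imCLM)
  have hα : ∀ y ∈ O, ContDiffAt ℝ ∞ α y := fun y hy => h.smooth.contDiffAt (h.isOpen.mem_nhds hy)
  refine ⟨fun y => T (α y), T.contDiff.contDiffAt.comp _ (hα _ hO), ?_⟩
  filter_upwards [h.isOpen.mem_nhds hO] with y hy
  apply alternating_ext
  intro a b
  have hd := (hα y hy).differentiableAt (by simp)
  have h1 : DifferentiableAt ℝ (fun y => T (α y)) y := T.differentiableAt.comp y hd
  rw [extDeriv_oneForm h1]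
  have h2 : fderiv ℝ (fun y => T (α y)) y = T.comp (fderiv ℝ α y) :=
    (T.hasFDerivAt.comp y hd.hasFDerivAt).fderiv
  have h3 := congrArg (fun z : ℂ => (4 * Real.pi)⁻¹ * z.im) (h.fderiv_sub hcurv hy a b)
  have h4 : ∀ c : ℝ, (4 * Real.pi)⁻¹ * (2 * Real.pi * Complex.I * (2 * (c : ℂ))).im = c := by
    intro c
    have : (2 * Real.pi * Complex.I * (2 * (c : ℂ))) = ((4 * Real.pi * c : ℝ) : ℂ) * Complex.I := by
      push_cast; ring
    rw [this, Complex.re_ofReal_mul |> fun _ => Complex.im_ofReal_mul, Complex.I_im]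
    field_simp
  have h5 : ∀ a b, (T.comp (fderiv ℝ α y)) a b = (4 * Real.pi)⁻¹ * (fderiv ℝ α y a b).im :=
    fun a b => rfl
  change _ = fderiv ℝ (fun y => T (α y)) y a b - fderiv ℝ (fun y => T (α y)) y b a
  rw [h2, h5, h5, ← mul_sub, ← Complex.sub_im, h3, h4]

end Curvature

end HermitianLineBundle

end PreHam

namespace PreHam

theorem tder_ofReal {B : Type*} [NormedAddCommGroup B] [NormedSpace ℝ B] {H : Type*}
    [TopologicalSpace H] {J : ModelWithCorners ℝ B H} {Z : Type*} [TopologicalSpace Z]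
    [ChartedSpace H Z] {f : Z → ℝ} {z : Z} (hf : MDifferentiableAt J 𝓘(ℝ, ℝ) f z) (w : B) :
    MDifferentiableAt J 𝓘(ℝ, ℂ) (fun z => (f z : ℂ)) z ∧
      tder J 𝓘(ℝ, ℂ) (fun z => (f z : ℂ)) z w = (tder J 𝓘(ℝ, ℝ) f z w : ℂ) := by
  refine ⟨MDifferentiableAt.comp (I' := 𝓘(ℝ, ℝ)) (g := fun x : ℝ => (x : ℂ)) z
    Complex.ofRealCLM.mdifferentiableAt hf, ?_⟩
  rw [tder_comp_apply (I' := 𝓘(ℝ, ℝ)) (g := fun x : ℝ => (x : ℂ))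
    Complex.ofRealCLM.mdifferentiableAt hf rfl, tder_eq_fderiv]
  exact congrArg (fun T : ℝ →L[ℝ] ℂ => T _) Complex.ofRealCLM.fderiv

universe w

theorem HermitianLineBundle.along_total_congr {V : Type*} [NormedAddCommGroup V] [NormedSpace ℝ V]
    [FiniteDimensional ℝ V]
    {M : Type*} [TopologicalSpace M] [ChartedSpace V M] [IsManifold 𝓘(ℝ, V) ∞ M] [T2Space M]
    {L : HermitianLineBundle.{w} V M} {nabla : CovariantDerivative 𝓘(ℝ, V) ℂ L.Fiber}
    {B : Type*} [NormedAddCommGroup B] [NormedSpace ℝ B] {H : Type*}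
    [TopologicalSpace H] {J : ModelWithCorners ℝ B H} {Z : Type*} [TopologicalSpace Z]
    [ChartedSpace H Z] {σ τ : Z → L.Total} (h : σ = τ) (z : Z) (ξ : B) :
    (⟨_, along J nabla σ z ξ⟩ : L.Total) = ⟨_, along J nabla τ z ξ⟩ := by
  rw [h]

/-! ### The induced connection is a covariant derivative. -/

section InducedConnection

open HermitianLineBundle LineModel

variable {EG : Type*} [NormedAddCommGroup EG] [NormedSpace ℝ EG] [FiniteDimensional ℝ EG]
  {G : Type*} [TopologicalSpace G] [ChartedSpace EG G] [Group G] [LieGroup 𝓘(ℝ, EG) ∞ G]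
  {EK : Type*} [NormedAddCommGroup EK] [NormedSpace ℝ EK] [FiniteDimensional ℝ EK]
  {K : Subgroup G} [ChartedSpace EK K] [LieGroup 𝓘(ℝ, EK) ∞ K]
  (hK : IsMaximalCompactLieSubgroup (EG := EG) (EK := EK) K)
  {S : SpinComplement (EG := EG) (EK := EK) K}
  {V : Type*} [NormedAddCommGroup V] [NormedSpace ℝ V] [FiniteDimensional ℝ V]
  {N : Type*} [TopologicalSpace N] [ChartedSpace V N] [IsManifold 𝓘(ℝ, V) ∞ N] [T2Space N]
  [MulAction K N] [ContMDiffSMul 𝓘(ℝ, EK) 𝓘(ℝ, V) ∞ K N]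
  [ChartedSpace (V × S.𝔭) (AssocSpace K N)] [IsManifold 𝓘(ℝ, V × S.𝔭) ∞ (AssocSpace K N)]
  (A : AssocAtlas S V N) {L : HermitianLineBundle.{w} V N} {aL : L.Action EK K}
  {nabla : CovariantDerivative 𝓘(ℝ, V) ℂ L.Fiber} {ν : TwoForm V N} {Φ : N → (EK →L[ℝ] ℝ)}

theorem HermitianLineBundle.IsSpincPrequantisation.hasConnForms
    (hP : L.IsSpincPrequantisation aL nabla ν Φ) : HasConnForms nabla :=
  fun x₀ => exists_connForm hP.smooth hP.complex_linear x₀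

namespace AssocAtlas

theorem pullSec_add (s t : ∀ m, (A.lineBundle aL).Fiber m) (g : G) (n : N) :
    A.pullSec aL (s + t) g n = A.pullSec aL s g n + A.pullSec aL t g n := map_add _ _ _

theorem pullSec_smul (c : ℂ) (s : ∀ m, (A.lineBundle aL).Fiber m) (g : G) (n : N) :
    A.pullSec aL (fun m => c • s m) g n = c • A.pullSec aL s g n := map_smul _ _ _

theorem pullDer_add {s t : ∀ m, (A.lineBundle aL).Fiber m} {g : G} {n : N}
    (hs : (A.lineBundle aL).IsDiffAt s (assocMk K (g, n)))
    (ht : (A.lineBundle aL).IsDiffAt t (assocMk K (g, n))) (u : EG × V) :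
    A.pullDer aL nabla (s + t) g n u = A.pullDer aL nabla s g n u + A.pullDer aL nabla t g n u := by
  have h := along_add (nabla := nabla) (b := fun p : G × N => p.2)
    (s := fun p => A.pullSec aL s p.1 p.2)
    (t := fun p => A.pullSec aL t p.1 p.2) (z := (g, n)) (A.mdifferentiableAt_pullTot hs)
    (A.mdifferentiableAt_pullTot ht) u
  refine Eq.trans ?_ h
  have h2 := along_total_congr (nabla := nabla) (J := 𝓘(ℝ, EG).prod 𝓘(ℝ, V)) (funext fun p : G × N =>
    congrArg (TotalSpace.mk p.2) (A.pullSec_add s t p.1 p.2)) (g, n) u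
  injection h2

/-- The product rule for `pullDer`. -/
theorem pullDer_smul (hc : HasConnForms nabla) {s t : ∀ m, (A.lineBundle aL).Fiber m} {g : G} {n : N}
    (hs : (A.lineBundle aL).IsDiffAt s (assocMk K (g, n))) {f : G × N → ℂ}
    (hf : MDifferentiableAt (𝓘(ℝ, EG).prod 𝓘(ℝ, V)) 𝓘(ℝ, ℂ) f (g, n))
    (ht : ∀ p : G × N, A.pullSec aL t p.1 p.2 = f p • A.pullSec aL s p.1 p.2) (u : EG × V) :
    A.pullDer aL nabla t g n u =
      tder (𝓘(ℝ, EG).prod 𝓘(ℝ, V)) 𝓘(ℝ, ℂ) f (g, n) u • A.pullSec aL s g n +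
        f (g, n) • A.pullDer aL nabla s g n u := by
  have h := hc.along_smul (A.mdifferentiableAt_pullTot hs) hf u
  refine Eq.trans ?_ h
  have h2 : A.pullTot aL t = fun p => (⟨(A.pullTot aL s p).proj, f p • (A.pullTot aL s p).snd⟩ : L.Total) :=
    funext fun p => congrArg (TotalSpace.mk p.2) (ht p)
  have h3 := along_total_congr (nabla := nabla) (J := 𝓘(ℝ, EG).prod 𝓘(ℝ, V)) h2 (g, n) u
  injection h3

/-- `pullDer` in terms of partial derivatives. -/
theorem pullDer_eq (hc : HasConnForms nabla) {s : ∀ m, (A.lineBundle aL).Fiber m} {g : G} {n : N}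
    (hs : (A.lineBundle aL).IsDiffAt s (assocMk K (g, n))) (η : EG) (v : V) :
    MDifferentiableAt 𝓘(ℝ, EG) 𝓘(ℝ, L.Fiber n) (fun a => A.pullSec aL s a n) g ∧
    A.pullDer aL nabla s g n (η, v) = evL (nabla (A.pullSec aL s g) n) v +
      tder 𝓘(ℝ, EG) 𝓘(ℝ, L.Fiber n) (fun a => A.pullSec aL s a n) g η := by
  have h0 := A.mdifferentiableAt_pullTot hs
  have h1 := along_prod (nabla := nabla) h0 η v
  have hg : MDifferentiableAt 𝓘(ℝ, EG) (𝓘(ℝ, V).prod 𝓘(ℝ, ℂ))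
      (fun a : G => (⟨n, A.pullSec aL s a n⟩ : L.Total)) g :=
    MDifferentiableAt.comp (g := A.pullTot aL s) g h0
      (mdifferentiableAt_id.prodMk mdifferentiableAt_const)
  have hn : L.IsDiffAt (A.pullSec aL s g) n :=
    MDifferentiableAt.comp (g := A.pullTot aL s) n h0
      (mdifferentiableAt_const.prodMk mdifferentiableAt_id)
  obtain ⟨h2, h3⟩ := along_const (nabla := nabla) hg η
  refine ⟨h2, ?_⟩
  have h4 := hc.along_section (b := fun n : N => n) (s := A.pullSec aL s g) (z := n)
    mdifferentiableAt_id hn v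
  rw [tder_id] at h4
  refine h1.trans ((congrArg₂ (· + ·) h3 h4).trans (add_comm _ _))

/-- At the preferred representative `Tq` sends `(gX, v)` to the model vector `(v, X)`, so
derivatives on `M` and on `G × N` agree literally. -/
theorem tder_comp_mk {f : AssocSpace K N → ℂ} {m : AssocSpace K N}
    (hf : MDifferentiableAt 𝓘(ℝ, V × S.𝔭) 𝓘(ℝ, ℂ) f m) (w : V × S.𝔭) :
    MDifferentiableAt (𝓘(ℝ, EG).prod 𝓘(ℝ, V)) 𝓘(ℝ, ℂ) (fun p : G × N => f (assocMk K p))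
      (A.rG m, A.rN m) ∧
    tder (𝓘(ℝ, EG).prod 𝓘(ℝ, V)) 𝓘(ℝ, ℂ) (fun p : G × N => f (assocMk K p)) (A.rG m, A.rN m)
      (lvec (w.2 : EG) (A.rG m), w.1) = tder 𝓘(ℝ, V × S.𝔭) 𝓘(ℝ, ℂ) f m w := by
  have hf' : MDifferentiableAt 𝓘(ℝ, V × S.𝔭) 𝓘(ℝ, ℂ) f (assocMk K (A.rG m, A.rN m)) := by
    rwa [A.mk_rep]
  refine ⟨MDifferentiableAt.comp (I' := 𝓘(ℝ, V × S.𝔭)) _ hf' (A.mdiff_mk _), ?_⟩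
  rw [tder_comp_apply hf (A.mdiff_mk _) (A.mk_rep m)]
  exact congrArg _ (A.dq_rep m w.1 w.2)

variable (aL) in
/-- The induced connection on `G ×_K L`. -/
def indConn (hc : HasConnForms nabla) :
    CovariantDerivative 𝓘(ℝ, V × S.𝔭) ℂ (A.lineBundle aL).Fiber where
  toFun := A.indNabla aL nabla
  isCovariantDerivativeOnUniv :=
    { add := by
        intro s t m hs ht _
        ext w
        have hs' : (A.lineBundle aL).IsDiffAt s (assocMk K (A.rG m, A.rN m)) := by
          rw [A.mk_rep]; exact hs
        have ht' : (A.lineBundle aL).IsDiffAt t (assocMk K (A.rG m, A.rN m)) := by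
          rw [A.mk_rep]; exact ht
        have h := A.pullDer_add (nabla := nabla) hs' ht' (lvec ((w : V × S.𝔭).2 : EG) (A.rG m), (w : V × S.𝔭).1)
        exact (congrArg (A.lineIso aL (A.rG m) (A.rN m)) h).trans (map_add _ _ _)
      leibniz := by
        intro s f m hs hf _
        ext w
        have hs' : (A.lineBundle aL).IsDiffAt s (assocMk K (A.rG m, A.rN m)) := by
          rw [A.mk_rep]; exact hs
        obtain ⟨hf', hfd⟩ := tder_ofReal hf w
        obtain ⟨h1, h2⟩ := A.tder_comp_mk hf' w
        have h := A.pullDer_smul hc (t := f • s) hs' h1 (fun p => A.pullSec_smul _ _ _ _)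
          (lvec ((w : V × S.𝔭).2 : EG) (A.rG m), (w : V × S.𝔭).1)
        rw [h2, hfd, A.mk_rep, add_comm] at h
        have h3 : A.lineIso aL (A.rG m) (A.rN m) (A.pullSec aL s (A.rG m) (A.rN m)) =
            A.lineVal aL (s m) :=
          (A.lineMk_pullSec aL s (A.rG m) (A.rN m)).trans (by rw [A.mk_rep]; rfl)
        refine (congrArg (A.lineIso aL (A.rG m) (A.rN m)) h).trans ?_
        rw [map_add, map_smul, map_smul, h3]
        rfl }

/-- On the section of the chart itself `kap` equals `1`, so coordinates in `G ×_K L` are the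
coordinates of `L` in its trivialisation at the representative. -/
theorem co_lineMk {m₀ : AssocSpace K N} {y : V × S.𝔭}
    (h1 : y.1 ∈ (extChartAt 𝓘(ℝ, V) (A.rN m₀)).target) (h2 : y.2 ∈ A.sl.ball)
    (hb : (extChartAt 𝓘(ℝ, V) (A.rN m₀)).symm y.1 ∈ (L.triv (A.rN m₀)).baseSet) :
    (extChartAt 𝓘(ℝ, V × S.𝔭) m₀).symm y ∈ A.lineDom L m₀ ∧
    ∀ l : L.Fiber ((extChartAt 𝓘(ℝ, V) (A.rN m₀)).symm y.1),
      (A.lineBundle aL).co m₀ ⟨_, A.lineMk aL (A.rG m₀ * slicePt S.𝔭 y.2)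
        ((extChartAt 𝓘(ℝ, V) (A.rN m₀)).symm y.1) l⟩ = L.co (A.rN m₀) ⟨_, l⟩ := by
  have hy : y ∈ (extChartAt 𝓘(ℝ, V × S.𝔭) m₀).target := by rw [A.target_eq]; exact ⟨h1, h2⟩
  have hm : (extChartAt 𝓘(ℝ, V × S.𝔭) m₀).symm y ∈ A.lineDom L m₀ := by
    refine ⟨(extChartAt 𝓘(ℝ, V × S.𝔭) m₀).map_target hy, ?_⟩
    rw [mem_ofPred_eq, loc, (extChartAt 𝓘(ℝ, V × S.𝔭) m₀).right_inv hy]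
    exact hb
  refine ⟨hm, fun l => ?_⟩
  have hk : A.kap m₀ (A.rG m₀ * slicePt S.𝔭 y.2) = 1 := by
    have h := A.sl.snd_apply y.2 h2 1
    rw [kap, inv_mul_cancel_left]
    simpa using h
  rw [A.chart_symm] at hm
  refine (A.ratio_lineIso aL (A.rG m₀ * slicePt S.𝔭 y.2) ⟨_, l⟩ hm).trans ?_
  rw [hk, aL.tot_one]
  rfl

variable (Φ α) in
/-- The connection form of the induced connection. -/
def indForm (α : V → V →L[ℝ] ℂ) (m₀ : AssocSpace K N) (y : V × S.𝔭) : V × S.𝔭 →L[ℝ] ℂ :=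
  (α y.1).comp (ContinuousLinearMap.fst ℝ V S.𝔭) + ((2 * Real.pi * Complex.I * 2 : ℂ)) •
    Complex.ofRealCLM.comp ((Φ ((extChartAt 𝓘(ℝ, V) (A.rN m₀)).symm y.1)).comp
      ((S.projL hK).comp ((mcChart G (oneChart EG G 1 + (y.2 : EG))).comp
        (S.𝔭.subtypeL.comp (ContinuousLinearMap.snd ℝ V S.𝔭)))))

end AssocAtlas

end InducedConnection

end PreHam

namespace PreHam

universe w

/-! ### Connection forms of the induced connection. -/

section InducedConnForm

open HermitianLineBundle LineModel

variable {EG : Type*} [NormedAddCommGroup EG] [NormedSpace ℝ EG] [FiniteDimensional ℝ EG]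
  {G : Type*} [TopologicalSpace G] [ChartedSpace EG G] [Group G] [LieGroup 𝓘(ℝ, EG) ∞ G]
  {EK : Type*} [NormedAddCommGroup EK] [NormedSpace ℝ EK] [FiniteDimensional ℝ EK]
  {K : Subgroup G} [ChartedSpace EK K] [LieGroup 𝓘(ℝ, EK) ∞ K]
  (hK : IsMaximalCompactLieSubgroup (EG := EG) (EK := EK) K)
  {S : SpinComplement (EG := EG) (EK := EK) K}
  {V : Type*} [NormedAddCommGroup V] [NormedSpace ℝ V] [FiniteDimensional ℝ V]
  {N : Type*} [TopologicalSpace N] [ChartedSpace V N] [IsManifold 𝓘(ℝ, V) ∞ N] [T2Space N]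
  [MulAction K N] [ContMDiffSMul 𝓘(ℝ, EK) 𝓘(ℝ, V) ∞ K N]
  [ChartedSpace (V × S.𝔭) (AssocSpace K N)] [IsManifold 𝓘(ℝ, V × S.𝔭) ∞ (AssocSpace K N)]
  (A : AssocAtlas S V N) {L : HermitianLineBundle.{w} V N} {aL : L.Action EK K}
  {nabla : CovariantDerivative 𝓘(ℝ, V) ℂ L.Fiber} {ν : TwoForm V N} {Φ : N → (EK →L[ℝ] ℝ)}

namespace AssocAtlas

/-- Every tangent vector `ζ` of the slice at `σ(y)` is `σ(y) θ(ζ)`, with `θ` the left Maurer–Cartan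
form. Writing it so brings `mcChart` into the connection form. -/
theorem tder_assocSec {m₀ : AssocSpace K N} {y : V × S.𝔭}
    (h1 : y.1 ∈ (extChartAt 𝓘(ℝ, V) (A.rN m₀)).target) (h2 : y.2 ∈ A.sl.ball) (w : V × S.𝔭) :
    MDifferentiableAt 𝓘(ℝ, V × S.𝔭) (𝓘(ℝ, EG).prod 𝓘(ℝ, V))
      (assocSec S.𝔭 (A.rG m₀) (A.rN m₀)) y ∧
    tder 𝓘(ℝ, V × S.𝔭) (𝓘(ℝ, EG).prod 𝓘(ℝ, V)) (assocSec S.𝔭 (A.rG m₀) (A.rN m₀)) y w =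
      (lvec (mcChart G (oneChart EG G 1 + (y.2 : EG)) w.2) (A.rG m₀ * slicePt S.𝔭 y.2),
        tder 𝓘(ℝ, V) 𝓘(ℝ, V) (extChartAt 𝓘(ℝ, V) (A.rN m₀)).symm y.1 w.1) := by
  have hs := contMDiff_assocSec (EG := EG) (G := G) A.sl (g₀ := A.rG m₀) h1 h2
  refine ⟨hs.mdifferentiableAt (by simp), ?_⟩
  have hσ : MDifferentiableAt 𝓘(ℝ, S.𝔭) 𝓘(ℝ, EG) (slicePt S.𝔭 : S.𝔭 → G) y.2 :=
    (contMDiffAt_slicePt (A.sl.ball_target _ h2)).mdifferentiableAt (by simp)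
  have f1 : MDifferentiableAt 𝓘(ℝ, V × S.𝔭) 𝓘(ℝ, V) (Prod.fst : V × S.𝔭 → V) y :=
    differentiableAt_fst.mdifferentiableAt
  have f2 : MDifferentiableAt 𝓘(ℝ, V × S.𝔭) 𝓘(ℝ, S.𝔭) (Prod.snd : V × S.𝔭 → S.𝔭) y :=
    differentiableAt_snd.mdifferentiableAt
  have hm : MDifferentiableAt 𝓘(ℝ, EG) 𝓘(ℝ, EG) (fun a : G => A.rG m₀ * a) (slicePt S.𝔭 y.2) :=
    mdiff_mul_left _ _
  have hl : MDifferentiableAt 𝓘(ℝ, S.𝔭) 𝓘(ℝ, EG) (fun X => A.rG m₀ * slicePt S.𝔭 X) y.2 :=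
    MDifferentiableAt.comp (I' := 𝓘(ℝ, EG)) _ hm hσ
  have hf : MDifferentiableAt 𝓘(ℝ, V × S.𝔭) 𝓘(ℝ, EG) (fun y : V × S.𝔭 => A.rG m₀ * slicePt S.𝔭 y.2) y :=
    MDifferentiableAt.comp (I' := 𝓘(ℝ, S.𝔭)) (g := fun X => A.rG m₀ * slicePt S.𝔭 X) _ hl f2
  have hg : MDifferentiableAt 𝓘(ℝ, V × S.𝔭) 𝓘(ℝ, V)
      (fun y : V × S.𝔭 => (extChartAt 𝓘(ℝ, V) (A.rN m₀)).symm y.1) y :=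
    MDifferentiableAt.comp (I' := 𝓘(ℝ, V)) (g := (extChartAt 𝓘(ℝ, V) (A.rN m₀)).symm) _
      (mdifferentiableAt_chart_symm h1) f1
  refine (tder_prodMk hf hg w).trans ?_
  have d1 := tder_comp_apply (g := (extChartAt 𝓘(ℝ, V) (A.rN m₀)).symm)
    (mdifferentiableAt_chart_symm h1) f1 rfl w
  have d2 := tder_comp_apply (g := fun X => A.rG m₀ * slicePt S.𝔭 X) hl f2 rfl w
  have d3 := tder_comp_apply (g := fun a : G => A.rG m₀ * a) hm hσ rfl w.2
  rw [d1, d2, tder_eq_fderiv, tder_eq_fderiv, fderiv_fst, fderiv_snd]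
  simp only [ContinuousLinearMap.coe_fst', ContinuousLinearMap.coe_snd']
  rw [d3, ← lvec_mc (slicePt S.𝔭 y.2 : G) (tder 𝓘(ℝ, S.𝔭) 𝓘(ℝ, EG) (slicePt S.𝔭) y.2 w.2),
    mul_left_tder_lvec, tder_slicePt (A.sl.ball_target _ h2)]
  rfl

/-- The inverse chart is `q` after the section of the chart. -/
theorem tder_chart_symm_eq_dq {m₀ : AssocSpace K N} {y : V × S.𝔭}
    (h1 : y.1 ∈ (extChartAt 𝓘(ℝ, V) (A.rN m₀)).target) (h2 : y.2 ∈ A.sl.ball) (w : V × S.𝔭) :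
    tder 𝓘(ℝ, V × S.𝔭) 𝓘(ℝ, V × S.𝔭) (extChartAt 𝓘(ℝ, V × S.𝔭) m₀).symm y w =
      dq S (A.rG m₀ * slicePt S.𝔭 y.2, (extChartAt 𝓘(ℝ, V) (A.rN m₀)).symm y.1)
        (lvec (mcChart G (oneChart EG G 1 + (y.2 : EG)) w.2) (A.rG m₀ * slicePt S.𝔭 y.2),
          tder 𝓘(ℝ, V) 𝓘(ℝ, V) (extChartAt 𝓘(ℝ, V) (A.rN m₀)).symm y.1 w.1) := by
  obtain ⟨hd, hdt⟩ := A.tder_assocSec h1 h2 w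
  have e : ((extChartAt 𝓘(ℝ, V × S.𝔭) m₀).symm : V × S.𝔭 → AssocSpace K N) =
      fun y => assocMk K (assocSec S.𝔭 (A.rG m₀) (A.rN m₀) y) := funext (A.chart_symm m₀)
  refine (congrArg (fun f => tder 𝓘(ℝ, V × S.𝔭) 𝓘(ℝ, V × S.𝔭) f y w) e).trans ?_
  refine (tder_comp_apply (g := assocMk K) (A.mdiff_mk _) hd rfl w).trans ?_
  rw [hdt]
  rfl

theorem contDiffOn_indForm {α : V → V →L[ℝ] ℂ} {m₀ : AssocSpace K N} {O : Set V}
    (hO : O ⊆ (extChartAt 𝓘(ℝ, V) (A.rN m₀)).target) (hO' : IsOpen O)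
    (hα : ContDiffOn ℝ ∞ α O) (hΦ : ContMDiff 𝓘(ℝ, V) 𝓘(ℝ, EK →L[ℝ] ℝ) ∞ Φ) :
    ContDiffOn ℝ ∞ (A.indForm hK Φ α m₀) {y | y.1 ∈ O ∧ y.2 ∈ A.sl.ball} := by
  intro y hy
  apply ContDiffAt.contDiffWithinAt
  have h1 : ContDiffAt ℝ ∞ (fun y : V × S.𝔭 => α y.1) y :=
    ContDiffAt.comp (g := α) (f := fun y : V × S.𝔭 => y.1) y
      (hα.contDiffAt (hO'.mem_nhds hy.1)) contDiffAt_fst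
  have h2 : ContDiffAt ℝ ∞ (fun y : V × S.𝔭 => Φ ((extChartAt 𝓘(ℝ, V) (A.rN m₀)).symm y.1)) y := by
    have h : ContDiffAt ℝ ∞ (fun z => Φ ((extChartAt 𝓘(ℝ, V) (A.rN m₀)).symm z)) y.1 :=
      contMDiffAt_iff_contDiffAt.1
      (ContMDiffAt.comp (I' := 𝓘(ℝ, V)) y.1 (hΦ _) (contMDiffAt_chart_symm (hO hy.1)))
    exact ContDiffAt.comp (g := fun z => Φ ((extChartAt 𝓘(ℝ, V) (A.rN m₀)).symm z))
      (f := fun y : V × S.𝔭 => y.1) y h contDiffAt_fst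
  have h3 : ContDiffAt ℝ ∞ (fun y : V × S.𝔭 => mcChart G (oneChart EG G 1 + (y.2 : EG))) y := by
    have h := (contDiffOn_mcChart (E := EG) (G := G)).contDiffAt
      (extChartAt_target_nhds (A.sl.ball_target _ hy.2))
    refine ContDiffAt.comp (g := mcChart G) (f := fun y : V × S.𝔭 => oneChart EG G 1 + (y.2 : EG))
      y h (contDiffAt_const.add ?_)
    exact (S.𝔭.subtypeL.contDiff.comp contDiff_snd).contDiffAt
  have h4 : ContDiffAt ℝ ∞ (fun y : V × S.𝔭 =>
      Complex.ofRealCLM.comp ((Φ ((extChartAt 𝓘(ℝ, V) (A.rN m₀)).symm y.1)).comp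
      ((S.projL hK).comp ((mcChart G (oneChart EG G 1 + (y.2 : EG))).comp
        (S.𝔭.subtypeL.comp (ContinuousLinearMap.snd ℝ V S.𝔭)))))) y :=
    contDiffAt_const.clm_comp
    (h2.clm_comp (contDiffAt_const.clm_comp (h3.clm_comp contDiffAt_const)))
  exact (h1.clm_comp contDiffAt_const).add (h4.const_smul _)

theorem lco_eq_pullTot {m₀ : AssocSpace K N} {y : V × S.𝔭}
    (h1 : y.1 ∈ (extChartAt 𝓘(ℝ, V) (A.rN m₀)).target) (h2 : y.2 ∈ A.sl.ball)
    (hb : (extChartAt 𝓘(ℝ, V) (A.rN m₀)).symm y.1 ∈ (L.triv (A.rN m₀)).baseSet)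
    (s : ∀ m, (A.lineBundle aL).Fiber m) :
    (A.lineBundle aL).lco m₀ s y =
      L.co (A.rN m₀) (A.pullTot aL s (assocSec S.𝔭 (A.rG m₀) (A.rN m₀) y)) := by
  refine Eq.trans ?_ ((A.co_lineMk (aL := aL) h1 h2 hb).2 (A.pullSec aL s _ _))
  rw [lco, A.chart_symm]
  exact congrArg (fun z => (A.lineBundle aL).co m₀ ⟨_, z⟩) (A.lineMk_pullSec aL s _ _).symm

/-- Composed with the section of the chart, the pulled-back function is a map into `L` over a chart
of `N`. The chain rule for `along` and the connection form of `N` give `d + α`; the moment term is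
accounted for separately. -/
theorem co_pullDer {α : V → V →L[ℝ] ℂ} {m₀ : AssocSpace K N} {O : Set V}
    (h : IsConnForm nabla (A.rN m₀) O α) {y : V × S.𝔭} (hO : y.1 ∈ O) (h2 : y.2 ∈ A.sl.ball)
    {s : ∀ m, (A.lineBundle aL).Fiber m}
    (hs : (A.lineBundle aL).IsDiffAt s (assocMk K (assocSec S.𝔭 (A.rG m₀) (A.rN m₀) y)))
    (w : V × S.𝔭) :
    L.co (A.rN m₀) ⟨(extChartAt 𝓘(ℝ, V) (A.rN m₀)).symm y.1,
      A.pullDer aL nabla s (A.rG m₀ * slicePt S.𝔭 y.2) ((extChartAt 𝓘(ℝ, V) (A.rN m₀)).symm y.1)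
        (lvec (mcChart G (oneChart EG G 1 + (y.2 : EG)) w.2) (A.rG m₀ * slicePt S.𝔭 y.2),
          tder 𝓘(ℝ, V) 𝓘(ℝ, V) (extChartAt 𝓘(ℝ, V) (A.rN m₀)).symm y.1 w.1)⟩ =
      fderiv ℝ ((A.lineBundle aL).lco m₀ s) y w + α y.1 w.1 * (A.lineBundle aL).lco m₀ s y := by
  have h1 := h.subset hO
  obtain ⟨hd, hdt⟩ := A.tder_assocSec h1 h2 w
  have hp := A.mdifferentiableAt_pullTot hs
  have hσ : MDifferentiableAt 𝓘(ℝ, V × S.𝔭) (𝓘(ℝ, V).prod 𝓘(ℝ, ℂ))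
      (fun y => A.pullTot aL s (assocSec S.𝔭 (A.rG m₀) (A.rN m₀) y)) y :=
    MDifferentiableAt.comp (I' := 𝓘(ℝ, EG).prod 𝓘(ℝ, V)) (g := A.pullTot aL s) y hp hd
  have h3 := along_comp (nabla := nabla) (σ := A.pullTot aL s)
    (h := assocSec S.𝔭 (A.rG m₀) (A.rN m₀)) (z := y) hp hd w
  rw [hdt] at h3
  have hright := (extChartAt 𝓘(ℝ, V) (A.rN m₀)).right_inv h1
  have h4 := h.co_along (σ := fun y => A.pullTot aL s (assocSec S.𝔭 (A.rG m₀) (A.rN m₀) y)) (z := y)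
    ((extChartAt 𝓘(ℝ, V) (A.rN m₀)).map_target h1)
    (by change extChartAt 𝓘(ℝ, V) (A.rN m₀) ((extChartAt 𝓘(ℝ, V) (A.rN m₀)).symm y.1) ∈ O
        rw [hright]; exact hO) hσ w
  rw [h3] at h4
  have hproj : tder 𝓘(ℝ, V × S.𝔭) 𝓘(ℝ, V)
      (fun z : V × S.𝔭 => (extChartAt 𝓘(ℝ, V) (A.rN m₀)).symm z.1) y w =
      tder 𝓘(ℝ, V) 𝓘(ℝ, V) (extChartAt 𝓘(ℝ, V) (A.rN m₀)).symm y.1 w.1 := by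
    have f1 : MDifferentiableAt 𝓘(ℝ, V × S.𝔭) 𝓘(ℝ, V) (Prod.fst : V × S.𝔭 → V) y :=
      differentiableAt_fst.mdifferentiableAt
    refine (tder_comp_apply (g := (extChartAt 𝓘(ℝ, V) (A.rN m₀)).symm)
      (mdifferentiableAt_chart_symm h1) f1 rfl w).trans ?_
    rw [tder_eq_fderiv, fderiv_fst]
    rfl
  have hlco : (A.lineBundle aL).lco m₀ s =ᶠ[𝓝 y]
      fun y => L.co (A.rN m₀) (A.pullTot aL s (assocSec S.𝔭 (A.rG m₀) (A.rN m₀) y)) := by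
    filter_upwards [(h.isOpen.prod A.sl.ball_open).mem_nhds (show y ∈ O ×ˢ A.sl.ball from ⟨hO, h2⟩)]
      with y' hy'
    exact A.lco_eq_pullTot (h.subset hy'.1) hy'.2 (h.base _ hy'.1) s
  have h5 := tder_chart_symm h1 w.1
  rw [← hproj] at h5
  have h6 : α (extChartAt 𝓘(ℝ, V) (A.rN m₀) ((extChartAt 𝓘(ℝ, V) (A.rN m₀)).symm y.1))
      (tder 𝓘(ℝ, V) 𝓘(ℝ, V) (extChartAt 𝓘(ℝ, V) (A.rN m₀))
        ((extChartAt 𝓘(ℝ, V) (A.rN m₀)).symm y.1) (tder 𝓘(ℝ, V × S.𝔭) 𝓘(ℝ, V)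
      (fun z : V × S.𝔭 => (extChartAt 𝓘(ℝ, V) (A.rN m₀)).symm z.1) y w)) = α y.1 w.1 := by
    rw [h5, hright]
  rw [← tder_eq_fderiv, tder_congr hlco, A.lco_eq_pullTot h1 h2 (h.base _ hO) s, ← h6]
  exact h4

/-- The connection forms of the induced connection. -/
theorem isConnForm_indForm (hc : HasConnForms nabla) (hP : L.IsSpincPrequantisation aL nabla ν Φ)
    (hΦ : ContMDiff 𝓘(ℝ, V) 𝓘(ℝ, EK →L[ℝ] ℝ) ∞ Φ)
    {α : V → V →L[ℝ] ℂ} {m₀ : AssocSpace K N} {O : Set V} (h : IsConnForm nabla (A.rN m₀) O α) :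
    IsConnForm (A.indConn aL hc) m₀ {y | y.1 ∈ O ∧ y.2 ∈ A.sl.ball} (A.indForm hK Φ α m₀) where
  isOpen := h.isOpen.prod A.sl.ball_open
  subset := by
    intro y hy
    rw [A.target_eq]
    exact ⟨h.subset hy.1, hy.2⟩
  base y hy := (A.co_lineMk (aL := aL) (h.subset hy.1) hy.2 (h.base _ hy.1)).1
  smooth := A.contDiffOn_indForm hK h.subset h.isOpen h.smooth hΦ
  formula := by
    intro y hy s hs w
    have h1 := h.subset hy.1
    have hm := A.chart_symm m₀ y
    have hs' : (A.lineBundle aL).IsDiffAt s (assocMk K (assocSec S.𝔭 (A.rG m₀) (A.rN m₀) y)) := by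
      rwa [← hm]
    have hder := A.co_pullDer h hy.1 hy.2 hs' w
    -- The formula for arbitrary `ξ ∈ 𝔤` is needed here: away from the centre the Maurer–Cartan
    -- value of a slice direction may leave `𝔭`, and its `𝔨`-part gives the second term of
    -- `indForm`.
    have hind := A.indNabla_dq hK hc hP (g := A.rG m₀ * slicePt S.𝔭 y.2)
      (n := (extChartAt 𝓘(ℝ, V) (A.rN m₀)).symm y.1) hs'
      (mcChart G (oneChart EG G 1 + (y.2 : EG)) w.2)
      (tder 𝓘(ℝ, V) 𝓘(ℝ, V) (extChartAt 𝓘(ℝ, V) (A.rN m₀)).symm y.1 w.1)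
    rw [← A.tder_chart_symm_eq_dq h1 hy.2 w] at hind
    have gen : ∀ m m', m = m' → ∀ u : V × S.𝔭,
        (⟨m, evL (A.indNabla aL nabla s m) u⟩ : (A.lineBundle aL).Total) =
          ⟨m', evL (A.indNabla aL nabla s m') u⟩ := by
      rintro _ _ rfl _; rfl
    have hbase := h.base _ hy.1
    refine (congrArg ((A.lineBundle aL).co m₀) (gen _ _ hm _)).trans ?_
    refine (congrArg (fun z => (A.lineBundle aL).co m₀ ⟨assocMk K
      (assocSec S.𝔭 (A.rG m₀) (A.rN m₀) y), z⟩) hind).trans ?_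
    refine ((A.co_lineMk (aL := aL) h1 hy.2 hbase).2 _).trans ?_
    rw [co_add hbase, co_smul hbase, hder]
    have h8 := A.lco_eq_pullTot h1 hy.2 hbase s
    have h7 : A.indForm hK Φ α m₀ y w = α y.1 w.1 +
        (2 * Real.pi * Complex.I * 2 : ℂ) * (Φ ((extChartAt 𝓘(ℝ, V) (A.rN m₀)).symm y.1)
          (S.projL hK (mcChart G (oneChart EG G 1 + (y.2 : EG)) w.2)) : ℝ) := rfl
    rw [h7]
    have h9 : L.co (A.rN m₀) ⟨(extChartAt 𝓘(ℝ, V) (A.rN m₀)).symm y.1,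
        A.pullSec aL s (A.rG m₀ * slicePt S.𝔭 y.2) ((extChartAt 𝓘(ℝ, V) (A.rN m₀)).symm y.1)⟩ =
        (A.lineBundle aL).lco m₀ s y := h8.symm
    rw [h9]
    ring

theorem hasConnForms_indConn (hK : IsMaximalCompactLieSubgroup (EG := EG) (EK := EK) K)
    (hc : HasConnForms nabla) (hP : L.IsSpincPrequantisation aL nabla ν Φ)
    (hΦ : ContMDiff 𝓘(ℝ, V) 𝓘(ℝ, EK →L[ℝ] ℝ) ∞ Φ) : HasConnForms (A.indConn aL hc) := by
  intro m₀
  obtain ⟨O, α, h, hO⟩ := hc (A.rN m₀)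
  refine ⟨_, _, A.isConnForm_indForm hK hc hP hΦ h, ?_⟩
  rw [A.chart_self]
  exact ⟨hO, A.sl.zero_mem⟩

end AssocAtlas

end InducedConnForm

end PreHam

namespace PreHam

universe w

/-! ### The induced two-form and the curvature of the induced connection. -/

section InducedCurvature

open HermitianLineBundle LineModel

variable {EG : Type*} [NormedAddCommGroup EG] [NormedSpace ℝ EG] [FiniteDimensional ℝ EG]
  {G : Type*} [TopologicalSpace G] [ChartedSpace EG G] [Group G] [LieGroup 𝓘(ℝ, EG) ∞ G]
  {EK : Type*} [NormedAddCommGroup EK] [NormedSpace ℝ EK] [FiniteDimensional ℝ EK]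
  {K : Subgroup G} [ChartedSpace EK K] [LieGroup 𝓘(ℝ, EK) ∞ K]
  (hK : IsMaximalCompactLieSubgroup (EG := EG) (EK := EK) K)
  {S : SpinComplement (EG := EG) (EK := EK) K}
  {V : Type*} [NormedAddCommGroup V] [NormedSpace ℝ V] [FiniteDimensional ℝ V]
  {N : Type*} [TopologicalSpace N] [ChartedSpace V N] [IsManifold 𝓘(ℝ, V) ∞ N] [T2Space N]
  [MulAction K N] [ContMDiffSMul 𝓘(ℝ, EK) 𝓘(ℝ, V) ∞ K N]
  [ChartedSpace (V × S.𝔭) (AssocSpace K N)] [IsManifold 𝓘(ℝ, V × S.𝔭) ∞ (AssocSpace K N)]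
  (A : AssocAtlas S V N) {L : HermitianLineBundle.{w} V N} {aL : L.Action EK K}
  {nabla : CovariantDerivative 𝓘(ℝ, V) ℂ L.Fiber} {ν : TwoForm V N} {Φ : N → (EK →L[ℝ] ℝ)}

namespace SpinComplement

variable (S Φ) in
/-- The potential on `V × 𝔭` of the second term of the induced two-form. -/
def mcForm (n : N) (y : V × S.𝔭) : V × S.𝔭 →L[ℝ] ℝ :=
  (Φ n).comp ((S.projL hK).comp ((mcChart G (oneChart EG G 1 + (y.2 : EG))).comp
    (S.𝔭.subtypeL.comp (ContinuousLinearMap.snd ℝ V S.𝔭))))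

theorem hasFDerivAt_mcChart_snd {y : V × S.𝔭} (hy : y.2 = 0) :
    HasFDerivAt (fun y : V × S.𝔭 => mcChart G (oneChart EG G 1 + (y.2 : EG)))
      ((fderiv ℝ (mcChart G) (oneChart EG G 1)).comp
        (S.𝔭.subtypeL.comp (ContinuousLinearMap.snd ℝ V S.𝔭))) y := by
  have h1 : HasFDerivAt (fun y : V × S.𝔭 => oneChart EG G 1 + (y.2 : EG))
      (S.𝔭.subtypeL.comp (ContinuousLinearMap.snd ℝ V S.𝔭)) y :=
    (S.𝔭.subtypeL.comp (ContinuousLinearMap.snd ℝ V S.𝔭)).hasFDerivAt.const_add _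
  have h2 : HasFDerivAt (mcChart G) (fderiv ℝ (mcChart G) (oneChart EG G 1))
      (oneChart EG G 1 + (y.2 : EG)) := by
    rw [hy, ZeroMemClass.coe_zero, add_zero]
    exact (((contDiffOn_mcChart (E := EG) (G := G)).contDiffAt
      (extChartAt_target_nhds one_mem_target)).differentiableAt (by simp)).hasFDerivAt
  exact h2.comp y h1

theorem mcChart_snd {y : V × S.𝔭} (hy : y.2 = 0) :
    mcChart G (oneChart EG G 1 + (y.2 : EG)) = ContinuousLinearMap.id ℝ EG := by
  rw [hy, ZeroMemClass.coe_zero, add_zero, mcChart_one]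

variable (S Φ) in
/-- The two-form `-⟨Φ(n), [X, Y]⟩` on `V × 𝔭`. -/
def bracketForm (n : N) : (V × S.𝔭) [⋀^Fin 2]→L[ℝ] ℝ :=
  extDeriv (oneForm (S.mcForm (V := V) hK Φ n)) (0 : V × S.𝔭)

/-- This is the Maurer–Cartan equation at `1`. Defining the form as an exterior derivative makes it
alternating and continuous from the start. -/
theorem bracketForm_apply (n : N) (a b : V × S.𝔭) :
    S.bracketForm (V := V) hK Φ n ![a, b] = - Φ n (S.projL hK (lieBr G (a.2 : EG) (b.2 : EG))) := by
  have h := (S.hasFDerivAt_mcChart_snd (V := V) (G := G) (y := (0 : V × S.𝔭)) rfl)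
  have hd : HasFDerivAt (S.mcForm (V := V) hK Φ n) _ (0 : V × S.𝔭) :=
    (hasFDerivAt_const (Φ n) _).clm_comp ((hasFDerivAt_const (S.projL hK) _).clm_comp
      (h.clm_comp (hasFDerivAt_const (S.𝔭.subtypeL.comp (ContinuousLinearMap.snd ℝ V S.𝔭)) _)))
  have h1 : ∀ a b : V × S.𝔭, fderiv ℝ (S.mcForm hK Φ n) 0 a b =
      Φ n (S.projL hK (fderiv ℝ (mcChart G) (oneChart EG G 1) (a.2 : EG) (b.2 : EG))) := by
    intro a b
    rw [hd.fderiv]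
    simp
  rw [bracketForm, extDeriv_oneForm hd.differentiableAt, h1, h1, ← map_sub, ← map_sub,
    fderiv_mcChart_sub, map_neg, map_neg]

end SpinComplement

namespace AssocAtlas

variable (ν Φ) in
/-- The value of the induced two-form, as an alternating form on the model space. -/
def indTwoFormAt (m : AssocSpace K N) : (V × S.𝔭) [⋀^Fin 2]→L[ℝ] ℝ :=
  (show V [⋀^Fin 2]→L[ℝ] ℝ from ν (A.rN m)).compContinuousLinearMap
    (ContinuousLinearMap.fst ℝ V S.𝔭) + S.bracketForm (V := V) hK Φ (A.rN m)

variable (ν Φ) in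
/-- The induced two-form on `G ×_K N`. -/
def indTwoForm : TwoForm (V × S.𝔭) (AssocSpace K N) := fun m => A.indTwoFormAt hK ν Φ m

theorem indTwoForm_apply (m : AssocSpace K N) (a b : V × S.𝔭) :
    A.indTwoForm hK ν Φ m ![a, b] = ν (A.rN m) ![a.1, b.1] -
      Φ (A.rN m) (S.projL hK (lieBr G (a.2 : EG) (b.2 : EG))) := by
  have h1 := compContinuousLinearMap_two (V := V) (ν (A.rN m)) (ContinuousLinearMap.fst ℝ V S.𝔭) a b
  have h2 := S.bracketForm_apply hK (Φ := Φ) (A.rN m) a b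
  rw [sub_eq_add_neg, ← h2]
  exact congrArg (· + _) h1

/-- The curvature of `N` accounts for `ν`, the Maurer–Cartan equation for the bracket. The identity
is proved at the centre of a chart only, which suffices because each point is the centre of its
preferred chart. -/
theorem fderiv_indForm_sub (hP : L.IsSpincPrequantisation aL nabla ν Φ)
    (hΦ : ContMDiff 𝓘(ℝ, V) 𝓘(ℝ, EK →L[ℝ] ℝ) ∞ Φ)
    {α : V → V →L[ℝ] ℂ} {m : AssocSpace K N} {O : Set V} (h : IsConnForm nabla (A.rN m) O α)
    (hO : extChartAt 𝓘(ℝ, V) (A.rN m) (A.rN m) ∈ O) (a b : V × S.𝔭) :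
    fderiv ℝ (A.indForm hK Φ α m) (extChartAt 𝓘(ℝ, V × S.𝔭) m m) a b -
      fderiv ℝ (A.indForm hK Φ α m) (extChartAt 𝓘(ℝ, V × S.𝔭) m m) b a =
      2 * Real.pi * Complex.I * (2 * (A.indTwoForm hK ν Φ m ![a, b] : ℝ)) := by
  set y : V × S.𝔭 := extChartAt 𝓘(ℝ, V × S.𝔭) m m with hy
  have hy1 : y.1 = extChartAt 𝓘(ℝ, V) (A.rN m) (A.rN m) := congrArg Prod.fst (A.chart_self m)
  have hy2 : y.2 = 0 := congrArg Prod.snd (A.chart_self m)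
  rw [← hy1] at hO
  have hα : HasFDerivAt (fun y : V × S.𝔭 => α y.1)
      ((fderiv ℝ α y.1).comp (ContinuousLinearMap.fst ℝ V S.𝔭)) y :=
    ((h.smooth.contDiffAt (h.isOpen.mem_nhds hO)).differentiableAt (by simp)).hasFDerivAt.comp y
      hasFDerivAt_fst
  have hu : DifferentiableAt ℝ
      (fun y : V × S.𝔭 => Φ ((extChartAt 𝓘(ℝ, V) (A.rN m)).symm y.1)) y := by
    have h : ContDiffAt ℝ ∞ (fun z => Φ ((extChartAt 𝓘(ℝ, V) (A.rN m)).symm z)) y.1 :=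
      contMDiffAt_iff_contDiffAt.1
      (ContMDiffAt.comp (I' := 𝓘(ℝ, V)) y.1 (hΦ _) (contMDiffAt_chart_symm (h.subset hO)))
    exact (h.differentiableAt (by simp)).comp y differentiableAt_fst
  have hm := S.hasFDerivAt_mcChart_snd (G := G) hy2
  have hd : HasFDerivAt (A.indForm hK Φ α m) _ y :=
    (hα.clm_comp (hasFDerivAt_const (ContinuousLinearMap.fst ℝ V S.𝔭) y)).add
    (((hasFDerivAt_const Complex.ofRealCLM y).clm_comp
      (hu.hasFDerivAt.clm_comp ((hasFDerivAt_const (S.projL hK) y).clm_comp (hm.clm_comp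
        (hasFDerivAt_const (S.𝔭.subtypeL.comp (ContinuousLinearMap.snd ℝ V S.𝔭)) y))))).const_smul
        (2 * Real.pi * Complex.I * 2 : ℂ))
  have hsymm : (extChartAt 𝓘(ℝ, V) (A.rN m)).symm y.1 = A.rN m := by
    rw [hy1]; exact extChartAt_to_inv _
  have key : ∀ a b : V × S.𝔭, fderiv ℝ (A.indForm hK Φ α m) y a b = fderiv ℝ α y.1 a.1 b.1 +
      (2 * Real.pi * Complex.I * 2 : ℂ) * (Φ (A.rN m) (S.projL hK
        (fderiv ℝ (mcChart G) (oneChart EG G 1) (a.2 : EG) (b.2 : EG))) : ℝ) := by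
    intro a b
    rw [hd.fderiv, S.mcChart_snd hy2, hsymm]
    -- At the centre `mcChart` is the identity and `projL` kills `𝔭`, so the term with the
    -- derivative of `Φ` disappears.
    simp [S.projL_coe hK]
  rw [key, key, A.indTwoForm_apply]
  have h1 := h.fderiv_sub hP.curvature hO a.1 b.1
  have h2 : chartForm ν (A.rN m) y.1 ![a.1, b.1] = ν (A.rN m) ![a.1, b.1] := by
    have gen : ∀ n, n = A.rN m → ∀ a b : V, ν n ![a, b] = ν (A.rN m) ![a, b] := by
      rintro _ rfl _ _; rfl
    rw [chartForm_apply]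
    refine (gen _ hsymm _ _).trans ?_
    rw [hy1, tder_chart_symm_self]
    rfl
  rw [h2] at h1
  have h3 := congrArg (fun ξ => (Φ (A.rN m) (S.projL hK ξ) : ℂ))
    (fderiv_mcChart_sub (G := G) (a.2 : EG) (b.2 : EG))
  simp only [map_sub, map_neg, Complex.ofReal_sub, Complex.ofReal_neg] at h3
  push_cast
  linear_combination h1 + (2 * Real.pi * Complex.I * 2 : ℂ) * h3

/-- The local curvature formula is evaluated at `x` in the chart centred there, where fields and
sections have their own values as coordinates. -/
theorem indConn_curvature (hc : HasConnForms nabla) (hP : L.IsSpincPrequantisation aL nabla ν Φ)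
    (hΦ : ContMDiff 𝓘(ℝ, V) 𝓘(ℝ, EK →L[ℝ] ℝ) ∞ Φ)
    (v w : ∀ x : AssocSpace K N, TangentSpace 𝓘(ℝ, V × S.𝔭) x)
    (s : ∀ x, (A.lineBundle aL).Fiber x)
    (hv : IsSmoothField v) (hw : IsSmoothField w) (hs : (A.lineBundle aL).IsSmoothSection s)
    (x : AssocSpace K N) :
    A.indConn aL hc (fun y => A.indConn aL hc s y (w y)) x (v x) -
      A.indConn aL hc (fun y => A.indConn aL hc s y (v y)) x (w x) -
      A.indConn aL hc s x (VectorField.mlieBracket 𝓘(ℝ, V × S.𝔭) v w x) =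
      (2 * Real.pi * Complex.I * (2 * (A.indTwoForm hK ν Φ x ![v x, w x] : ℝ)) : ℂ) • s x := by
  have : CompleteSpace (V × S.𝔭) := FiniteDimensional.complete ℝ (V × S.𝔭)
  obtain ⟨O, α, h, hO⟩ := hc (A.rN x)
  have hI := A.isConnForm_indForm hK hc hP hΦ h
  have hy : extChartAt 𝓘(ℝ, V × S.𝔭) x x ∈ {y : V × S.𝔭 | y.1 ∈ O ∧ y.2 ∈ A.sl.ball} := by
    rw [A.chart_self]
    exact ⟨hO, A.sl.zero_mem⟩
  have h1 := hI.curvature hy hs hv hw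
  have hx : (extChartAt 𝓘(ℝ, V × S.𝔭) x).symm (extChartAt 𝓘(ℝ, V × S.𝔭) x x) = x :=
    extChartAt_to_inv _
  have hfield : ∀ v : ∀ x : AssocSpace K N, TangentSpace 𝓘(ℝ, V × S.𝔭) x,
      chartField x v (extChartAt 𝓘(ℝ, V × S.𝔭) x x) = v x := by
    intro v
    have gen : ∀ m, m = x → tder 𝓘(ℝ, V × S.𝔭) 𝓘(ℝ, V × S.𝔭) (extChartAt 𝓘(ℝ, V × S.𝔭) x) m (v m) =
        v x := by
      rintro _ rfl
      rw [tder_chart_self]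
      rfl
    exact gen _ hx
  have hlco : ∀ t : ∀ m, (A.lineBundle aL).Fiber m,
      (A.lineBundle aL).lco x t (extChartAt 𝓘(ℝ, V × S.𝔭) x x) =
        (A.lineBundle aL).co x ⟨x, t x⟩ := by
    intro t
    have gen : ∀ m, m = x → (A.lineBundle aL).co x ⟨m, t m⟩ = (A.lineBundle aL).co x ⟨x, t x⟩ := by
      rintro _ rfl; rfl
    exact gen _ hx
  rw [hlco, hlco, hfield, hfield] at h1
  apply co_injective ((A.lineBundle aL).mem_base x)
  rw [co_smul ((A.lineBundle aL).mem_base x)]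
  exact h1.trans (congrArg (· * _) (A.fderiv_indForm_sub hK hP hΦ h hO (v x) (w x)))

end AssocAtlas

end InducedCurvature

end PreHam

namespace PreHam

/-! ### Invariance of the induced form, and the momentum map. -/

section InducedMomentum

variable {EG : Type*} [NormedAddCommGroup EG] [NormedSpace ℝ EG] [FiniteDimensional ℝ EG]
  {G : Type*} [TopologicalSpace G] [ChartedSpace EG G] [Group G] [LieGroup 𝓘(ℝ, EG) ∞ G]
  {EK : Type*} [NormedAddCommGroup EK] [NormedSpace ℝ EK] [FiniteDimensional ℝ EK]
  {K : Subgroup G} [ChartedSpace EK K] [LieGroup 𝓘(ℝ, EK) ∞ K]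
  (hK : IsMaximalCompactLieSubgroup (EG := EG) (EK := EK) K)
  {S : SpinComplement (EG := EG) (EK := EK) K}
  {V : Type*} [NormedAddCommGroup V] [NormedSpace ℝ V] [FiniteDimensional ℝ V]
  {N : Type*} [TopologicalSpace N] [ChartedSpace V N] [IsManifold 𝓘(ℝ, V) ∞ N] [T2Space N]
  [MulAction K N] [ContMDiffSMul 𝓘(ℝ, EK) 𝓘(ℝ, V) ∞ K N]
  [ChartedSpace (V × S.𝔭) (AssocSpace K N)] [IsManifold 𝓘(ℝ, V × S.𝔭) ∞ (AssocSpace K N)]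
  (A : AssocAtlas S V N) {ν : TwoForm V N} {Φ : N → (EK →L[ℝ] ℝ)}

theorem lieBr_swap (X Y : EG) : lieBr G X Y = - lieBr G Y X := by
  rw [eq_neg_iff_add_eq_zero, ← neg_eq_zero, neg_add, ← fderiv_mcChart_sub, ← fderiv_mcChart_sub]
  abel

theorem lieBr_add_left (X X' Y : EG) : lieBr G (X + X') Y = lieBr G X Y + lieBr G X' Y := by
  rw [← neg_inj, neg_add, ← fderiv_mcChart_sub, ← fderiv_mcChart_sub, ← fderiv_mcChart_sub, map_add,
    map_add, add_apply]
  abel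

theorem contMDiff_Ad_inv (X : EG) : ContMDiff 𝓘(ℝ, EG) 𝓘(ℝ, EG) ∞ (fun g : G => Ad g⁻¹ X) :=
  ((contMDiff_Ad (G := G) (E := EG)).comp (contMDiff_inv 𝓘(ℝ, EG) ∞)).clm_apply contMDiff_const

theorem mdiff_Ad_inv (X : EG) (g : G) :
    MDifferentiableAt 𝓘(ℝ, EG) 𝓘(ℝ, EG) (fun g : G => Ad g⁻¹ X) g :=
  (contMDiff_Ad_inv X).contMDiffAt.mdifferentiableAt (by simp)

/-- Differentiate `Ad((h a h⁻¹)⁻¹) Ad(h)X = Ad(h) Ad(a⁻¹)X` at `a = 1`. -/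
theorem Ad_lieBr (h : G) (X Y : EG) : Ad h (lieBr G X Y) = lieBr G (Ad h X) (Ad h Y) := by
  have h1 := tder_comp_apply (g := fun g : G => Ad g⁻¹ (Ad h X)) (y := (1 : G)) (mdiff_Ad_inv _ _)
    (mdiff_conj h 1) (by simp) Y
  rw [← Ad_eq, tder_Ad_inv] at h1
  have e : (fun a : G => Ad (h * a * h⁻¹)⁻¹ (Ad h X)) = fun a => Ad h (Ad a⁻¹ X) := by
    ext a
    rw [mul_inv_rev, mul_inv_rev, inv_inv, Ad_mul, Ad_mul, Ad_inv_Ad]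
  rw [e] at h1
  rw [← h1, ← tder_Ad_inv, tder_comp_apply (g := fun ξ : EG => Ad h ξ)
    (Ad h).mdifferentiableAt (mdiff_Ad_inv X 1) rfl, tder_eq_fderiv]
  exact (congrArg (fun T : EG →L[ℝ] EG => T _) (Ad h).fderiv).symm

/-- Writing points near `g` as `g a` turns the function into `a ↦ Ad(a⁻¹) Ad(g⁻¹)X`, whose
derivative at `1` is a bracket. -/
theorem tder_Ad_inv_lvec (X Y : EG) (g : G) :
    tder 𝓘(ℝ, EG) 𝓘(ℝ, EG) (fun a : G => Ad a⁻¹ X) g (lvec Y g) = lieBr G (Ad g⁻¹ X) Y := by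
  have h1 := tder_comp_apply (g := fun a : G => Ad a⁻¹ X) (y := g) (mdiff_Ad_inv _ _)
    (mdiff_mul_left g 1) (mul_one g) Y
  rw [← lvec_eq] at h1
  rw [← h1, ← tder_Ad_inv]
  simp only [mul_inv_rev, Ad_mul]

/-- `[𝔨, 𝔭] ⊆ 𝔭` is the derivative at `1` of the invariance of `𝔭` under `Ad(K)`. -/
theorem SpinComplement.projL_lieBr_lieIncl (Z : EK) (Y : S.𝔭) :
    S.projL hK (lieBr G (lieIncl K Z) (Y : EG)) = 0 := by
  have h1 := tder_comp_apply (g := fun a : G => S.projL hK (Ad a⁻¹ (Y : EG))) (y := (1 : G))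
    (MDifferentiableAt.comp (I' := 𝓘(ℝ, EG)) (g := fun ξ => S.projL hK ξ) _
      (S.projL hK).mdifferentiableAt (mdiff_Ad_inv _ _)) (mdiff_coe hK 1) rfl Z
  have e : (fun k : K => S.projL hK (Ad (k : G)⁻¹ (Y : EG))) = fun _ => 0 := by
    ext k
    exact S.projL_coe hK ⟨_, S.Ad_mem k⁻¹ Y⟩
  rw [e, tder_const, tder_comp_apply (g := fun ξ => S.projL hK ξ) (y := Ad (1 : G)⁻¹ (Y : EG))
    (S.projL hK).mdifferentiableAt (mdiff_Ad_inv _ _) rfl, ← lieIncl_eq, tder_Ad_inv,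
    tder_eq_fderiv] at h1
  have h2 : fderiv ℝ (fun ξ => S.projL hK ξ) (Ad (1 : G)⁻¹ (Y : EG)) = S.projL hK :=
    (S.projL hK).fderiv
  rw [h2] at h1
  rw [lieBr_swap, map_neg, ← h1]
  simp

theorem SpinComplement.projL_lieBr (ξ : EG) (Y : S.𝔭) :
    S.projL hK (lieBr G ξ (Y : EG)) = S.projL hK (lieBr G (S.compl hK ξ : EG) (Y : EG)) := by
  conv_lhs => rw [← S.compl_add_projL hK ξ]
  rw [lieBr_add_left, map_add, S.projL_lieBr_lieIncl hK, add_zero]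

namespace AssocAtlas

include A in
-- `q` is a submersion, and vertical vectors allow the group part to be moved into `𝔭`. This reduces
-- each tangential identity on `M` to vectors of this shape.
theorem exists_dq (hK : IsMaximalCompactLieSubgroup (EG := EG) (EK := EK) K) (g : G) (n : N)
    (u : V × S.𝔭) : ∃ (v : V) (Y : S.𝔭), dq S (g, n) (lvec (Y : EG) g, v) = u := by
  obtain ⟨⟨ξ, v⟩, h⟩ := A.submersion (g, n) u
  have h' : dq S (g, n) (ξ, v) = u := h
  rw [← lvec_mc g ξ, A.dq_eq hK] at h'
  exact ⟨_, _, h'⟩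

/-- The form is defined at the preferred representative. Passing to `(g, n)` applies `ρ(g)` to all
arguments, and the value is unchanged by invariance of `ν`, equivariance of `Φ` and compatibility of
`Ad` with brackets and projection. -/
theorem indTwoFormAt_dq (hν : IsInvariantForm K ν) (hΦ : ∀ (k : K) n Z, Φ (k • n) Z = Φ n (Ad k⁻¹ Z))
    (g : G) (n : N) (v w : V) (X Y : S.𝔭) :
    A.indTwoFormAt hK ν Φ (assocMk K (g, n))
      ![dq S (g, n) (lvec (X : EG) g, v), dq S (g, n) (lvec (Y : EG) g, w)] =
      ν n ![v, w] - Φ n (S.projL hK (lieBr G (X : EG) (Y : EG))) := by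
  rw [A.dq_mk_rep, A.dq_mk_rep]
  refine (A.indTwoForm_apply hK _ _ _).trans ?_
  have h1 : A.rN (assocMk K (g, n)) = A.r.ρ g • n := A.r.repN_mk g n
  have gen : ∀ n', n' = A.r.ρ g • n → ∀ a b : V, ν n' ![a, b] = ν (A.r.ρ g • n) ![a, b] := by
    rintro _ rfl _ _; rfl
  have h2 : ν (A.r.ρ g • n) ![actL V (A.r.ρ g) n v, actL V (A.r.ρ g) n w] = ν n ![v, w] :=
    hν (A.r.ρ g) n v w
  have h3 := (gen _ h1 (actL V (A.r.ρ g) n v) (actL V (A.r.ρ g) n w)).trans h2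
  have h4 : Φ (A.rN (assocMk K (g, n))) (S.projL hK (lieBr G (Ad (A.r.ρ g : G) (X : EG))
      (Ad (A.r.ρ g : G) (Y : EG)))) = Φ n (S.projL hK (lieBr G (X : EG) (Y : EG))) := by
    rw [h1, ← Ad_lieBr, S.proj_Ad hK, hΦ, Ad_inv_Ad]
  exact congrArg₂ (· - ·) h3 h4

variable (Φ) in
/-- The induced momentum map. -/
def indPhi (m : AssocSpace K N) : EG →L[ℝ] ℝ :=
  (Φ (A.rN m)).comp ((S.projL hK).comp (Ad (A.rG m)⁻¹))

/-- The factor `Ad(ρ(g))` from the group component passes through the projection to `𝔨` and cancels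
by equivariance of `Φ`. -/
theorem indPhi_mk (hΦ : ∀ (k : K) n Z, Φ (k • n) Z = Φ n (Ad k⁻¹ Z)) (g : G) (n : N) (Y : EG) :
    A.indPhi hK Φ (assocMk K (g, n)) Y = Φ n (S.projL hK (Ad g⁻¹ Y)) := by
  have h1 : A.rN (assocMk K (g, n)) = A.r.ρ g • n := A.r.repN_mk g n
  have h2 : A.rG (assocMk K (g, n)) = g * (A.r.ρ g : G)⁻¹ := A.r.repG_mk g n
  change Φ (A.rN _) (S.projL hK (Ad (A.rG _)⁻¹ Y)) = _
  rw [h1, h2, mul_inv_rev, inv_inv, Ad_mul, S.proj_Ad hK, hΦ, Ad_inv_Ad]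

theorem contMDiff_indPhi (hΦ : ∀ (k : K) n Z, Φ (k • n) Z = Φ n (Ad k⁻¹ Z))
    (hs : ContMDiff 𝓘(ℝ, V) 𝓘(ℝ, EK →L[ℝ] ℝ) ∞ Φ) :
    ContMDiff 𝓘(ℝ, V × S.𝔭) 𝓘(ℝ, EG →L[ℝ] ℝ) ∞ (A.indPhi hK Φ) := by
  intro m
  obtain ⟨p, rfl⟩ := assocMk_surjective m
  apply A.contMDiffAt_of_mk
  have e : (fun p : G × N => A.indPhi hK Φ (assocMk K p)) =
      fun p => (Φ p.2).comp ((S.projL hK).comp (Ad p.1⁻¹)) := by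
    ext p Y
    exact A.indPhi_mk hK hΦ p.1 p.2 Y
  rw [e]
  have h1 : ContMDiff (𝓘(ℝ, EG).prod 𝓘(ℝ, V)) 𝓘(ℝ, EG →L[ℝ] EG) ∞
      (fun p : G × N => (Ad p.1⁻¹ : EG →L[ℝ] EG)) :=
    (contMDiff_Ad (G := G) (E := EG)).comp ((contMDiff_inv 𝓘(ℝ, EG) ∞).comp contMDiff_fst)
  exact (hs.comp contMDiff_snd).clm_comp (contMDiff_const.clm_comp h1) p

theorem isInvariantForm_indTwoForm (hν : IsInvariantForm K ν)
    (hΦ : ∀ (k : K) n Z, Φ (k • n) Z = Φ n (Ad k⁻¹ Z)) :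
    IsInvariantForm G (A.indTwoForm hK ν Φ) := by
  intro h m a b
  obtain ⟨⟨g, n⟩, rfl⟩ := assocMk_surjective m
  obtain ⟨v, X, rfl⟩ := A.exists_dq hK g n a
  obtain ⟨w, Y, rfl⟩ := A.exists_dq hK g n b
  refine Eq.trans ?_ (A.indTwoFormAt_dq hK hν hΦ g n v w X Y).symm
  refine Eq.trans ?_ (A.indTwoFormAt_dq hK hν hΦ (h * g) n v w X Y)
  rw [← A.tder_smul_dq, ← A.tder_smul_dq]
  rfl

include A in
-- `a ↦ [a g, n]` has velocity `g Ad(g⁻¹)X` in the group direction and none along `N`.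
theorem fundL_mk (g : G) (n : N) (X : EG) :
    fundL (V × S.𝔭) (H := G) (assocMk K (g, n)) X = dq S (g, n) (lvec (Ad g⁻¹ X) g, 0) := by
  have h1 : MDifferentiableAt 𝓘(ℝ, EG) 𝓘(ℝ, EG) (fun a : G => a * g) 1 := mdiff_mul_right _ _
  have h := tder_comp_apply (y := (g, n)) (f := fun a : G => (a * g, n)) (A.mdiff_mk (g, n))
    (h1.prodMk mdifferentiableAt_const) (by simp) X
  rw [tder_prodMk h1 mdifferentiableAt_const, mul_right_tder_one, tder_const] at h
  exact h

/-- The `N`-derivative gives `-ν` on the fundamental vector of the `𝔨`-part of `Ad(g⁻¹)X`, and the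
`G`-derivative gives `Φ` of the projected bracket with `Y`. On the other side the fundamental vector
on `M` is split by `dq_eq` into its `𝔭`-part and that same fundamental vector on `N`. The brackets
match because `[𝔨, 𝔭] ⊆ 𝔭`. -/
theorem hamilton_indPhi (hν : IsInvariantForm K ν) (hM : IsMomentumMap K ν Φ)
    (g : G) (n : N) (X : EG) (w : V) (Y : S.𝔭) :
    tder 𝓘(ℝ, V × S.𝔭) 𝓘(ℝ, ℝ) (fun y => A.indPhi hK Φ y X) (assocMk K (g, n))
      (dq S (g, n) (lvec (Y : EG) g, w)) =
      - A.indTwoFormAt hK ν Φ (assocMk K (g, n))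
        ![fundL (V × S.𝔭) (H := G) (assocMk K (g, n)) X, dq S (g, n) (lvec (Y : EG) g, w)] := by
  have hsm : MDifferentiableAt 𝓘(ℝ, V × S.𝔭) 𝓘(ℝ, ℝ) (fun y => A.indPhi hK Φ y X)
      (assocMk K (g, n)) :=
    ((A.contMDiff_indPhi hK hM.equivariant hM.smooth).clm_apply
      contMDiff_const).contMDiffAt.mdifferentiableAt (by simp)
  have h0 := tder_comp_apply (g := fun y => A.indPhi hK Φ y X) hsm (A.mdiff_mk (g, n)) rfl
    (lvec (Y : EG) g, w)
  have hd : MDifferentiableAt (𝓘(ℝ, EG).prod 𝓘(ℝ, V)) 𝓘(ℝ, ℝ)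
      (fun p : G × N => A.indPhi hK Φ (assocMk K p) X) (g, n) :=
    MDifferentiableAt.comp (I' := 𝓘(ℝ, V × S.𝔭)) (g := fun y => A.indPhi hK Φ y X) _ hsm
      (A.mdiff_mk (g, n))
  rw [tder_prod hd] at h0
  rw [A.fundL_mk, A.dq_eq hK g n (Ad g⁻¹ X), A.indTwoFormAt_dq hK hν hM.equivariant, zero_add]
  refine h0.symm.trans ?_
  have e1 : (fun a : G => A.indPhi hK Φ (assocMk K (a, n)) X) =
      fun a => ((Φ n).comp (S.projL hK)) (Ad a⁻¹ X) :=
    funext fun a => A.indPhi_mk hK hM.equivariant a n X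
  have e2 : (fun x : N => A.indPhi hK Φ (assocMk K (g, x)) X) =
      fun x => Φ x (S.projL hK (Ad g⁻¹ X)) :=
    funext fun x => A.indPhi_mk hK hM.equivariant g x X
  have h2 : tder 𝓘(ℝ, V) 𝓘(ℝ, ℝ) (fun x => Φ x (S.projL hK (Ad g⁻¹ X))) n w =
      - ν n ![fundL V (H := K) n (S.projL hK (Ad g⁻¹ X)), w] :=
    hM.hamilton n (S.projL hK (Ad g⁻¹ X)) w
  dsimp only
  rw [e1, e2, h2, tder_comp_apply (g := fun ξ => ((Φ n).comp (S.projL hK)) ξ)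
    ((Φ n).comp (S.projL hK)).mdifferentiableAt (mdiff_Ad_inv _ _) rfl, tder_Ad_inv_lvec,
    tder_eq_fderiv]
  have h3 : fderiv ℝ (fun ξ => ((Φ n).comp (S.projL hK)) ξ) (Ad g⁻¹ X) = (Φ n).comp (S.projL hK) :=
    ((Φ n).comp (S.projL hK)).fderiv
  rw [h3, ContinuousLinearMap.comp_apply, S.projL_lieBr hK]
  ring

theorem isMomentumMap_indPhi (hν : IsInvariantForm K ν) (hM : IsMomentumMap K ν Φ) :
    IsMomentumMap G (A.indTwoForm hK ν Φ) (A.indPhi hK Φ) where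
  smooth := A.contMDiff_indPhi hK hM.equivariant hM.smooth
  equivariant h m X := by
    obtain ⟨⟨g, n⟩, rfl⟩ := assocMk_surjective m
    rw [smul_assocMk, A.indPhi_mk hK hM.equivariant, A.indPhi_mk hK hM.equivariant, mul_inv_rev,
      Ad_mul]
  hamilton m X u := by
    obtain ⟨⟨g, n⟩, rfl⟩ := assocMk_surjective m
    obtain ⟨w, Y, rfl⟩ := A.exists_dq hK g n u
    exact A.hamilton_indPhi hK hν hM g n X w Y

end AssocAtlas

end InducedMomentum

end PreHam

namespace PreHam

theorem tder_bilinear {B : Type*} [NormedAddCommGroup B] [NormedSpace ℝ B] {H : Type*}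
    [TopologicalSpace H] {J : ModelWithCorners ℝ B H} {Z : Type*} [TopologicalSpace Z]
    [ChartedSpace H Z] {E E' F : Type*} [NormedAddCommGroup E] [NormedSpace ℝ E]
    [NormedAddCommGroup E'] [NormedSpace ℝ E'] [NormedAddCommGroup F] [NormedSpace ℝ F]
    {b : E × E' → F} (hb : IsBoundedBilinearMap ℝ b)
    {f : Z → E} {f' : Z → E'} {z : Z} (hf : MDifferentiableAt J 𝓘(ℝ, E) f z)
    (hf' : MDifferentiableAt J 𝓘(ℝ, E') f' z) (ξ : B) :
    tder J 𝓘(ℝ, F) (fun z => b (f z, f' z)) z ξ =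
      b (f z, tder J 𝓘(ℝ, E') f' z ξ) + b (tder J 𝓘(ℝ, E) f z ξ, f' z) := by
  have hp : MDifferentiableAt J 𝓘(ℝ, E × E') (fun z => (f z, f' z)) z := hf.prodMk_space hf'
  have h1 := tder_comp_apply (g := (Prod.fst : E × E' → E))
    (differentiableAt_fst (𝕜 := ℝ)).mdifferentiableAt hp rfl ξ
  have h2 := tder_comp_apply (g := (Prod.snd : E × E' → E'))
    (differentiableAt_snd (𝕜 := ℝ)).mdifferentiableAt hp rfl ξ
  rw [tder_eq_fderiv, fderiv_fst] at h1
  rw [tder_eq_fderiv, fderiv_snd] at h2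
  rw [tder_comp_apply (hb.differentiableAt (f z, f' z)).mdifferentiableAt hp rfl, tder_eq_fderiv,
    hb.fderiv]
  change b (f z, (tder J 𝓘(ℝ, E × E') _ z ξ).2) + b ((tder J 𝓘(ℝ, E × E') _ z ξ).1, f' z) = _
  exact congrArg₂ (fun x y => b (f z, y) + b (x, f' z)) h1.symm h2.symm

theorem tder_clm_comp {B : Type*} [NormedAddCommGroup B] [NormedSpace ℝ B] {H : Type*}
    [TopologicalSpace H] {J : ModelWithCorners ℝ B H} {Z : Type*} [TopologicalSpace Z]
    [ChartedSpace H Z] {E F : Type*} [NormedAddCommGroup E] [NormedSpace ℝ E]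
    [NormedAddCommGroup F] [NormedSpace ℝ F] (T : E →L[ℝ] F)
    {f : Z → E} {z : Z} (hf : MDifferentiableAt J 𝓘(ℝ, E) f z) (ξ : B) :
    tder J 𝓘(ℝ, F) (fun z => T (f z)) z ξ = T (tder J 𝓘(ℝ, E) f z ξ) := by
  rw [tder_comp_apply T.mdifferentiableAt hf rfl, tder_eq_fderiv, T.fderiv]

universe w

namespace HermitianLineBundle

/-- The inner product of smooth sections is smooth. -/
theorem contMDiff_inner {V : Type*} [NormedAddCommGroup V] [NormedSpace ℝ V]
    {M : Type*} [TopologicalSpace M] [ChartedSpace V M] [IsManifold 𝓘(ℝ, V) ∞ M]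
    {L : HermitianLineBundle.{w} V M} {s t : ∀ x, L.Fiber x} (hs : L.IsSmoothSection s)
    (ht : L.IsSmoothSection t) :
    ContMDiff 𝓘(ℝ, V) 𝓘(ℝ, ℂ) ∞ (fun x => Inner.inner ℂ (s x) (t x)) := by
  intro x
  have hx := L.mem_base x
  have hn : ContMDiffAt 𝓘(ℝ, V) 𝓘(ℝ, ℝ) ∞ (fun y => ‖L.unit x y‖ ^ 2) x :=
    ContMDiffAt.comp (I' := 𝓘(ℝ, V).prod 𝓘(ℝ, ℂ)) x (L.metric_smooth _)
      (contMDiffAt_unit hx contMDiffAt_id)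
  have hn' : ContMDiffAt 𝓘(ℝ, V) 𝓘(ℝ, ℂ) ∞ (fun y => ((‖L.unit x y‖ ^ 2 : ℝ) : ℂ)) x :=
    ContMDiffAt.comp (I' := 𝓘(ℝ, ℝ)) (g := fun r : ℝ => (r : ℂ)) x
      Complex.ofRealCLM.contDiff.contMDiff.contMDiffAt hn
  have hs' : ContMDiffAt 𝓘(ℝ, V) 𝓘(ℝ, ℂ) ∞ (fun y => L.co x ⟨y, s y⟩) x :=
    ((contMDiffAt_iff hx).1 (hs x)).2
  have ht' : ContMDiffAt 𝓘(ℝ, V) 𝓘(ℝ, ℂ) ∞ (fun y => L.co x ⟨y, t y⟩) x :=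
    ((contMDiffAt_iff hx).1 (ht x)).2
  have hsc : ContMDiffAt 𝓘(ℝ, V) 𝓘(ℝ, ℂ) ∞ (fun y => Complex.conjCLE (L.co x ⟨y, s y⟩)) x :=
    ContMDiffAt.comp (I' := 𝓘(ℝ, ℂ)) (g := fun z => Complex.conjCLE z) x
      Complex.conjCLE.contDiff.contMDiff.contMDiffAt hs'
  have hmul : ∀ {a b : M → ℂ}, ContMDiffAt 𝓘(ℝ, V) 𝓘(ℝ, ℂ) ∞ a x → ContMDiffAt 𝓘(ℝ, V) 𝓘(ℝ, ℂ) ∞ b x →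
      ContMDiffAt 𝓘(ℝ, V) 𝓘(ℝ, ℂ) ∞ (fun y => a y * b y) x := fun ha hb =>
    ContMDiffAt.comp (I' := 𝓘(ℝ, ℂ × ℂ)) (g := fun p : ℂ × ℂ => p.1 * p.2) x
      contDiff_mul.contMDiff.contMDiffAt (ha.prodMk_space hb)
  have h := hmul (hmul hsc ht') hn'
  refine h.congr_of_eventuallyEq ?_
  filter_upwards [(L.triv x).open_baseSet.mem_nhds hx] with y hy
  conv_lhs => rw [← co_smul_unit hy (s y), ← co_smul_unit hy (t y)]
  rw [inner_smul_left, inner_smul_right, inner_self_eq_norm_sq_to_K, ← mul_assoc]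
  simp

end HermitianLineBundle

/-! ### The prequantisation axioms for the induced connection. -/

section InducedPrequantisation

open HermitianLineBundle LineModel

variable {EG : Type*} [NormedAddCommGroup EG] [NormedSpace ℝ EG] [FiniteDimensional ℝ EG]
  {G : Type*} [TopologicalSpace G] [ChartedSpace EG G] [Group G] [LieGroup 𝓘(ℝ, EG) ∞ G]
  {EK : Type*} [NormedAddCommGroup EK] [NormedSpace ℝ EK] [FiniteDimensional ℝ EK]
  {K : Subgroup G} [ChartedSpace EK K] [LieGroup 𝓘(ℝ, EK) ∞ K]
  (hK : IsMaximalCompactLieSubgroup (EG := EG) (EK := EK) K)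
  {S : SpinComplement (EG := EG) (EK := EK) K}
  {V : Type*} [NormedAddCommGroup V] [NormedSpace ℝ V] [FiniteDimensional ℝ V]
  {N : Type*} [TopologicalSpace N] [ChartedSpace V N] [IsManifold 𝓘(ℝ, V) ∞ N] [T2Space N]
  [MulAction K N] [ContMDiffSMul 𝓘(ℝ, EK) 𝓘(ℝ, V) ∞ K N]
  [ChartedSpace (V × S.𝔭) (AssocSpace K N)] [IsManifold 𝓘(ℝ, V × S.𝔭) ∞ (AssocSpace K N)]
  (A : AssocAtlas S V N) {L : HermitianLineBundle.{w} V N} {aL : L.Action EK K}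
  {nabla : CovariantDerivative 𝓘(ℝ, V) ℂ L.Fiber} {ν : TwoForm V N} {Φ : N → (EK →L[ℝ] ℝ)}

namespace AssocAtlas

theorem contMDiff_left_translate (h : G) :
    ContMDiff (𝓘(ℝ, EG).prod 𝓘(ℝ, V)) (𝓘(ℝ, EG).prod 𝓘(ℝ, V)) ∞
      (fun p : G × N => (h * p.1, p.2)) :=
  (contMDiff_const.mul contMDiff_fst).prodMk contMDiff_snd

theorem tder_left_translate (h g : G) (n : N) (X : EG) (v : V) :
    tder (𝓘(ℝ, EG).prod 𝓘(ℝ, V)) (𝓘(ℝ, EG).prod 𝓘(ℝ, V)) (fun p : G × N => (h * p.1, p.2)) (g, n)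
      (lvec X g, v) = (lvec X (h * g), v) := by
  rw [tder_prod ((contMDiff_left_translate h).contMDiffAt.mdifferentiableAt (by simp))]
  have e1 := tder_prodMk (I := 𝓘(ℝ, EG)) (I' := 𝓘(ℝ, EG)) (I'' := 𝓘(ℝ, V)) (f := fun a : G => h * a)
    (g := fun _ : G => n) (x := g) (mdiff_mul_left h g) mdifferentiableAt_const (lvec X g)
  have e2 := tder_prodMk (I := 𝓘(ℝ, V)) (I' := 𝓘(ℝ, EG)) (I'' := 𝓘(ℝ, V)) (f := fun _ : N => h * g)
    (g := fun a : N => a) (x := n) mdifferentiableAt_const mdifferentiableAt_id v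
  dsimp only
  rw [e1, e2, mul_left_tder_lvec, tder_const, tder_const, tder_id]
  simp

theorem pullSec_section_smooth {s : ∀ m, (A.lineBundle aL).Fiber m}
    (hs : (A.lineBundle aL).IsSmoothSection s) (g : G) : L.IsSmoothSection (A.pullSec aL s g) :=
  (A.pullSec_smooth aL hs).comp (contMDiff_const.prodMk contMDiff_id)

variable (aL) in
/-- `lineMk` as a real-linear map. -/
def lineMkL (g : G) (n : N) : L.Fiber n →L[ℝ] (A.lineBundle aL).Fiber (assocMk K (g, n)) :=
  (A.lineMk aL g n).toContinuousLinearEquiv.toContinuousLinearMap.restrictScalars ℝ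

theorem indNabla_complex_linear (hc : HasConnForms nabla) {s : ∀ m, (A.lineBundle aL).Fiber m}
    (hs : (A.lineBundle aL).IsSmoothSection s) (m : AssocSpace K N) (w : V × S.𝔭) :
    evL (A.indNabla aL nabla (fun m => Complex.I • s m) m) w =
      Complex.I • evL (A.indNabla aL nabla s m) w := by
  have h := A.pullDer_smul hc (g := A.rG m) (n := A.rN m) (hs.isDiffAt _)
    (f := fun _ => Complex.I) mdifferentiableAt_const
    (fun p => A.pullSec_smul Complex.I s p.1 p.2) (lvec (w.2 : EG) (A.rG m), w.1)
  rw [tder_const, zero_apply, zero_smul, zero_add] at h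
  exact (congrArg (A.lineIso aL (A.rG m) (A.rN m)) h).trans (map_smul _ _ _)

theorem inner_pullSec (s t : ∀ m, (A.lineBundle aL).Fiber m) (g : G) (n : N) :
    inner ℂ (s (assocMk K (g, n))) (t (assocMk K (g, n))) =
      inner ℂ (A.pullSec aL s g n) (A.pullSec aL t g n) :=
  ((A.lineMk aL g n).symm.inner_map_map _ _).symm

include hK in
-- The inner product of sections is differentiated on `G × N`: along `N` by compatibility of `∇^N`
-- with the metric, along `G` by the product rule in one fixed fibre. For `X ∈ 𝔭` the moment terms
-- are zero.
theorem indNabla_hermitian (hP : L.IsSpincPrequantisation aL nabla ν Φ)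
    {s t : ∀ m, (A.lineBundle aL).Fiber m}
    (hs : (A.lineBundle aL).IsSmoothSection s) (ht : (A.lineBundle aL).IsSmoothSection t)
    (g : G) (n : N) (X : S.𝔭) (v : V) :
    tder 𝓘(ℝ, V × S.𝔭) 𝓘(ℝ, ℂ) (fun m => inner ℂ (s m) (t m)) (assocMk K (g, n))
      (dq S (g, n) (lvec (X : EG) g, v)) =
    inner ℂ (evL (A.indNabla aL nabla s (assocMk K (g, n))) (dq S (g, n) (lvec (X : EG) g, v)))
        (t (assocMk K (g, n))) +
      inner ℂ (s (assocMk K (g, n)))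
        (evL (A.indNabla aL nabla t (assocMk K (g, n))) (dq S (g, n) (lvec (X : EG) g, v))) := by
  have hc := hP.hasConnForms
  have hf : MDifferentiableAt 𝓘(ℝ, V × S.𝔭) 𝓘(ℝ, ℂ) (fun m => inner ℂ (s m) (t m))
      (assocMk K (g, n)) := (contMDiff_inner hs ht).contMDiffAt.mdifferentiableAt (by simp)
  have hd : MDifferentiableAt (𝓘(ℝ, EG).prod 𝓘(ℝ, V)) 𝓘(ℝ, ℂ)
      (fun p : G × N => inner ℂ (s (assocMk K p)) (t (assocMk K p))) (g, n) :=
    MDifferentiableAt.comp (I' := 𝓘(ℝ, V × S.𝔭)) (g := fun m => inner ℂ (s m) (t m)) _ hf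
      (A.mdiff_mk (g, n))
  have h0 := tder_comp_apply (g := fun m => inner ℂ (s m) (t m)) hf (A.mdiff_mk (g, n)) rfl
    (lvec (X : EG) g, v)
  rw [tder_prod hd] at h0
  refine h0.symm.trans ?_
  obtain ⟨s1, s2⟩ := A.pullDer_eq hc (hs.isDiffAt (assocMk K (g, n))) (lvec (X : EG) g) v
  obtain ⟨t1, t2⟩ := A.pullDer_eq hc (ht.isDiffAt (assocMk K (g, n))) (lvec (X : EG) g) v
  have e1 : (fun a : G => inner ℂ (s (assocMk K (a, n))) (t (assocMk K (a, n)))) =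
      fun a => inner ℂ (A.pullSec aL s a n) (A.pullSec aL t a n) :=
    funext fun a => A.inner_pullSec s t a n
  have e2 : (fun x : N => inner ℂ (s (assocMk K (g, x))) (t (assocMk K (g, x)))) =
      fun x => inner ℂ (A.pullSec aL s g x) (A.pullSec aL t g x) :=
    funext fun x => A.inner_pullSec s t g x
  have h1 : tder 𝓘(ℝ, EG) 𝓘(ℝ, ℂ) (fun a => inner ℂ (A.pullSec aL s a n) (A.pullSec aL t a n)) g
      (lvec (X : EG) g) = _ :=
    tder_bilinear (isBoundedBilinearMap_inner (𝕜 := ℂ) (E := L.Fiber n)) s1 t1 (lvec (X : EG) g)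
  have h2 : tder 𝓘(ℝ, V) 𝓘(ℝ, ℂ) (fun x => inner ℂ (A.pullSec aL s g x) (A.pullSec aL t g x)) n v =
      inner ℂ (evL (nabla (A.pullSec aL s g) n) v) (A.pullSec aL t g n) +
        inner ℂ (A.pullSec aL s g n) (evL (nabla (A.pullSec aL t g) n) v) :=
    hP.hermitian _ _ (A.pullSec_section_smooth hs g) (A.pullSec_section_smooth ht g) n v
  dsimp only at h1 ⊢
  rw [e1, e2, h1, h2, A.indNabla_dq hK hc hP (hs.isDiffAt _), A.indNabla_dq hK hc hP (ht.isDiffAt _),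
    S.projL_coe hK, map_zero, ← A.lineMk_pullSec aL s g n, ← A.lineMk_pullSec aL t g n,
    LinearIsometryEquiv.inner_map_map, LinearIsometryEquiv.inner_map_map, s2, t2]
  simp only [Complex.ofReal_zero, mul_zero, zero_smul, add_zero, inner_add_left, inner_add_right]
  ring

theorem pullSec_act {s t : ∀ m, (A.lineBundle aL).Fiber m} {h : G}
    (hst : ∀ m, t (h • m) = A.lineAct aL h m (s m)) (g : G) (n : N) :
    A.pullSec aL t (h * g) n = A.pullSec aL s g n := by
  have h1 := hst (assocMk K (g, n))
  rw [← A.lineMk_pullSec aL s g n, A.lineAct_mk] at h1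
  exact (A.lineMk aL (h * g) n).toLinearEquiv.symm_apply_eq.2 h1

/-- Sections related by `h` have pulled-back functions that differ by left translation, `t_{hg}(n) =
s_g(n)`, and left translation takes `gξ` to `hgξ`. -/
theorem pullDer_act {s t : ∀ m, (A.lineBundle aL).Fiber m} {h : G}
    (hst : ∀ m, t (h • m) = A.lineAct aL h m (s m)) (ht : (A.lineBundle aL).IsSmoothSection t)
    (g : G) (n : N) (ξ : EG) (v : V) :
    A.pullDer aL nabla t (h * g) n (lvec ξ (h * g), v) = A.pullDer aL nabla s g n (lvec ξ g, v) := by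
  have h1 := along_comp (nabla := nabla) (σ := A.pullTot aL t) (h := fun p : G × N => (h * p.1, p.2))
    (z := (g, n)) (A.mdifferentiableAt_pullTot (ht.isDiffAt _))
    ((contMDiff_left_translate h).contMDiffAt.mdifferentiableAt (by simp)) (lvec ξ g, v)
  rw [tder_left_translate] at h1
  have h2 : (fun p : G × N => A.pullTot aL t (h * p.1, p.2)) = A.pullTot aL s :=
    funext fun p => congrArg (TotalSpace.mk p.2) (A.pullSec_act hst p.1 p.2)
  have h3 := along_total_congr (nabla := nabla) (J := 𝓘(ℝ, EG).prod 𝓘(ℝ, V)) h2 (g, n)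
    (lvec ξ g, v)
  refine h1.symm.trans ?_
  injection h3

include hK in
theorem indNabla_invariant (hP : L.IsSpincPrequantisation aL nabla ν Φ)
    {s t : ∀ m, (A.lineBundle aL).Fiber m} {h : G}
    (hst : ∀ m, t (h • m) = A.lineAct aL h m (s m))
    (hs : (A.lineBundle aL).IsSmoothSection s) (ht : (A.lineBundle aL).IsSmoothSection t)
    (g : G) (n : N) (X : S.𝔭) (v : V) :
    evL (A.indNabla aL nabla t (h • assocMk K (g, n)))
      (actL (V × S.𝔭) h (assocMk K (g, n)) (dq S (g, n) (lvec (X : EG) g, v))) =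
      A.lineAct aL h (assocMk K (g, n))
        (evL (A.indNabla aL nabla s (assocMk K (g, n))) (dq S (g, n) (lvec (X : EG) g, v))) := by
  have hc := hP.hasConnForms
  rw [A.indNabla_dq hK hc hP (hs.isDiffAt _), A.lineAct_mk]
  have h1 : actL (V × S.𝔭) h (assocMk K (g, n)) (dq S (g, n) (lvec (X : EG) g, v)) =
    dq S (h * g, n) (lvec (X : EG) (h * g), v) := A.tder_smul_dq h g n X v
  rw [h1]
  refine (A.indNabla_dq hK hc hP (g := h * g) (ht.isDiffAt _) (X : EG) v).trans ?_
  rw [A.pullDer_act hst ht, A.pullSec_act hst]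

include hK in
-- The fundamental vector at `[g, n]` is `Tq(g Ad(g⁻¹)X)`. The moment term in `indNabla_dq` is then
-- `⟨Φ_M, X⟩`, and the other term is the derivative of `h ↦ s_{hg}(n)`, which is `h⁻¹ s(h [g, n])`
-- seen in the fibre of `L` over `n`.
theorem indNabla_kostant (hP : L.IsSpincPrequantisation aL nabla ν Φ)
    {s : ∀ m, (A.lineBundle aL).Fiber m} (hs : (A.lineBundle aL).IsSmoothSection s)
    (g : G) (n : N) (X : EG) :
    evL (A.indNabla aL nabla s (assocMk K (g, n))) (fundL (V × S.𝔭) (H := G) (assocMk K (g, n)) X) =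
      (2 * Real.pi * Complex.I * (2 * (Φ n (S.projL hK (Ad g⁻¹ X)) : ℝ)) : ℂ) •
          s (assocMk K (g, n)) +
        tder 𝓘(ℝ, EG) 𝓘(ℝ, (A.lineBundle aL).Fiber (assocMk K (g, n)))
          (fun h : G => (A.lineAct aL h (assocMk K (g, n))).symm (s (h • assocMk K (g, n)))) 1 X := by
  have hc := hP.hasConnForms
  obtain ⟨h1, h2⟩ := A.pullDer_eq hc (hs.isDiffAt (assocMk K (g, n))) (lvec (Ad g⁻¹ X) g) (0 : V)
  have e : (fun h : G => (A.lineAct aL h (assocMk K (g, n))).symm (s (h • assocMk K (g, n)))) =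
      fun h => A.lineMkL aL g n (A.pullSec aL s (h * g) n) := by
    funext h
    refine (A.lineAct aL h (assocMk K (g, n))).toLinearEquiv.symm_apply_eq.2 ?_
    exact ((A.lineAct_mk aL h g n _).trans (A.lineMk_pullSec aL s (h * g) n)).symm
  have hr : MDifferentiableAt 𝓘(ℝ, EG) 𝓘(ℝ, EG) (fun a : G => a * g) 1 := mdiff_mul_right _ _
  have h1' : MDifferentiableAt 𝓘(ℝ, EG) 𝓘(ℝ, L.Fiber n) (fun a => A.pullSec aL s a n) (1 * g) := by
    rwa [one_mul]
  have h3 : MDifferentiableAt 𝓘(ℝ, EG) 𝓘(ℝ, L.Fiber n) (fun a => A.pullSec aL s (a * g) n) 1 :=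
    MDifferentiableAt.comp (I' := 𝓘(ℝ, EG)) (g := fun a => A.pullSec aL s a n) _ h1' hr
  rw [e, tder_clm_comp (A.lineMkL aL g n) h3, A.fundL_mk, A.indNabla_dq hK hc hP (hs.isDiffAt _), h2,
    tder_comp_apply (g := fun a => A.pullSec aL s a n) h1 hr (one_mul g), mul_right_tder_one,
    map_zero, zero_add, map_add, map_smul, A.lineMk_pullSec, add_comm]
  rfl

/-- The induced connection is a prequantisation. -/
theorem isSpincPrequantisation_indConn (hP : L.IsSpincPrequantisation aL nabla ν Φ)
    (hM : IsMomentumMap K ν Φ) :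
    (A.lineBundle aL).IsSpincPrequantisation (A.lineAction aL) (A.indConn aL hP.hasConnForms)
      (A.indTwoForm hK ν Φ) (A.indPhi hK Φ) where
  smooth := smooth_of_connForm (A.hasConnForms_indConn hK hP.hasConnForms hP hM.smooth)
  complex_linear s hs m v := A.indNabla_complex_linear hP.hasConnForms hs m v
  hermitian s t hs ht m u := by
    obtain ⟨⟨g, n⟩, rfl⟩ := assocMk_surjective m
    obtain ⟨w, Y, rfl⟩ := A.exists_dq hK g n u
    exact A.indNabla_hermitian hK hP hs ht g n Y w
  invariant h s t hs ht hst m u := by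
    obtain ⟨⟨g, n⟩, rfl⟩ := assocMk_surjective m
    obtain ⟨w, Y, rfl⟩ := A.exists_dq hK g n u
    exact A.indNabla_invariant hK hP hst hs ht g n Y w
  curvature v w s hv hw hs m := A.indConn_curvature hK hP.hasConnForms hP hM.smooth v w s hv hw hs m
  kostant X s hs m := by
    obtain ⟨⟨g, n⟩, rfl⟩ := assocMk_surjective m
    rw [A.indPhi_mk hK hM.equivariant]
    exact A.indNabla_kostant hK hP hs g n X

/-- For `X ∈ 𝔭` the moment term vanishes, and the derivative on `G × N` is the sum of its partial
derivatives. -/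
theorem indConn_tangentVec (hK : IsMaximalCompactLieSubgroup (EG := EG) (EK := EK) K)
    (hP : L.IsSpincPrequantisation aL nabla ν Φ) {s : ∀ m, (A.lineBundle aL).Fiber m}
    (hs : (A.lineBundle aL).IsSmoothSection s) (g : G) (n : N) (v : V) (X : S.𝔭) :
    A.indConn aL hP.hasConnForms s (assocMk K (g, n)) (S.tangentVec g n v X) =
      A.lineMk aL g n (nabla (A.pullSec aL s g) n v +
        mvfderiv 𝓘(ℝ, EG) (fun a : G => A.pullSec aL s a n) g (leftVec (X : EG) g)) := by
  have hc := hP.hasConnForms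
  have h := A.indNabla_dq hK hc hP (hs.isDiffAt (assocMk K (g, n))) (X : EG) v
  rw [S.projL_coe hK, map_zero, (A.pullDer_eq hc (hs.isDiffAt (assocMk K (g, n))) _ v).2] at h
  simp only [Complex.ofReal_zero, mul_zero, zero_smul, add_zero] at h
  exact h

end AssocAtlas

end InducedPrequantisation

end PreHam

namespace PreHam


/-! ### Assembly of the induced structures. -/

section Induction

open HermitianLineBundle

variable {EG : Type uEG} [NormedAddCommGroup EG] [NormedSpace ℝ EG] [FiniteDimensional ℝ EG]
  {G : Type uG} [TopologicalSpace G] [ChartedSpace EG G] [Group G] [LieGroup 𝓘(ℝ, EG) ∞ G]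
  {EK : Type uEK} [NormedAddCommGroup EK] [NormedSpace ℝ EK] [FiniteDimensional ℝ EK]
  {K : Subgroup G} [ChartedSpace EK K] [LieGroup 𝓘(ℝ, EK) ∞ K]
  (hK : IsMaximalCompactLieSubgroup (EG := EG) (EK := EK) K)
  {S : SpinComplement (EG := EG) (EK := EK) K}
  {V : Type uV} [NormedAddCommGroup V] [NormedSpace ℝ V] [FiniteDimensional ℝ V]
  {N : Type uN} [TopologicalSpace N] [ChartedSpace V N] [IsManifold 𝓘(ℝ, V) ∞ N] [T2Space N]
  [MulAction K N] [ContMDiffSMul 𝓘(ℝ, EK) 𝓘(ℝ, V) ∞ K N]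
  [ChartedSpace (V × S.𝔭) (AssocSpace K N)] [IsManifold 𝓘(ℝ, V × S.𝔭) ∞ (AssocSpace K N)]
  [T2Space (AssocSpace K N)]
  {Q : QuadraticForm ℝ V} (A : AssocAtlas S V N) (D : PreHamSpinc.{wL, wP} EK K N Q)

namespace AssocAtlas

/-- Pre-Hamiltonian induction. -/
def preHamSpinc : PreHamSpinc.{wL, max wP uEG uG uV uN} EG G (AssocSpace K N) (Q.prod S.Q) where
  form := A.indTwoForm hK D.form D.Φ
  -- Smoothness and closedness of the form are read off from its being a multiple of the curvature.
  presymplectic := (A.hasConnForms_indConn hK D.prequantisation.hasConnForms D.prequantisation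
    D.momentum.smooth).isPresymplectic (A.indConn_curvature hK D.prequantisation.hasConnForms
      D.prequantisation D.momentum.smooth)
  form_invariant := A.isInvariantForm_indTwoForm hK D.form_invariant D.momentum.equivariant
  Φ := A.indPhi hK D.Φ
  momentum := A.isMomentumMap_indPhi hK D.form_invariant D.momentum
  L := A.lineBundle D.actL
  actL := A.lineAction D.actL
  nabla := A.indConn D.actL D.prequantisation.hasConnForms
  prequantisation := A.isSpincPrequantisation_indConn hK D.prequantisation D.momentum
  P := A.spincStructure D.actP
  actP := A.spincAction D.actP
  det := A.detIso D.actP D.det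

theorem preHamSpinc_form (n : N) (v w : V) (X Y : S.𝔭) :
    (A.preHamSpinc hK D).form (assocMk K ((1 : G), n)) ![S.tangentVec 1 n v X, S.tangentVec 1 n w Y] =
      D.form n ![v, w] - D.Φ n (S.proj (lieBr G (X : EG) (Y : EG))) := by
  rw [S.proj_eq hK]
  exact A.indTwoFormAt_dq hK D.form_invariant D.momentum.equivariant 1 n v w X Y

/-- The structures on `G ×_K N` are the induced ones. -/
def induces : Induces S D (A.preHamSpinc hK D) where
  form_eq := A.preHamSpinc_form hK D
  Φ_eq g n Y := by
    rw [S.proj_eq hK]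
    exact A.indPhi_mk hK D.momentum.equivariant g n Y
  lineMk := A.lineMk D.actL
  lineMk_smooth := A.lineQ_smooth D.actL
  lineMk_K g k n l := A.lineQ_tot D.actL g k ⟨n, l⟩
  lineMk_G g' g n l := A.lineAct_lineQ D.actL g' g ⟨n, l⟩
  nabla_eq s hs g n v X := A.indConn_tangentVec hK D.prequantisation hs g n v X
  spinMk g _ p := A.spinMk D.actP g p
  spinMk_act g n p u := congrArg ULift.up (A.spinVal_act D.actP g p u)
  spinMk_K g k n p := A.spinTotal_ext D.actP (assocMk_mul_inv g k n) (A.spinVal_tot D.actP g k ⟨n, p⟩)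
  spinMk_G g' g n p := A.spinTotal_ext D.actP rfl (A.spinShift_mul D.actP g' g ⟨n, p⟩)
  spinMk_smooth := by
    rintro c hc _ ⟨m₀, d, hd, rfl⟩
    obtain ⟨u, hu1, hu2⟩ := A.exists_spinTrans D.actP m₀ hc hd
    exact ⟨u, fun y hy hy' => congrArg ULift.up (hu1 y hy hy'), hu2⟩
  spinMk_frame g n p v X := A.spinFrame_spinVal D.actP g p v X
  spinMk_det g n p c := A.detVal_spinVal D.actP D.det g p c

end AssocAtlas

end Induction

end PreHam

end

theorem theorem4p2
    -- `G` is a connected Lie group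
    {EG : Type uEG} [NormedAddCommGroup EG] [NormedSpace ℝ EG] [FiniteDimensional ℝ EG]
    {G : Type uG} [TopologicalSpace G] [ChartedSpace EG G] [Group G] [LieGroup 𝓘(ℝ, EG) ∞ G]
    [T2Space G] [ConnectedSpace G]
    -- `K` is a maximal compact subgroup of `G`
    {EK : Type uEK} [NormedAddCommGroup EK] [NormedSpace ℝ EK] [FiniteDimensional ℝ EK]
    (K : Subgroup G) [ChartedSpace EK K] [LieGroup 𝓘(ℝ, EK) ∞ K]
    (hK : PreHam.IsMaximalCompactLieSubgroup (EG := EG) (EK := EK) K)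
    -- the complement `𝔭` of `𝔨`, its inner product, and the lift `K → Spin(𝔭)`
    (S : PreHam.SpinComplement (EG := EG) (EK := EK) K)
    -- `N` is a `K`-manifold, modelled on the Euclidean space `(V, Q)`
    {V : Type uV} [NormedAddCommGroup V] [NormedSpace ℝ V] [FiniteDimensional ℝ V]
    (Q : QuadraticForm ℝ V) (hQ : Q.PosDef)
    {N : Type uN} [TopologicalSpace N] [ChartedSpace V N] [IsManifold 𝓘(ℝ, V) ∞ N]
    [T2Space N] [SecondCountableTopology N]
    [MulAction K N] [ContMDiffSMul 𝓘(ℝ, EK) 𝓘(ℝ, V) ∞ K N]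
    -- `N` is pre-Hamiltonian, prequantised, with a `Spin^c`-structure
    (D : PreHam.PreHamSpinc.{wL, wP} EK K N Q) :
    -- `M = G ×_K N` is a quotient manifold on which `G` acts smoothly
    T2Space (PreHam.AssocSpace K N) ∧ SecondCountableTopology (PreHam.AssocSpace K N) ∧
    ∃ (_ : ChartedSpace (V × S.𝔭) (PreHam.AssocSpace K N))
      (_ : IsManifold 𝓘(ℝ, V × S.𝔭) ∞ (PreHam.AssocSpace K N)),
      PreHam.IsQuotientManifold S (V := V) N ∧
      ContMDiffSMul 𝓘(ℝ, EG) 𝓘(ℝ, V × S.𝔭) ∞ G (PreHam.AssocSpace K N) ∧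
      -- the induced structures make `M` a pre-Hamiltonian `G`-manifold, prequantised, with a
      -- `Spin^c`-structure
      (Q.prod S.Q).PosDef ∧
      ∃ D' : PreHam.PreHamSpinc.{wL, max wP uEG uG uV uN} EG G (PreHam.AssocSpace K N)
          (Q.prod S.Q),
        Nonempty (PreHam.Induces S D D') := by
  open PreHam in
  have : IsTopologicalGroup G := topologicalGroup_of_lieGroup 𝓘(ℝ, EG) ∞
  have : ContinuousSMul K N := ContMDiffSMul.continuousSMul (I := 𝓘(ℝ, EK)) (I' := 𝓘(ℝ, V)) ∞
  have : SecondCountableTopology G := secondCountableTopology_of_connected EG G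
  have hq := isOpenQuotientMap_assocMk (K := K) (N := N)
  -- A compact subgroup of a Hausdorff group is closed.
  have hT2 : T2Space (AssocSpace K N) := t2Space_assocSpace hK.compact.isClosed
  obtain ⟨r⟩ := exists_retract K
  obtain ⟨sl⟩ := exists_slice hK S.isCompl
  let _ := assocCharted r sl V N
  have : IsManifold 𝓘(ℝ, V × S.𝔭) ∞ (AssocSpace K N) := isManifold_assocCharted r sl
  -- The preferred charts are by definition those of the slice `sl` and the representatives `r`;
  -- this equation is all that the constructions on `M` use about the smooth structure.
  have A : AssocAtlas S V N := ⟨r, sl, fun _ => rfl⟩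
  exact ⟨hT2, hq.isQuotientMap.secondCountableTopology hq.isOpenMap, inferInstance, inferInstance,
    ⟨A.contMDiff_mk, A.submersion⟩, ⟨A.contMDiff_smul⟩, hQ.prod S.posDef,
    A.preHamSpinc hK D, ⟨A.induces hK D⟩⟩
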